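/- Let $n\ge 2$, let $q$ and $\bar q^{1/n}$ be independent variables, $\mathbb K=\mathbb Q(q,\bar q^{1/n})$, and let $V$ be the $n$-dimensional vector space over $\mathbb K$, with elementary matrices $E_{ij}\in\mathrm{End}(V)$, $1\le i,j\le n$. Put $$R(x)=\sum_{i,j}E_{ii}\otimes E_{jj}\Big(\tfrac{q-xq^{-1}}{1-x}\Big)^{\delta_{ij}}+(q-q^{-1})\sum_{i\ne j}E_{ij}\otimes E_{ji}\frac{x^{\delta_{i<j}}}{1-x},\qquad \widetilde R(x)=R_{21}\Big(\frac1{x\bar q^2}\Big),\qquad f(x)=\frac{(1-xq^2)(1-xq^{-2})}{(1-x)^2}.$$ Subscripts of tensors denote the tensor factors on which they act. **Shuffle algebra.** For $k\ge0$ let $\mathcal A_{\mathrm{big},k}$ be the space of $X=X_{1\dots k}(z_1,\dots,z_k)\in\mathrm{End}(V^{\otimes k})(z_1,\dots,z_k)$ such that $X\prod_{i\ne j}(z_i-z_j\bar q^2)$ has Laurent polynomial entries and $X=R_\sigma\,X_{\sigma(1)\dots\sigma(k)}(z_{\sigma(1)},\dots,z_{\sigma(k)})\,R_\sigma^{-1}$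 for every $\sigma\in S_k$ and every braid lift $R_\sigma$ of $\sigma$ (a product of crossings, built up by $R_{\sigma\tau}=R_\sigma\cdot\sigma R_\tau\sigma^{-1}$ for $\tau=(i\ i{+}1)$, where $R_\tau$ is $R_{i,i+1}(z_i/z_{i+1})$ or $R_{i+1,i}(z_{i+1}/z_i)^{-1}$). Let $\mathcal A_k\subset\mathcal A_{\mathrm{big},k}$ be the subspace of the $X$ which satisfy the following wheel condition for every composition $k=\lambda_1+\dots+\lambda_u$ into positive parts. With $c_1=1$ and $c_{s+1}=c_s+\lambda_s$, there is $Y\in\mathrm{End}(V^{\otimes u})(y_1,\dots,y_u)$ such that the iterated residue of $X$ at $z_{c_s+e}=y_s\bar q^{2e}$ ($1\le s\le u$, $0\le e<\lambda_s$) equals $$(q^{-1}-q)^{k-u}\prod f\Big(\frac{y_s\bar q^{2d}}{y_t\bar q^{2e}}\Big)\cdot\Big[\prod_{u\ge s\ge1}\ \prod_{s\le t\le u}\ \prod_{1\le e<\lambda_t}R_{c_s,c_t+e}\Big(\frac{y_s}{y_t\bar q^{2e}}\Big)\Big]\,Y_{c_1\dots c_u}\,\Big[\prod_{1\le s\le u}\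 \prod_{u\ge t>s}\ \prod_{\lambda_t>e\ge1}R_{c_t+e,c_s}\Big(\frac{y_t\bar q^{2e}}{y_s\bar q^{2\lambda_s}}\Big)\Big]\,P .$$ Here the matrix products are ordered as indicated. The product of $f$'s is over unordered pairs $(s,d)\ne(t,e)$ with $1\le d<\lambda_s$, $1\le e<\lambda_t$ (note that $f(x)=f(1/x)$). $P$ is the permutation operator on $V^{\otimes k}$ which moves the factor $c_s+e$ to the place $c_s+e+1$ for $e<\lambda_s-1$, and the factor $c_{s+1}-1$ to the place $c_s$. The residues are normalized so that $\frac1{\alpha-x}$ has residue $1$ at $x=\alpha$. **Grading.** For integers $i\le j$ let $[i;j)=\varsigma^i+\dots+\varsigma^{j-1}\in\mathbb Z^n$, where $\varsigma^x$ is the standard basis vector whose index is congruent to $x$ mod $n$, and $[i;j)=-[j;i)$ for $i>j$; this depends only on the class of $(i,j)$ in $\mathbb Z^2/(n,n)\mathbb Z$. If $\phi$ is homogeneous, then $\phi\,E_{i_1j_1}\otimes\dots\otimes E_{i_kj_k}$ has degree $(\mathbf d,k)$ with $\mathbf d=(\deg\phi)(1,\dots,1)-\sum_a[i_a;j_a)$.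 Let $\mathcal A_{\mathbf d,k}\subset\mathcal A_k$ be the subspace of degree $(\mathbf d,k)$, and $|\mathbf d|=d_1+\dots+d_n$. **Coproduct and slopes.** Let $\widetilde{\mathcal A}^+$ be the extended algebra, generated by the $\mathcal A_k$ and by symbols $s_{[i;j)}$ ($1\le i\le n$, $i\le j$) with $s_{[i;i)}$ invertible, which form the series $S(x)=\sum s_{[i;j+nd)}\otimes E_{ij}x^{-d}$ (over $1\le i,j\le n$, $d\ge0$, with $i\le j$ if $d=0$), subject to $$R(\tfrac xy)S_1(x)S_2(y)=S_2(y)S_1(x)R(\tfrac xy),$$ $$X\,S_0(y)=S_0(y)\,\frac{R_{k0}(\frac{z_k}y)\cdots R_{10}(\frac{z_1}y)}{f(\frac{z_k}y)\cdots f(\frac{z_1}y)}\,X\,\widetilde R_{10}(\tfrac{z_1}y)\cdots\widetilde R_{k0}(\tfrac{z_k}y).$$ Define $T(x)$ by $D^{-1}S(xq^{2n}\bar q^2)^\dagger D\,T(x)^\dagger=1$, where $D=\mathrm{diag}(q^2,\dots,q^{2n})$ and $\dagger$ is the transpose. The coproduct of $X\in\mathcal A_k$ is $\Delta(X)=\sum_{i=0}^k\Delta_{i,k-i}(X)$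 with $$\Delta_{i,k-i}(X)=\big(S_k(z_k)\cdots S_{i+1}(z_{i+1})\otimes1\big)\Big[\frac{X_{1\dots i}(z_1,\dots,z_i)\otimes X_{i+1\dots k}(z_{i+1},\dots,z_k)}{\prod_{1\le a\le i<b\le k}f(z_a/z_b)}\Big]\big(T_{i+1}(z_{i+1})\cdots T_k(z_k)\otimes1\big),$$ where the bracket is the expansion of $X/\prod f(z_a/z_b)$ for $z_1,\dots,z_i\ll z_{i+1},\dots,z_k$, with everything which concerns the first $i$ tensor factors and variables on the left of $\otimes$, and the rest on the right. For $\mu\in\mathbb Q$, let $\mathcal A_{\le\mu|\mathbf d,k}$ be the space of all $X\in\mathcal A_{\mathbf d,k}$ such that, for all $0\le i\le k$, only summands $X_1\otimes X_2$ with $X_2$ of degree $(\mathbf d_2,k-i)$, $|\mathbf d_2|\le\mu(k-i)$, occur in $\Delta_{i,k-i}(X)$. **Lemma.** For all $n\ge2$, $k\ge0$, $\mu\in\mathbb Q$ and $\mathbf d\in\mathbb Z^n$, the number of unordered collections (multisets) $$(i_1,j_1,\lambda_1),\dots,(i_u,j_u,\lambda_u)$$ such that - $\lambda_s\ge1$ are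 integers with $\sum_s\lambda_s=k$, - $(i_s,j_s)\in\mathbb Z^2/(n,n)\mathbb Z$ with $\sum_s[i_s;j_s)=\mathbf d$, - $j_s-i_s\le\mu\lambda_s$ for all $s$, is finite, and $\dim_{\mathbb K}\mathcal A_{\le\mu|\mathbf d,k}$ is at most this number. -/

import Mathlib

open scoped TensorProduct

noncomputable section

namespace MatrixShuffle

/-! ### The ground field and rational functions -/

/-- The ground field `ℚ(q, q̄^{1/n})`, with two independent transcendental generators. -/
def K : Type := FractionRing (MvPolynomial (Fin 2) ℚ)

instance : Field K := inferInstanceAs (Field (FractionRing (MvPolynomial (Fin 2) ℚ)))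

instance : Algebra (MvPolynomial (Fin 2) ℚ) K :=
  inferInstanceAs (Algebra (MvPolynomial (Fin 2) ℚ) (FractionRing (MvPolynomial (Fin 2) ℚ)))

instance : IsFractionRing (MvPolynomial (Fin 2) ℚ) K :=
  inferInstanceAs (IsFractionRing (MvPolynomial (Fin 2) ℚ) (FractionRing (MvPolynomial (Fin 2) ℚ)))

/-- The parameter `q`. -/
def q : K := algebraMap (MvPolynomial (Fin 2) ℚ) K (MvPolynomial.X 0)

/-- The parameter `q̄^{1/n}`. -/
def qbarRoot : K := algebraMap (MvPolynomial (Fin 2) ℚ) K (MvPolynomial.X 1)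

/-- The parameter `q̄`. -/
def qbar (n : ℕ) : K := qbarRoot ^ n

/-- Rational functions in `k` variables over `K`. -/
def RatFun (k : ℕ) : Type := FractionRing (MvPolynomial (Fin k) K)

instance (k : ℕ) : Field (RatFun k) :=
  inferInstanceAs (Field (FractionRing (MvPolynomial (Fin k) K)))

instance (k : ℕ) : Algebra (MvPolynomial (Fin k) K) (RatFun k) :=
  inferInstanceAs (Algebra (MvPolynomial (Fin k) K) (FractionRing (MvPolynomial (Fin k) K)))

instance (k : ℕ) : IsFractionRing (MvPolynomial (Fin k) K) (RatFun k) :=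
  inferInstanceAs (IsFractionRing (MvPolynomial (Fin k) K) (FractionRing (MvPolynomial (Fin k) K)))

instance (k : ℕ) : Algebra K (RatFun k) :=
  ((algebraMap (MvPolynomial (Fin k) K) (RatFun k)).comp MvPolynomial.C).toAlgebra

instance (k : ℕ) : IsScalarTower K (MvPolynomial (Fin k) K) (RatFun k) :=
  IsScalarTower.of_algebraMap_eq fun _ => rfl

/-- The variable `z_i`. -/
def z {k : ℕ} (i : Fin k) : RatFun k :=
  algebraMap (MvPolynomial (Fin k) K) (RatFun k) (MvPolynomial.X i)

instance : Algebra K (LaurentSeries K) := HahnSeries.instAlgebra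

instance (k : ℕ) : Algebra K (LaurentSeries (RatFun k)) := HahnSeries.instAlgebra

/-- `End(V^{⊗k})(z_1, …, z_k)` for `V` of dimension `n`: the entry `X I J` is the coefficient of
`E_{I_1 J_1} ⊗ ⋯ ⊗ E_{I_k J_k}`. Indices in `{1, …, n}` are encoded by `Fin n`. -/
abbrev Tensor (n k : ℕ) : Type := Matrix (Fin k → Fin n) (Fin k → Fin n) (RatFun k)

/-- Renaming variables, `z_i ↦ z_{e i}`, for an injective map of indices. -/
def renameVars {k l : ℕ} (e : Fin k ↪ Fin l) : RatFun k →ₐ[K] RatFun l :=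
  IsFractionRing.liftAlgHom
    (g := (IsScalarTower.toAlgHom K (MvPolynomial (Fin l) K) (RatFun l)).comp
      (MvPolynomial.rename e))
    ((IsFractionRing.injective (MvPolynomial (Fin l) K) (RatFun l)).comp
      (MvPolynomial.rename_injective e e.injective))

/-! ### Placing tensors on strands, and the `R`-matrix -/

open Classical in
/-- For distinct strands `c`, the tensor `M` acting in the tensor factors `c`, and the identity in
all other tensor factors: the notation `M_{c_1 c_2 …}`. -/
def onStrands {ι κ L : Type*} {n : ℕ} [Zero L] (c : κ → ι)
    (M : Matrix (κ → Fin n) (κ → Fin n) L) : Matrix (ι → Fin n) (ι → Fin n) L :=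
  fun I J => if ∀ m, m ∉ Set.range c → I m = J m then M (I ∘ c) (J ∘ c) else 0

/-- The trigonometric `R`-matrix
`R(x) = ∑_{i,j} E_ii ⊗ E_jj ((q - x q⁻¹) / (1 - x))^{δ_ij}
  + (q - q⁻¹) ∑_{i ≠ j} E_ij ⊗ E_ji x^{δ_{i<j}} / (1 - x)`. -/
def rMatrix {L : Type*} [Field L] [Algebra K L] (n : ℕ) (x : L) :
    Matrix (Fin 2 → Fin n) (Fin 2 → Fin n) L :=
  fun I J =>
    if I 0 = J 0 ∧ I 1 = J 1 then
      if I 0 = I 1 then (algebraMap K L q - x * algebraMap K L q⁻¹) / (1 - x) else 1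
    else if I 0 = J 1 ∧ I 1 = J 0 then
      algebraMap K L (q - q⁻¹) * ((if I 0 < I 1 then x else 1) / (1 - x))
    else 0

/-- `R_{ij}(x)`. -/
def R {L : Type*} [Field L] [Algebra K L] (n : ℕ) {k : ℕ} (i j : Fin k) (x : L) :
    Matrix (Fin k → Fin n) (Fin k → Fin n) L :=
  onStrands ![i, j] (rMatrix n x)

/-- `R̃_{ij}(x)`, where `R̃(x) = R_{21}(1 / (x q̄²))`. -/
def Rtilde {L : Type*} [Field L] [Algebra K L] (n : ℕ) {k : ℕ} (i j : Fin k) (x : L) :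
    Matrix (Fin k → Fin n) (Fin k → Fin n) L :=
  R n j i (1 / (x * algebraMap K L (qbar n ^ 2)))

/-- The scalar `f(x) = (1 - x q²)(1 - x q⁻²) / (1 - x)²`, so that `R_{12}(x) R_{21}(1/x) = f(x)`. -/
def f {L : Type*} [Field L] [Algebra K L] (x : L) : L :=
  (1 - x * algebraMap K L (q ^ 2)) * (1 - x * algebraMap K L ((q⁻¹) ^ 2)) / (1 - x) ^ 2

/-! ### Symmetric tensors with prescribed poles -/

/-- `IsBraidLift σ M` says that `M = R_σ(z_1, …, z_k)` for some braid lifting the permutation `σ`: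
a product of crossings `R_{ab}(z_a/z_b)` or `R_{ba}(z_b/z_a)⁻¹`. Lifts are built up through
`R_{σ τ} = R_σ · (σ R_τ σ⁻¹)` for `τ` a transposition of neighbours. -/
inductive IsBraidLift {n k : ℕ} : Equiv.Perm (Fin k) → Tensor n k → Prop
  | one : IsBraidLift 1 1
  | over (σ : Equiv.Perm (Fin k)) (M : Tensor n k) (i j : Fin k) (h : i.val + 1 = j.val)
      (hM : IsBraidLift σ M) :
      IsBraidLift (σ * Equiv.swap i j) (M * R n (σ i) (σ j) (z (σ i) / z (σ j)))
  | under (σ : Equiv.Perm (Fin k)) (M : Tensor n k) (i j : Fin k) (h : i.val + 1 = j.val)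
      (hM : IsBraidLift σ M) :
      IsBraidLift (σ * Equiv.swap i j) (M * (R n (σ j) (σ i) (z (σ j) / z (σ i)))⁻¹)

/-- `σ X σ⁻¹ = X_{σ(1) … σ(k)}(z_{σ(1)}, …, z_{σ(k)})`. -/
def permute {n k : ℕ} (σ : Equiv.Perm (Fin k)) (X : Tensor n k) : Tensor n k :=
  fun I J => renameVars σ.toEmbedding (X (I ∘ σ) (J ∘ σ))

/-- Laurent polynomials in `z_1, …, z_k`, inside the field of rational functions. -/
def laurent (k : ℕ) : Subalgebra K (RatFun k) :=
  Algebra.adjoin K (Set.range (fun i : Fin k => z i) ∪ Set.range (fun i : Fin k => (z i)⁻¹))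

/-- The vertical degree `k` piece of `𝒜⁺_big`: the tensors `X` such that
`X · ∏_{i ≠ j} (z_i - z_j q̄²)` has Laurent polynomial entries, and which are symmetric:
`X = R_σ (σ X σ⁻¹) R_σ⁻¹` for all `σ` and all braid lifts `R_σ` (which are invertible). -/
def bigSpace (n k : ℕ) : Submodule K (Tensor n k) where
  carrier := {X |
    (∀ I J, X I J * ∏ p : Fin k × Fin k with p.1 ≠ p.2,
      (z p.1 - z p.2 * algebraMap K (RatFun k) (qbar n ^ 2)) ∈ laurent k) ∧
    ∀ (σ : Equiv.Perm (Fin k)) (M : Tensor n k), IsBraidLift σ M → X * M = M * permute σ X}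
  zero_mem' := by
    refine ⟨fun I J => by simp, fun σ M _ => ?_⟩
    have : permute σ (0 : Tensor n k) = 0 := by ext; simp [permute]
    simp [this]
  add_mem' := by
    rintro X Y ⟨hX, hX'⟩ ⟨hY, hY'⟩
    refine ⟨fun I J => ?_, fun σ M hM => ?_⟩
    · rw [Matrix.add_apply, add_mul]
      exact add_mem (hX I J) (hY I J)
    · have : permute σ (X + Y) = permute σ X + permute σ Y := by ext; simp [permute]
      rw [this, add_mul, mul_add, hX' σ M hM, hY' σ M hM]
  smul_mem' := by
    rintro c X ⟨hX, hX'⟩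
    refine ⟨fun I J => ?_, fun σ M hM => ?_⟩
    · rw [Matrix.smul_apply, smul_mul_assoc]
      exact Subalgebra.smul_mem _ (hX I J) c
    · have : permute σ (c • X) = c • permute σ X := by
        ext I J
        exact (renameVars σ.toEmbedding).toLinearMap.map_smul c (X (I ∘ σ) (J ∘ σ))
      rw [this, smul_mul_assoc, mul_smul_comm, hX' σ M hM]

/-! ### Iterated residues and the wheel conditions -/

/-- The rational function `φ` is regular at the (generic) point `z_j = w_j`, with value `v`. -/
def HasValueAt {k u : ℕ} (w : Fin k → RatFun u) (φ : RatFun k) (v : RatFun u) : Prop :=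
  ∃ a b : MvPolynomial (Fin k) K, MvPolynomial.aeval w b ≠ 0 ∧
    φ * algebraMap (MvPolynomial (Fin k) K) (RatFun k) b =
      algebraMap (MvPolynomial (Fin k) K) (RatFun k) a ∧
    v * MvPolynomial.aeval w b = MvPolynomial.aeval w a

/-- The first element `c_s` of the block `s = {c_s, …, c_s + λ_s - 1}` of a composition
`k = λ_1 + ⋯ + λ_u`. The element `c_s + e` is `c.embedding s e`. -/
def head {k : ℕ} (c : Composition k) (s : Fin c.length) : Fin k :=
  c.embedding s ⟨0, c.one_le_blocksFun s⟩

/-- The point `z_{c_s + e} = y_s q̄^{2e}`; the variables `y_1, …, y_u` are those of `RatFun u`. -/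
def wheelPoint (n : ℕ) {k : ℕ} (c : Composition k) (j : Fin k) : RatFun c.length :=
  z (c.index j) * algebraMap K (RatFun c.length) (qbar n ^ (2 * (c.invEmbedding j).val))

/-- `Z(y_1, …, y_u)` is the iterated residue of `X` at
`z_{c_s} = y_s, z_{c_s + 1} = y_s q̄², …, z_{c_{s+1} - 1} = y_s q̄^{2(λ_s - 1)}`, for all `s`, with
`1 / (α - x)` having residue `1` at `x = α`. As the poles are simple, it is obtained by multiplying
with the factors `z_j q̄² - z_{j+1}`, for neighbours `j, j+1` of the same block, and specializing. -/
def IsWheelResidue {n k : ℕ} (c : Composition k) (X : Tensor n k)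
    (Z : Matrix (Fin k → Fin n) (Fin k → Fin n) (RatFun c.length)) : Prop :=
  ∀ I J, HasValueAt (wheelPoint n c)
    (X I J * ∏ p : Fin k × Fin k with p.1.val + 1 = p.2.val ∧ c.index p.1 = c.index p.2,
      (z p.1 * algebraMap K (RatFun k) (qbar n ^ 2) - z p.2)) (Z I J)

/-- The product of `f(y_s q̄^{2d} / (y_t q̄^{2e}))` over unordered pairs `(s,d) ≠ (t,e)` with
`1 ≤ d < λ_s`, `1 ≤ e < λ_t`. -/
def wheelScalar (n : ℕ) {k : ℕ} (c : Composition k) : RatFun c.length :=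
  ∏ p : Fin k × Fin k with
      p.1 < p.2 ∧ 1 ≤ (c.invEmbedding p.1).val ∧ 1 ≤ (c.invEmbedding p.2).val,
    f (wheelPoint n c p.1 / wheelPoint n c p.2)

/-- `∏_{u ≥ s ≥ 1} ∏_{s ≤ t ≤ u} ∏_{1 ≤ e < λ_t} R_{c_s, c_t + e}(y_s / (y_t q̄^{2e}))`, ordered. -/
def wheelLeft (n : ℕ) {k : ℕ} (c : Composition k) :
    Matrix (Fin k → Fin n) (Fin k → Fin n) (RatFun c.length) :=
  ((List.finRange c.length).reverse.flatMap fun s =>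
    ((List.finRange c.length).filter (fun t => s ≤ t)).flatMap fun t =>
      ((List.finRange (c.blocksFun t)).filter (fun e => 1 ≤ e.val)).map fun e =>
        R n (head c s) (c.embedding t e)
          (z s / (z t * algebraMap K (RatFun c.length) (qbar n ^ (2 * e.val))))).prod

/-- `∏_{1 ≤ s ≤ u} ∏_{u ≥ t > s} ∏_{λ_t > e ≥ 1} R_{c_t + e, c_s}(y_t q̄^{2e} / (y_s q̄^{2λ_s}))`,
ordered. -/
def wheelRight (n : ℕ) {k : ℕ} (c : Composition k) :
    Matrix (Fin k → Fin n) (Fin k → Fin n) (RatFun c.length) :=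
  ((List.finRange c.length).flatMap fun s =>
    ((List.finRange c.length).reverse.filter (fun t => s < t)).flatMap fun t =>
      ((List.finRange (c.blocksFun t)).reverse.filter (fun e => 1 ≤ e.val)).map fun e =>
        R n (c.embedding t e) (head c s)
          ((z t * algebraMap K (RatFun c.length) (qbar n ^ (2 * e.val))) /
            (z s * algebraMap K (RatFun c.length) (qbar n ^ (2 * c.blocksFun s))))).prod

/-- The permutation `c_s + e ↦ c_s + e + 1`, `c_{s+1} - 1 ↦ c_s` of each block, as an operator
on `V^{⊗k}` which moves the tensor factor `j` to the position `σ(j)`. -/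
def wheelPerm (n : ℕ) {k : ℕ} (c : Composition k) :
    Matrix (Fin k → Fin n) (Fin k → Fin n) (RatFun c.length) :=
  fun I J => if ∀ j, I (c.embedding (c.index j) (finRotate _ (c.invEmbedding j))) = J j
    then 1 else 0

/-- The right-hand side of the wheel condition, as a function of `Y = X^{(λ_1, …, λ_u)}`. -/
def wheelRHS {n k : ℕ} (c : Composition k) (Y : Tensor n c.length) :
    Matrix (Fin k → Fin n) (Fin k → Fin n) (RatFun c.length) :=
  (algebraMap K (RatFun c.length) ((q⁻¹ - q) ^ (k - c.length)) * wheelScalar n c) •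
    (wheelLeft n c * onStrands (head c) Y * wheelRight n c * wheelPerm n c)

theorem HasValueAt.zero {k u : ℕ} (w : Fin k → RatFun u) : HasValueAt w 0 0 :=
  ⟨0, 1, by simp, by simp, by simp⟩

theorem HasValueAt.add {k u : ℕ} {w : Fin k → RatFun u} {φ ψ : RatFun k} {v v' : RatFun u}
    (h : HasValueAt w φ v) (h' : HasValueAt w ψ v') : HasValueAt w (φ + ψ) (v + v') := by
  obtain ⟨a, b, hb, h1, h2⟩ := h
  obtain ⟨a', b', hb', h1', h2'⟩ := h'
  refine ⟨a * b' + a' * b, b * b', ?_, ?_, ?_⟩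
  · simpa using ⟨hb, hb'⟩
  · simp only [map_mul, map_add, ← h1, ← h1']; ring
  · simp only [map_mul, map_add, ← h2, ← h2']; ring

theorem HasValueAt.smul {k u : ℕ} {w : Fin k → RatFun u} {φ : RatFun k} {v : RatFun u}
    (r : K) (h : HasValueAt w φ v) : HasValueAt w (r • φ) (r • v) := by
  obtain ⟨a, b, hb, h1, h2⟩ := h
  refine ⟨r • a, b, hb, ?_, ?_⟩
  · rw [smul_mul_assoc, h1, Algebra.smul_def, Algebra.smul_def, map_mul]; rfl
  · rw [smul_mul_assoc, h2, map_smul]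

theorem onStrands_add {ι κ L : Type*} {n : ℕ} [AddZeroClass L] (c : κ → ι)
    (M N : Matrix (κ → Fin n) (κ → Fin n) L) :
    onStrands c (M + N) = onStrands c M + onStrands c N := by
  ext I J
  rw [Matrix.add_apply]
  unfold onStrands
  split_ifs
  · exact Matrix.add_apply M N (I ∘ c) (J ∘ c)
  · exact (add_zero _).symm

theorem onStrands_smul {ι κ L S : Type*} {n : ℕ} [Zero L] [SMulZeroClass S L] (c : κ → ι) (r : S)
    (M : Matrix (κ → Fin n) (κ → Fin n) L) :
    onStrands c (r • M) = r • onStrands c M := by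
  ext I J
  rw [Matrix.smul_apply]
  unfold onStrands
  split_ifs
  · exact Matrix.smul_apply r M (I ∘ c) (J ∘ c)
  · exact (smul_zero _).symm

theorem onStrands_zero {ι κ L : Type*} {n : ℕ} [Zero L] (c : κ → ι) :
    onStrands c (0 : Matrix (κ → Fin n) (κ → Fin n) L) = 0 := by
  ext I J
  simp [onStrands]

/-- The vertical degree `k` piece of the shuffle algebra `𝒜⁺`: the elements of `𝒜⁺_big` which
satisfy the wheel conditions for all compositions of `k`. -/
def shuffleSpace (n k : ℕ) : Submodule K (Tensor n k) where
  carrier := {X | X ∈ bigSpace n k ∧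
    ∀ c : Composition k, ∃ Y : Tensor n c.length, IsWheelResidue c X (wheelRHS c Y)}
  zero_mem' := by
    refine ⟨zero_mem _, fun c => ⟨0, fun I J => ?_⟩⟩
    simpa [wheelRHS, onStrands_zero] using HasValueAt.zero _
  add_mem' := by
    rintro X X' ⟨hX, hX'⟩ ⟨hY, hY'⟩
    refine ⟨add_mem hX hY, fun c => ?_⟩
    obtain ⟨Y, h⟩ := hX' c
    obtain ⟨Y', h'⟩ := hY' c
    refine ⟨Y + Y', fun I J => ?_⟩
    have : wheelRHS c (Y + Y') = wheelRHS c Y + wheelRHS c Y' := by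
      simp only [wheelRHS, onStrands_add, mul_add, add_mul, smul_add]
    rw [this, Matrix.add_apply, Matrix.add_apply, add_mul]
    exact (h I J).add (h' I J)
  smul_mem' := by
    rintro r X ⟨hX, hX'⟩
    refine ⟨Submodule.smul_mem _ r hX, fun c => ?_⟩
    obtain ⟨Y, h⟩ := hX' c
    refine ⟨r • Y, fun I J => ?_⟩
    have : wheelRHS c (r • Y) = r • wheelRHS c Y := by
      simp only [wheelRHS, onStrands_smul, mul_smul_comm, smul_mul_assoc]
      rw [smul_comm]
    rw [this, Matrix.smul_apply, Matrix.smul_apply, smul_mul_assoc]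
    exact (h I J).smul r

/-! ### The horizontal grading -/

/-- `[i;j) = ς^i + ⋯ + ς^{j-1} ∈ ℤ^n` for `i ≤ j`, where `ς^x` is the basis vector in position
`x mod n`, and `[i;j) = -[j;i)` for `i > j`. The coordinates `1, …, n` are encoded by `Fin n`. -/
def root (n : ℕ) (i j : ℤ) : Fin n → ℤ := fun r =>
  (((Finset.Ico i j).filter fun x => x ≡ (r.val : ℤ) + 1 [ZMOD n]).card : ℤ) -
    (((Finset.Ico j i).filter fun x => x ≡ (r.val : ℤ) + 1 [ZMOD n]).card : ℤ)

/-- The rational function `φ` is homogeneous of degree `h` (or zero). -/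
def IsHomogeneousOfDegree {k : ℕ} (φ : RatFun k) (h : ℤ) : Prop :=
  φ = 0 ∨ ∃ (a b : MvPolynomial (Fin k) K) (l m : ℕ), b ≠ 0 ∧ a.IsHomogeneous l ∧ b.IsHomogeneous m ∧
    (l : ℤ) - m = h ∧
    φ * algebraMap (MvPolynomial (Fin k) K) (RatFun k) b =
      algebraMap (MvPolynomial (Fin k) K) (RatFun k) a

theorem IsHomogeneousOfDegree.add {k : ℕ} {φ ψ : RatFun k} {h : ℤ}
    (hφ : IsHomogeneousOfDegree φ h) (hψ : IsHomogeneousOfDegree ψ h) :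
    IsHomogeneousOfDegree (φ + ψ) h := by
  rcases hφ with rfl | ⟨a, b, l, m, hb, ha1, hb1, hd, h1⟩
  · simpa using hψ
  rcases hψ with rfl | ⟨a', b', l', m', hb', ha1', hb1', hd', h1'⟩
  · exact Or.inr ⟨a, b, l, m, hb, ha1, hb1, hd, by simpa using h1⟩
  refine Or.inr ⟨a * b' + a' * b, b * b', l + m', m + m', mul_ne_zero hb hb', ?_, hb1.mul hb1', ?_, ?_⟩
  · refine (ha1.mul hb1').add ?_
    have : l + m' = l' + m := by lia
    rw [this]
    exact ha1'.mul hb1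
  · push_cast; lia
  · simp only [map_mul, map_add, ← h1, ← h1']; ring

/-- The tensors all of whose components `φ · E_{I_1 J_1} ⊗ ⋯ ⊗ E_{I_k J_k}` have horizontal degree
`(hom deg φ) δ - ∑_a [I_a; J_a) = d`, where `δ = (1, …, 1)`. -/
def hdegSpace (n k : ℕ) (d : Fin n → ℤ) : Submodule K (Tensor n k) where
  carrier := {X | ∀ (I J : Fin k → Fin n) (r : Fin n),
    IsHomogeneousOfDegree (X I J)
      (d r + ∑ a, root n ((I a).val + 1) ((J a).val + 1) r)}
  zero_mem' := fun I J r => Or.inl rfl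
  add_mem' := fun hX hY I J r => (hX I J r).add (hY I J r)
  smul_mem' := by
    intro c X hX I J r
    rcases hX I J r with h0 | ⟨a, b, l, m, hb, ha1, hb1, hd, h1⟩
    · exact Or.inl (by rw [Matrix.smul_apply, h0, smul_zero])
    refine Or.inr ⟨MvPolynomial.C c * a, b, l, m, hb, ?_, hb1, hd, ?_⟩
    · simpa using (MvPolynomial.isHomogeneous_C (Fin k) c).mul ha1
    · rw [Matrix.smul_apply, smul_mul_assoc, h1, Algebra.smul_def, map_mul]; rfl

/-! ### The extended shuffle algebra -/

/-- The coefficient of `x^m` in the expansion of `R(x)` in non-negative powers of `x`. -/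
def rCoeff (n m : ℕ) : Matrix (Fin 2 → Fin n) (Fin 2 → Fin n) K :=
  (rMatrix n (HahnSeries.single (1 : ℤ) (1 : K) : LaurentSeries K)).map fun φ => φ.coeff m

/-- With strand `0` in front of the `k` strands of `X`, and `w = 1/y`, the matrix
`R_{k0}(z_k/y) ⋯ R_{10}(z_1/y) X R̃_{10}(z_1/y) ⋯ R̃_{k0}(z_k/y) / (f(z_k/y) ⋯ f(z_1/y))`,
whose entries are expanded as Laurent series in `w`. -/
def psiMat {n k : ℕ} (X : Tensor n k) :
    Matrix (Fin (k + 1) → Fin n) (Fin (k + 1) → Fin n) (LaurentSeries (RatFun k)) :=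
  let x : Fin k → LaurentSeries (RatFun k) := fun m => HahnSeries.single (1 : ℤ) (z m)
  (∏ m, f (x m))⁻¹ •
    (((List.finRange k).reverse.map fun m => R n m.succ 0 (x m)).prod *
      onStrands Fin.succ (X.map HahnSeries.C) *
      ((List.finRange k).map fun m => Rtilde n m.succ 0 (x m)).prod)

/-- The coefficient of `E_{cb} y^{-d}`, for the auxiliary strand `0`, of `psiMat X`. -/
def Psi {n k : ℕ} (X : Tensor n k) (c b : Fin n) (d : ℕ) : Tensor n k :=
  fun I J => (psiMat X (Fin.cons c I) (Fin.cons b J)).coeff d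

/-- The generators: `s a b d` stands for `s_{[a;b+nd)}`, `psi a` for `ψ_a = s_{[a;a)}⁻¹`, and
`x k X` for a tensor `X` in `End(V^{⊗k})(z_1, …, z_k)`. -/
inductive Gen (n : ℕ) : Type
  | s (a b : Fin n) (d : ℕ) : Gen n
  | psi (a : Fin n) : Gen n
  | x (k : ℕ) (X : Tensor n k) : Gen n

/-- The generator `s_{[a;b+nd)}` of the free algebra, for any `d : ℤ` (zero if `d < 0`). -/
def freeS (n : ℕ) (a b : Fin n) (d : ℤ) : FreeAlgebra K (Gen n) :=
  if 0 ≤ d then FreeAlgebra.ι K (Gen.s a b d.toNat) else 0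

/-- The generator of the free algebra given by a tensor `X`. -/
def freeX {n k : ℕ} (X : Tensor n k) : FreeAlgebra K (Gen n) := FreeAlgebra.ι K (Gen.x k X)

/-- The defining relations of the extended algebra.

* `s_tri`, `s_psi`, `psi_s`: `S(∞)` is upper triangular, with invertible diagonal.
* `rtt`: the coefficient of `x^{-p} y^{-r}` in the matrix entry at `(a,c), (b,e)` of
  `R(x/y) S_1(x) S_2(y) = S_2(y) S_1(x) R(x/y)`.
* `x_add`, `x_smul`, `x_one`: tensors are embedded linearly, and the unit is the empty tensor.
* `x_s`: the coefficient of `E_{ab} y^{-d}` in `X S_0(y) = S_0(y) (R ⋯ R X R̃ ⋯ R̃ / (f ⋯ f))`. -/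
inductive ExtRel (n : ℕ) : FreeAlgebra K (Gen n) → FreeAlgebra K (Gen n) → Prop
  | s_tri (a b : Fin n) (h : b < a) : ExtRel n (freeS n a b 0) 0
  | s_psi (a : Fin n) : ExtRel n (freeS n a a 0 * FreeAlgebra.ι K (Gen.psi a)) 1
  | psi_s (a : Fin n) : ExtRel n (FreeAlgebra.ι K (Gen.psi a) * freeS n a a 0) 1
  | rtt (a b c e : Fin n) (p : ℤ) (r : ℕ) : ExtRel n
      (∑ m ∈ Finset.range (r + 1), ∑ a' : Fin n, ∑ c' : Fin n,
        rCoeff n m ![a, c] ![a', c'] • (freeS n a' b (p + m) * freeS n c' e (r - m)))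
      (∑ m ∈ Finset.range (r + 1), ∑ b' : Fin n, ∑ e' : Fin n,
        rCoeff n m ![b', e'] ![b, e] • (freeS n c e' (r - m) * freeS n a b' (p + m)))
  | x_add (k : ℕ) (X Y : Tensor n k) : ExtRel n (freeX (X + Y)) (freeX X + freeX Y)
  | x_smul (k : ℕ) (r : K) (X : Tensor n k) : ExtRel n (freeX (r • X)) (r • freeX X)
  | x_one : ExtRel n (freeX (1 : Tensor n 0)) 1
  | x_s (k : ℕ) (X : Tensor n k) (a b : Fin n) (d : ℕ) : ExtRel n
      (freeX X * freeS n a b d)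
      (∑ c : Fin n, ∑ m ∈ Finset.range (d + 1), freeS n a c (d - m) * freeX (Psi X c b m))

/-- The extended algebra, in which the first tensor factors of coproducts live: it is generated by
the `s_{[i;j)}` and by tensors. Every word which occurs in the coproduct of a tensor contains exactly
one tensor `X`, so the value of the (shuffle) product of two tensors never matters; it is not imposed
here. The part which is linear in tensors of `k` strands is the free left module generated by them
over the algebra of the `s_{[i;j)}`, so it contains the piece of vertical degree `k` of the extended
shuffle algebra, with the same relations. -/
def Ext (n : ℕ) : Type := RingQuot (ExtRel n)

instance (n : ℕ) : Ring (Ext n) := inferInstanceAs (Ring (RingQuot (ExtRel n)))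

instance (n : ℕ) : Algebra K (Ext n) := inferInstanceAs (Algebra K (RingQuot (ExtRel n)))

/-- The quotient map from the free algebra. -/
def toExt (n : ℕ) : FreeAlgebra K (Gen n) →ₐ[K] Ext n := RingQuot.mkAlgHom K (ExtRel n)

theorem toExt_rel {n : ℕ} {u v : FreeAlgebra K (Gen n)} (h : ExtRel n u v) :
    toExt n u = toExt n v := RingQuot.mkAlgHom_rel K h

/-- The element `s_{[a;b+nd)}`. -/
def sElt (n : ℕ) (a b : Fin n) (d : ℕ) : Ext n := toExt n (freeS n a b d)

/-- A tensor, as an element of the extended algebra. -/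
def xLin (n k : ℕ) : Tensor n k →ₗ[K] Ext n where
  toFun X := toExt n (freeX X)
  map_add' X Y := by
    rw [toExt_rel (ExtRel.x_add k X Y), map_add]
  map_smul' r X := by
    rw [toExt_rel (ExtRel.x_smul k r X), map_smul]; rfl

instance (n m : ℕ) : Algebra K (HahnSeries ℤ (Ext n ⊗[K] RatFun m)) := HahnSeries.instAlgebra

/-- The matrix-valued series `D⁻¹ S(x q^{2n} q̄²)^† D` in powers of `1/x`, where `†` is the
transpose and `D = diag(q², …, q^{2n})`. -/
def sDual (n : ℕ) : PowerSeries (Matrix (Fin n) (Fin n) (Ext n)) :=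
  PowerSeries.mk fun d => Matrix.of fun a b =>
    ((q ^ (2 * (a.val + 1)))⁻¹ * q ^ (2 * (b.val + 1)) * ((q ^ (2 * n) * qbar n ^ 2) ^ d)⁻¹) •
      sElt n b a d

/-- The element `t_{[a;b+nd)}`, the coefficient of `E_{ab} x^{-d}` in the series `T(x)` determined
by `D⁻¹ S(x q^{2n} q̄²)^† D T(x)^† = 1`. The first factor is an invertible series. -/
def tElt (n : ℕ) (a b : Fin n) (d : ℕ) : Ext n :=
  PowerSeries.coeff d (Ring.inverse (sDual n)) b a

/-! ### The coproduct and slopes -/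

theorem aeval_single_monomial {k : ℕ} (w : Fin k → ℤ) (s : Fin k →₀ ℕ) (c : K) :
    MvPolynomial.aeval (fun a => (HahnSeries.single (w a) (z a) : LaurentSeries (RatFun k)))
      (MvPolynomial.monomial s c) =
    HahnSeries.single (Finsupp.weight w s)
      (algebraMap (MvPolynomial (Fin k) K) (RatFun k) (MvPolynomial.monomial s c)) := by
  have key : ∀ s : Fin k →₀ ℕ,
      MvPolynomial.aeval (fun a => (HahnSeries.single (w a) (z a) : LaurentSeries (RatFun k)))
        (MvPolynomial.monomial s (1 : K)) =
      HahnSeries.single (Finsupp.weight w s)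
        (algebraMap (MvPolynomial (Fin k) K) (RatFun k) (MvPolynomial.monomial s 1)) := by
    intro s
    induction s using Finsupp.induction_linear with
    | zero => simp
    | add s t hs ht =>
      have h : (MvPolynomial.monomial (s + t) (1 : K)) =
          MvPolynomial.monomial s 1 * MvPolynomial.monomial t 1 := by
        rw [MvPolynomial.monomial_mul, one_mul]
      rw [h, map_mul, hs, ht, HahnSeries.single_mul_single, map_add,
        map_mul (algebraMap (MvPolynomial (Fin k) K) (RatFun k))]
    | single a e =>
      have h : (MvPolynomial.monomial (Finsupp.single a e) (1 : K)) = MvPolynomial.X a ^ e :=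
        MvPolynomial.X_pow_eq_monomial.symm
      rw [h, map_pow, MvPolynomial.aeval_X, HahnSeries.single_pow, Finsupp.weight_single,
        map_pow (algebraMap (MvPolynomial (Fin k) K) (RatFun k))]
      rfl
  have h : MvPolynomial.monomial s c = c • MvPolynomial.monomial s (1 : K) := by
    rw [MvPolynomial.smul_monomial, smul_eq_mul, mul_one]
  rw [h, map_smul, key]
  ext p
  rw [HahnSeries.coeff_smul, HahnSeries.coeff_single, HahnSeries.coeff_single]
  split_ifs
  · rw [Algebra.smul_def, Algebra.smul_def, map_mul]; rfl
  · exact smul_zero _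

theorem coeff_aeval_single {k : ℕ} (w : Fin k → ℤ) (P : MvPolynomial (Fin k) K) (p : ℤ) :
    (MvPolynomial.aeval (fun a => (HahnSeries.single (w a) (z a) : LaurentSeries (RatFun k)))
      P).coeff p =
    algebraMap (MvPolynomial (Fin k) K) (RatFun k)
      (MvPolynomial.weightedHomogeneousComponent w p P) := by
  induction P using MvPolynomial.induction_on' with
  | monomial s c =>
    rw [aeval_single_monomial, HahnSeries.coeff_single]
    split_ifs with h
    · rw [(MvPolynomial.isWeightedHomogeneous_monomial w s c
        h.symm).weightedHomogeneousComponent_same]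
    · rw [(MvPolynomial.isWeightedHomogeneous_monomial w s c
        rfl).weightedHomogeneousComponent_ne p h, map_zero]
  | add P Q hP hQ => rw [map_add, HahnSeries.coeff_add, hP, hQ, map_add, map_add]

theorem aeval_single_injective {k : ℕ} (w : Fin k → ℤ) : Function.Injective
    (MvPolynomial.aeval (R := K)
      (fun a => (HahnSeries.single (w a) (z a) : LaurentSeries (RatFun k)))) := by
  rw [injective_iff_map_eq_zero]
  intro P hP
  ext s
  have h := coeff_aeval_single w P (Finsupp.weight w s)
  rw [hP, HahnSeries.coeff_zero] at h
  have h0 := (IsFractionRing.injective (MvPolynomial (Fin k) K) (RatFun k))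
    ((map_zero _).trans h)
  have h1 := congrArg (MvPolynomial.coeff s) h0
  rw [MvPolynomial.coeff_weightedHomogeneousComponent, if_pos rfl] at h1
  exact h1.symm

/-- Substitute `z_a ↦ z_a ω^{w_a}` and expand as a Laurent series in `ω`. -/
def expand {k : ℕ} (w : Fin k → ℤ) : RatFun k →ₐ[K] LaurentSeries (RatFun k) :=
  IsFractionRing.liftAlgHom
    (g := MvPolynomial.aeval (R := K)
      (fun a => (HahnSeries.single (w a) (z a) : LaurentSeries (RatFun k))))
    (aeval_single_injective w)

/-- The multiplication of functions of `z_1, …, z_i` with functions of `z_{i+1}, …, z_{i+m}`. -/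
def mulFun (i m : ℕ) : RatFun i ⊗[K] RatFun m →ₐ[K] RatFun (i + m) :=
  Algebra.TensorProduct.productMap (renameVars (Fin.castAddEmb m)) (renameVars (Fin.natAddEmb i))

/-- The coefficient of `E_{I_1 J_1} ⊗ ⋯` in the first factor of `End(V^{⊗i})(z) ⊗ K(z)`. -/
def entryMap {n : ℕ} (i m : ℕ) (I J : Fin i → Fin n) :
    Tensor n i ⊗[K] RatFun m →ₗ[K] RatFun (i + m) :=
  (mulFun i m).toLinearMap ∘ₗ LinearMap.rTensor (RatFun m) (Matrix.entryLinearMap K (RatFun i) I J)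

/-- The matrix, in strand `b` of `m` strands, of the series `∑_d g a b' d ⊗ E_{ab'} z_b^{-d}`, where
`ω` keeps track of the degree in `1/z_b`. -/
def strandSeries {n m : ℕ} (g : Fin n → Fin n → ℕ → Ext n) (b : Fin m) :
    Matrix (Fin m → Fin n) (Fin m → Fin n) (HahnSeries ℤ (Ext n ⊗[K] RatFun m)) :=
  onStrands (fun _ : Fin 1 => b) fun I J =>
    HahnSeries.ofPowerSeries ℤ _ (PowerSeries.mk fun d => g (I 0) (J 0) d ⊗ₜ[K] (z b ^ d)⁻¹)

/-- `(S_m(z_m) ⋯ S_1(z_1) ⊗ 1) · τ · (T_1(z_1) ⋯ T_m(z_m) ⊗ 1)`, where the `m` strands are those of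
the second factor, whose variables are `z_1, …, z_m` here. -/
def dress {n i m : ℕ}
    (τ : Matrix (Fin m → Fin n) (Fin m → Fin n) (HahnSeries ℤ (Tensor n i ⊗[K] RatFun m))) :
    Matrix (Fin m → Fin n) (Fin m → Fin n) (HahnSeries ℤ (Ext n ⊗[K] RatFun m)) :=
  ((List.finRange m).reverse.map (strandSeries (sElt n))).prod *
    τ.map (fun φ => φ.map (LinearMap.rTensor (RatFun m) (xLin n i))) *
    ((List.finRange m).map (strandSeries (tElt n))).prod

/-- `τ` is the expansion of `X(z_1, …, z_{i+m}) / ∏_{a ≤ i < b} f(z_a/z_b)` for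
`z_1, …, z_i ≪ z_{i+1}, …, z_{i+m}`, with the functions and tensors of the first `i` strands
collected on the left of `⊗`. The coefficient of `ω^p` is the part of degree `-p` in
`z_{i+1}, …, z_{i+m}`. -/
def IsExpansion {n : ℕ} (i m : ℕ) (X : Tensor n (i + m))
    (τ : Matrix (Fin m → Fin n) (Fin m → Fin n) (HahnSeries ℤ (Tensor n i ⊗[K] RatFun m))) : Prop :=
  ∀ (I₁ J₁ : Fin i → Fin n) (I₂ J₂ : Fin m → Fin n),
    (τ I₂ J₂).map (entryMap i m I₁ J₁) =
      expand (Fin.append (fun _ : Fin i => (0 : ℤ)) (fun _ : Fin m => -1))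
        (X (Fin.append I₁ I₂) (Fin.append J₁ J₂) /
          ∏ a : Fin i, ∏ b : Fin m, f (z (Fin.castAdd m a) / z (Fin.natAdd i b)))

/-- The component `Δ(X)_{i,m}` of the coproduct of `X`, in vertical degrees `i` and `m`, has only
summands `X_1 ⊗ X_2` with `|hdeg X_2| ≤ μ m`. The degree of the term of `E_{I J} ω^p` in the second
factor is `n (-p) - ∑_b |[I_b; J_b)|`. -/
def SlopeCond {n : ℕ} (μ : ℚ) (i m : ℕ) (X : Tensor n (i + m)) : Prop :=
  ∃ τ, IsExpansion i m X τ ∧ ∀ (I J : Fin m → Fin n) (p : ℤ),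
    μ * m < (((n : ℤ) * (-p) - ∑ b, (((J b).val : ℤ) - ((I b).val : ℤ)) : ℤ) : ℚ) →
      (dress τ I J).coeff p = 0

theorem SlopeCond.zero {n : ℕ} (μ : ℚ) (i m : ℕ) : SlopeCond μ i m (0 : Tensor n (i + m)) := by
  refine ⟨0, fun I₁ J₁ I₂ J₂ => ?_, fun I J p _ => ?_⟩
  · rw [Matrix.zero_apply, Matrix.zero_apply, zero_div, map_zero]
    ext p
    simp
  · have h : (0 : Matrix (Fin m → Fin n) (Fin m → Fin n)
        (HahnSeries ℤ (Tensor n i ⊗[K] RatFun m))).map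
          (fun φ => φ.map (LinearMap.rTensor (RatFun m) (xLin n i))) = 0 := by
      ext I J p
      simp
    rw [dress, h, Matrix.mul_zero, Matrix.zero_mul]
    rfl

theorem dress_add {n i m : ℕ}
    (τ τ' : Matrix (Fin m → Fin n) (Fin m → Fin n) (HahnSeries ℤ (Tensor n i ⊗[K] RatFun m))) :
    dress (τ + τ') = dress τ + dress τ' := by
  have h : (τ + τ').map (fun φ => φ.map (LinearMap.rTensor (RatFun m) (xLin n i))) =
      τ.map (fun φ => φ.map (LinearMap.rTensor (RatFun m) (xLin n i))) +
        τ'.map (fun φ => φ.map (LinearMap.rTensor (RatFun m) (xLin n i))) := by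
    ext I J p
    simp
  rw [dress, h, Matrix.mul_add, Matrix.add_mul]
  rfl

theorem dress_smul {n i m : ℕ} (r : K)
    (τ : Matrix (Fin m → Fin n) (Fin m → Fin n) (HahnSeries ℤ (Tensor n i ⊗[K] RatFun m))) :
    dress (r • τ) = r • dress τ := by
  have h : (r • τ).map (fun φ => φ.map (LinearMap.rTensor (RatFun m) (xLin n i))) =
      r • τ.map (fun φ => φ.map (LinearMap.rTensor (RatFun m) (xLin n i))) := by
    ext I J p
    simp
  have h1 : IsScalarTower K (HahnSeries ℤ (Ext n ⊗[K] RatFun m))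
      (HahnSeries ℤ (Ext n ⊗[K] RatFun m)) := by
    exact @IsScalarTower.right K (HahnSeries ℤ (Ext n ⊗[K] RatFun m)) _ _ HahnSeries.instAlgebra
  have h2 : SMulCommClass K (HahnSeries ℤ (Ext n ⊗[K] RatFun m))
      (HahnSeries ℤ (Ext n ⊗[K] RatFun m)) := by
    exact @Algebra.to_smulCommClass K (HahnSeries ℤ (Ext n ⊗[K] RatFun m)) _ _
      HahnSeries.instAlgebra
  rw [dress, h]
  exact (congrArg (· * _) (Matrix.mul_smul _ r _)).trans (Matrix.smul_mul r _ _)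

theorem SlopeCond.add {n : ℕ} {μ : ℚ} {i m : ℕ} {X Y : Tensor n (i + m)}
    (hX : SlopeCond μ i m X) (hY : SlopeCond μ i m Y) : SlopeCond μ i m (X + Y) := by
  obtain ⟨τ, h1, h2⟩ := hX
  obtain ⟨τ', h1', h2'⟩ := hY
  refine ⟨τ + τ', fun I₁ J₁ I₂ J₂ => ?_, fun I J p hp => ?_⟩
  · have h : ((τ + τ') I₂ J₂).map (entryMap i m I₁ J₁) =
        (τ I₂ J₂).map (entryMap i m I₁ J₁) + (τ' I₂ J₂).map (entryMap i m I₁ J₁) := by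
      ext p; simp
    rw [h, h1, h1', Matrix.add_apply, add_div, map_add]
  · rw [dress_add, Matrix.add_apply, HahnSeries.coeff_add, h2 I J p hp, h2' I J p hp, add_zero]

theorem SlopeCond.smul {n : ℕ} {μ : ℚ} {i m : ℕ} {X : Tensor n (i + m)} (r : K)
    (hX : SlopeCond μ i m X) : SlopeCond μ i m (r • X) := by
  obtain ⟨τ, h1, h2⟩ := hX
  refine ⟨r • τ, fun I₁ J₁ I₂ J₂ => ?_, fun I J p hp => ?_⟩
  · have h : ((r • τ) I₂ J₂).map (entryMap i m I₁ J₁) =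
        r • (τ I₂ J₂).map (entryMap i m I₁ J₁) := by
      ext p; simp
    rw [h, h1, Matrix.smul_apply, smul_div_assoc, map_smul]
  · rw [dress_smul, Matrix.smul_apply, HahnSeries.coeff_smul, h2 I J p hp, smul_zero]

/-- The tensors in `k` strands all of whose coproduct components satisfy the slope condition. -/
def slopeSpace (n k : ℕ) (μ : ℚ) : Submodule K (Tensor n k) where
  carrier := {X | ∀ (i m : ℕ) (h : k = i + m), SlopeCond μ i m (h ▸ X)}
  zero_mem' := by
    intro i m h
    subst h
    exact SlopeCond.zero μ i m
  add_mem' := by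
    intro X Y hX hY i m h
    subst h
    exact (hX i m rfl).add (hY i m rfl)
  smul_mem' := by
    intro r X hX i m h
    subst h
    exact (hX i m rfl).smul r

/-- `𝒜_{≤ μ | d, k}`. -/
def slopePiece (n k : ℕ) (μ : ℚ) (d : Fin n → ℤ) : Submodule K (Tensor n k) :=
  shuffleSpace n k ⊓ hdegSpace n k d ⊓ slopeSpace n k μ

/-! ### Collections -/

/-- `ℤ² / (n,n)ℤ`. -/
abbrev Pairs (n : ℕ) : Type := (ℤ × ℤ) ⧸ AddSubgroup.zmultiples ((n : ℤ), (n : ℤ))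

/-- `j - i`, for the class of `(i, j)` modulo `(n, n)`. -/
def Pairs.diff (n : ℕ) : Pairs n →+ ℤ :=
  QuotientAddGroup.lift _ (AddMonoidHom.snd ℤ ℤ - AddMonoidHom.fst ℤ ℤ) (by
    rintro _ ⟨t, rfl⟩
    simp)

theorem card_Ico_modEq_shift (n : ℕ) (i j r t : ℤ) :
    ((Finset.Ico (i + t * n) (j + t * n)).filter fun x => x ≡ r [ZMOD n]).card =
      ((Finset.Ico i j).filter fun x => x ≡ r [ZMOD n]).card := by
  symm
  refine Finset.card_bij (fun x _ => x + t * n) ?_ ?_ ?_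
  · intro x hx
    simp only [Finset.mem_filter, Finset.mem_Ico] at hx ⊢
    refine ⟨⟨by lia, by lia⟩, ?_⟩
    exact (Int.modEq_iff_dvd.mpr ⟨-t, by ring⟩).trans hx.2
  · intro x _ y _ h
    exact add_right_cancel h
  · intro y hy
    simp only [Finset.mem_filter, Finset.mem_Ico] at hy
    refine ⟨y - t * n, ?_, by ring⟩
    simp only [Finset.mem_filter, Finset.mem_Ico]
    refine ⟨⟨by lia, by lia⟩, ?_⟩
    exact (Int.modEq_iff_dvd.mpr ⟨t, by ring⟩).trans hy.2

/-- `[i;j)`, for the class of `(i, j)` modulo `(n, n)`. -/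
def Pairs.root {n : ℕ} (c : Pairs n) : Fin n → ℤ :=
  Quotient.liftOn' c (fun p => MatrixShuffle.root n p.1 p.2) (by
    intro p p' h
    rw [QuotientAddGroup.leftRel_apply] at h
    obtain ⟨t, ht⟩ := h
    have h1 : p'.1 = p.1 + t * n := by
      have := congrArg Prod.fst ht
      simp at this
      linarith
    have h2 : p'.2 = p.2 + t * n := by
      have := congrArg Prod.snd ht
      simp at this
      linarith
    funext r
    simp only [MatrixShuffle.root, h1, h2, card_Ico_modEq_shift])

/-- The unordered collections of triples `(i_s, j_s, λ_s)`, with `λ_s ≥ 1` and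
`(i_s, j_s) ∈ ℤ² / (n,n)ℤ`, such that `∑ λ_s = k`, `∑ [i_s;j_s) = d` and `j_s - i_s ≤ μ λ_s`. -/
def collections (n k : ℕ) (μ : ℚ) (d : Fin n → ℤ) : Set (Multiset (Pairs n × ℕ)) :=
  {C | (∀ c ∈ C, 1 ≤ c.2) ∧ (C.map fun c => c.2).sum = k ∧ (C.map fun c => c.1.root).sum = d ∧
    ∀ c ∈ C, ((Pairs.diff n c.1 : ℤ) : ℚ) ≤ μ * c.2}

end MatrixShuffle

end

open scoped TensorProduct
open Finset (univ mem_filter mem_filter_univ mem_univ sum_congr range sum_eq_single prod_filter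
  prod_mul_distrib prod_congr sum_eq_zero sum_comm prod_ne_zero_iff sum_add_distrib prod_insert mem_Ico filter_filter)
open HahnSeries (single C single_mul_single coeff_sum coeff_single_mul coeff_single_of_ne coeff_add)
open Function (update comp_apply Injective update_of_ne)
open Equiv (Perm swap)
open Fin (cons lt_def le_def)
open List (finRange map_congr_left)
open Matrix (mul_apply smul_apply)

noncomputable section

namespace MatrixShuffle

set_option linter.unusedSectionVars false

variable {ι : Type*} [Fintype ι] [DecidableEq ι] {n k u : ℕ} {L : Type*} [Field L] [Algebra K L]
  {φ ψ : RatFun k} {i j a : Fin k} {X Y : Tensor n k} {xs : List ι} {σ : Perm (Fin k)}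

/-- Laurent series in the auxiliary variable. -/
notation "Ser" k:max => LaurentSeries (RatFun k)
/-- The product of the auxiliary variable and `z m`. -/
notation "zt" m:max => single (1 : ℤ) (z m)
/-- The constants in a `K`-algebra. -/
notation "ofK" => algebraMap K _
/-- A multi-index with one index more. -/
notation:67 a:68 "◁" I:67 => Fin.cons (α := fun _ => Fin _) a I
/-- The constants among the rational functions. -/
notation "cst" => algebraMap K (RatFun _)
/-- The constants among the rational functions in a given number of variables. -/
notation:max "cOn" k:max => algebraMap K (RatFun k)
/-- The constants in a given algebra. -/
notation:max "cIn" L:max => algebraMap K L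

/-- Operators on `V^{⊗ι}` with entries in `L`. -/
abbrev Op (ι : Type*) (n : ℕ) (L : Type*) : Type _ := Matrix (ι → Fin n) (ι → Fin n) L

/-! ### Permutation operators and `R`-matrices on arbitrary sets of strands -/

section RAlgebra

variable {ι L : Type*} [Fintype ι] [DecidableEq ι]

/-- The permutation operator `(Pm σ ψ)(I) = ψ(I ∘ σ)`. -/
def Pm (L : Type*) [Zero L] [One L] (σ : Perm ι) : Op ι n L := fun I J => if J = I ∘ σ then 1 else 0

lemma Pm_mul_apply [NonAssocSemiring L] (σ : Perm ι) (M : Op ι n L)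
    (I J : ι → Fin n) : (Pm L σ * M : Op ι n L) I J = M (I ∘ σ) J := by
  simp [Pm, mul_apply]

lemma mul_Pm_apply [NonAssocSemiring L] (σ : Perm ι) (M : Op ι n L)
    (I J : ι → Fin n) : (M * Pm L σ : Op ι n L) I J = M I (J ∘ σ.symm) := by
  have h : ∀ K, (J = K ∘ σ) ↔ (J ∘ σ.symm = K) := by aesop
  simp [Pm, mul_apply, h]

lemma Pm_mul_Pm [NonAssocSemiring L] (σ τ : Perm ι) :
    (Pm L σ * Pm L τ : Op ι n L) = Pm L (σ * τ) := by
  ext I J; rw [Pm_mul_apply]; rfl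

lemma Pm_one [NonAssocSemiring L] : (Pm L (1 : Perm ι) : Op ι n L) = 1 := by
  ext I J; simp [Pm, Matrix.one_apply, eq_comm]

lemma Pm_mul_inv [NonAssocSemiring L] (σ : Perm ι) : (Pm L σ * Pm L σ⁻¹ : Op ι n L) = 1 := by
  rw [Pm_mul_Pm, mul_inv_cancel, Pm_one]

lemma Pm_inv_mul [NonAssocSemiring L] (σ : Perm ι) : (Pm L σ⁻¹ * Pm L σ : Op ι n L) = 1 := by
  rw [Pm_mul_Pm, inv_mul_cancel, Pm_one]

/-- The matrix `M` acts trivially in the tensor factor `x`. -/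
def TrivOn [Zero L] (x : ι) (M : Op ι n L) : Prop := (∀ I J, I x ≠ J x → M I J = 0) ∧
    ∀ I J (t : Fin n), I x = J x → M (update I x t) (update J x t) = M I J

lemma TrivOn.one [Zero L] [One L] (x : ι) : TrivOn x (1 : Op ι n L) := by
  refine ⟨fun I J h => Matrix.one_apply_ne fun e => h (by rw [e]), fun I J t h => ?_⟩
  have : update I x t = update J x t ↔ I = J := by
    constructor
    · intro e; funext y
      by_cases hy : y = x
      · rw [hy, h]
      · simpa [hy] using congrFun e y
    · rintro rfl; rfl
  simp [Matrix.one_apply, this]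

theorem TrivOn.smul {S : Type*} [Zero L] [SMulZeroClass S L] {x : ι} {M : Op ι n L}
    (h : TrivOn x M) (r : S) : TrivOn x (r • M) :=
  ⟨fun I J e => by rw [Matrix.smul_apply, h.1 I J e, smul_zero],
    fun I J t e => by rw [Matrix.smul_apply, Matrix.smul_apply, h.2 I J t e]⟩

lemma TrivOn.mul [NonAssocSemiring L] {x : ι} {M N : Op ι n L}
    (h : TrivOn x M) (h' : TrivOn x N) : TrivOn x (M * N) := by
  refine ⟨fun I J e => ?_, fun I J t e => ?_⟩
  · rw [mul_apply]; refine sum_eq_zero fun K _ => ?_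
    by_cases hK : I x = K x
    · rw [h'.1 K J (hK ▸ e), mul_zero]
    · rw [h.1 I K hK, zero_mul]
  · rw [mul_apply, mul_apply]
    rw [← Finset.sum_filter_of_ne (p := fun K => K x = t),
      ← Finset.sum_filter_of_ne (p := fun K => K x = I x) (f := fun K => M I K * N K J)]
    · refine Finset.sum_bij' (fun K _ => update K x (I x)) (fun K _ => update K x t) ?_ ?_ ?_ ?_ ?_
      · intro K _; simp
      · intro K _; simp
      · grind
      · grind
      · intro K hK; simp only [mem_filter_univ] at hK
        have h1 := h.2 I (update K x (I x)) t (by simp)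
        have h2 := h'.2 (update K x (I x)) J t (by simp [e])
        simp only [Function.update_idem] at h1 h2; rw [← h1, ← h2]; simp [← hK]
    · intro K _ hK; by_contra hc; exact hK (by rw [h.1 I K (Ne.symm hc), zero_mul])
    · intro K _ hK; by_contra hc; refine hK ?_; rw [h.1 _ K (by simpa using Ne.symm hc), zero_mul]

lemma TrivOn.list_prod [Semiring L] {x : ι} {l : List (Op ι n L)}
    (h : ∀ M ∈ l, TrivOn x M) : TrivOn x l.prod := by
  induction l with
  | nil => simpa using TrivOn.one x
  | cons M l ih =>
    rw [List.prod_cons]; exact (h M (by simp)).mul (ih fun N hN => h N (by simp [hN]))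

lemma onStrands_pos {κ : Type*} [Zero L] {c : κ → ι} (M : Op κ n L)
    {I J : ι → Fin n} (h : ∀ m, m ∉ Set.range c → I m = J m) :
    onStrands c M I J = M (I ∘ c) (J ∘ c) := if_pos h

lemma onStrands_neg {κ : Type*} [Zero L] {c : κ → ι} (M : Op κ n L)
    {I J : ι → Fin n} (h : ¬ ∀ m, m ∉ Set.range c → I m = J m) :
    onStrands c M I J = 0 := if_neg h

lemma TrivOn.onStrands {κ : Type*} [Zero L] (c : κ → ι)
    (M : Op κ n L) {x : ι} (hx : x ∉ Set.range c) :
    TrivOn x (onStrands c M) := by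
  have key : ∀ (I : ι → Fin n) (t : Fin n), update I x t ∘ c = I ∘ c := by grind
  refine ⟨fun I J e => ?_, fun I J t e => ?_⟩
  · rw [MatrixShuffle.onStrands, if_neg fun h => e (h x hx)]
  · have hp : (∀ m, m ∉ Set.range c → update I x t m = update J x t m) ↔
        ∀ m, m ∉ Set.range c → I m = J m := by
      grind
    by_cases h : ∀ m, m ∉ Set.range c → I m = J m
    · rw [onStrands_pos M h, onStrands_pos M (hp.2 h), key, key]
    · rw [onStrands_neg M h, onStrands_neg M fun h' => h (hp.1 h')]

variable [Field L] [Algebra K L]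

/-- The diagonal coefficient of the `R`-matrix. -/
def rDiag (x : L) (a b : Fin n) : L :=
  if a = b then (cIn L q - x * cIn L q⁻¹) / (1 - x) else 1

/-- The off-diagonal coefficient of the `R`-matrix. -/
def rOff (x : L) (a b : Fin n) : L :=
  if a = b then 0 else cIn L (q - q⁻¹) * ((if a < b then x else 1) / (1 - x))

/-- The `R`-matrix acting on the strands `a`, `b` of a set of strands `ι`. -/
def Rm (a b : ι) (x : L) : Op ι n L := onStrands ![a, b] (rMatrix n x)

lemma R_eq_Rm (i j : Fin k) (x : L) : R n i j x = Rm i j x := rfl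

lemma range_pair (a b : ι) : Set.range ![a, b] = {a, b} := by aesop

lemma TrivOn.rm {a b y : ι} (ha : y ≠ a) (hb : y ≠ b) (x : L) : TrivOn (n := n) y (Rm a b x) :=
  TrivOn.onStrands _ _ (by simp [range_pair, ha, hb])

lemma comp_swap_eq_iff {a b : ι} (I J : ι → Fin n) :
    J = I ∘ swap a b ↔ (∀ m, m ≠ a → m ≠ b → I m = J m) ∧ I a = J b ∧ I b = J a := by
  aesop

lemma Rm_apply {a b : ι} (hab : a ≠ b) (x : L) (I J : ι → Fin n) :
    Rm a b x I J = (if I = J then rDiag x (I a) (I b) else 0) +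
      (if J = I ∘ swap a b then rOff x (I a) (I b) else 0) := by
  have h1 : (∀ m, m ∉ Set.range ![a, b] → I m = J m) ↔ ∀ m, m ≠ a → m ≠ b → I m = J m := by aesop
  have h2 : I = J ↔ (∀ m, m ≠ a → m ≠ b → I m = J m) ∧ I a = J a ∧ I b = J b := by
    constructor
    · rintro rfl; simp
    · rintro ⟨h, ha, hb⟩; funext m
      by_cases hma : m = a
      · rw [hma, ha]
      grind
  simp only [comp_swap_eq_iff, h2]; unfold Rm
  by_cases h : ∀ m, m ≠ a → m ≠ b → I m = J m
  · rw [onStrands_pos _ (h1.2 h)]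
    have e0 : rMatrix n x (I ∘ ![a, b]) (J ∘ ![a, b]) = if I a = J a ∧ I b = J b then
        rDiag x (I a) (I b) else if I a = J b ∧ I b = J a then
        cIn L (q - q⁻¹) * ((if I a < I b then x else 1) / (1 - x)) else 0 := rfl
    rw [e0]; simp only [eq_true h, rOff, true_and]; grind
  · rw [onStrands_neg _ fun h' => h (h1.1 h'), if_neg fun h' => h h'.1,
      if_neg fun h' => h h'.1, add_zero]

lemma Rm_mulVec {a b : ι} (hab : a ≠ b) (x : L) (ψ : (ι → Fin n) → L) (I : ι → Fin n) :
    (Rm a b x).mulVec ψ I = rDiag x (I a) (I b) * ψ I + rOff x (I a) (I b) * ψ (I ∘ swap a b) := by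
  simp [Matrix.mulVec, dotProduct, Rm_apply hab, add_mul, sum_add_distrib]

lemma Rm_mul_apply {a b : ι} (hab : a ≠ b) (x : L) (M : Op ι n L) (I J : ι → Fin n) :
    (Rm a b x * M : Op ι n L) I J = rDiag x (I a) (I b) * M I J +
      rOff x (I a) (I b) * M (I ∘ swap a b) J := by
  simp [mul_apply, Rm_apply hab, add_mul, sum_add_distrib]

lemma eq_comp_swap_symm {a b : ι} (I J : ι → Fin n) : J = I ∘ swap a b ↔ I = J ∘ swap a b := by
  aesop

lemma mul_Rm_apply {a b : ι} (hab : a ≠ b) (x : L) (M : Op ι n L) (I J : ι → Fin n) :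
    (M * Rm a b x : Op ι n L) I J = M I J * rDiag x (J a) (J b) +
      M I (J ∘ swap a b) * rOff x (J b) (J a) := by
  simp only [mul_apply, Rm_apply hab, mul_add, sum_add_distrib, eq_comp_swap_symm _ J]; simp

lemma TrivOn.commute_Rm {a b : ι} (hab : a ≠ b) {M : Op ι n L}
    (ha : TrivOn a M) (hb : TrivOn b M) (x : L) : M * Rm a b x = Rm a b x * M := by
  ext I J; rw [mul_Rm_apply hab, Rm_mul_apply hab]; congr 1
  · by_cases h : I a = J a ∧ I b = J b
    · rw [h.1, h.2, mul_comm]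
    · rw [not_and_or] at h; rcases h with h | h
      · rw [ha.1 I J h]; ring
      · rw [hb.1 I J h]; ring
  · by_cases h : I a = J b ∧ I b = J a
    · rw [h.1, h.2, mul_comm]; congr 1
      have e1 : J ∘ swap a b = update (update J a (J b)) b (J a) := by grind
      have e2 : I ∘ swap a b = update (update I a (I b)) b (I a) := by grind
      have e3 : J = update (update (J ∘ swap a b) a (I b)) b (I a) := by grind
      conv_rhs => rw [e2, e3]
      rw [hb.2 _ _ _ (by simp [hab.symm, h.2]), ha.2 _ _ _ (by simp [h.1])]
    · rw [not_and_or] at h; rcases h with h | h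
      · rw [ha.1 I _ (by simpa using h), hb.1 _ J (by simpa using h)]; ring
      · rw [hb.1 I _ (by simpa using h), ha.1 _ J (by simpa using h)]; ring

lemma Rm_commute {a b c d : ι} (hab : a ≠ b) (hac : a ≠ c) (had : a ≠ d)
    (hbc : b ≠ c) (hbd : b ≠ d) (x y : L) :
    (Rm a b x * Rm c d y : Op ι n L) = Rm c d y * Rm a b x :=
  ((TrivOn.rm hac had y).commute_Rm hab (TrivOn.rm hbc hbd y) x).symm

lemma Pm_mul_Rm (σ : Perm ι) {a b : ι} (hab : a ≠ b) (x : L) :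
    (Pm L σ * Rm a b x : Op ι n L) = Rm (σ a) (σ b) x * Pm L σ := by
  ext I J; rw [Pm_mul_apply, mul_Pm_apply, Rm_apply hab, Rm_apply (σ.injective.ne hab)]
  have e1 : I ∘ σ = J ↔ I = J ∘ σ.symm := by aesop
  have e2 : J = (I ∘ σ) ∘ swap a b ↔ J ∘ σ.symm = I ∘ swap (σ a) (σ b) := by
    have : (I ∘ σ) ∘ swap a b = (I ∘ swap (σ a) (σ b)) ∘ σ := by aesop
    rw [this]; constructor
    · rintro rfl; ext; simp
    · intro h; rw [← h]; ext; simp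
  simp only [e1, e2, comp_apply]

lemma q_ne_zero : q ≠ 0 := by
  have h := (IsFractionRing.injective (MvPolynomial (Fin 2) ℚ) K).ne
    (MvPolynomial.X_ne_zero (0 : Fin 2))
  simpa [q] using h

lemma Rm_unitarity {a b : ι} (hab : a ≠ b) {x : L} (h0 : x ≠ 0) (h1 : x ≠ 1) :
    (Rm a b x * Rm b a x⁻¹ : Op ι n L) = f x • 1 := by
  have hq : cIn L q ≠ 0 := by simpa using q_ne_zero
  have h1' : 1 - x ≠ 0 := sub_ne_zero.2 (Ne.symm h1)
  have h2' : 1 - x⁻¹ ≠ 0 := sub_ne_zero.2 fun h => h1 (inv_eq_one.1 h.symm)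
  have h3 : x - 1 ≠ 0 := sub_ne_zero.2 h1; apply Matrix.mulVec_injective; funext ψ I
  rw [← Matrix.mulVec_mulVec, Rm_mulVec hab, Rm_mulVec hab.symm, Rm_mulVec hab.symm,
    Matrix.smul_mulVec, Matrix.one_mulVec, Pi.smul_apply, smul_eq_mul, Equiv.swap_comm b a]
  have e : (I ∘ swap a b) ∘ swap a b = I := by funext m; simp
  have e2 : 1 - x⁻¹ = (x - 1) / x := by field_simp
  rw [e]
  simp only [comp_apply, Equiv.swap_apply_left, Equiv.swap_apply_right, f, rDiag, rOff, e2,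
    map_sub, map_inv₀, map_pow]
  rcases lt_trichotomy (I a) (I b) with h | h | h
  · grind
  · grind
  grind

/-- Change of the three indices `a`, `b`, `c`. -/
def upd3 (a b c : ι) (I : ι → Fin n) (p r t : Fin n) : ι → Fin n :=
  update (update (update I a p) b r) c t

lemma upd3_self (a b c : ι) (I : ι → Fin n) : upd3 a b c I (I a) (I b) (I c) = I := by simp [upd3]

lemma Rm_mulVec_upd12 {a b c : ι} (hab : a ≠ b) (hac : a ≠ c) (hbc : b ≠ c) (x : L)
    (ψ : (ι → Fin n) → L) (I : ι → Fin n) (p r t : Fin n) :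
    (Rm a b x).mulVec ψ (upd3 a b c I p r t) = rDiag x p r * ψ (upd3 a b c I p r t) +
      rOff x p r * ψ (upd3 a b c I r p t) := by
  have e : upd3 a b c I p r t ∘ swap a b = upd3 a b c I r p t := by
    symm; rw [comp_swap_eq_iff]; refine ⟨fun m h1 h2 => ?_, ?_, ?_⟩
    · by_cases h3 : m = c <;> simp [upd3, h1, h2, h3]
    · simp [upd3, hab, hac, hbc]
    · simp [upd3, hab, hac, hbc]
  rw [Rm_mulVec hab, e]; simp [upd3, hab, hac, hbc]

lemma Rm_mulVec_upd13 {a b c : ι} (hab : a ≠ b) (hac : a ≠ c) (hbc : b ≠ c) (x : L)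
    (ψ : (ι → Fin n) → L) (I : ι → Fin n) (p r t : Fin n) :
    (Rm a c x).mulVec ψ (upd3 a b c I p r t) = rDiag x p t * ψ (upd3 a b c I p r t) +
      rOff x p t * ψ (upd3 a b c I t r p) := by
  have e : upd3 a b c I p r t ∘ swap a c = upd3 a b c I t r p := by
    symm; rw [comp_swap_eq_iff]; refine ⟨fun m h1 h2 => ?_, ?_, ?_⟩
    · by_cases h3 : m = b <;> simp [upd3, h1, h2, h3, hbc]
    · simp [upd3, hab, hac, hbc]
    · simp [upd3, hab, hac, hbc]
  rw [Rm_mulVec hac, e]; simp [upd3, hab, hac, hbc]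

lemma Rm_mulVec_upd23 {a b c : ι} (hab : a ≠ b) (hac : a ≠ c) (hbc : b ≠ c) (x : L)
    (ψ : (ι → Fin n) → L) (I : ι → Fin n) (p r t : Fin n) :
    (Rm b c x).mulVec ψ (upd3 a b c I p r t) = rDiag x r t * ψ (upd3 a b c I p r t) +
      rOff x r t * ψ (upd3 a b c I p t r) := by
  have e : upd3 a b c I p r t ∘ swap b c = upd3 a b c I p t r := by
    symm; rw [comp_swap_eq_iff]; refine ⟨fun m h1 h2 => ?_, ?_, ?_⟩
    · by_cases h3 : m = a
      · subst h3; simp [upd3, h1, h2]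
      · simp [upd3, h1, h2, h3]
    · simp [upd3, hab, hac, hbc]
    · simp [upd3, hab, hac, hbc]
  rw [Rm_mulVec hbc, e]; simp [upd3, hab, hac, hbc]

lemma rDiag_self (x : L) (a : Fin n) :
    rDiag x a a = (cIn L q - x * (cIn L q)⁻¹) / (1 - x) := by
  simp [rDiag]

lemma rDiag_ne (x : L) {a b : Fin n} (h : a ≠ b) : rDiag x a b = 1 := if_neg h

lemma rOff_self (x : L) (a : Fin n) : rOff x a a = 0 := if_pos rfl

lemma rOff_lt (x : L) {a b : Fin n} (h : a < b) :
    rOff x a b = (cIn L q - (cIn L q)⁻¹) * (x / (1 - x)) := by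
  simp [rOff, h.ne, h]

lemma rOff_gt (x : L) {a b : Fin n} (h : b < a) :
    rOff x a b = (cIn L q - (cIn L q)⁻¹) * (1 / (1 - x)) := by
  simp [rOff, h.ne', not_lt_of_gt h]

set_option maxHeartbeats 4000000 in
lemma Rm_yangBaxter {a b c : ι} (hab : a ≠ b) (hac : a ≠ c) (hbc : b ≠ c) {x y : L}
    (hx : x ≠ 1) (hy : y ≠ 1) (hxy : x * y ≠ 1) :
    (Rm a b x * Rm a c (x * y) * Rm b c y : Op ι n L) = Rm b c y * Rm a c (x * y) * Rm a b x := by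
  have hq : cIn L q ≠ 0 := by simpa using q_ne_zero
  have hx' : 1 - x ≠ 0 := sub_ne_zero.2 (Ne.symm hx)
  have hy' : 1 - y ≠ 0 := sub_ne_zero.2 (Ne.symm hy)
  have hxy' : 1 - x * y ≠ 0 := sub_ne_zero.2 (Ne.symm hxy)
  have hyx' : 1 - y * x ≠ 0 := by rwa [mul_comm]
  apply Matrix.mulVec_injective; funext ψ I; rw [← upd3_self a b c I]
  generalize I a = p
  generalize I b = r
  generalize I c = t
  simp only [← Matrix.mulVec_mulVec, Rm_mulVec_upd12 hab hac hbc, Rm_mulVec_upd13 hab hac hbc,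
    Rm_mulVec_upd23 hab hac hbc]
  generalize upd3 a b c I = U
  rcases lt_trichotomy p r with h1 | h1 | h1 <;> rcases lt_trichotomy r t with h2 | h2 | h2 <;>
    rcases lt_trichotomy p t with h3 | h3 | h3 <;>
    first
    | (exfalso; omega)
    | (subst_vars
       simp (discharger := omega) only [rDiag_self, rOff_self, rOff_lt, rOff_gt, rDiag_ne]
       generalize cIn L q = Q at *
       field_simp <;> ring)

end RAlgebra

/-! ### Leading terms of Hahn series -/

/-- The coefficients of `x` below `c` vanish, and the one at `c` is `a`. -/
def HasLead {A : Type*} [Zero A] (x : HahnSeries ℤ A) (c : ℤ) (a : A) : Prop :=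
  (∀ m < c, x.coeff m = 0) ∧ x.coeff c = a

section HasLead

variable {A : Type*}

lemma HasLead.mul [Ring A] {x y : HahnSeries ℤ A} {c d : ℤ} {a b : A}
    (hx : HasLead x c a) (hy : HasLead y d b) : HasLead (x * y) (c + d) (a * b) := by
  constructor
  · intro m hm; rw [HahnSeries.coeff_mul]; refine sum_eq_zero fun ij hij => ?_
    rw [Finset.mem_addAntidiagonal] at hij; rcases lt_or_ge ij.1 c with h | h
    · rw [hx.1 _ h, zero_mul]
    · rw [hy.1 _ (by lia), mul_zero]
  · rw [HahnSeries.coeff_mul, sum_eq_single (c, d)]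
    · rw [hx.2, hy.2]
    · intro ij hij hne; rw [Finset.mem_addAntidiagonal] at hij
      rcases lt_trichotomy ij.1 c with h | h | h
      · rw [hx.1 _ h, zero_mul]
      · exact absurd (Prod.ext h (by simp only; lia)) hne
      · rw [hy.1 _ (by lia), mul_zero]
    · intro h; rw [Finset.mem_addAntidiagonal] at h
      simp only [HahnSeries.mem_support, ne_eq, and_true, not_and_or, not_not] at h; grind

lemma HasLead.add [AddMonoid A] {x y : HahnSeries ℤ A} {c : ℤ} {a b : A}
    (hx : HasLead x c a) (hy : HasLead y c b) : HasLead (x + y) c (a + b) :=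
  ⟨fun m hm => by rw [coeff_add, hx.1 m hm, hy.1 m hm, add_zero], by rw [coeff_add, hx.2, hy.2]⟩

lemma HasLead.sum [AddCommMonoid A] {κ : Type*} {s : Finset κ} {x : κ → HahnSeries ℤ A} {c : ℤ}
    {a : κ → A} (h : ∀ i ∈ s, HasLead (x i) c (a i)) :
    HasLead (∑ i ∈ s, x i) c (∑ i ∈ s, a i) := by
  constructor
  · intro m hm; rw [coeff_sum]; exact sum_eq_zero fun i hi => (h i hi).1 m hm
  · rw [coeff_sum]; exact sum_congr rfl fun i hi => (h i hi).2

lemma HasLead.mono [Zero A] {x : HahnSeries ℤ A} {c d : ℤ} {a : A} (h : HasLead x c a)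
    (hd : d < c) : HasLead x d 0 :=
  ⟨fun m hm => h.1 m (hm.trans hd), h.1 d hd⟩

lemma HasLead.single [Zero A] (c : ℤ) (a : A) : HasLead (single c a) c a :=
  ⟨fun m hm => coeff_single_of_ne hm.ne, by simp⟩

lemma HasLead.zero [Zero A] (c : ℤ) : HasLead (0 : HahnSeries ℤ A) c 0 := ⟨fun m _ => rfl, rfl⟩

lemma HasLead.one [Ring A] : HasLead (1 : HahnSeries ℤ A) 0 1 := HasLead.single 0 1

lemma HasLead.neg [AddGroup A] {x : HahnSeries ℤ A} {c : ℤ} {a : A} (h : HasLead x c a) :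
    HasLead (-x) c (-a) :=
  ⟨fun m hm => by rw [HahnSeries.coeff_neg, h.1 m hm, neg_zero], by rw [HahnSeries.coeff_neg, h.2]⟩

lemma HasLead.prod [CommRing A] {κ : Type*} (s : Finset κ) {x : κ → HahnSeries ℤ A} {c : κ → ℤ}
    {a : κ → A} (h : ∀ i ∈ s, HasLead (x i) (c i) (a i)) :
    HasLead (∏ i ∈ s, x i) (∑ i ∈ s, c i) (∏ i ∈ s, a i) := by
  classical
  induction s using Finset.induction_on with
  | empty => simpa using HasLead.one
  | insert i s hi ih =>
    rw [prod_insert hi, Finset.sum_insert hi, prod_insert hi]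
    exact (h i (by simp)).mul (ih fun j hj => h j (by simp [hj]))

lemma exists_hasLead [Zero A] {x : HahnSeries ℤ A} (hx : x ≠ 0) : ∃ c a, a ≠ 0 ∧ HasLead x c a := by
  refine ⟨x.order, x.leadingCoeff, HahnSeries.leadingCoeff_ne_zero.2 hx, fun m hm => ?_, ?_⟩
  · exact HahnSeries.coeff_eq_zero_of_lt_order hm
  · exact HahnSeries.leadingCoeff_eq.symm

lemma HasLead.inv [Field A] {x : HahnSeries ℤ A} {c : ℤ} {a : A} (h : HasLead x c a)
    (ha : a ≠ 0) : HasLead x⁻¹ (-c) a⁻¹ := by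
  have hx : x ≠ 0 := by rintro rfl; exact ha (by rw [← h.2]; rfl)
  obtain ⟨d, b, hb, h'⟩ := exists_hasLead (inv_ne_zero hx); have h1 := h.mul h'
  rw [mul_inv_cancel₀ hx] at h1
  have hcd : c + d = 0 := by
    by_contra hne; have h2 : (1 : HahnSeries ℤ A).coeff (c + d) = 0 := by simp_all
    exact mul_ne_zero ha hb (by rw [← h1.2, h2])
  have hab : a * b = 1 := by rw [← h1.2, hcd, HahnSeries.coeff_one, if_pos rfl]
  grind

end HasLead

/-! ### Gradings of matrices over Hahn series -/

/-- The data of a grading, in which `ω^p E_{IJ}` has order `N p + ∑_b w_b (g(I_b) - g(J_b))`. -/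
structure Grading (ι : Type*) (n : ℕ) where
  /-- the order of `ω` -/
  N : ℕ
  pos : 0 < N
  /-- the weights of the strands -/
  w : ι → ℤ
  /-- the orders of the basis vectors -/
  g : Fin n → ℤ

section Gauge

variable {ι : Type*} [Fintype ι] [DecidableEq ι] {n : ℕ} {A : Type*} [Ring A]

/-- The order of `E_{IJ}`. -/
def Grading.shift (G : Grading ι n) (I J : ι → Fin n) : ℤ := ∑ b, G.w b * (G.g (I b) - G.g (J b))

lemma Grading.shift_add (G : Grading ι n) (I J T : ι → Fin n) :
    G.shift I J + G.shift J T = G.shift I T := by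
  rw [Grading.shift, Grading.shift, Grading.shift, ← sum_add_distrib]
  exact sum_congr rfl fun b _ => by ring

lemma Grading.shift_self (G : Grading ι n) (I : ι → Fin n) : G.shift I I = 0 := by
  simp [Grading.shift]

/-- Substitution `ω ↦ ω^N`. -/
def stretch (N : ℕ) (hN : 0 < N) : HahnSeries ℤ A →+* HahnSeries ℤ A :=
  HahnSeries.embDomainRingHom (AddMonoidHom.mulLeft (N : ℤ)) (fun a b h => by aesop) (fun a b => by
      simp_all)

lemma stretch_coeff_mul (N : ℕ) (hN : 0 < N) (x : HahnSeries ℤ A) (p : ℤ) :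
    (stretch N hN x).coeff (N * p) = x.coeff p :=
  HahnSeries.embDomain_coeff

lemma stretch_coeff_of_not_dvd (N : ℕ) (hN : 0 < N) (x : HahnSeries ℤ A) (m : ℤ)
    (hm : ¬ (N : ℤ) ∣ m) : (stretch N hN x).coeff m = 0 := by
  refine HahnSeries.embDomain_of_notMem_range ?_; rintro ⟨p, hp⟩; exact hm ⟨p, hp.symm⟩

/-- The matrix in which the grading by order is the grading of Hahn series. -/
def gauge (G : Grading ι n) (M : Op ι n (HahnSeries ℤ A)) : Op ι n (HahnSeries ℤ A) :=
  fun I J => stretch G.N G.pos (M I J) * single (G.shift I J) 1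

lemma gauge_coeff (G : Grading ι n) (M : Op ι n (HahnSeries ℤ A)) (I J : ι → Fin n) (p : ℤ) :
    (gauge G M I J).coeff (G.N * p + G.shift I J) = (M I J).coeff p := by
  rw [gauge, HahnSeries.coeff_mul_single_add, mul_one, stretch_coeff_mul]

lemma gauge_coeff_of_not_dvd (G : Grading ι n) (M : Op ι n (HahnSeries ℤ A)) (I J : ι → Fin n)
    (m : ℤ) (hm : ¬ (G.N : ℤ) ∣ m - G.shift I J) : (gauge G M I J).coeff m = 0 := by
  rw [gauge, HahnSeries.coeff_mul_single, mul_one, stretch_coeff_of_not_dvd _ _ _ _ hm]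

lemma gauge_mul (G : Grading ι n) (M M' : Op ι n (HahnSeries ℤ A)) :
    gauge G (M * M') = gauge G M * gauge G M' := by
  ext1 I J; rw [gauge, mul_apply, mul_apply, map_sum, Finset.sum_mul]
  refine sum_congr rfl fun T _ => ?_
  have hc : ∀ (c : ℤ) (x : HahnSeries ℤ A), single c (1 : A) * x = x * single c (1 : A) := by
    intro c x; ext m; rw [HahnSeries.coeff_mul_single, coeff_single_mul, one_mul, mul_one]
  have h1 : single (G.shift I J) (1 : A) = single (G.shift I T) 1 * single (G.shift T J) 1 := by
    rw [single_mul_single, G.shift_add, mul_one]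
  simp only [gauge]; rw [map_mul, h1, mul_assoc, mul_assoc]; congr 1
  rw [← mul_assoc, ← hc (G.shift I T), mul_assoc]

/-- All terms of `M` have order at least `E`, and `M₀` are the terms of order `E`. -/
def OrdLead (G : Grading ι n) (M : Op ι n (HahnSeries ℤ A)) (E : ℤ) (M₀ : Op ι n A) : Prop :=
  ∀ I J, HasLead (gauge G M I J) E (M₀ I J)

/-- All terms of `M` have order at least `E`. -/
def OrdGE (G : Grading ι n) (M : Op ι n (HahnSeries ℤ A)) (E : ℤ) : Prop :=
  ∀ I J, ∀ m < E, (gauge G M I J).coeff m = 0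

lemma OrdLead.ordGE {G : Grading ι n} {M : Op ι n (HahnSeries ℤ A)} {E : ℤ} {M₀ : Op ι n A}
    (h : OrdLead G M E M₀) : OrdGE G M E := fun I J => (h I J).1

lemma OrdGE.ordLead {G : Grading ι n} {M : Op ι n (HahnSeries ℤ A)} {E : ℤ} (h : OrdGE G M E) :
    OrdLead G M E (fun I J => (gauge G M I J).coeff E) := fun I J => ⟨h I J, rfl⟩

lemma OrdLead.unique {G : Grading ι n} {M : Op ι n (HahnSeries ℤ A)} {E : ℤ} {M₀ M₁ : Op ι n A}
    (h : OrdLead G M E M₀) (h' : OrdLead G M E M₁) : M₀ = M₁ := by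
  ext I J; rw [← (h I J).2, ← (h' I J).2]

lemma ordGE_iff {G : Grading ι n} {M : Op ι n (HahnSeries ℤ A)} {E : ℤ} :
    OrdGE G M E ↔ ∀ I J p, G.N * p + G.shift I J < E → (M I J).coeff p = 0 := by
  constructor
  · intro h I J p hp; rw [← gauge_coeff G]; exact h I J _ hp
  · intro h I J m hm
    by_cases hd : (G.N : ℤ) ∣ m - G.shift I J
    · obtain ⟨p, hp⟩ := hd; have : m = G.N * p + G.shift I J := by lia
      rw [this, gauge_coeff]; exact h I J p (by lia)
    · exact gauge_coeff_of_not_dvd _ _ _ _ _ hd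

lemma OrdLead.coeff {G : Grading ι n} {M : Op ι n (HahnSeries ℤ A)} {E : ℤ} {M₀ : Op ι n A}
    (h : OrdLead G M E M₀) (I J : ι → Fin n) (p : ℤ) (hp : G.N * p + G.shift I J = E) :
    (M I J).coeff p = M₀ I J := by
  rw [← gauge_coeff G, hp, (h I J).2]

lemma OrdLead.mul {G : Grading ι n} {M M' : Op ι n (HahnSeries ℤ A)} {E E' : ℤ}
    {M₀ M₁ : Op ι n A} (h : OrdLead G M E M₀) (h' : OrdLead G M' E' M₁) :
    OrdLead G (M * M') (E + E') (M₀ * M₁) := by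
  intro I J; rw [gauge_mul, mul_apply, mul_apply]; exact HasLead.sum fun T _ => (h I T).mul (h' T J)

lemma OrdGE.mul {G : Grading ι n} {M M' : Op ι n (HahnSeries ℤ A)} {E E' : ℤ}
    (h : OrdGE G M E) (h' : OrdGE G M' E') : OrdGE G (M * M') (E + E') :=
  (h.ordLead.mul h'.ordLead).ordGE

lemma ordLead_of_entries {G : Grading ι n} {M : Op ι n (HahnSeries ℤ A)} {E : ℤ} {M₀ : Op ι n A}
    (h : ∀ I J, ∃ c a, HasLead (M I J) c a ∧
      ((G.N * c + G.shift I J = E ∧ M₀ I J = a) ∨ (E < G.N * c + G.shift I J ∧ M₀ I J = 0))) :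
    OrdLead G M E M₀ := by
  intro I J; obtain ⟨c, a, hl, hE⟩ := h I J; have hN : (0 : ℤ) < G.N := by have := G.pos; lia
  have h1 : HasLead (gauge G M I J) (G.N * c + G.shift I J) a := by
    constructor
    · intro m hm
      by_cases hd : (G.N : ℤ) ∣ m - G.shift I J
      · obtain ⟨p, hp⟩ := hd; have hm' : m = G.N * p + G.shift I J := by lia
        rw [hm', gauge_coeff]; refine hl.1 p ?_; simp_all
      · exact gauge_coeff_of_not_dvd _ _ _ _ _ hd
    · rw [gauge_coeff]; exact hl.2
  rcases hE with ⟨rfl, h2⟩ | ⟨h2, h3⟩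
  · rw [h2]; exact h1
  · rw [h3]; exact h1.mono h2

lemma OrdLead.one {G : Grading ι n} : OrdLead G (1 : Op ι n (HahnSeries ℤ A)) 0 1 := by
  refine ordLead_of_entries fun I J => ?_
  by_cases h : I = J
  · subst h
    exact ⟨0, 1, by rw [Matrix.one_apply_eq]; exact HasLead.one,
      Or.inl ⟨by rw [G.shift_self]; ring, by rw [Matrix.one_apply_eq]⟩⟩
  · have hN : (0 : ℤ) < G.N := by have := G.pos; lia
    refine ⟨|G.shift I J| + 1, 0, by rw [Matrix.one_apply_ne h]; exact HasLead.zero _,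
      Or.inr ⟨?_, by rw [Matrix.one_apply_ne h]⟩⟩
    have h1 := neg_abs_le (G.shift I J)
    have h2 : |G.shift I J| + 1 ≤ G.N * (|G.shift I J| + 1) := by aesop
    lia

lemma OrdGE.zero {G : Grading ι n} (E : ℤ) : OrdGE G (0 : Op ι n (HahnSeries ℤ A)) E := by
  rw [ordGE_iff]; intro I J p _; rfl

lemma OrdLead.list_prod {κ : Type*} {G : Grading ι n} (l : List κ)
    {M : κ → Op ι n (HahnSeries ℤ A)} {M₀ : κ → Op ι n A}
    (h : ∀ i ∈ l, OrdLead G (M i) 0 (M₀ i)) :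
    OrdLead G (l.map M).prod 0 (l.map M₀).prod := by
  induction l with
  | nil => exact OrdLead.one
  | cons i l ih =>
    rw [List.map_cons, List.map_cons, List.prod_cons, List.prod_cons]
    exact (h i (by simp)).mul (ih fun j hj => h j (by simp [hj]))

theorem OrdLead.smul {G : Grading ι n} {M : Op ι n (HahnSeries ℤ A)} {E : ℤ} {M₀ : Op ι n A}
    (h : OrdLead G M E M₀) {φ : HahnSeries ℤ A} {c : ℤ} {a : A} (hφ : HasLead φ c a) :
    OrdLead G (φ • M) (G.N * c + E) (a • M₀) := by
  intro I J
  have e : gauge G (φ • M) I J = stretch G.N G.pos φ * gauge G M I J := by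
    rw [gauge, gauge, Matrix.smul_apply, smul_eq_mul, map_mul, mul_assoc]
  rw [e, Matrix.smul_apply, smul_eq_mul]
  refine HasLead.mul ⟨fun m hm => ?_, by rw [stretch_coeff_mul, hφ.2]⟩ (h I J)
  have hN : (0 : ℤ) < G.N := by have := G.pos; lia
  by_cases hd : (G.N : ℤ) ∣ m
  · obtain ⟨p, rfl⟩ := hd; rw [stretch_coeff_mul]; exact hφ.1 p (lt_of_mul_lt_mul_left hm hN.le)
  · exact stretch_coeff_of_not_dvd _ _ _ _ hd

lemma OrdGE.smul {G : Grading ι n} {M : Op ι n (HahnSeries ℤ A)} {E : ℤ}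
    (h : OrdGE G M E) {φ : HahnSeries ℤ A} {c : ℤ} (hφ : ∀ m < c, φ.coeff m = 0) :
    OrdGE G (φ • M) (G.N * c + E) :=
  (h.ordLead.smul ⟨hφ, rfl⟩).ordGE

lemma OrdGE.mono {G : Grading ι n} {M : Op ι n (HahnSeries ℤ A)} {E E' : ℤ}
    (h : OrdGE G M E) (h' : E' ≤ E) : OrdGE G M E' := fun I J m hm => h I J m (by lia)

lemma exists_ordLead {G : Grading ι n} {M : Op ι n (HahnSeries ℤ A)} (hM : M ≠ 0) :
    ∃ E M₀, M₀ ≠ 0 ∧ OrdLead G M E M₀ := by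
  classical
  have hne : (univ.filter fun p : (ι → Fin n) × (ι → Fin n) => M p.1 p.2 ≠ 0).Nonempty := by
    by_contra h; rw [Finset.not_nonempty_iff_eq_empty, Finset.filter_eq_empty_iff] at h
    exact hM (by ext1 I J; simpa using h (mem_univ (I, J)))
  have hg : ∀ I J, M I J ≠ 0 → gauge G M I J ≠ 0 := by
    intro I J h h0; obtain ⟨c, a, ha, hl⟩ := exists_hasLead h; refine ha ?_
    rw [← hl.2, ← gauge_coeff G, h0]; rfl
  obtain ⟨p, hp, hmin⟩ := Finset.exists_min_image _
    (fun p : (ι → Fin n) × (ι → Fin n) => (gauge G M p.1 p.2).order) hne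
  refine ⟨(gauge G M p.1 p.2).order, fun I J => (gauge G M I J).coeff (gauge G M p.1 p.2).order,
    ?_, fun I J => ⟨fun m hm => ?_, rfl⟩⟩
  · intro h0; have := congrFun (congrFun h0 p.1) p.2; rw [← HahnSeries.leadingCoeff_eq] at this
    exact HahnSeries.leadingCoeff_ne_zero.2 (hg _ _ (by simpa using hp)) this
  · by_cases h : M I J = 0
    · simp [gauge, h]
    · exact HahnSeries.coeff_eq_zero_of_lt_order (hm.trans_le (hmin (I, J) (by simpa using h)))

end Gauge

/-! ### Leading terms of `R`-matrices -/

section RLead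

variable {ι : Type*} [Fintype ι] [DecidableEq ι] {n : ℕ} {L F : Type*} [Field L] [Algebra K L]
  [Field F] [Algebra K F]

lemma algebraMap_q_ne_zero : cIn F q ≠ 0 := by simpa using q_ne_zero

/-- The leading term of the `R`-matrix, when its argument is a monomial of degree `δ` with
coefficient `x₀`. -/
def rLead (n : ℕ) (δ : ℤ) (a b : ι) (x₀ : F) : Op ι n F := if δ = 0 then Rm a b x₀ else
    Matrix.diagonal fun I => if I a = I b then (if 0 < δ then ofK q else (ofK q)⁻¹) else 1

lemma hasLead_one_sub {δ : ℤ} {x₀ : F} : HasLead (1 - single δ x₀) (min δ 0)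
      (if δ = 0 then 1 - x₀ else if 0 < δ then 1 else -x₀) := by
  rw [sub_eq_add_neg]; rcases lt_trichotomy δ 0 with h | h | h
  · rw [if_neg h.ne, if_neg h.le.not_gt, min_eq_left h.le, ← zero_add (-x₀)]
    exact (HasLead.one.mono h).add (HasLead.single _ _).neg
  · rw [if_pos h, h, min_self, sub_eq_add_neg]; exact HasLead.one.add (HasLead.single _ _).neg
  · rw [if_neg h.ne', if_pos h, min_eq_right h.le, ← add_zero (1 : F)]; refine HasLead.one.add ?_
    have := ((HasLead.single δ x₀).neg).mono h; exact this

/-- Compatibility of a homomorphism to Laurent series with the ground field. -/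
def IsConst (e : L →+* HahnSeries ℤ F) : Prop := ∀ c : K, e (ofK c) = single 0 (ofK c)

lemma ordLead_R {G : Grading ι n} {e : L →+* HahnSeries ℤ F} (he : IsConst e) {a b : ι}
    (hab : a ≠ b) {x : L} {x₀ : F} (hx : e x = single (G.w a - G.w b) x₀)
    (hx0 : x₀ ≠ 0) (hx1 : G.w a = G.w b → x₀ ≠ 1)
    (hG : G.w a ≠ G.w b → ∀ i j : Fin n, i < j → 0 < G.g j - G.g i ∧ G.g j - G.g i < G.N) :
    OrdLead G ((Rm a b x : Op ι n L).map e) 0 (rLead n (G.w a - G.w b) a b x₀) := by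
  have hq := algebraMap_q_ne_zero (F := F); set δ := G.w a - G.w b with hδ
  set d : F := if δ = 0 then 1 - x₀ else if 0 < δ then 1 else -x₀ with hd
  have hd0 : d ≠ 0 := by grind
  have hD : HasLead (e (1 - x)) (min δ 0) d := by rw [map_sub, map_one, hx]; exact hasLead_one_sub
  have hDi : HasLead (e (1 - x)⁻¹) (-min δ 0) d⁻¹ := by rw [map_inv₀]; exact hD.inv hd0
  have hdiag : HasLead (e ((cIn L q - x * cIn L q⁻¹) / (1 - x))) 0
      (if δ = 0 then (cIn F q - x₀ * cIn F q⁻¹) / (1 - x₀) else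
        if 0 < δ then cIn F q else (cIn F q)⁻¹) := by
    have h1 : HasLead (e (cIn L q - x * cIn L q⁻¹)) (min δ 0)
        (if δ = 0 then cIn F q - x₀ * cIn F q⁻¹ else
          if 0 < δ then cIn F q else -(x₀ * cIn F q⁻¹)) := by
      rw [map_sub, map_mul, hx, he, he, single_mul_single, add_zero, sub_eq_add_neg]
      rcases lt_trichotomy δ 0 with h | h | h
      · rw [if_neg h.ne, if_neg h.le.not_gt, min_eq_left h.le,
          ← zero_add (-(x₀ * cIn F q⁻¹))]
        exact ((HasLead.single _ _).mono h).add (HasLead.single _ _).neg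
      · rw [if_pos h, h, min_self, sub_eq_add_neg]
        exact (HasLead.single _ _).add (HasLead.single _ _).neg
      · rw [if_neg h.ne', if_pos h, min_eq_right h.le, ← add_zero (cIn F q)]
        have h2 := ((HasLead.single δ (x₀ * cIn F q⁻¹)).neg).mono h
        have h3 := (HasLead.single 0 (cIn F q)).add h2; simpa only [add_zero] using h3
    have h2 := h1.mul hDi; rw [← map_mul, ← div_eq_mul_inv, add_neg_cancel] at h2
    convert h2 using 1; rw [hd]; split_ifs with h3 h4
    · rw [div_eq_mul_inv]
    · simp
    · rw [map_inv₀]; field_simp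
  have hoff0 : ∀ i j : Fin n, j < i → ∃ c, HasLead (e (rOff x i j)) (-min δ 0) c := by
    refine fun i j hij => ⟨cIn F (q - q⁻¹) * d⁻¹, ?_⟩
    have : rOff x i j = cIn L (q - q⁻¹) * (1 - x)⁻¹ := by
      rw [rOff, if_neg hij.ne', if_neg (not_lt_of_gt hij), one_div]
    rw [this, map_mul, he, ← zero_add (-min δ 0)]; exact (HasLead.single _ _).mul hDi
  have hoff1 : ∀ i j : Fin n, i < j → ∃ c, HasLead (e (rOff x i j)) (δ - min δ 0) c := by
    refine fun i j hij => ⟨cIn F (q - q⁻¹) * (x₀ * d⁻¹), ?_⟩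
    have : rOff x i j = cIn L (q - q⁻¹) * (x * (1 - x)⁻¹) := by
      rw [rOff, if_neg hij.ne, if_pos hij, div_eq_mul_inv]
    rw [this, map_mul, map_mul, hx, he, ← zero_add (δ - min δ 0), sub_eq_add_neg]
    exact (HasLead.single _ _).mul ((HasLead.single _ _).mul hDi)
  have hshift : ∀ I : ι → Fin n, G.shift I (I ∘ swap a b) = δ * (G.g (I a) - G.g (I b)) := by
    intro I
    rw [Grading.shift, ← Finset.sum_subset (Finset.subset_univ {a, b}), Finset.sum_pair hab, hδ]
    · simp; ring
    · intro m _ hm; simp only [Finset.mem_insert, Finset.mem_singleton, not_or] at hm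
      simp [Equiv.swap_apply_of_ne_of_ne hm.1 hm.2]
  have hzero : ∀ I J : ι → Fin n, ∃ c : ℤ, 0 < G.N * c + G.shift I J := by
    refine fun I J => ⟨|G.shift I J| + 1, ?_⟩
    have hN : (1 : ℤ) ≤ G.N := by have := G.pos; lia
    nlinarith [neg_abs_le (G.shift I J), abs_nonneg (G.shift I J)]
  refine ordLead_of_entries fun I J => ?_; rw [Matrix.map_apply, Rm_apply hab]
  by_cases hIJ : I = J
  · subst hIJ; rw [if_pos rfl]
    by_cases hs : I = I ∘ swap a b
    · have hi : I a = I b := by simpa using congrFun hs a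
      have : rOff x (I a) (I b) = 0 := by rw [rOff, if_pos hi]
      rw [this, ite_self, add_zero, rDiag, if_pos hi]
      refine ⟨0, _, hdiag, Or.inl ⟨by rw [G.shift_self]; ring, ?_⟩⟩; rw [rLead]
      by_cases h0 : δ = 0
      · rw [if_pos h0, if_pos h0, Rm_apply hab, if_pos rfl, rOff, if_pos hi, ite_self, add_zero,
          rDiag, if_pos hi]
      · rw [if_neg h0, if_neg h0, Matrix.diagonal_apply_eq, if_pos hi]
    · rw [if_neg hs, add_zero]
      have hi : I a ≠ I b := fun hi => hs ((comp_swap_eq_iff I I).2 ⟨fun _ _ _ => rfl, hi, hi.symm⟩)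
      rw [rDiag, if_neg hi, map_one]
      refine ⟨0, 1, HasLead.one, Or.inl ⟨by rw [G.shift_self]; ring, ?_⟩⟩; rw [rLead]
      by_cases h0 : δ = 0
      · rw [if_pos h0, Rm_apply hab, if_pos rfl, if_neg hs, add_zero, rDiag, if_neg hi]
      · rw [if_neg h0, Matrix.diagonal_apply_eq, if_neg hi]
  · rw [if_neg hIJ, zero_add]
    by_cases hs : J = I ∘ swap a b
    · rw [if_pos hs]
      have hi : I a ≠ I b := fun hi => hIJ (((comp_swap_eq_iff I I).2 ⟨fun _ _ _ => rfl, hi, hi.symm⟩).trans hs.symm)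
      have hsh : G.shift I J = δ * (G.g (I a) - G.g (I b)) := by rw [hs, hshift]
      by_cases h0 : δ = 0
      · obtain ⟨c, hc⟩ : ∃ c, HasLead (e (rOff x (I a) (I b))) 0 c := by
          rcases lt_or_gt_of_ne hi with h | h
          exacts [by simpa [h0] using hoff1 _ _ h, by simpa [h0] using hoff0 _ _ h]
        refine ⟨0, c, hc, Or.inl ⟨by rw [hsh, h0]; ring, ?_⟩⟩
        rw [rLead, if_pos h0, Rm_apply hab, if_neg hIJ, if_pos hs, zero_add, ← hc.2]
        have hex : e x = single 0 x₀ := by rw [hx, h0]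
        have hC : ∀ y : F, (single 0 y : HahnSeries ℤ F) = C y := fun _ => rfl
        have hd1 : e (1 - x) = C (1 - x₀) := by rw [map_sub, map_one, hex, hC, map_sub, map_one]
        have : e (rOff x (I a) (I b)) = C (rOff x₀ (I a) (I b)) := by
          rw [rOff, rOff, if_neg hi, if_neg hi]; split_ifs
          · rw [map_mul, map_div₀, he, hd1, hex, hC, hC, map_mul, map_div₀]
          · rw [map_mul, map_div₀, he, hd1, map_one, hC, map_mul, map_div₀, map_one]
        rw [this]; exact (HahnSeries.coeff_single_same 0 _).symm
      · have hlead0 : rLead n δ a b x₀ I J = 0 := by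
          rw [rLead, if_neg h0, Matrix.diagonal_apply_ne _ hIJ]
        have hG' := hG (by lia); rcases lt_or_gt_of_ne hi with h | h
        · obtain ⟨c, hc⟩ := hoff1 _ _ h; refine ⟨_, c, hc, Or.inr ⟨?_, hlead0⟩⟩
          have := hG' _ _ h; rw [hsh]
          rcases lt_or_gt_of_ne h0 with h3 | h3 <;> simp only [min_eq_left, min_eq_right, h3.le] <;>
            nlinarith
        · obtain ⟨c, hc⟩ := hoff0 _ _ h; refine ⟨_, c, hc, Or.inr ⟨?_, hlead0⟩⟩
          have := hG' _ _ h; rw [hsh]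
          rcases lt_or_gt_of_ne h0 with h3 | h3 <;> simp only [min_eq_left, min_eq_right, h3.le] <;>
            nlinarith
    · rw [if_neg hs, map_zero]; obtain ⟨c, hc⟩ := hzero I J
      refine ⟨c, 0, HasLead.zero c, Or.inr ⟨hc, ?_⟩⟩; rw [rLead]
      by_cases h0 : δ = 0
      · rw [if_pos h0, Rm_apply hab, if_neg hIJ, if_neg hs, add_zero]
      · rw [if_neg h0]; exact Matrix.diagonal_apply_ne _ hIJ

end RLead

/-! ### Ordered products in a monoid with a solution of the Yang–Baxter equation -/

section Trains

variable {ι M : Type*} [Monoid M]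

/-- The product `r_{i x_1} r_{i x_2} ⋯`. -/
def train (r : ι → ι → M) (xs : List ι) (i : ι) : M := (xs.map (r i)).prod

lemma train_nil (r : ι → ι → M) (i : ι) : train r [] i = 1 := rfl

lemma train_cons (r : ι → ι → M) (x : ι) (xs : List ι) (i : ι) :
    train r (x :: xs) i = r i x * train r xs i := by
  aesop

lemma train_append (r : ι → ι → M) (xs ys : List ι) (i : ι) :
    train r (xs ++ ys) i = train r xs i * train r ys i := by
  rw [train, List.map_append, List.prod_append, train, train]

lemma commute_list_prod {m : M} {l : List M} (h : ∀ y ∈ l, Commute m y) : Commute m l.prod :=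
  Commute.list_prod_right _ _ h

lemma commute_train {r : ι → ι → M} {m : M} {xs : List ι} {i : ι}
    (h : ∀ x ∈ xs, Commute m (r i x)) : Commute m (train r xs i) := by
  refine commute_list_prod fun y' hy' => ?_; grind

/-- The hypotheses on `r`, for strands in a set: the Yang–Baxter equation and locality. -/
structure IsYB (r : ι → ι → M) (S : ι → ι → Prop) : Prop where
  /-- the Yang–Baxter equation -/
  yb : ∀ a b c, a ≠ b → a ≠ c → b ≠ c → S a b → S a c → S b c →
    r a b * r a c * r b c = r b c * r a c * r a b
  /-- locality -/
  comm : ∀ a b c d, a ≠ b → a ≠ c → a ≠ d → b ≠ c → b ≠ d → c ≠ d → S a b → S c d →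
    Commute (r a b) (r c d)

variable {r : ι → ι → M} {S : ι → ι → Prop}

lemma train_swap (hr : IsYB r S) {i j : ι} (hij : i ≠ j) (hS : S i j) :
    ∀ xs, xs.Nodup → (∀ x ∈ xs, x ≠ i ∧ x ≠ j ∧ S i x ∧ S j x) →
    train r xs j * train r xs i * r i j = r i j * train r xs i * train r xs j
  | [], _, _ => by simp [train_nil]
  | x :: xs, hd, hx => by
    obtain ⟨hxi, hxj, hSi, hSj⟩ := hx x (by simp); obtain ⟨hx1, hd'⟩ := List.nodup_cons.1 hd
    have hx' : ∀ y ∈ xs, y ≠ i ∧ y ≠ j ∧ S i y ∧ S j y := fun y hy => hx y (by simp [hy])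
    have ih := train_swap hr hij hS xs hd' hx'
    have hne : ∀ y ∈ xs, y ≠ x := fun y hy h => hx1 (h ▸ hy)
    have c1 : Commute (r i x) (train r xs j) := commute_train fun y hy =>
      hr.comm _ _ _ _ hxi.symm hij (hx' y hy).1.symm hxj (hne y hy).symm
        (hx' y hy).2.1.symm hSi (hx' y hy).2.2.2
    have c2 : Commute (r j x) (train r xs i) := commute_train fun y hy =>
      hr.comm _ _ _ _ hxj.symm hij.symm (hx' y hy).2.1.symm hxi (hne y hy).symm
        (hx' y hy).1.symm hSj (hx' y hy).2.2.1
    rw [train_cons, train_cons]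
    calc r j x * train r xs j * (r i x * train r xs i) * r i j
        = r j x * (train r xs j * r i x) * train r xs i * r i j := by simp only [mul_assoc]
      _ = r j x * r i x * (train r xs j * train r xs i * r i j) := by grind
      _ = (r j x * r i x * r i j) * (train r xs i * train r xs j) := by grind
      _ = r i j * r i x * (r j x * train r xs i) * train r xs j := by
        rw [← hr.yb i j x hij hxi.symm hxj.symm hS hSi hSj]; simp only [mul_assoc]
      _ = r i j * (r i x * train r xs i) * (r j x * train r xs j) := by grind

lemma train_train (hr : IsYB r S) {i : ι} {xs : List ι} (hxs : xs.Nodup)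
    (hi : ∀ x ∈ xs, x ≠ i ∧ S i x) :
    ∀ es, es.Nodup → (∀ e ∈ es, e ≠ i ∧ S i e ∧ ∀ x ∈ xs, x ≠ e ∧ S e x) →
    (es.reverse.map (train r xs)).prod * train r xs i * train r es i =
      train r es i * train r xs i * (es.reverse.map (train r xs)).prod
  | [], _, _ => by simp [train_nil]
  | e :: es, hd, he => by
    obtain ⟨hei, hSe, hex⟩ := he e (by simp); obtain ⟨he1, hd'⟩ := List.nodup_cons.1 hd
    have he' : ∀ e' ∈ es, e' ≠ i ∧ S i e' ∧ ∀ x ∈ xs, x ≠ e' ∧ S e' x :=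
      fun y hy => he y (by simp [hy])
    have ih := train_train hr hxs hi es hd' he'
    have hne : ∀ y ∈ es, y ≠ e := fun y hy h => he1 (h ▸ hy)
    have sw := train_swap hr hei.symm hSe xs hxs fun x hx =>
      ⟨(hi x hx).1, (hex x hx).1, (hi x hx).2, (hex x hx).2⟩
    have c1 : Commute (r i e) (es.reverse.map (train r xs)).prod := by
      refine commute_list_prod fun y' hy' => ?_; obtain ⟨y, hy, rfl⟩ := List.mem_map.1 hy'
      rw [List.mem_reverse] at hy
      exact commute_train fun x hx => hr.comm _ _ _ _ hei.symm (he' y hy).1.symm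
        (hi x hx).1.symm (hne y hy).symm (hex x hx).1.symm ((he' y hy).2.2 x hx).1.symm hSe
        ((he' y hy).2.2 x hx).2
    have c2 : Commute (train r xs e) (train r es i) := by
      refine commute_train fun y hy => Commute.symm ?_
      exact commute_train fun x hx => hr.comm _ _ _ _ (he' y hy).1.symm hei.symm
        (hi x hx).1.symm (hne y hy) ((he' y hy).2.2 x hx).1.symm (hex x hx).1.symm
        (he' y hy).2.1 (hex x hx).2
    rw [List.reverse_cons, List.map_append, List.prod_append, train_cons, List.map_singleton,
      List.prod_singleton]
    set Λ := (es.reverse.map (train r xs)).prod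
    calc Λ * train r xs e * train r xs i * (r i e * train r es i)
        = Λ * (train r xs e * train r xs i * r i e) * train r es i := by simp only [mul_assoc]
      _ = (Λ * r i e) * train r xs i * (train r xs e * train r es i) := by grind
      _ = r i e * (Λ * train r xs i * train r es i) * train r xs e := by grind
      _ = _ := by rw [ih]; simp only [mul_assoc]

lemma trains_interchange (hr : IsYB r S) {xs es : List ι} (hxs : xs.Nodup) (hes : es.Nodup)
    (hex : ∀ e ∈ es, ∀ x ∈ xs, x ≠ e ∧ S e x) :
    ∀ fs : List ι, fs.Nodup → (∀ i ∈ fs, (∀ x ∈ xs, x ≠ i ∧ S i x) ∧ ∀ e ∈ es, e ≠ i ∧ S i e) →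
    (es.reverse.map (train r xs)).prod * (fs.map (train r xs)).prod * (fs.map (train r es)).prod =
      (fs.map fun i => train r es i * train r xs i).prod * (es.reverse.map (train r xs)).prod
  | [], _, _ => by simp
  | i :: fs, hd, hf => by
    obtain ⟨hi1, hi2⟩ := hf i (by simp); obtain ⟨hf1, hd'⟩ := List.nodup_cons.1 hd
    have hf' := fun y (hy : y ∈ fs) => hf y (by simp [hy])
    have hne : ∀ y ∈ fs, y ≠ i := fun y hy h => hf1 (h ▸ hy)
    have ih := trains_interchange hr hxs hes hex fs hd' hf'
    have tt := train_train hr (i := i) hxs hi1 es hes fun e he =>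
      ⟨(hi2 e he).1, (hi2 e he).2, hex e he⟩
    have c : Commute (train r es i) (fs.map (train r xs)).prod := by
      refine commute_list_prod fun y' hy' => ?_; obtain ⟨y, hy, rfl⟩ := List.mem_map.1 hy'
      refine commute_train fun x hx => Commute.symm (commute_train fun e he => ?_)
      exact hr.comm _ _ _ _ ((hf' y hy).1 x hx).1.symm (hne y hy) ((hf' y hy).2 e he).1.symm
        (hi1 x hx).1 (hex e he x hx).1 (hi2 e he).1.symm
        ((hf' y hy).1 x hx).2 (hi2 e he).2
    simp only [List.map_cons, List.prod_cons]; set Λ := (es.reverse.map (train r xs)).prod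
    calc Λ * (train r xs i * (fs.map (train r xs)).prod) *
          (train r es i * (fs.map (train r es)).prod)
        = Λ * train r xs i * ((fs.map (train r xs)).prod * train r es i) *
          (fs.map (train r es)).prod := by simp only [mul_assoc]
      _ = (Λ * train r xs i * train r es i) * (fs.map (train r xs)).prod *
          (fs.map (train r es)).prod := by rw [← c.eq]; simp only [mul_assoc]
      _ = train r es i * train r xs i * (Λ * (fs.map (train r xs)).prod *
          (fs.map (train r es)).prod) := by rw [tt]; simp only [mul_assoc]
      _ = _ := by rw [ih]; simp only [mul_assoc]

end Trains

/-! ### Trains of `R`-matrices -/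

section RTrains

variable {ι : Type*} [Fintype ι] [DecidableEq ι] {n : ℕ} {L : Type*} [Field L] [Algebra K L]

/-- `R_{ab}(v_a/v_b)`. -/
def Rv (n : ℕ) (v : ι → L) (a b : ι) : Op ι n L := Rm a b (v a / v b)

lemma isYB_Rv (v : ι → L) (hv : ∀ i, v i ≠ 0) : IsYB (Rv n v) (fun a b => v a ≠ v b) where
  yb a b c hab hac hbc h1 h2 h3 := by
    have e : v a / v c = v a / v b * (v b / v c) := by grind
    have h1' := fun h => h1 ((div_eq_one_iff_eq (hv b)).1 h)
    have h3' := fun h => h3 ((div_eq_one_iff_eq (hv c)).1 h)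
    have h2' := fun h => h2 ((div_eq_one_iff_eq (hv c)).1 h); rw [Rv, Rv, Rv, e]
    exact Rm_yangBaxter hab hac hbc h1' h3' (e ▸ h2')
  comm a b c d hab hac had hbc hbd hcd _ _ := Rm_commute hab hac had hbc hbd _ _

/-- `R_{ba}(v_b/v_a)`, in the opposite monoid. -/
def RvOp (n : ℕ) (v : ι → L) (a b : ι) : (Op ι n L)ᵐᵒᵖ := MulOpposite.op (Rm b a (v b / v a))

lemma isYB_RvOp (v : ι → L) (hv : ∀ i, v i ≠ 0) : IsYB (RvOp n v) (fun a b => v a ≠ v b) where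
  yb a b c hab hac hbc h1 h2 h3 := by
    rw [RvOp, RvOp, RvOp, ← MulOpposite.op_mul, ← MulOpposite.op_mul, ← MulOpposite.op_mul,
      ← MulOpposite.op_mul]
    congr 1
    have := (isYB_Rv (n := n) v hv).yb c b a hbc.symm hac.symm hab.symm h3.symm h2.symm h1.symm
    simp only [Rv, mul_assoc] at this ⊢; exact this
  comm a b c d hab hac had hbc hbd hcd _ _ := by
    have := Rm_commute (n := n) hab.symm hbd hbc had hac (v b / v a) (v d / v c)
    exact (MulOpposite.op_mul _ _).symm.trans
      ((congrArg MulOpposite.op this.symm).trans (MulOpposite.op_mul _ _))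

end RTrains

/-! ### Values of rational functions -/

section Values

variable {w : Fin k → RatFun u}

lemma cst_injective (k : ℕ) : Injective (algebraMap (MvPolynomial (Fin k) K) (RatFun k)) :=
  IsFractionRing.injective _ _

lemma z_ne_zero (i : Fin k) : (z i : RatFun k) ≠ 0 := by
  exact fun h => MvPolynomial.X_ne_zero i (cst_injective k (h.trans (map_zero _).symm))

lemma HasValueAt.mul {v v' : RatFun u}
    (h : HasValueAt w φ v) (h' : HasValueAt w ψ v') : HasValueAt w (φ * ψ) (v * v') := by
  obtain ⟨a, b, hb, h1, h2⟩ := h; obtain ⟨a', b', hb', h1', h2'⟩ := h'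
  refine ⟨a * a', b * b', ?_, ?_, ?_⟩
  · simpa using ⟨hb, hb'⟩
  · simp only [map_mul, ← h1, ← h1']; ring
  · simp only [map_mul, ← h2, ← h2']; ring

lemma HasValueAt.poly (P : MvPolynomial (Fin k) K) :
    HasValueAt w (algebraMap _ (RatFun k) P) (MvPolynomial.aeval w P) :=
  ⟨P, 1, by simp, by simp, by simp⟩

lemma HasValueAt.const (c : K) : HasValueAt w (cst c) (cst c) := by
  have := HasValueAt.poly (w := w) (MvPolynomial.C c); rwa [MvPolynomial.aeval_C] at this

lemma HasValueAt.one : HasValueAt w (1 : RatFun k) 1 := by simpa using HasValueAt.const (1 : K)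

lemma HasValueAt.z (i : Fin k) : HasValueAt w (z i) (w i) := by
  have := HasValueAt.poly (w := w) (MvPolynomial.X i); rwa [MvPolynomial.aeval_X] at this

lemma HasValueAt.neg {v : RatFun u} (h : HasValueAt w φ v) : HasValueAt w (-φ) (-v) := by
  simpa using h.smul (-1)

lemma HasValueAt.sub {v v' : RatFun u}
    (h : HasValueAt w φ v) (h' : HasValueAt w ψ v') : HasValueAt w (φ - ψ) (v - v') := by
  rw [sub_eq_add_neg, sub_eq_add_neg]; exact h.add h'.neg

lemma HasValueAt.inv {v : RatFun u} (h : HasValueAt w φ v) (hv : v ≠ 0) : HasValueAt w φ⁻¹ v⁻¹ := by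
  obtain ⟨a, b, hb, h1, h2⟩ := h
  have ha : MvPolynomial.aeval w a ≠ 0 := by rw [← h2]; exact mul_ne_zero hv hb
  have hφ : φ ≠ 0 := by
    rintro rfl; rw [zero_mul] at h1; have := cst_injective k ((map_zero _).trans h1)
    exact ha (by rw [← this, map_zero])
  refine ⟨b, a, ha, ?_, ?_⟩
  · rw [← h1, inv_mul_cancel_left₀ hφ]
  · rw [← h2, inv_mul_cancel_left₀ hv]

lemma HasValueAt.div {v v' : RatFun u}
    (h : HasValueAt w φ v) (h' : HasValueAt w ψ v') (hv : v' ≠ 0) :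
    HasValueAt w (φ / ψ) (v / v') := by
  rw [div_eq_mul_inv, div_eq_mul_inv]; exact h.mul (h'.inv hv)

lemma HasValueAt.pow {v : RatFun u} (h : HasValueAt w φ v) (m : ℕ) :
    HasValueAt w (φ ^ m) (v ^ m) := by
  induction m with
  | zero => simpa using HasValueAt.one
  | succ m ih => rw [pow_succ, pow_succ]; exact ih.mul h

lemma HasValueAt.sum {κ : Type*} (s : Finset κ) {φ : κ → RatFun k} {v : κ → RatFun u}
    (h : ∀ i ∈ s, HasValueAt w (φ i) (v i)) : HasValueAt w (∑ i ∈ s, φ i) (∑ i ∈ s, v i) := by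
  classical
  induction s using Finset.induction_on with
  | empty => simpa using HasValueAt.zero w
  | insert i s hi ih =>
    rw [Finset.sum_insert hi, Finset.sum_insert hi]
    exact (h i (by simp)).add (ih fun j hj => h j (by simp [hj]))

lemma HasValueAt.prod {κ : Type*} (s : Finset κ) {φ : κ → RatFun k} {v : κ → RatFun u}
    (h : ∀ i ∈ s, HasValueAt w (φ i) (v i)) : HasValueAt w (∏ i ∈ s, φ i) (∏ i ∈ s, v i) := by
  classical
  induction s using Finset.induction_on with
  | empty => simpa using HasValueAt.one
  | insert i s hi ih =>
    rw [prod_insert hi, prod_insert hi]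
    exact (h i (by simp)).mul (ih fun j hj => h j (by simp [hj]))

lemma HasValueAt.unique {v v' : RatFun u} (h : HasValueAt w φ v)
    (h' : HasValueAt w φ v') : v = v' := by
  obtain ⟨a, b, hb, h1, h2⟩ := h; obtain ⟨a', b', hb', h1', h2'⟩ := h'
  have e : a * b' = a' * b := by apply cst_injective k; rw [map_mul, map_mul, ← h1, ← h1']; ring
  have e' := congrArg (MvPolynomial.aeval w) e; grind

lemma HasValueAt.map {u' : ℕ} (ρ : RatFun u →ₐ[K] RatFun u') {v : RatFun u}
    (h : HasValueAt w φ v) : HasValueAt (fun i => ρ (w i)) φ (ρ v) := by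
  obtain ⟨a, b, hb, h1, h2⟩ := h
  have e : ∀ P : MvPolynomial (Fin k) K,
      MvPolynomial.aeval (fun i => ρ (w i)) P = ρ (MvPolynomial.aeval w P) := fun P => by
    rw [← AlgHom.comp_apply, MvPolynomial.comp_aeval]
  refine ⟨a, b, ?_, h1, ?_⟩
  · rw [e]; exact fun h0 => hb (ρ.toRingHom.injective (h0.trans (map_zero ρ).symm))
  · rw [e, e, ← map_mul, h2]

lemma renameVars_algebraMap {l : ℕ} (e : Fin l ↪ Fin k) (P : MvPolynomial (Fin l) K) :
    renameVars e (algebraMap _ (RatFun l) P) = algebraMap _ (RatFun k) (MvPolynomial.rename e P) :=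
  IsFractionRing.liftAlgHom_apply _ _ |>.trans (IsFractionRing.lift_algebraMap _ _)

lemma renameVars_z {l : ℕ} (e : Fin l ↪ Fin k) (i : Fin l) : renameVars e (z i) = z (e i) := by
  rw [z, renameVars_algebraMap, MvPolynomial.rename_X, z]

lemma HasValueAt.rename {l : ℕ} (e : Fin l ↪ Fin k) {φ : RatFun l} {v : RatFun u}
    (h : HasValueAt (w ∘ e) φ v) : HasValueAt w (renameVars e φ) v := by
  obtain ⟨a, b, hb, h1, h2⟩ := h
  refine ⟨MvPolynomial.rename e a, MvPolynomial.rename e b, ?_, ?_, ?_⟩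
  · rwa [MvPolynomial.aeval_rename]
  · rw [← renameVars_algebraMap, ← renameVars_algebraMap, ← map_mul, h1]
  · rw [MvPolynomial.aeval_rename, MvPolynomial.aeval_rename, h2]

lemma hasVal_z (φ : RatFun k) : HasValueAt z φ φ := by
  obtain ⟨a, b, hb, rfl⟩ := IsFractionRing.div_surjective (A := MvPolynomial (Fin k) K) φ
  have hb0 : algebraMap _ (RatFun k) b ≠ 0 := fun h =>
    nonZeroDivisors.ne_zero hb (cst_injective k (h.trans (map_zero _).symm))
  have e : ∀ P : MvPolynomial (Fin k) K,
      MvPolynomial.aeval (z : Fin k → RatFun k) P = algebraMap _ _ P := by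
    intro P
    have : (MvPolynomial.aeval (z : Fin k → RatFun k)) =
        IsScalarTower.toAlgHom K (MvPolynomial (Fin k) K) (RatFun k) := by
      aesop
    rw [this]; rfl
  refine ⟨a, b, ?_, ?_, ?_⟩
  · rwa [e]
  · rw [div_mul_cancel₀ _ hb0]
  · rw [e, e, div_mul_cancel₀ _ hb0]

/-- Rational functions which are regular at a point. -/
def valRing (w : Fin k → RatFun u) : Subalgebra K (RatFun k) where
  carrier := {φ | ∃ v, HasValueAt w φ v}
  mul_mem' := fun ⟨_, h⟩ ⟨_, h'⟩ => ⟨_, h.mul h'⟩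
  add_mem' := fun ⟨_, h⟩ ⟨_, h'⟩ => ⟨_, h.add h'⟩
  algebraMap_mem' c := ⟨_, HasValueAt.const c⟩

end Values

/-! ### Laurent polynomials -/

section Laurent

lemma z_mem_laurent (i : Fin k) : z i ∈ laurent k := Algebra.subset_adjoin (Or.inl ⟨i, rfl⟩)

lemma z_inv_mem_laurent (i : Fin k) : (z i)⁻¹ ∈ laurent k := Algebra.subset_adjoin (Or.inr ⟨i, rfl⟩)

lemma const_mem_laurent (c : K) : cst c ∈ laurent k := (laurent k).algebraMap_mem c

lemma laurent_le {S : Subalgebra K (RatFun k)} (h : ∀ i, z i ∈ S) (h' : ∀ i, (z i)⁻¹ ∈ S) :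
    laurent k ≤ S := by
  refine Algebra.adjoin_le ?_; rintro _ (⟨i, rfl⟩ | ⟨i, rfl⟩)
  · exact h i
  · exact h' i

lemma laurent_le_valRing {w : Fin k → RatFun u} (hw : ∀ i, w i ≠ 0) : laurent k ≤ valRing w :=
  laurent_le (fun i => ⟨_, HasValueAt.z i⟩) fun i => ⟨_, (HasValueAt.z i).inv (hw i)⟩

lemma laurent_value {w : Fin k → RatFun u} (hw : ∀ i, w i ≠ 0)
    (h1 : ∀ i, w i ∈ laurent u) (h2 : ∀ i, (w i)⁻¹ ∈ laurent u)
    (hφ : φ ∈ laurent k) {v : RatFun u} (hv : HasValueAt w φ v) : v ∈ laurent u := by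
  let S : Subalgebra K (RatFun k) :=
    { carrier := {φ | ∃ v, HasValueAt w φ v ∧ v ∈ laurent u}
      mul_mem' := fun ⟨_, h, m⟩ ⟨_, h', m'⟩ => ⟨_, h.mul h', mul_mem m m'⟩
      add_mem' := fun ⟨_, h, m⟩ ⟨_, h', m'⟩ => ⟨_, h.add h', add_mem m m'⟩
      algebraMap_mem' := fun c => ⟨_, HasValueAt.const c, const_mem_laurent c⟩ }
  have hS : laurent k ≤ S := laurent_le (fun i => ⟨_, HasValueAt.z i, h1 i⟩)
    fun i => ⟨_, (HasValueAt.z i).inv (hw i), h2 i⟩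
  obtain ⟨v', hv', hm⟩ := hS hφ
  rwa [hv.unique hv']

lemma laurent_value_trans {u' : ℕ} {w : Fin k → RatFun u} {w' : Fin u → RatFun u'}
    {w'' : Fin k → RatFun u'} (hw : ∀ i, w i ≠ 0) (hw'' : ∀ i, w'' i ≠ 0)
    (hww : ∀ i, HasValueAt w' (w i) (w'' i)) (hφ : φ ∈ laurent k)
    {v : RatFun u} (hv : HasValueAt w φ v) :
    ∃ v', HasValueAt w' v v' ∧ HasValueAt w'' φ v' := by
  let S : Subalgebra K (RatFun k) :=
    { carrier := {φ | ∃ v v', HasValueAt w φ v ∧ HasValueAt w' v v' ∧ HasValueAt w'' φ v'}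
      mul_mem' := fun ⟨_, _, h, m, r⟩ ⟨_, _, h', m', r'⟩ => ⟨_, _, h.mul h', m.mul m', r.mul r'⟩
      add_mem' := fun ⟨_, _, h, m, r⟩ ⟨_, _, h', m', r'⟩ => ⟨_, _, h.add h', m.add m', r.add r'⟩
      algebraMap_mem' := fun c => ⟨_, _, HasValueAt.const c, HasValueAt.const c,
        HasValueAt.const c⟩ }
  have hS : laurent k ≤ S := laurent_le (fun i => ⟨_, _, HasValueAt.z i, hww i, HasValueAt.z i⟩)
    fun i => ⟨_, _, (HasValueAt.z i).inv (hw i), (hww i).inv (hw'' i),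
      (HasValueAt.z i).inv (hw'' i)⟩
  obtain ⟨v₁, v', h1, h2, h3⟩ := hS hφ; rw [← h1.unique hv]
  exact ⟨v', by rwa [← h1.unique hv] at *, h3⟩

lemma laurent_denominator (hφ : φ ∈ laurent k) :
    ∃ (N : ℕ) (P : MvPolynomial (Fin k) K),
      φ * (∏ i, z i) ^ N = algebraMap _ (RatFun k) P := by
  have hz : (∏ i, z i : RatFun k) =
      algebraMap (MvPolynomial (Fin k) K) (RatFun k) (∏ i, MvPolynomial.X i) := by
    aesop
  let S : Subalgebra K (RatFun k) :=
    { carrier := {φ | ∃ (N : ℕ) (P : MvPolynomial (Fin k) K),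
        φ * (∏ i, z i) ^ N = algebraMap _ (RatFun k) P}
      mul_mem' := by
        rintro φ ψ ⟨N, P, h⟩ ⟨N', P', h'⟩
        exact ⟨N + N', P * P', by rw [map_mul, ← h, ← h']; ring⟩
      add_mem' := by
        rintro φ ψ ⟨N, P, h⟩ ⟨N', P', h'⟩
        refine ⟨N + N', P * (∏ i, MvPolynomial.X i) ^ N' + P' * (∏ i, MvPolynomial.X i) ^ N, ?_⟩
        grind
      algebraMap_mem' := fun c => ⟨0, MvPolynomial.C c, by rw [pow_zero, mul_one]; rfl⟩ }
  refine laurent_le (S := S) (fun i => ⟨0, MvPolynomial.X i, by rw [pow_zero, mul_one]; rfl⟩)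
    (fun i => ⟨1, ∏ j ∈ univ.erase i, MvPolynomial.X j, ?_⟩) hφ
  rw [pow_one, ← Finset.mul_prod_erase univ _ (mem_univ i),
    inv_mul_cancel_left₀ (z_ne_zero i), map_prod]
  rfl

lemma poly_mem_laurent (P : MvPolynomial (Fin k) K) : algebraMap _ (RatFun k) P ∈ laurent k := by
  induction P using MvPolynomial.induction_on with
  | C c => exact const_mem_laurent c
  | add P Q hP hQ => rw [map_add]; exact add_mem hP hQ
  | mul_X P i hP => rw [map_mul]; exact mul_mem hP (z_mem_laurent i)

/-- The point `z_i = α z_a`. -/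
def hyper (i a : Fin k) (α : K) : Fin k → RatFun k := update z i (ofK α * z a)

lemma hyper_self (i a : Fin k) (α : K) : hyper i a α i = ofK α * z a := Function.update_self _ _ _

lemma hyper_ne (h : j ≠ i) (a : Fin k) (α : K) : hyper i a α j = z j := update_of_ne h _ _

lemma ofK_ne_zero {c : K} (hc : c ≠ 0) : cIn L c ≠ 0 := by simpa using hc

lemma hyper_ne_zero (i a : Fin k) {α : K} (hα : α ≠ 0) (j : Fin k) : hyper i a α j ≠ 0 := by
  by_cases h : j = i
  · subst h; rw [hyper_self]; exact mul_ne_zero (ofK_ne_zero hα) (z_ne_zero a)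
  · rw [hyper_ne h]; exact z_ne_zero j

lemma X_sub_dvd (α : K) {P : MvPolynomial (Fin k) K} (hP : MvPolynomial.aeval (hyper i a α) P = 0) :
    MvPolynomial.X i - MvPolynomial.C α * MvPolynomial.X a ∣ P := by
  set s : MvPolynomial (Fin k) K →ₐ[K] MvPolynomial (Fin k) K :=
    MvPolynomial.aeval (update MvPolynomial.X i (MvPolynomial.C α * MvPolynomial.X a)) with hs
  have h1 : ∀ Q, algebraMap _ (RatFun k) (s Q) = MvPolynomial.aeval (hyper i a α) Q := by
    intro Q
    have : (IsScalarTower.toAlgHom K (MvPolynomial (Fin k) K) (RatFun k)).comp s =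
        MvPolynomial.aeval (hyper i a α) := by
      apply MvPolynomial.algHom_ext; intro j
      rw [AlgHom.comp_apply, hs, MvPolynomial.aeval_X, MvPolynomial.aeval_X, hyper]
      by_cases h : j = i
      · aesop
      · rw [update_of_ne h, update_of_ne h]; rfl
    rw [← this]; rfl
  have h2 : ∀ Q, MvPolynomial.X i - MvPolynomial.C α * MvPolynomial.X a ∣ Q - s Q := by
    intro Q
    induction Q using MvPolynomial.induction_on with
    | C c => rw [hs, MvPolynomial.aeval_C]; exact ⟨0, by rw [mul_zero]; exact sub_self _⟩
    | add Q Q' h h' => rw [map_add]; have := dvd_add h h'; convert this using 1; ring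
    | mul_X Q j h =>
      rw [map_mul]
      have e : Q * MvPolynomial.X j - s Q * s (MvPolynomial.X j) =
          (Q - s Q) * MvPolynomial.X j + s Q * (MvPolynomial.X j - s (MvPolynomial.X j)) := by ring
      rw [e]; refine dvd_add (h.mul_right _) (Dvd.dvd.mul_left ?_ _); rw [hs, MvPolynomial.aeval_X]
      by_cases hj : j = i
      · subst hj; rw [Function.update_self]
      · rw [update_of_ne hj, sub_self]; exact dvd_zero _
  have h3 : s P = 0 := cst_injective k (by rw [h1, hP, map_zero]); have := h2 P
  rwa [h3, sub_zero] at this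

lemma hyper_form_ne_zero (hia : i ≠ a) (α : K) : (z i - cst α * z a) ≠ 0 := by
  intro h
  have h1 : (MvPolynomial.X i - MvPolynomial.C α * MvPolynomial.X a :
      MvPolynomial (Fin k) K) = 0 := by
    apply cst_injective k; rwa [map_sub, map_mul, map_zero]
  have h2 := congrArg (MvPolynomial.eval (update 0 i (1 : K))) h1
  simp [update_of_ne hia.symm] at h2

lemma laurent_div (hia : i ≠ a) {α : K} (hα : α ≠ 0)
    (hφ : φ ∈ laurent k) (h0 : HasValueAt (hyper i a α) φ 0) :
    φ * (z i - cst α * z a)⁻¹ ∈ laurent k := by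
  obtain ⟨N, P, hP⟩ := laurent_denominator hφ
  have hv : HasValueAt (hyper i a α) (φ * (∏ j, z j) ^ N) (0 * (∏ j, hyper i a α j) ^ N) :=
    h0.mul ((HasValueAt.prod _ fun j _ => HasValueAt.z j).pow N)
  rw [hP, zero_mul] at hv; obtain ⟨Q, hQ⟩ := X_sub_dvd α ((HasValueAt.poly P).unique hv)
  have hprod : (∏ j, z j : RatFun k) ≠ 0 := prod_ne_zero_iff.2 fun j _ => z_ne_zero j
  have hinv : ((∏ j, z j : RatFun k) ^ N)⁻¹ ∈ laurent k := by
    rw [← inv_pow, ← Finset.prod_inv_distrib]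
    exact pow_mem (prod_mem fun j _ => z_inv_mem_laurent j) N
  have hne := hyper_form_ne_zero hia α
  have : φ * (z i - cst α * z a)⁻¹ = algebraMap _ (RatFun k) Q * ((∏ j, z j : RatFun k) ^ N)⁻¹ := by
    rw [← div_eq_mul_inv, ← div_eq_mul_inv, div_eq_div_iff hne (pow_ne_zero _ hprod), hP, hQ,
      map_mul, mul_comm, map_sub, map_mul]
    rfl
  rw [this]; exact mul_mem (poly_mem_laurent Q) hinv

/-- Rational functions with poles only at the hyperplanes `z_i = α z_a`, for `i < a`. -/
def tameRing (a : Fin k) : Subalgebra K (RatFun k) :=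
  Algebra.adjoin K (laurent k ∪ {φ | ∃ (i : Fin k) (α : K), i < a ∧ α ≠ 0 ∧
    φ = (z i - cst α * z a)⁻¹})

lemma laurent_le_tameRing (a : Fin k) : laurent k ≤ tameRing a :=
  fun _ h => Algebra.subset_adjoin (Or.inl h)

lemma inv_mem_tameRing (hia : i < a) {α : K} (hα : α ≠ 0) : (z i - cst α * z a)⁻¹ ∈ tameRing a :=
  Algebra.subset_adjoin (Or.inr ⟨i, α, hia, hα, rfl⟩)

lemma mem_laurent_of_tame (hφ : φ ∈ tameRing a)
    (h : ∀ (i : Fin k) (α : K), i < a → α ≠ 0 → φ ∈ valRing (hyper i a α)) : φ ∈ laurent k := by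
  have hl : ∃ l : List (Fin k × K), (∀ p ∈ l, p.1 < a ∧ p.2 ≠ 0) ∧
      φ * (l.map fun p => (z p.1 - cst p.2 * z a)).prod ∈ laurent k := by
    clear h
    have hmem : ∀ l : List (Fin k × K),
        (l.map fun p => (z p.1 - cst p.2 * z a)).prod ∈ laurent k := by
      refine fun l => list_prod_mem fun y hy => ?_; obtain ⟨p, -, rfl⟩ := List.mem_map.1 hy
      exact sub_mem (z_mem_laurent _) (mul_mem (const_mem_laurent _) (z_mem_laurent _))
    induction hφ using Algebra.adjoin_induction with
    | mem φ hφ =>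
      rcases hφ with h | ⟨i, α, h1, h2, rfl⟩
      · exact ⟨[], by simp, by simpa using h⟩
      · refine ⟨[(i, α)], by simpa using ⟨h1, h2⟩, ?_⟩; grind
    | algebraMap c => exact ⟨[], by simp, by simpa using const_mem_laurent c⟩
    | add φ ψ _ _ h h' =>
      obtain ⟨l, h1, h2⟩ := h; obtain ⟨l', h1', h2'⟩ := h'; refine ⟨l ++ l', ?_, ?_⟩
      · grind
      · rw [List.map_append, List.prod_append]
        have := add_mem (mul_mem h2 (hmem l')) (mul_mem h2' (hmem l)); convert this using 1; ring
    | mul φ ψ _ _ h h' =>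
      obtain ⟨l, h1, h2⟩ := h; obtain ⟨l', h1', h2'⟩ := h'; refine ⟨l ++ l', ?_, ?_⟩
      · grind
      · rw [List.map_append, List.prod_append]; have := mul_mem h2 h2'; convert this using 1; ring
  obtain ⟨l, hl1, hl2⟩ := hl
  clear hφ
  induction l with
  | nil => simpa using hl2
  | cons p l ih =>
    refine ih (fun p' hp' => hl1 p' (by simp [hp'])) ?_; obtain ⟨hp1, hp2⟩ := hl1 p (by simp)
    set P := (l.map fun p => (z p.1 - cst p.2 * z a)).prod with hP
    rw [List.map_cons, List.prod_cons] at hl2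
    have hPv : P ∈ valRing (hyper p.1 a p.2) := by
      refine laurent_le_valRing (hyper_ne_zero _ _ hp2) ?_; refine list_prod_mem fun y hy => ?_
      obtain ⟨p, -, rfl⟩ := List.mem_map.1 hy
      exact sub_mem (z_mem_laurent _) (mul_mem (const_mem_laurent _) (z_mem_laurent _))
    obtain ⟨v, hv⟩ := h p.1 p.2 hp1 hp2; obtain ⟨v', hv'⟩ := hPv
    have hz : HasValueAt (hyper p.1 a p.2) (z p.1 - cst p.2 * z a) 0 := by
      have := (HasValueAt.z (w := hyper p.1 a p.2) p.1).sub
        ((HasValueAt.const (w := hyper p.1 a p.2) p.2).mul (HasValueAt.z a))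
      rwa [hyper_self, hyper_ne hp1.ne', sub_self] at this
    have h0 := hv.mul (hz.mul hv'); rw [zero_mul, mul_zero] at h0
    have := laurent_div hp1.ne hp2 hl2 h0; have hne := hyper_form_ne_zero hp1.ne p.2
    have e : φ * ((z p.1 - cst p.2 * z a) * P) * (z p.1 - cst p.2 * z a)⁻¹ = φ * P := by grind
    rwa [e] at this

end Laurent

/-! ### Matrices with entries in a subalgebra -/

section EntriesIn

variable {ι : Type*} [Fintype ι] [DecidableEq ι] {n : ℕ} {L : Type*} [Field L] [Algebra K L]
  {O : Subalgebra K L}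

/-- The entries of `M` belong to `O`. -/
def EntriesIn (O : Subalgebra K L) (M : Op ι n L) : Prop := ∀ I J, M I J ∈ O

lemma EntriesIn.mul {M N : Op ι n L} (h : EntriesIn O M) (h' : EntriesIn O N) :
    EntriesIn O (M * N) := by
  intro I J; rw [mul_apply]; exact sum_mem fun T _ => mul_mem (h I T) (h' T J)

lemma EntriesIn.one : EntriesIn O (1 : Op ι n L) := by
  intro I J; rw [Matrix.one_apply]; split_ifs
  · exact one_mem _
  · exact zero_mem _

lemma EntriesIn.smul {M : Op ι n L} (h : EntriesIn O M) {c : L} (hc : c ∈ O) :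
    EntriesIn O (c • M) := fun I J => mul_mem hc (h I J)

lemma EntriesIn.of_smul {M : Op ι n L} {c : L} (h : EntriesIn O (c • M)) (hc : c⁻¹ ∈ O)
    (h0 : c ≠ 0) : EntriesIn O M := by
  have := h.smul hc; rwa [smul_smul, inv_mul_cancel₀ h0, one_smul] at this

lemma EntriesIn.pm (σ : Perm ι) : EntriesIn O (Pm L σ : Op ι n L) := by
  intro I J; unfold Pm; split_ifs
  · exact one_mem _
  · exact zero_mem _

/-- `M` is invertible over `O`. -/
def RegInv (O : Subalgebra K L) (M : Op ι n L) : Prop :=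
  ∃ M' : Op ι n L, M * M' = 1 ∧ M' * M = 1 ∧ EntriesIn O M ∧ EntriesIn O M'

lemma RegInv.mul {M N : Op ι n L} (h : RegInv O M) (h' : RegInv O N) : RegInv O (M * N) := by
  obtain ⟨M', h1, h2, h3, h4⟩ := h; obtain ⟨N', h1', h2', h3', h4'⟩ := h'
  refine ⟨N' * M', ?_, ?_, h3.mul h3', h4'.mul h4⟩
  · rw [mul_assoc, ← mul_assoc N, h1', one_mul, h1]
  · rw [mul_assoc, ← mul_assoc M', h2, one_mul, h2']

lemma RegInv.one : RegInv O (1 : Op ι n L) :=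
  ⟨1, one_mul _, one_mul _, EntriesIn.one, EntriesIn.one⟩

lemma RegInv.list_prod {l : List (Op ι n L)} (h : ∀ M ∈ l, RegInv O M) : RegInv O l.prod := by
  induction l with
  | nil => exact RegInv.one
  | cons M l ih =>
    rw [List.prod_cons]; exact (h M (by simp)).mul (ih fun N hN => h N (by simp [hN]))

lemma RegInv.pm (σ : Perm ι) : RegInv O (Pm L σ : Op ι n L) :=
  ⟨Pm L σ⁻¹, Pm_mul_inv σ, Pm_inv_mul σ, EntriesIn.pm _, EntriesIn.pm _⟩

lemma RegInv.isUnit {M : Op ι n L} (h : RegInv O M) : IsUnit M := by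
  obtain ⟨M', h1, h2, h3, h4⟩ := h; exact ⟨⟨M, M', h1, h2⟩, rfl⟩

lemma RegInv.of_mul_left {A G : Op ι n L} (hA : RegInv O A) (h : EntriesIn O (A * G)) :
    EntriesIn O G := by
  obtain ⟨M', h1, h2, h3, h4⟩ := hA; have := h4.mul h; rwa [← mul_assoc, h2, one_mul] at this

lemma RegInv.of_mul_right {A G : Op ι n L} (hA : RegInv O A) (h : EntriesIn O (G * A)) :
    EntriesIn O G := by
  obtain ⟨M', h1, h2, h3, h4⟩ := hA; have := h.mul h4; rwa [mul_assoc, h1, mul_one] at this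

lemma EntriesIn.rm {a b : ι} (hab : a ≠ b) {x : L} (hx : x ∈ O) (hx' : (1 - x)⁻¹ ∈ O) :
    EntriesIn O (Rm a b x : Op ι n L) := by
  have hq : ∀ c : K, ofK c ∈ O := O.algebraMap_mem; intro I J; rw [Rm_apply hab, rDiag, rOff]
  refine add_mem ?_ ?_
  · split_ifs
    · rw [div_eq_mul_inv]; exact mul_mem (sub_mem (hq _) (mul_mem hx (hq _))) hx'
    · exact one_mem _
    · exact zero_mem _
  · split_ifs
    · exact zero_mem _
    · rw [div_eq_mul_inv]; exact mul_mem (hq _) (mul_mem hx hx')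
    · rw [div_eq_mul_inv]; exact mul_mem (hq _) (mul_mem (one_mem _) hx')
    · exact zero_mem _

theorem EntriesIn.smul_rm {a b : ι} (hab : a ≠ b) {x : L} (hx : x ∈ O) (hx1 : x ≠ 1) :
    EntriesIn O ((1 - x) • (Rm a b x : Op ι n L)) := by
  have hq : ∀ c : K, ofK c ∈ O := O.algebraMap_mem
  have h1 : 1 - x ≠ 0 := sub_ne_zero.2 (Ne.symm hx1); intro I J
  rw [Matrix.smul_apply, smul_eq_mul, Rm_apply hab, rDiag, rOff, mul_add]; refine add_mem ?_ ?_
  · split_ifs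
    · rw [mul_div_cancel₀ _ h1]; exact sub_mem (hq _) (mul_mem hx (hq _))
    · rw [mul_one]; exact sub_mem (one_mem _) hx
    · rw [mul_zero]; exact zero_mem _
  · split_ifs
    · rw [mul_zero]; exact zero_mem _
    · rw [mul_left_comm, mul_div_cancel₀ _ h1]; exact mul_mem (hq _) hx
    · rw [mul_left_comm, mul_div_cancel₀ _ h1]; exact mul_mem (hq _) (one_mem _)
    · rw [mul_zero]; exact zero_mem _

/-- The numerator of `f(x)` is a unit of `O`. -/
def FUnit (O : Subalgebra K L) (x : L) : Prop :=
  ∃ c ∈ O, c * ((1 - x * ofK (q ^ 2)) * (1 - x * ofK ((q⁻¹) ^ 2))) = 1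

lemma FUnit.inv {x : L} (h : FUnit O x) (h0 : x ≠ 0) (hx : x ∈ O) : FUnit O x⁻¹ := by
  obtain ⟨c, hc, h⟩ := h; have hq : cIn L q ≠ 0 := algebraMap_q_ne_zero
  refine ⟨x ^ 2 * c, mul_mem (pow_mem hx 2) hc, ?_⟩; refine Eq.trans ?_ h
  simp only [map_pow, map_inv₀]; field_simp; ring

lemma f_mul_sq {x : L} (hx : x ≠ 1) : f x * (1 - x) ^ 2 =
    (1 - x * ofK (q ^ 2)) * (1 - x * ofK ((q⁻¹) ^ 2)) := by
  have h1 : 1 - x ≠ 0 := sub_ne_zero.2 (Ne.symm hx); rw [f, div_mul_cancel₀ _ (pow_ne_zero 2 h1)]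

lemma q_sub_inv_ne_zero : (q - q⁻¹ : K) ≠ 0 := by
  intro h; have hq := q_ne_zero; have h1 : q ^ 2 = 1 := by grind
  have h2 : (MvPolynomial.X 0 : MvPolynomial (Fin 2) ℚ) ^ 2 = 1 := by
    apply IsFractionRing.injective (MvPolynomial (Fin 2) ℚ) K; rw [map_pow, map_one]; exact h1
  have h3 := congrArg (MvPolynomial.eval 0) h2; simp at h3

lemma regInv_rm {a b : ι} (hab : a ≠ b) {x : L} (hx : x ∈ O) (hxi : x⁻¹ ∈ O) (h0 : x ≠ 0)
    (hx1 : x ≠ 1) (h1 : (1 - x)⁻¹ ∈ O) (hf : FUnit O x) : RegInv O (Rm a b x : Op ι n L) := by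
  have h1' : 1 - x ≠ 0 := sub_ne_zero.2 (Ne.symm hx1); obtain ⟨c, hc, hc1⟩ := hf
  have hfi : c * (1 - x) ^ 2 * f x = 1 := by refine Eq.trans ?_ hc1; rw [← f_mul_sq hx1]; ring
  have hf0 : f x ≠ 0 := right_ne_zero_of_mul_eq_one hfi
  have e1 : (Rm a b x : Op ι n L) * ((c * (1 - x) ^ 2) • Rm b a x⁻¹) = 1 := by
    rw [mul_smul_comm, Rm_unitarity hab h0 hx1, smul_smul, hfi, one_smul]
  refine ⟨(c * (1 - x) ^ 2) • Rm b a x⁻¹, e1, mul_eq_one_comm.1 e1, EntriesIn.rm hab hx h1,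
    (EntriesIn.rm hab.symm hxi ?_).smul (mul_mem hc (pow_mem (sub_mem (one_mem _) hx) 2))⟩
  have : (1 - x⁻¹)⁻¹ = -(x * (1 - x)⁻¹) := by grind
  rw [this]; exact neg_mem (mul_mem hx h1)

variable {G : Op ι n L}

lemma exists_ne_fin (hn : 2 ≤ n) (t : Fin n) : ∃ s : Fin n, s ≠ t := by
  have : Nontrivial (Fin n) := Fin.nontrivial_iff_two_le.2 hn; exact exists_ne t

lemma strip_aux {s t : Fin n} (hst : s ≠ t) {x g : L} (hx1 : x ≠ 1) (h0 : x ≠ 0)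
    (hxi : x⁻¹ ∈ O) (h : (1 - x) * (g * rOff x s t) ∈ O) : g ∈ O := by
  have h1 : 1 - x ≠ 0 := sub_ne_zero.2 (Ne.symm hx1)
  have hq := ofK_ne_zero (L := L) q_sub_inv_ne_zero
  have hqi : (ofK (q - q⁻¹))⁻¹ ∈ O := by rw [← map_inv₀]; exact O.algebraMap_mem _
  rw [rOff, if_neg hst] at h
  generalize cIn L (q - q⁻¹) = c at *
  by_cases hlt : s < t
  · rw [if_pos hlt] at h; have := mul_mem h (mul_mem hqi hxi); convert this using 1; field_simp
  · rw [if_neg hlt] at h; have := mul_mem h hqi; convert this using 1; field_simp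

theorem strip_right (hn : 2 ≤ n) {i x : ι} (hxi : x ≠ i) (hG : TrivOn x G) {ξ : L} (h1 : ξ ≠ 1)
    (h0 : ξ ≠ 0) (hξ : ξ⁻¹ ∈ O) (h : EntriesIn O ((1 - ξ) • (G * Rm x i ξ))) : EntriesIn O G := by
  intro I J
  by_cases e : I x = J x
  swap
  · rw [hG.1 I J e]; exact zero_mem _
  obtain ⟨s, hs⟩ := exists_ne_fin hn (J i); rw [← hG.2 I J s e]
  have h2 := h (Function.update I x s) (Function.update J x s ∘ Equiv.swap x i)
  rw [Matrix.smul_apply, smul_eq_mul, mul_Rm_apply hxi, hG.1 _ _ (by simp [hxi.symm, hs]),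
    zero_mul, zero_add] at h2
  have e1 : (Function.update J x s ∘ Equiv.swap x i) ∘ Equiv.swap x i = Function.update J x s := by
    grind
  have e2 : (update J x s ∘ swap x i) i = s := by simp
  have e3 : (update J x s ∘ swap x i) x = J i := by simp [hxi.symm]
  rw [e1, e2, e3] at h2; exact strip_aux hs h1 h0 hξ h2

theorem strip_left (hn : 2 ≤ n) {i x : ι} (hxi : x ≠ i) (hG : TrivOn x G) {ξ : L} (h1 : ξ ≠ 1)
    (h0 : ξ ≠ 0) (hξ : ξ⁻¹ ∈ O) (h : EntriesIn O ((1 - ξ) • (Rm i x ξ * G))) : EntriesIn O G := by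
  intro I J
  by_cases e : I x = J x
  swap
  · rw [hG.1 I J e]; exact zero_mem _
  obtain ⟨s, hs⟩ := exists_ne_fin hn (I i); rw [← hG.2 I J s e]
  have h2 := h (Function.update I x s ∘ Equiv.swap i x) (Function.update J x s)
  rw [Matrix.smul_apply, smul_eq_mul, Rm_mul_apply hxi.symm,
    hG.1 _ _ (by simp [hxi.symm, hs.symm]), mul_zero, zero_add] at h2
  have e1 : (Function.update I x s ∘ Equiv.swap i x) ∘ Equiv.swap i x = Function.update I x s := by
    grind
  have e2 : (update I x s ∘ swap i x) i = s := by simp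
  have e3 : (update I x s ∘ swap i x) x = I i := by simp [hxi.symm]
  rw [e1, e2, e3, mul_comm (rOff _ _ _)] at h2; exact strip_aux hs h1 h0 hξ h2

lemma strip (hn : 2 ≤ n) {i x : ι} (hxi : x ≠ i) (hG : TrivOn x G) {ξ ξ' : L} (h1 : ξ ≠ 1)
    (h0 : ξ ≠ 0) (hm : ξ ∈ O) (hξ : ξ⁻¹ ∈ O) (h1' : ξ' ≠ 1) (h0' : ξ' ≠ 0) (hm' : ξ' ∈ O)
    (hξ' : ξ'⁻¹ ∈ O) (hf : FUnit O ξ ∨ FUnit O ξ')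
    (h : EntriesIn O (((1 - ξ) * (1 - ξ')) • (Rm i x ξ * G * Rm x i ξ'))) : EntriesIn O G := by
  have key : ∀ ζ : L, ζ ∈ O → ζ⁻¹ ∈ O → ζ ≠ 0 → ζ ≠ 1 → FUnit O ζ →
      ∃ c ∈ O, c * ((1 - ζ) * (1 - ζ⁻¹)) * f ζ = 1 := by
    intro ζ hζ hζ' hζ0 hζ1 hfζ; obtain ⟨c, hc, hc1⟩ := hfζ
    refine ⟨c * (-ζ), mul_mem hc (neg_mem hζ), ?_⟩; refine Eq.trans ?_ hc1; rw [← f_mul_sq hζ1]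
    field_simp; ring
  rcases hf with hf | hf
  · have h1i : ξ⁻¹ ≠ 1 := fun h => h1 (inv_eq_one.1 h)
    obtain ⟨c, hc, hc1⟩ := key ξ⁻¹ hξ (by rwa [inv_inv]) (inv_ne_zero h0) h1i (hf.inv h0 hm)
    refine strip_right hn hxi hG h1' h0' hξ' ?_
    have h2 := ((EntriesIn.smul_rm (n := n) hxi hξ h1i).mul h).smul hc
    have e : c • ((1 - ξ⁻¹) • Rm x i ξ⁻¹ * ((1 - ξ) * (1 - ξ')) • (Rm i x ξ * G * Rm x i ξ')) =
        (1 - ξ') • (G * Rm x i ξ') := by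
      have hu := Rm_unitarity (n := n) hxi (inv_ne_zero h0) h1i; rw [inv_inv] at hu
      rw [smul_mul_smul_comm, mul_assoc (Rm i x ξ), ← mul_assoc (Rm x i ξ⁻¹), hu, smul_mul_assoc,
        one_mul, smul_smul, smul_smul]
      grind
    rwa [e] at h2
  · have h1i : ξ'⁻¹ ≠ 1 := fun h => h1' (inv_eq_one.1 h)
    obtain ⟨c, hc, hc1⟩ := key ξ' hm' hξ' h0' h1' hf; refine strip_left hn hxi hG h1 h0 hξ ?_
    have h2 := (h.mul (EntriesIn.smul_rm (n := n) hxi.symm hξ' h1i)).smul hc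
    have e : c • (((1 - ξ) * (1 - ξ')) • (Rm i x ξ * G * Rm x i ξ') *
        (1 - ξ'⁻¹) • Rm i x ξ'⁻¹) = (1 - ξ) • (Rm i x ξ * G) := by
      have hu := Rm_unitarity (n := n) hxi h0' h1'
      rw [smul_mul_smul_comm, mul_assoc (Rm i x ξ * G), hu, mul_smul_comm, mul_one, smul_smul,
        smul_smul]
      congr 1
      calc _ = (c * ((1 - ξ') * (1 - ξ'⁻¹)) * f ξ') * (1 - ξ) := by ring
        _ = _ := by rw [hc1, one_mul]
    rwa [e] at h2

lemma TrivOn.train {v : ι → L} {y i : ι} {xs : List ι} (hi : y ≠ i) (hxs : y ∉ xs) :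
    TrivOn y (train (Rv n v) xs i) := by
  refine TrivOn.list_prod fun M hM => ?_; obtain ⟨x, hx, rfl⟩ := List.mem_map.1 hM
  exact TrivOn.rm hi (fun h => hxs (h ▸ hx)) _

/-- `∏ R_{x i}(v_x/v_i)` over the list in reverse order. -/
def trainR (n : ℕ) (v : ι → L) (xs : List ι) (i : ι) : Op ι n L :=
  (xs.reverse.map fun x => (Rm x i (v x / v i) : Op ι n L)).prod

lemma trainR_cons (v : ι → L) (x : ι) (xs : List ι) (i : ι) :
    trainR n v (x :: xs) i = trainR n v xs i * Rm x i (v x / v i) := by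
  rw [trainR, List.reverse_cons, List.map_append, List.prod_append, List.map_singleton,
    List.prod_singleton, trainR]

lemma trainR_append (v : ι → L) (xs ys : List ι) (i : ι) :
    trainR n v (xs ++ ys) i = trainR n v ys i * trainR n v xs i := by
  rw [trainR, List.reverse_append, List.map_append, List.prod_append, trainR, trainR]

lemma op_trainR (v : ι → L) (xs : List ι) (i : ι) :
    MulOpposite.op (trainR n v xs i) = train (RvOp n v) xs i := by
  induction xs with
  | nil => rfl
  | cons x xs ih => rw [trainR_cons, MulOpposite.op_mul, ih, train_cons, RvOp]

lemma TrivOn.trainR {v : ι → L} {y i : ι} {xs : List ι} (hi : y ≠ i) (hxs : y ∉ xs) :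
    TrivOn y (trainR n v xs i) := by
  refine TrivOn.list_prod fun M hM => ?_; obtain ⟨x, hx, rfl⟩ := List.mem_map.1 hM
  have hx' : x ∈ xs := by simpa using hx
  have hyx : y ≠ x := fun h => hxs (h ▸ hx'); exact TrivOn.rm hyx hi _

lemma strip_trains (hn : 2 ≤ n) {i : ι} {v v' : ι → L} :
    ∀ xs, xs.Nodup → (∀ x ∈ xs, x ≠ i ∧ TrivOn x G ∧
      (v i / v x ≠ 1 ∧ v i / v x ≠ 0 ∧ v i / v x ∈ O ∧ (v i / v x)⁻¹ ∈ O) ∧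
      (v' x / v' i ≠ 1 ∧ v' x / v' i ≠ 0 ∧ v' x / v' i ∈ O ∧ (v' x / v' i)⁻¹ ∈ O) ∧
      (FUnit O (v i / v x) ∨ FUnit O (v' x / v' i))) →
    EntriesIn O ((xs.map fun x => (1 - v i / v x) * (1 - v' x / v' i)).prod •
      (train (Rv n v) xs i * G * trainR n v' xs i)) → EntriesIn O G
  | [], _, _, h => by simpa [train, trainR] using h
  | x :: xs, hd, hx, h => by
    obtain ⟨hxi, hT, ⟨a1, a2, a3, a4⟩, ⟨b1, b2, b3, b4⟩, hf⟩ := hx x (by simp)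
    obtain ⟨hx1, hd'⟩ := List.nodup_cons.1 hd
    refine strip_trains hn xs hd' (fun y hy => hx y (by simp [hy])) ?_
    have hT' : TrivOn x ((xs.map fun x => (1 - v i / v x) * (1 - v' x / v' i)).prod •
      (train (Rv n v) xs i * G * trainR n v' xs i)) :=
      (((TrivOn.train hxi hx1).mul hT).mul (TrivOn.trainR hxi hx1)).smul _
    refine strip hn hxi hT' a1 a2 a3 a4 b1 b2 b3 b4 hf ?_
    rw [train_cons, trainR_cons, List.map_cons, List.prod_cons] at h; convert h using 1
    rw [mul_smul_comm, smul_mul_assoc, smul_smul, Rv]; simp only [mul_assoc]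

end EntriesIn

/-! ### Values of matrices -/

section MVal

variable {ι : Type*} [Fintype ι] [DecidableEq ι] {n k u : ℕ} {w : Fin k → RatFun u}

/-- The matrix `M` is regular at `w`, with value `M'`. -/
def MVal (w : Fin k → RatFun u) (M : Op ι n (RatFun k)) (M' : Op ι n (RatFun u)) : Prop :=
  ∀ I J, HasValueAt w (M I J) (M' I J)

lemma MVal.mul {M N : Op ι n (RatFun k)} {M' N' : Op ι n (RatFun u)} (h : MVal w M M')
    (h' : MVal w N N') : MVal w (M * N) (M' * N') := by
  intro I J; rw [mul_apply, mul_apply]; exact HasValueAt.sum _ fun T _ => (h I T).mul (h' T J)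

lemma MVal.one : MVal w (1 : Op ι n (RatFun k)) 1 := by
  intro I J; rw [Matrix.one_apply, Matrix.one_apply]; split_ifs
  · exact HasValueAt.one
  · exact HasValueAt.zero w

lemma MVal.smul {M : Op ι n (RatFun k)} {M' : Op ι n (RatFun u)} (h : MVal w M M')
    {φ : RatFun k} {v : RatFun u} (hφ : HasValueAt w φ v) : MVal w (φ • M) (v • M') :=
  fun I J => hφ.mul (h I J)

lemma MVal.unique {M : Op ι n (RatFun k)} {M' M'' : Op ι n (RatFun u)} (h : MVal w M M')
    (h' : MVal w M M'') : M' = M'' := by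
  ext I J; exact (h I J).unique (h' I J)

lemma MVal.list_prod {κ : Type*} (l : List κ) {M : κ → Op ι n (RatFun k)}
    {M' : κ → Op ι n (RatFun u)} (h : ∀ i ∈ l, MVal w (M i) (M' i)) :
    MVal w (l.map M).prod (l.map M').prod := by
  induction l with
  | nil => exact MVal.one
  | cons i l ih =>
    rw [List.map_cons, List.map_cons, List.prod_cons, List.prod_cons]
    exact (h i (by simp)).mul (ih fun j hj => h j (by simp [hj]))

lemma MVal.pm (σ : Perm ι) : MVal w (Pm (RatFun k) σ : Op ι n (RatFun k)) (Pm (RatFun u) σ) := by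
  intro I J; unfold Pm; split_ifs
  · exact HasValueAt.one
  · exact HasValueAt.zero w

lemma MVal.rm {a b : ι} (hab : a ≠ b) {x : RatFun k} {x' : RatFun u} (hx : HasValueAt w x x')
    (h1 : x' ≠ 1) : MVal w (Rm a b x : Op ι n (RatFun k)) (Rm a b x') := by
  have hd := HasValueAt.one.sub hx; have h1' : 1 - x' ≠ 0 := sub_ne_zero.2 (Ne.symm h1); intro I J
  rw [Rm_apply hab, Rm_apply hab, rDiag, rDiag, rOff, rOff]; refine HasValueAt.add ?_ ?_
  · split_ifs
    · exact ((HasValueAt.const q).sub (hx.mul (HasValueAt.const _))).div hd h1'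
    · exact HasValueAt.one
    · exact HasValueAt.zero w
  · split_ifs
    · exact HasValueAt.zero w
    · exact (HasValueAt.const _).mul (hx.div hd h1')
    · exact (HasValueAt.const _).mul (HasValueAt.one.div hd h1')
    · exact HasValueAt.zero w

lemma HasValueAt.mem {φ : RatFun k} {v : RatFun u} (h : HasValueAt w φ v) : φ ∈ valRing w := ⟨v, h⟩

lemma HasValueAt.ne_zero {φ : RatFun k} {v : RatFun u} (h : HasValueAt w φ v) (hv : v ≠ 0) :
    φ ≠ 0 := by
  rintro rfl; exact hv (h.unique (HasValueAt.zero w))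

lemma HasValueAt.ne_one {φ : RatFun k} {v : RatFun u} (h : HasValueAt w φ v) (hv : v ≠ 1) :
    φ ≠ 1 := by
  rintro rfl; exact hv (h.unique HasValueAt.one)

lemma HasValueAt.inv_mem {φ : RatFun k} {v : RatFun u} (h : HasValueAt w φ v) (hv : v ≠ 0) :
    φ⁻¹ ∈ valRing w := ⟨_, h.inv hv⟩

/-- The values at which the `R`-matrix is neither singular nor degenerate. -/
def Nondeg (x : L) : Prop := x ≠ 0 ∧ x ≠ 1 ∧ x * ofK (q ^ 2) ≠ 1 ∧ x * ofK ((q⁻¹) ^ 2) ≠ 1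

lemma HasValueAt.fUnit {φ : RatFun k} {v : RatFun u} (h : HasValueAt w φ v)
    (h1 : v * ofK (q ^ 2) ≠ 1) (h2 : v * ofK ((q⁻¹) ^ 2) ≠ 1) :
    FUnit (valRing w) φ := by
  have h3 := (HasValueAt.one.sub (h.mul (HasValueAt.const (q ^ 2)))).mul
    (HasValueAt.one.sub (h.mul (HasValueAt.const ((q⁻¹) ^ 2))))
  have h4 := mul_ne_zero (sub_ne_zero.2 h1.symm) (sub_ne_zero.2 h2.symm)
  exact ⟨_, h3.inv_mem h4, inv_mul_cancel₀ (h3.ne_zero h4)⟩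

lemma RegInv.rm_of_value {a b : ι} (hab : a ≠ b) {x : RatFun k} {x' : RatFun u}
    (hx : HasValueAt w x x') (h : Nondeg x') :
    RegInv (valRing w) (Rm a b x : Op ι n (RatFun k)) :=
  regInv_rm hab hx.mem (hx.inv_mem h.1) (hx.ne_zero h.1) (hx.ne_one h.2.1)
    ((HasValueAt.one.sub hx).inv_mem (sub_ne_zero.2 h.2.1.symm)) (hx.fUnit h.2.2.1 h.2.2.2)

end MVal

/-! ### Block structures -/

/-- `b j` is the first element of the block of `j`, for a decomposition into intervals. -/
structure IsBlk {k : ℕ} (b : Fin k → Fin k) : Prop where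
  le : ∀ j, b j ≤ j
  mono : Monotone b
  idem : ∀ j, b (b j) = b j

section Composition

variable (c : Composition k)

/-- The first element of the block of `j`. -/
def blk (j : Fin k) : Fin k := head c (c.index j)

lemma head_val (s : Fin c.length) : (head c s).val = c.sizeUpTo s := by aesop

lemma blk_add (j : Fin k) : (blk c j).val + (c.invEmbedding j).val = j.val := by
  rw [blk, head_val, c.coe_invEmbedding, Nat.add_sub_cancel' (c.sizeUpTo_index_le j)]

lemma index_head (s : Fin c.length) : c.index (head c s) = s := c.index_embedding _ _

lemma blk_head (s : Fin c.length) : blk c (head c s) = head c s := by rw [blk, index_head]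

lemma blk_embedding (s : Fin c.length) (e : Fin (c.blocksFun s)) :
    blk c (c.embedding s e) = head c s := by rw [blk, c.index_embedding]

lemma head_strictMono : StrictMono (head c) := by
  intro s t h; rw [lt_def, head_val, head_val]
  exact (c.sizeUpTo_strict_mono s.2).trans_le (c.monotone_sizeUpTo h)

lemma head_injective : Injective (head c) := (head_strictMono c).injective

lemma index_mono : Monotone c.index := by
  intro i j h; by_contra hlt; rw [not_le] at hlt; have h1 := c.lt_sizeUpTo_index_succ j
  have h2 := c.monotone_sizeUpTo (Nat.succ_le_of_lt hlt); have h3 := c.sizeUpTo_index_le i; grind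

lemma isBlk_blk : IsBlk (blk c) where
  le j := by rw [le_def]; have := blk_add c j; lia
  mono i j h := (head_strictMono c).monotone (index_mono c h)
  idem j := blk_head c _

lemma head_lt_blk_iff (s : Fin c.length) (j : Fin k) : head c s < blk c j ↔ s < c.index j :=
  (head_strictMono c).lt_iff_lt

lemma exists_composition {b : Fin k → Fin k} (hb : IsBlk b) :
    ∃ c : Composition k, blk c = b := by
  let C : CompositionAsSet k :=
    { boundaries := insert (Fin.last k)
        ((univ.filter fun h => b h = h).map Fin.castSuccEmb)
      zero_mem := by
        rcases Nat.eq_zero_or_pos k with rfl | hk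
        · exact Finset.mem_insert_self _ _
        · refine Finset.mem_insert_of_mem ?_
          rw [Finset.mem_map]
          refine ⟨⟨0, hk⟩, ?_, rfl⟩
          rw [mem_filter]
          refine ⟨mem_univ _, le_antisymm (hb.le _) ?_⟩
          rw [le_def]; exact Nat.zero_le _
      getLast_mem := Finset.mem_insert_self _ _ }
  let c := C.toComposition
  have hbd : c.boundaries = C.boundaries := C.toComposition_boundaries
  have h1 : ∀ s, b (head c s) = head c s := by
    intro s
    have hm : c.boundary s.castSucc ∈ C.boundaries := by
      rw [← hbd]; exact Finset.mem_map_of_mem _ (mem_univ _)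
    have hv : c.boundary s.castSucc = (head c s).castSucc := by
      aesop
    rw [hv] at hm
    rcases Finset.mem_insert.1 hm with h | h
    · exact absurd h (Fin.castSucc_lt_last _).ne
    simp_all
  have h2 : ∀ h, b h = h → ∃ s, head c s = h := by
    intro h hh
    have hm : h.castSucc ∈ c.boundaries := by
      aesop
    obtain ⟨i, -, hi⟩ := Finset.mem_map.1 hm
    have hi' : c.sizeUpTo i = h.val := congrArg Fin.val hi
    have hlt : i.val < c.length := by
      by_contra hge
      rw [c.sizeUpTo_ofLength_le i (by lia)] at hi'
      have := h.2
      lia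
    exact ⟨⟨i, hlt⟩, Fin.ext (by rw [head_val]; exact hi')⟩
  refine ⟨c, funext fun j => ?_⟩
  apply le_antisymm
  · rw [blk, ← h1]
    exact hb.mono ((isBlk_blk c).le j)
  · obtain ⟨s, hs⟩ := h2 (b j) (hb.idem j)
    rw [← hs]
    refine (head_strictMono c).monotone ?_
    by_contra hlt
    rw [not_le] at hlt
    have h3 := c.lt_sizeUpTo_index_succ j
    have h4 := c.monotone_sizeUpTo (Nat.succ_le_of_lt hlt)
    have h5 := hb.le j
    rw [← hs, le_def, head_val] at h5
    grind

end Composition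

/-! ### The wheel condition on strands -/

section Blk

variable (n : ℕ) (b : Fin k → Fin k)

/-- The point `z_j = z_{b(j)} q̄^{2(j - b(j))}`. -/
def pt (j : Fin k) : RatFun k := z (b j) * cst (qbar n ^ (2 * (j.val - (b j).val)))

/-- The length of the block with first element `h`. -/
def blkLen (h : Fin k) : ℕ := (univ.filter fun j => b j = h).card

/-- The first elements of the blocks. -/
def heads : List (Fin k) := (finRange k).filter fun h => b h = h

/-- The other elements of the blocks. -/
def nonheads : List (Fin k) := (finRange k).filter fun x => b x ≠ x

variable {n}

/-- The left factor in the wheel condition. -/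
def lft (v : Fin k → RatFun k) : Tensor n k :=
  ((heads b).reverse.map fun h => train (Rv n v) ((nonheads b).filter (h < ·)) h).prod

variable (n) in
/-- The parameters in the right factor of the wheel condition. -/
def vR (v : Fin k → RatFun k) (j : Fin k) : RatFun k :=
  if b j = j then v j * cst (qbar n ^ (2 * blkLen b j)) else v j

/-- The right factor in the wheel condition. -/
def rgt (v : Fin k → RatFun k) : Tensor n k :=
  ((heads b).map fun h => trainR n (vR n b v) ((nonheads b).filter (h < b ·)) h).prod

/-- The scalar factor of the wheel condition. -/
def scl (v : Fin k → RatFun k) : RatFun k :=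
  ∏ p : Fin k × Fin k with p.1 < p.2 ∧ b p.1 ≠ p.1 ∧ b p.2 ≠ p.2, f (v p.1 / v p.2)

variable (n) in
/-- The factors of the common denominator which do not vanish at the wheel point. -/
def den (v : Fin k → RatFun k) : RatFun k :=
  ∏ p : Fin k × Fin k with p.1 ≠ p.2 ∧ ¬ (p.2.val + 1 = p.1.val ∧ b p.1 = b p.2),
    (v p.1 - v p.2 * cst (qbar n ^ 2))

/-- The cyclic permutation of each block. -/
def IsCyc (γ : Perm (Fin k)) : Prop := ∀ j, b (γ j) = b j ∧
    ((γ j).val = j.val + 1 ∨ (γ j = b j ∧ ∀ j' : Fin k, j'.val = j.val + 1 → b j' ≠ b j))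

variable (n k) in
/-- The common denominator of the tensors. -/
def poles : RatFun k := ∏ p : Fin k × Fin k with p.1 ≠ p.2, (z p.1 - z p.2 * cst (qbar n ^ 2))

lemma mem_heads {h : Fin k} : h ∈ heads b ↔ b h = h := by simp [heads, List.mem_finRange]

lemma mem_nonheads {x : Fin k} : x ∈ nonheads b ↔ b x ≠ x := by simp [nonheads, List.mem_finRange]

lemma finRange_sorted : (finRange k).Pairwise (· < ·) := List.pairwise_lt_finRange k

lemma heads_sorted : (heads b).Pairwise (· < ·) := finRange_sorted.filter _

lemma nonheads_sorted : (nonheads b).Pairwise (· < ·) := finRange_sorted.filter _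

lemma eq_of_sorted {l l' : List (Fin k)} (hl : l.Pairwise (· < ·)) (hl' : l'.Pairwise (· < ·))
    (h : ∀ x, x ∈ l ↔ x ∈ l') : l = l' := by
  have hn : l.Nodup := hl.imp fun h => h.ne; have hn' : l'.Nodup := hl'.imp fun h => h.ne
  exact ((List.perm_ext_iff_of_nodup hn hn').2 h).eq_of_pairwise
    (fun a b _ _ h1 h2 => absurd h2 (not_lt_of_gt h1)) hl hl'

end Blk

lemma prod_flatMap {M κ : Type*} [Monoid M] (l : List κ) (g : κ → List M) :
    (l.flatMap g).prod = (l.map fun a => (g a).prod).prod := by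
  induction l with
  | nil => rfl
  | cons a l ih => rw [List.flatMap_cons, List.prod_append, ih, List.map_cons, List.prod_cons]

section Bridge

variable (c : Composition k)

lemma heads_blk : (finRange c.length).map (head c) = heads (blk c) := by
  refine eq_of_sorted ?_ (heads_sorted _) fun x => ?_
  · rw [List.pairwise_map]; exact finRange_sorted.imp fun h => head_strictMono c h
  · rw [mem_heads, List.mem_map]; constructor
    · rintro ⟨s, -, rfl⟩; exact blk_head c s
    · intro h; exact ⟨_, List.mem_finRange _, h⟩

/-- The list of the elements of the blocks in `l`, except for the first ones. -/
def tails (l : List (Fin c.length)) : List (Fin k) :=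
  l.flatMap fun t => ((finRange (c.blocksFun t)).filter (fun e => 1 ≤ e.val)).map fun e =>
    c.embedding t e

lemma mem_tails {l : List (Fin c.length)} {x : Fin k} :
    x ∈ tails c l ↔ c.index x ∈ l ∧ blk c x ≠ x := by
  simp only [tails, List.mem_flatMap, List.mem_map, List.mem_filter, List.mem_finRange, true_and,
    decide_eq_true_eq]
  constructor
  · rintro ⟨t, ht, e, he, rfl⟩; refine ⟨by rwa [c.index_embedding], ?_⟩; rw [blk_embedding]; intro h
    have := congrArg Fin.val h; rw [head_val, c.coe_embedding] at this; lia
  · rintro ⟨h1, h2⟩; refine ⟨_, h1, c.invEmbedding x, ?_, c.embedding_comp_inv x⟩; by_contra h3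
    have := blk_add c x; exact h2 (Fin.ext (by lia))

lemma tails_sorted {l : List (Fin c.length)} (hl : l.Pairwise (· < ·)) :
    (tails c l).Pairwise (· < ·) := by
  rw [tails, List.pairwise_flatMap]; refine ⟨fun t _ => ?_, hl.imp fun {s t} hst x hx y hy => ?_⟩
  · rw [List.pairwise_map]
    exact (finRange_sorted.filter _).imp fun h => (c.embedding t).strictMono h
  · obtain ⟨e, -, rfl⟩ := List.mem_map.1 hx; obtain ⟨e', -, rfl⟩ := List.mem_map.1 hy
    rw [lt_def, c.coe_embedding, c.coe_embedding]
    have h1 := c.monotone_sizeUpTo (Nat.succ_le_of_lt hst); have h2 := c.sizeUpTo_succ' s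
    have := e.2; rw [Nat.succ_eq_add_one, h2] at h1; lia

lemma tails_reverse (l : List (Fin c.length)) : (l.reverse.flatMap fun t =>
      ((finRange (c.blocksFun t)).reverse.filter (fun e => 1 ≤ e.val)).map fun e =>
        c.embedding t e) = (tails c l).reverse := by
  induction l with
  | nil => rfl
  | cons t l ih =>
    have e : tails c (t :: l) = ((finRange (c.blocksFun t)).filter (fun e => 1 ≤ e.val)).map
        (fun e => c.embedding t e) ++ tails c l := List.flatMap_cons
    rw [List.reverse_cons, List.flatMap_append, ih, e, List.reverse_append, List.flatMap_singleton,
      List.filter_reverse, List.map_reverse]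

/-- The variables of the blocks, as those of their first elements. -/
def headEmb : Fin c.length ↪ Fin k := ⟨head c, head_injective c⟩

lemma rename_wheelPoint (j : Fin k) :
    renameVars (headEmb c) (wheelPoint n c j) = pt n (blk c) j := by
  have h := blk_add c j; have e : j.val - (blk c j).val = (c.invEmbedding j).val := by lia
  rw [wheelPoint, map_mul, renameVars_z, AlgHom.commutes, pt, e]; rfl

theorem blkLen_blk (s : Fin c.length) : blkLen (blk c) (head c s) = c.blocksFun s := by
  rw [blkLen]
  have : (Finset.univ.filter fun j => blk c j = head c s) =
      Finset.univ.map (c.embedding s).toEmbedding := by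
    ext j; simp only [Finset.mem_filter, Finset.mem_univ, true_and, Finset.mem_map]; constructor
    · intro h; have hi : c.index j = s := head_injective c h; subst hi
      exact ⟨_, c.embedding_comp_inv j⟩
    · rintro ⟨e, rfl⟩; exact blk_embedding c s e
  simp_all

section MapRm

variable {L L' : Type*} [Field L] [Algebra K L] [Field L'] [Algebra K L'] (ρ : L →ₐ[K] L')

lemma map_f (x : L) : ρ (f x) = f (ρ x) := by
  simp only [f, map_div₀, map_mul, map_sub, map_one, map_pow, AlgHom.commutes]

lemma map_rm {a b : ι} (hab : a ≠ b) (x : L) : (Rm a b x : Op ι n L).map ρ = Rm a b (ρ x) := by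
  ext I J; rw [Matrix.map_apply, Rm_apply hab, Rm_apply hab, map_add, rDiag, rDiag, rOff, rOff]
  congr 1
  · split_ifs <;> simp
  · split_ifs <;> simp

lemma map_onStrands {ι κ : Type*} [Fintype ι] [DecidableEq ι] (d : κ → ι) (M : Op κ n L) :
    (onStrands d M).map ρ = onStrands d (M.map ρ) := by
  ext I J; rw [Matrix.map_apply]
  by_cases h : ∀ m, m ∉ Set.range d → I m = J m
  · rw [onStrands_pos _ h, onStrands_pos _ h, Matrix.map_apply]
  · rw [onStrands_neg _ h, onStrands_neg _ h, map_zero]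

lemma map_mul_matrix (M N : Op ι n L) : (M * N).map ρ = M.map ρ * N.map ρ := Matrix.map_mul

lemma map_list_prod_mat (l : List (Op ι n L)) : l.prod.map ρ = (l.map fun M => M.map ρ).prod :=
  map_list_prod ρ.toRingHom.mapMatrix l

end MapRm

lemma pt_head (s : Fin c.length) : pt n (blk c) (head c s) = z (head c s) := by
  rw [pt, blk_head, Nat.sub_self, mul_zero, pow_zero, map_one, mul_one]

lemma pt_embedding (s : Fin c.length) (e : Fin (c.blocksFun s)) : pt n (blk c) (c.embedding s e) =
      z (head c s) * cst (qbar n ^ (2 * e.val)) := by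
  rw [pt, blk_embedding]; congr 4; rw [head_val, c.coe_embedding]; lia

lemma head_ne_embedding {s t : Fin c.length} {e : Fin (c.blocksFun t)} (he : 1 ≤ e.val) :
    head c s ≠ c.embedding t e := by
  intro h; have h1 := congrArg c.index h; rw [index_head, c.index_embedding] at h1; subst h1
  have := congrArg Fin.val h; rw [head_val, c.coe_embedding] at this; lia

lemma map_wheelLeft :
    (wheelLeft n c).map (renameVars (headEmb c)) = lft (blk c) (pt n (blk c)) := by
  rw [wheelLeft, prod_flatMap, map_list_prod_mat, lft, ← heads_blk, ← List.map_reverse,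
    List.map_map, List.map_map]
  congr 1; refine map_congr_left fun s _ => ?_
  rw [comp_apply, comp_apply, map_list_prod_mat, train]
  have hl : (nonheads (blk c)).filter (head c s < ·) =
      tails c ((finRange c.length).filter fun t => s ≤ t) := by
    refine eq_of_sorted ((nonheads_sorted _).filter _) (tails_sorted c (finRange_sorted.filter _))
      fun x => ?_
    rw [mem_tails, List.mem_filter, mem_nonheads, List.mem_filter]
    simp only [decide_eq_true_eq, List.mem_finRange, true_and]; rw [and_comm]
    refine and_congr_left fun hx => ?_; constructor
    · intro h; have := index_mono c h.le; rwa [index_head] at this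
    · refine fun h => lt_of_le_of_ne (((head_strictMono c).monotone h).trans ((isBlk_blk c).le x)) ?_
      rintro rfl; exact hx (blk_head c s)
  rw [hl, tails, List.map_flatMap, List.map_flatMap]; congr 1
  refine List.flatMap_congr fun t _ => ?_; rw [List.map_map, List.map_map]
  refine map_congr_left fun e he => ?_
  have he' : 1 ≤ e.val := by simpa using (List.mem_filter.1 he).2
  rw [comp_apply, comp_apply, R_eq_Rm, map_rm _ (head_ne_embedding c he'), Rv,
    pt_head, pt_embedding, map_div₀, map_mul, renameVars_z, renameVars_z, AlgHom.commutes]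
  rfl

lemma map_wheelRight :
    (wheelRight n c).map (renameVars (headEmb c)) = rgt (blk c) (pt n (blk c)) := by
  rw [wheelRight, prod_flatMap, map_list_prod_mat, rgt, ← heads_blk, List.map_map, List.map_map]
  congr 1; refine map_congr_left fun s _ => ?_
  rw [comp_apply, comp_apply, map_list_prod_mat, trainR]
  have hl : (nonheads (blk c)).filter (head c s < blk c ·) =
      tails c ((finRange c.length).filter fun t => s < t) := by
    refine eq_of_sorted ((nonheads_sorted _).filter _) (tails_sorted c (finRange_sorted.filter _))
      fun x => ?_
    rw [mem_tails, List.mem_filter, mem_nonheads, List.mem_filter]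
    simp only [decide_eq_true_eq, List.mem_finRange, true_and]; rw [and_comm, head_lt_blk_iff]
  rw [hl, ← tails_reverse, List.map_flatMap, List.map_flatMap, List.filter_reverse]; congr 1
  refine List.flatMap_congr fun t ht => ?_; rw [List.map_map, List.map_map]
  refine map_congr_left fun e he => ?_
  have he' : 1 ≤ e.val := by simpa using (List.mem_filter.1 he).2
  have hne := head_ne_embedding c (s := s) he'
  have h1 : vR n (blk c) (pt n (blk c)) (c.embedding t e) = pt n (blk c) (c.embedding t e) := by
    rw [vR, if_neg]; rw [blk_embedding]; exact head_ne_embedding c he'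
  have h2 : vR n (blk c) (pt n (blk c)) (head c s) =
      z (head c s) * cst (qbar n ^ (2 * c.blocksFun s)) := by
    rw [vR, if_pos (blk_head c s), pt_head, blkLen_blk]
  rw [comp_apply, comp_apply, R_eq_Rm, map_rm _ hne.symm, h1, h2,
    pt_embedding, map_div₀, map_mul, map_mul, renameVars_z, renameVars_z, AlgHom.commutes,
    AlgHom.commutes]
  rfl

lemma map_wheelScalar : renameVars (headEmb c) (wheelScalar n c) = scl (blk c) (pt n (blk c)) := by
  rw [wheelScalar, scl, map_prod]; refine prod_congr ?_ fun p _ => ?_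
  · have key : ∀ x, 1 ≤ (c.invEmbedding x).val ↔ blk c x ≠ x := by
      intro x; have := blk_add c x; rw [Ne, Fin.ext_iff]; lia
    ext p; simp only [mem_filter, key]
  · rw [map_f, map_div₀, rename_wheelPoint, rename_wheelPoint]

/-- The cyclic permutation of each block of a composition. -/
def cyc : Perm (Fin k) :=
  (c.blocksFinEquiv.symm.trans (Equiv.sigmaCongrRight fun s => finRotate (c.blocksFun s))).trans
    c.blocksFinEquiv

lemma cyc_apply (j : Fin k) :
    cyc c j = c.embedding (c.index j) (finRotate _ (c.invEmbedding j)) := rfl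

lemma isCyc_cyc : IsCyc (blk c) (cyc c) := by
  refine fun j => ⟨by rw [cyc_apply, blk_embedding]; rfl, ?_⟩; rw [cyc_apply, c.coe_embedding]
  have hj := blk_add c j; have hb : (blk c j).val = c.sizeUpTo (c.index j) := head_val c _
  obtain ⟨m, hm⟩ : ∃ m, c.blocksFun (c.index j) = m + 1 :=
    ⟨_, (Nat.sub_add_cancel (c.one_le_blocksFun _)).symm⟩
  have hv := (c.invEmbedding j).2
  by_cases hlast : (c.invEmbedding j).val + 1 < c.blocksFun (c.index j)
  · left
    have : (finRotate _ (c.invEmbedding j)).val = (c.invEmbedding j).val + 1 := by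
      generalize c.invEmbedding j = e at *
      generalize c.blocksFun (c.index j) = N at *
      subst hm; rw [coe_finRotate_of_ne_last]; intro h; rw [h, Fin.val_last] at hlast; lia
    rw [this]; lia
  · right
    have h0 : (finRotate _ (c.invEmbedding j)).val = 0 := by
      generalize c.invEmbedding j = e at *
      generalize c.blocksFun (c.index j) = N at *
      subst hm; have : e = Fin.last m := Fin.ext (by rw [Fin.val_last]; lia)
      rw [this, finRotate_last]; rfl
    refine ⟨Fin.ext ?_, fun j' hj' h => ?_⟩
    · rw [c.coe_embedding, h0, hb, add_zero]
    · have hi : c.index j' = c.index j := head_injective c h; have h1 := c.lt_sizeUpTo_index_succ j'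
      have h2 := c.sizeUpTo_succ' (c.index j); grind

lemma map_wheelPerm : (wheelPerm n c).map (renameVars (headEmb c)) = Pm (RatFun k) (cyc c) := by
  ext I J; rw [Matrix.map_apply, wheelPerm, Pm]
  have : (∀ j, I (c.embedding (c.index j) (finRotate _ (c.invEmbedding j))) = J j) ↔
      J = I ∘ cyc c := by
    rw [funext_iff]; exact forall_congr' fun j => eq_comm
  grind

theorem poles_split : ∃ ε : K, ε ≠ 0 ∧ poles k n =
    (∏ p : Fin k × Fin k with p.1.val + 1 = p.2.val ∧ c.index p.1 = c.index p.2,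
      (z p.1 * cOn k (qbar n ^ 2) - z p.2)) *
    (cOn k ε * ∏ p : Fin k × Fin k with
      p.1 ≠ p.2 ∧ ¬ (p.2.val + 1 = p.1.val ∧ blk c p.1 = blk c p.2),
      (z p.1 - z p.2 * cOn k (qbar n ^ 2))) := by
  set S := Finset.univ.filter fun p : Fin k × Fin k =>
    p.1.val + 1 = p.2.val ∧ c.index p.1 = c.index p.2
  refine ⟨(-1) ^ S.card, pow_ne_zero _ (by norm_num), ?_⟩
  rw [poles, ← Finset.prod_filter_mul_prod_filter_not _
    (fun p : Fin k × Fin k => p.2.val + 1 = p.1.val ∧ blk c p.1 = blk c p.2),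
    Finset.filter_filter, Finset.filter_filter, ← mul_assoc]
  congr 1
  have e1 : ∏ p : Fin k × Fin k with p.1 ≠ p.2 ∧ p.2.val + 1 = p.1.val ∧ blk c p.1 = blk c p.2,
      (z p.1 - z p.2 * cOn k (qbar n ^ 2)) =
      ∏ p ∈ S, (-1 : RatFun k) * (z p.1 * cOn k (qbar n ^ 2) - z p.2) := by
    refine Finset.prod_nbij' Prod.swap Prod.swap ?_ ?_ (fun _ _ => rfl) (fun _ _ => rfl) ?_
    · intro p hp; simp only [Finset.mem_filter, Finset.mem_univ, true_and, S] at hp ⊢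
      exact ⟨hp.2.1, (head_injective c hp.2.2).symm⟩
    · intro p hp; simp only [Finset.mem_filter, Finset.mem_univ, true_and, S] at hp ⊢
      refine ⟨?_, hp.1, congrArg (head c) hp.2.symm⟩; grind
    grind
  have e2 : cOn k ((-1) ^ S.card) = (-1) ^ S.card := by simp
  rw [e1, Finset.prod_mul_distrib, Finset.prod_const, e2, mul_comm]

lemma exists_wheel (hX : X ∈ shuffleSpace n k) {b : Fin k → Fin k}
    (hb : IsBlk b) : ∃ (γ : Perm (Fin k)) (Y : Tensor n k) (κ : K), IsCyc b γ ∧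
      (∀ x, b x ≠ x → TrivOn x Y) ∧
      (∀ I J, HasValueAt (fun j => z (b j)) (Y I J) (Y I J)) ∧ κ ≠ 0 ∧
      MVal (pt n b) (poles k n • X) ((cst κ * scl b (pt n b) * den n b (pt n b)) •
          (lft b (pt n b) * Y * rgt b (pt n b) * Pm (RatFun k) γ)) := by
  obtain ⟨c, rfl⟩ := exists_composition hb; obtain ⟨Y, hY⟩ := hX.2 c
  obtain ⟨ε, hε, hp⟩ := poles_split c
  have hqq : (q⁻¹ - q : K) ≠ 0 := by exact fun h => q_sub_inv_ne_zero (by linear_combination -h)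
  refine ⟨cyc c, onStrands (head c) (Y.map (renameVars (headEmb c))),
    (q⁻¹ - q) ^ (k - c.length) * ε, isCyc_cyc c, fun x hx => ?_,
    fun I J => ?_, mul_ne_zero (pow_ne_zero _ hqq) hε, fun I J => ?_⟩
  · refine TrivOn.onStrands _ _ ?_; rintro ⟨s, rfl⟩; exact hx (blk_head c s)
  · rw [onStrands]; split_ifs
    · refine HasValueAt.rename (headEmb c) ?_
      have e : (fun j => z (blk c j)) ∘ headEmb c = fun s => renameVars (headEmb c) (z s) :=
        funext fun s => by rw [renameVars_z]; exact congrArg z (blk_head c s)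
      rw [e]; exact (hasVal_z (Y (I ∘ head c) (J ∘ head c))).map (renameVars (headEmb c))
    · exact HasValueAt.zero _
  · have h1 := (hY I J).map (renameVars (headEmb c))
    have e1 : (fun j => renameVars (headEmb c) (wheelPoint n c j)) = pt n (blk c) :=
      funext fun j => rename_wheelPoint c j
    rw [e1] at h1
    have h2 : HasValueAt (pt n (blk c)) (cst ε * ∏ p : Fin k × Fin k with
        p.1 ≠ p.2 ∧ ¬ (p.2.val + 1 = p.1.val ∧ blk c p.1 = blk c p.2),
        (z p.1 - z p.2 * cst (qbar n ^ 2)))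
        (cst ε * den n (blk c) (pt n (blk c))) :=
      (HasValueAt.const ε).mul (HasValueAt.prod _ fun p _ =>
        (HasValueAt.z _).sub ((HasValueAt.z _).mul (HasValueAt.const _)))
    have h3 := h1.mul h2; rw [mul_assoc, ← hp, mul_comm] at h3
    have e2 : renameVars (headEmb c) (wheelRHS c Y I J) * (cst ε * den n (blk c) (pt n (blk c))) =
        ((cst ((q⁻¹ - q) ^ (k - c.length) * ε) *
          scl (blk c) (pt n (blk c)) * den n (blk c) (pt n (blk c))) •
          (lft (blk c) (pt n (blk c)) * onStrands (head c) (Y.map (renameVars (headEmb c))) *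
            rgt (blk c) (pt n (blk c)) * Pm (RatFun k) (cyc c)) : Tensor n k) I J := by
      rw [← map_wheelLeft, ← map_wheelRight, ← map_wheelPerm, ← map_onStrands, ← map_mul_matrix,
        ← map_mul_matrix, ← map_mul_matrix, wheelRHS, Matrix.smul_apply, Matrix.smul_apply,
        Matrix.map_apply, smul_eq_mul, smul_eq_mul, map_mul, map_mul, map_wheelScalar,
        AlgHom.commutes, map_mul (cst)]
      ring
    rwa [e2] at h3

end Bridge

/-! ### Genericity -/

lemma qbarRoot_ne_zero : qbarRoot ≠ 0 := by
  have h := (IsFractionRing.injective (MvPolynomial (Fin 2) ℚ) K).ne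
    (MvPolynomial.X_ne_zero (1 : Fin 2))
  simpa [qbarRoot] using h

lemma qbar_ne_zero (n : ℕ) : qbar n ≠ 0 := pow_ne_zero _ qbarRoot_ne_zero

lemma q_qbarRoot_inj {a b c d : ℕ} (h : q ^ a * qbarRoot ^ b = q ^ c * qbarRoot ^ d) :
    a = c ∧ b = d := by
  have h1 : (MvPolynomial.X 0 ^ a * MvPolynomial.X 1 ^ b : MvPolynomial (Fin 2) ℚ) =
      MvPolynomial.X 0 ^ c * MvPolynomial.X 1 ^ d := by
    apply IsFractionRing.injective (MvPolynomial (Fin 2) ℚ) K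
    rwa [map_mul, map_mul, map_pow, map_pow, map_pow, map_pow]
  have e : ∀ a b : ℕ, (MvPolynomial.X 0 ^ a * MvPolynomial.X 1 ^ b : MvPolynomial (Fin 2) ℚ) =
      MvPolynomial.monomial (Finsupp.single 0 a + Finsupp.single 1 b) 1 := by
    intro a b
    rw [MvPolynomial.X_pow_eq_monomial, MvPolynomial.X_pow_eq_monomial, MvPolynomial.monomial_mul,
      one_mul]
  rw [e, e] at h1; have h2 := (MvPolynomial.monomial_left_injective one_ne_zero) h1
  exact ⟨by simpa using DFunLike.congr_fun h2 0, by simpa using DFunLike.congr_fun h2 1⟩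

lemma q_qbar_inj (hn : 2 ≤ n) {a b c d : ℕ}
    (h : q ^ a * qbar n ^ b = q ^ c * qbar n ^ d) : a = c ∧ b = d := by
  rw [qbar, ← pow_mul, ← pow_mul] at h; obtain ⟨h1, h2⟩ := q_qbarRoot_inj h
  exact ⟨h1, Nat.eq_of_mul_eq_mul_left (by lia) h2⟩

section Generic

lemma nondeg_div {x y : L} (hx : x ≠ 0) (hy : y ≠ 0)
    (h1 : x ≠ y) (h2 : x * cIn L (q ^ 2) ≠ y) (h3 : x ≠ y * cIn L (q ^ 2)) :
    Nondeg (x / y) := by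
  have hq : cIn L q ≠ 0 := algebraMap_q_ne_zero
  refine ⟨div_ne_zero hx hy, fun h => h1 ((div_eq_one_iff_eq hy).1 h), fun h => h2 ?_,
    fun h => h3 ?_⟩
  · field_simp at h; exact h
  · rw [map_pow, map_inv₀] at h; rw [map_pow]; field_simp at h; exact h

lemma z_mul_ne (hij : i ≠ j) {c c' : K} (hc : c ≠ 0) : z i * cst c ≠ z j * cst c' := by
  refine fun h => hyper_form_ne_zero hij (c' / c) ?_; have := ofK_ne_zero (L := RatFun k) hc
  rw [map_div₀, sub_eq_zero]; field_simp
  linear_combination h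

lemma z_div_nondeg (hij : i ≠ j) {c c' : K} (hc : c ≠ 0) (hc' : c' ≠ 0) :
    Nondeg (z i * cst c / (z j * cst c')) := by
  have hq := pow_ne_zero 2 q_ne_zero
  refine nondeg_div (mul_ne_zero (z_ne_zero i) (ofK_ne_zero hc))
    (mul_ne_zero (z_ne_zero j) (ofK_ne_zero hc')) (z_mul_ne hij hc) ?_ ?_
  · rw [mul_assoc, ← map_mul]; exact z_mul_ne hij (mul_ne_zero hc hq)
  · rw [mul_assoc, ← map_mul]; exact z_mul_ne hij hc

lemma qbar_pow_ne_zero (n m : ℕ) : qbar n ^ m ≠ 0 := pow_ne_zero _ (qbar_ne_zero n)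

theorem z_qbar_div_nondeg (hn : 2 ≤ n) (i : Fin k) {c : K} (hc : c ≠ 0) {m m' : ℕ} (h : m ≠ m') :
    Nondeg (z i * cOn k c * cOn k (qbar n ^ m) /
      (z i * cOn k c * cOn k (qbar n ^ m'))) := by
  have hz := mul_ne_zero (z_ne_zero i) (ofK_ne_zero (L := RatFun k) hc)
  have hqb := fun m => ofK_ne_zero (L := RatFun k) (qbar_pow_ne_zero n m)
  have hinj := (cOn k).injective
  refine nondeg_div (mul_ne_zero hz (hqb m)) (mul_ne_zero hz (hqb m')) ?_ ?_ ?_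
  · intro e; have e1 := hinj (mul_left_cancel₀ hz e)
    have := (q_qbar_inj hn (a := 0) (c := 0) (by simpa using e1)).2; exact h this
  · intro e; rw [mul_assoc, ← map_mul] at e; have e1 := hinj (mul_left_cancel₀ hz e)
    have := (q_qbar_inj hn (a := 2) (c := 0) (by rw [mul_comm, e1, pow_zero, one_mul])).1; lia
  · intro e; rw [mul_assoc _ _ (cOn k (q ^ 2)), ← map_mul] at e
    have e1 := hinj (mul_left_cancel₀ hz e)
    have := (q_qbar_inj hn (a := 0) (b := m) (c := 2) (d := m') (by grind)).1; lia

lemma pt_ne_zero (b : Fin k → Fin k) (j : Fin k) : pt n b j ≠ 0 :=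
  mul_ne_zero (z_ne_zero _) (ofK_ne_zero (qbar_pow_ne_zero n _))

lemma pt_div_nondeg (hn : 2 ≤ n) {b : Fin k → Fin k} (hb : IsBlk b) (hij : i ≠ j) :
    Nondeg (pt n b i / pt n b j) := by
  by_cases h : b i = b j
  · have h1 := hb.le i; have h2 := hb.le j
    have hne : 2 * (i.val - (b i).val) ≠ 2 * (j.val - (b j).val) := by grind
    have := z_qbar_div_nondeg hn (b i) (one_ne_zero) hne; rw [map_one, mul_one] at this; rw [pt, pt]
    rwa [← h] at this ⊢
  · exact z_div_nondeg h (qbar_pow_ne_zero n _) (qbar_pow_ne_zero n _)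

lemma Nondeg.ne {x y : L} (hy : y ≠ 0)
    (h : Nondeg (x / y)) : x ≠ y := fun e => h.2.1 (by rw [e, div_self hy])

lemma Nondeg.regInv_top {L ι : Type*} [Field L] [Algebra K L] [Fintype ι] [DecidableEq ι]
    {x : L} (h : Nondeg x) {a b : ι} (hab : a ≠ b) : RegInv ⊤ (Rm a b x : Op ι n L) := by
  refine regInv_rm hab trivial trivial h.1 h.2.1 trivial ⟨_, trivial, inv_mul_cancel₀ ?_⟩
  exact mul_ne_zero (sub_ne_zero.2 h.2.2.1.symm) (sub_ne_zero.2 h.2.2.2.symm)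

lemma Nondeg.f_ne_zero {x : L} (h : Nondeg x) : f x ≠ 0 :=
  div_ne_zero (mul_ne_zero (sub_ne_zero.2 h.2.2.1.symm) (sub_ne_zero.2 h.2.2.2.symm))
    (pow_ne_zero 2 (sub_ne_zero.2 h.2.1.symm))

lemma vR_pt_eq (b : Fin k → Fin k) (j : Fin k) :
    ∃ c : K, c ≠ 0 ∧ vR n b (pt n b) j = z (b j) * cst c := by
  rw [vR]; split_ifs
  · refine ⟨qbar n ^ (2 * (j.val - (b j).val)) * qbar n ^ (2 * blkLen b j),
      mul_ne_zero (qbar_pow_ne_zero n _) (qbar_pow_ne_zero n _), ?_⟩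
    rw [pt, map_mul, mul_assoc]
  · exact ⟨_, qbar_pow_ne_zero n _, rfl⟩

end Generic

/-! ### Splitting off a block -/

/-- The decomposition `b₀` has the same blocks as `b₁`, except that the block `[a, e)` and the
strands before it are split into single strands. -/
structure IsSplit {k : ℕ} (b₀ b₁ : Fin k → Fin k) (a : Fin k) (e : ℕ) : Prop where
  lt : a.val < e
  le : e ≤ k
  eq_before : ∀ j < a, b₁ j = j
  eq_block : ∀ j, a ≤ j → j.val < e → b₁ j = a
  ge_after : ∀ j, e ≤ j.val → e ≤ (b₁ j).val
  old : ∀ j, j.val < e → b₀ j = j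
  same : ∀ j, e ≤ j.val → b₀ j = b₁ j

section Split

variable {b₀ b₁ : Fin k → Fin k} {e : ℕ}

/-- The strands before `a`. -/
def before (a : Fin k) : List (Fin k) := (finRange k).filter (· < a)

/-- The strands of the block `[a, e)`, except for the first one. -/
def inner (a : Fin k) (e : ℕ) : List (Fin k) := (finRange k).filter fun x => a < x ∧ x.val < e

lemma mem_before {x : Fin k} : x ∈ before a ↔ x < a := by simp [before, List.mem_finRange]

lemma mem_inner {x : Fin k} : x ∈ inner a e ↔ a < x ∧ x.val < e := by
  simp [inner, List.mem_finRange]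

lemma before_sorted : (before a).Pairwise (· < ·) := finRange_sorted.filter _

lemma inner_sorted : (inner a e).Pairwise (· < ·) := finRange_sorted.filter _

lemma sorted_append {l l' : List (Fin k)} (h : l.Pairwise (· < ·)) (h' : l'.Pairwise (· < ·))
    (hl : ∀ x ∈ l, ∀ y ∈ l', x < y) : (l ++ l').Pairwise (· < ·) :=
  List.pairwise_append.2 ⟨h, h', hl⟩

namespace IsSplit

variable (h : IsSplit b₀ b₁ a e)

/-- The other strands of the later blocks. -/
def tx (b₁ : Fin k → Fin k) (e : ℕ) : List (Fin k) :=
  (finRange k).filter fun x => e ≤ x.val ∧ b₁ x ≠ x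

/-- The first strands of the later blocks. -/
def th (b₁ : Fin k → Fin k) (e : ℕ) : List (Fin k) :=
  (finRange k).filter fun x => e ≤ x.val ∧ b₁ x = x

lemma mem_tx {x : Fin k} : x ∈ tx b₁ e ↔ e ≤ x.val ∧ b₁ x ≠ x := by simp [tx, List.mem_finRange]

lemma mem_th {x : Fin k} : x ∈ th b₁ e ↔ e ≤ x.val ∧ b₁ x = x := by simp [th, List.mem_finRange]

lemma tx_sorted : (tx b₁ e).Pairwise (· < ·) := finRange_sorted.filter _

lemma th_sorted : (th b₁ e).Pairwise (· < ·) := finRange_sorted.filter _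

include h

lemma heads_new : heads b₁ = (before a ++ [a]) ++ th b₁ e := by
  have hlt := h.lt
  refine eq_of_sorted (heads_sorted _) (sorted_append (sorted_append before_sorted
    (List.pairwise_singleton _ _) ?_) th_sorted ?_) ?_
  · simp only [mem_before, List.mem_singleton]; rintro x hx y rfl; exact hx
  · simp only [List.mem_append, mem_before, List.mem_singleton, mem_th, lt_def]
    rintro x (hx | rfl) y hy <;> lia
  · intro x; simp only [mem_heads, List.mem_append, mem_before, List.mem_singleton, mem_th]
    rcases lt_trichotomy x a with hx | hx | hx
    · simp [h.eq_before x hx, hx]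
    · subst hx; simp [h.eq_block x le_rfl hlt]
    · by_cases hxe : x.val < e
      · rw [h.eq_block x hx.le hxe]; simp [hx.ne, hx.ne', hx.not_gt, hxe]
      · simp [not_lt.1 hxe, hx.ne', hx.not_gt]

lemma nonheads_new : nonheads b₁ = inner a e ++ tx b₁ e := by
  have hlt := h.lt
  refine eq_of_sorted (nonheads_sorted _) (sorted_append inner_sorted tx_sorted ?_) ?_
  · simp only [mem_inner, mem_tx, lt_def]; rintro x hx y hy; lia
  · intro x; simp only [mem_nonheads, List.mem_append, mem_inner, mem_tx]
    rcases lt_trichotomy x a with hx | hx | hx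
    · rw [h.eq_before x hx]; simp [hx.not_gt]
    · subst hx; simp [h.eq_block x le_rfl hlt]
    · by_cases hxe : x.val < e
      · rw [h.eq_block x hx.le hxe]; simp [hx.ne, hx, hxe]
      · simp [not_lt.1 hxe, hxe]

lemma heads_old : heads b₀ = ((before a ++ [a]) ++ inner a e) ++ th b₁ e := by
  have hlt := h.lt
  refine eq_of_sorted (heads_sorted _) (sorted_append (sorted_append (sorted_append before_sorted
    (List.pairwise_singleton _ _) ?_) inner_sorted ?_) th_sorted ?_) ?_
  · simp only [mem_before, List.mem_singleton]; rintro x hx y rfl; exact hx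
  · simp only [List.mem_append, mem_before, List.mem_singleton, mem_inner, lt_def]
    rintro x (hx | rfl) y hy <;> lia
  · simp only [List.mem_append, mem_before, List.mem_singleton, mem_inner, mem_th, lt_def]
    rintro x ((hx | rfl) | hx) y hy <;> lia
  · intro x
    simp only [mem_heads, List.mem_append, mem_before, List.mem_singleton, mem_inner, mem_th]
    by_cases hxe : x.val < e
    · rw [h.old x hxe]; grind
    · have h1 : ¬ x < a := by rw [lt_def]; lia
      have h2 : x ≠ a := by rintro rfl; lia
      rw [h.same x (not_lt.1 hxe)]; simp [hxe, h1, h2, not_lt.1 hxe]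

lemma nonheads_old : nonheads b₀ = tx b₁ e := by
  refine eq_of_sorted (nonheads_sorted _) tx_sorted fun x => ?_; rw [mem_nonheads, mem_tx]
  by_cases hxe : x.val < e
  · simp [h.old x hxe, hxe]
  · rw [h.same x (not_lt.1 hxe)]; simp [not_lt.1 hxe]

lemma filter_all {l : List (Fin k)} {p : Fin k → Prop} [DecidablePred p]
    (hp : ∀ x ∈ l, p x) : l.filter p = l :=
  List.filter_eq_self.2 fun x hx => by simpa using hp x hx

lemma filter_none {l : List (Fin k)} {p : Fin k → Prop} [DecidablePred p]
    (hp : ∀ x ∈ l, ¬ p x) : l.filter p = [] :=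
  List.filter_eq_nil_iff.2 fun x hx => by simpa using hp x hx

lemma lft_new (v : Fin k → RatFun k) : (lft b₁ v : Tensor n k) =
    ((th b₁ e).reverse.map fun h => train (Rv n v) ((tx b₁ e).filter (h < ·)) h).prod *
    ((before a ++ [a]).reverse.map fun i =>
      train (Rv n v) (inner a e) i * train (Rv n v) (tx b₁ e) i).prod := by
  have hlt := h.lt
  rw [lft, h.heads_new, h.nonheads_new, List.reverse_append, List.map_append, List.prod_append]
  congr 2
  · refine map_congr_left fun x hx => ?_; rw [List.mem_reverse, mem_th] at hx
    rw [List.filter_append, h.filter_none, List.nil_append]; simp only [mem_inner, lt_def]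
    intro y hy; lia
  · refine map_congr_left fun x hx => ?_
    simp only [List.mem_reverse, List.mem_append, mem_before, List.mem_singleton] at hx
    rw [h.filter_all, train_append]; simp only [List.mem_append, mem_inner, mem_tx, lt_def] at hx ⊢
    grind

lemma lft_old (v : Fin k → RatFun k) : (lft b₀ v : Tensor n k) =
    ((th b₁ e).reverse.map fun h => train (Rv n v) ((tx b₁ e).filter (h < ·)) h).prod *
    (((inner a e).reverse.map (train (Rv n v) (tx b₁ e))).prod *
    ((before a ++ [a]).reverse.map (train (Rv n v) (tx b₁ e))).prod) := by
  have hlt := h.lt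
  rw [lft, h.heads_old, h.nonheads_old, List.reverse_append, List.map_append, List.prod_append]
  congr 1; rw [List.reverse_append, List.map_append, List.prod_append]; congr 2
  · refine map_congr_left fun x hx => ?_; rw [List.mem_reverse, mem_inner] at hx; rw [h.filter_all]
    simp only [mem_tx, lt_def]; intro y hy; lia
  · refine map_congr_left fun x hx => ?_
    simp only [List.mem_reverse, List.mem_append, mem_before, List.mem_singleton] at hx
    rw [h.filter_all]; simp only [mem_tx, lt_def] at hx ⊢; grind

lemma rgt_new (v : Fin k → RatFun k) : (rgt b₁ v : Tensor n k) =
    ((before a).map fun i => trainR n (vR n b₁ v) (tx b₁ e) i *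
      trainR n (vR n b₁ v) (inner a e) i).prod * trainR n (vR n b₁ v) (tx b₁ e) a *
    ((th b₁ e).map fun h => trainR n (vR n b₁ v) ((tx b₁ e).filter (h < b₁ ·)) h).prod := by
  have hlt := h.lt
  rw [rgt, h.heads_new, h.nonheads_new, List.map_append, List.prod_append, List.map_append,
    List.prod_append, List.map_singleton, List.prod_singleton]
  congr 2
  · congr 1; refine map_congr_left fun x hx => ?_; rw [mem_before] at hx
    rw [h.filter_all, trainR_append]; simp only [List.mem_append, mem_inner, mem_tx]
    rintro y (hy | hy)
    · rw [h.eq_block y hy.1.le hy.2]; exact hx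
    · have := h.ge_after y hy.1; rw [lt_def] at *; lia
  · rw [List.filter_append, h.filter_none, List.nil_append, h.filter_all]
    · simp only [mem_tx]; intro y hy; have := h.ge_after y hy.1; rw [lt_def]; lia
    · simp only [mem_inner]; intro y hy; rw [h.eq_block y hy.1.le hy.2]; exact lt_irrefl _
  · refine map_congr_left fun x hx => ?_; rw [mem_th] at hx
    rw [List.filter_append, h.filter_none, List.nil_append]; simp only [mem_inner]; intro y hy
    rw [h.eq_block y hy.1.le hy.2, lt_def]; lia

lemma rgt_old (v : Fin k → RatFun k) : (rgt b₀ v : Tensor n k) =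
    ((before a).map (trainR n (vR n b₀ v) (tx b₁ e))).prod *
    ((a :: inner a e).map (trainR n (vR n b₀ v) (tx b₁ e))).prod *
    ((th b₁ e).map fun h => trainR n (vR n b₀ v) ((tx b₁ e).filter (h < b₁ ·)) h).prod := by
  have hlt := h.lt
  have key : ∀ y ∈ tx b₁ e, e ≤ (b₀ y).val := by
    intro y hy; rw [mem_tx] at hy; rw [h.same y hy.1]; exact h.ge_after y hy.1
  rw [rgt, h.heads_old, h.nonheads_old, List.append_assoc (before a), List.singleton_append,
    List.map_append, List.prod_append, List.map_append, List.prod_append]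
  congr 2
  · congr 1; refine map_congr_left fun x hx => ?_; rw [mem_before] at hx; rw [h.filter_all]; grind
  · congr 1; refine map_congr_left fun x hx => ?_; rw [List.mem_cons, mem_inner] at hx
    rw [h.filter_all]; grind
  · refine map_congr_left fun x hx => ?_; congr 1; refine List.filter_congr fun y hy => ?_
    rw [mem_tx] at hy; rw [h.same y hy.1]

end IsSplit

end Split

section TrainLemmas

variable {ι : Type*} [Fintype ι] [DecidableEq ι] {n : ℕ} {L : Type*} [Field L] [Algebra K L]

lemma trainR_congr {u u' : ι → L} {xs : List ι} {j : ι} (hj : u j = u' j)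
    (h : ∀ x ∈ xs, u x = u' x) : trainR n u xs j = trainR n u' xs j := by
  rw [trainR, trainR]; congr 1; simp_all

lemma Pm_mul_prod {κ : Type*} (σ : Perm ι) (l : List κ) {F G : κ → Op ι n L}
    (h : ∀ x ∈ l, Pm L σ * F x = G x * Pm L σ) :
    Pm L σ * (l.map F).prod = (l.map G).prod * Pm L σ := by
  induction l with
  | nil => simp
  | cons x l ih =>
    rw [List.map_cons, List.map_cons, List.prod_cons, List.prod_cons, ← mul_assoc,
      h x (by simp), mul_assoc, ih fun y hy => h y (by simp [hy]), mul_assoc]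

lemma Pm_mul_trainR (σ : Perm ι) {u u' : ι → L} {xs : List ι} {j : ι}
    (hj : u' (σ j) = u j) (h : ∀ x ∈ xs, x ≠ j ∧ σ x = x ∧ u' x = u x) :
    Pm L σ * trainR n u xs j = trainR n u' xs (σ j) * Pm L σ := by
  rw [trainR, trainR]; refine Pm_mul_prod σ _ fun x hx => ?_
  obtain ⟨h1, h2, h3⟩ := h x (by simpa using hx); rw [Pm_mul_Rm σ h1, h2, hj, h3]

lemma train_mul_trainR {v : ι → L} (hv : ∀ i, v i ≠ 0) {j : ι} :
    ∀ xs : List ι, (∀ x ∈ xs, x ≠ j ∧ v j ≠ v x) →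
    train (Rv n v) xs j * trainR n v xs j = (xs.map fun x => f (v j / v x)).prod • (1 : Op ι n L)
  | [], _ => by simp [train, trainR]
  | x :: xs, h => by
    obtain ⟨h1, h2⟩ := h x (by simp)
    have ih := train_mul_trainR hv xs fun y hy => h y (by simp [hy])
    have hu := Rm_unitarity (n := n) h1.symm (div_ne_zero (hv j) (hv x))
      (fun h => h2 ((div_eq_one_iff_eq (hv x)).1 h))
    rw [inv_div] at hu
    rw [train_cons, trainR_cons, mul_assoc, ← mul_assoc (train _ _ _), ih, smul_mul_assoc, one_mul,
      mul_smul_comm, Rv, hu, smul_smul, List.map_cons, List.prod_cons, mul_comm]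

lemma trains_mul_trainRs {v : ι → L} (hv : ∀ i, v i ≠ 0) (xs : List ι) :
    ∀ es : List ι, (∀ e ∈ es, ∀ x ∈ xs, x ≠ e ∧ v e ≠ v x) →
    (es.reverse.map (train (Rv n v) xs)).prod * (es.map (trainR n v xs)).prod =
      (es.map fun e => (xs.map fun x => f (v e / v x)).prod).prod • (1 : Op ι n L)
  | [], _ => by simp
  | e :: es, h => by
    have ih := trains_mul_trainRs hv xs es fun y hy => h y (by simp [hy])
    have h1 := train_mul_trainR (n := n) hv xs (h e (by simp))
    rw [List.reverse_cons, List.map_append, List.prod_append, List.map_singleton,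
      List.prod_singleton, List.map_cons, List.prod_cons, mul_assoc, ← mul_assoc (train _ _ _), h1,
      smul_mul_assoc, one_mul, mul_smul_comm, ih, smul_smul, List.map_cons, List.prod_cons]

lemma unop_list_prod {κ M : Type*} [Monoid M] (l : List κ) (F : κ → Mᵐᵒᵖ) :
    ((l.reverse.map F).prod).unop = (l.map fun x => (F x).unop).prod := by
  induction l with
  | nil => rfl
  | cons x l ih =>
    rw [List.reverse_cons, List.map_append, List.prod_append, MulOpposite.unop_mul, ih,
      List.map_singleton, List.prod_singleton, List.map_cons, List.prod_cons]

lemma unop_train (u : ι → L) (xs : List ι) (i : ι) :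
    (train (RvOp n u) xs i).unop = trainR n u xs i := by
  rw [← op_trainR, MulOpposite.unop_op]

lemma trainRs_interchange {u : ι → L} (hu : ∀ i, u i ≠ 0) {xs es fs : List ι} (hxs : xs.Nodup)
    (hes : es.Nodup) (hfs : fs.Nodup) (hex : ∀ e ∈ es, ∀ x ∈ xs, x ≠ e ∧ u e ≠ u x)
    (hf : ∀ i ∈ fs, (∀ x ∈ xs, x ≠ i ∧ u i ≠ u x) ∧ ∀ e ∈ es, e ≠ i ∧ u i ≠ u e) :
    (fs.map (trainR n u es)).prod * ((fs.map (trainR n u xs)).prod *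
      (es.map (trainR n u xs)).prod) =
    (es.map (trainR n u xs)).prod * (fs.map fun i => trainR n u xs i * trainR n u es i).prod := by
  have h := trains_interchange (isYB_RvOp (n := n) u hu) hxs hes hex fs.reverse
    (List.nodup_reverse.2 hfs) (fun i hi => hf i (List.mem_reverse.1 hi))
  have h' := congrArg MulOpposite.unop h
  simp only [MulOpposite.unop_mul, unop_list_prod, unop_train] at h'; exact h'

lemma commute_train_of_trivOn {v : ι → L} {M : Op ι n L} {xs : List ι} {j : ι} (hj : TrivOn j M)
    (h : ∀ x ∈ xs, x ≠ j ∧ TrivOn x M) : Commute M (train (Rv n v) xs j) :=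
  commute_train fun x hx => hj.commute_Rm (h x hx).1.symm (h x hx).2 _

end TrainLemmas

namespace IsSplit

variable {b₀ b₁ : Fin k → Fin k} {e : ℕ} (h : IsSplit b₀ b₁ a e)

include h

lemma isBlk_old (hb : IsBlk b₁) : IsBlk b₀ where
  le j := by
    by_cases hj : j.val < e
    · rw [h.old j hj]
    · rw [h.same j (not_lt.1 hj)]; exact hb.le j
  mono i j hij := by
    by_cases hj : j.val < e
    · rw [h.old j hj, h.old i (lt_of_le_of_lt hij hj)]; exact hij
    · by_cases hi : i.val < e
      · rw [h.old i hi, h.same j (not_lt.1 hj), le_def]; have := h.ge_after j (not_lt.1 hj); lia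
      · rw [h.same i (not_lt.1 hi), h.same j (not_lt.1 hj)]; exact hb.mono hij
  idem j := by
    by_cases hj : j.val < e
    · rw [h.old j hj, h.old j hj]
    · rw [h.same j (not_lt.1 hj), h.same _ (h.ge_after j (not_lt.1 hj)), hb.idem]

lemma blkLen_before (hi : i < a) : blkLen b₁ i = blkLen b₀ i := by
  rw [blkLen, blkLen]; congr 1; refine Finset.filter_congr fun j _ => ?_; have hlt := h.lt
  by_cases hje : j.val < e
  · rw [h.old j hje]; rcases lt_or_ge j a with hj | hj
    · rw [h.eq_before j hj]
    · rw [h.eq_block j hj hje]; exact iff_of_false hi.ne' (hi.trans_le hj).ne'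
  · rw [h.same j (not_lt.1 hje)]

lemma blkLen_after (hi : e ≤ i.val) : blkLen b₁ i = blkLen b₀ i := by
  rw [blkLen, blkLen]; congr 1; refine Finset.filter_congr fun j _ => ?_; have hlt := h.lt
  by_cases hje : j.val < e
  · rw [h.old j hje]; rcases lt_or_ge j a with hj | hj
    · rw [h.eq_before j hj]
    · rw [h.eq_block j hj hje]; grind
  · rw [h.same j (not_lt.1 hje)]

lemma blkLen_old (hi : i.val < e) : blkLen b₀ i = 1 := by
  rw [blkLen, Finset.card_eq_one]
  refine ⟨i, Finset.eq_singleton_iff_unique_mem.2 ⟨by simp [h.old i hi], fun j hj => ?_⟩⟩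
  rw [mem_filter] at hj
  by_cases hje : j.val < e
  · rw [← hj.2, h.old j hje]
  · have := h.ge_after j (not_lt.1 hje); rw [← h.same j (not_lt.1 hje), hj.2] at this; lia

lemma blkLen_block : blkLen b₁ a = e - a.val := by
  rw [blkLen, ← Nat.card_Ico, ← Finset.card_map Fin.valEmbedding]; congr 1; have hlt := h.lt
  have hle := h.le; ext m
  simp only [Finset.mem_map, mem_filter_univ, Fin.valEmbedding_apply, mem_Ico]; constructor
  · rintro ⟨j, hj, rfl⟩; rcases lt_or_ge j a with hja | hja
    · rw [h.eq_before j hja] at hj; exact absurd hj hja.ne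
    · refine ⟨hja, ?_⟩; by_contra hje; have := h.ge_after j (not_lt.1 hje); rw [hj] at this; lia
  · rintro ⟨h1, h2⟩; exact ⟨⟨m, by lia⟩, h.eq_block _ h1 h2, rfl⟩

lemma vR_nonhead {v : Fin k → RatFun k} {x : Fin k} (hx : x ∈ inner a e ∨ x ∈ tx b₁ e) :
    vR n b₁ v x = v x := by
  rw [vR, if_neg]; rcases hx with hx | hx
  · rw [mem_inner] at hx; rw [h.eq_block x hx.1.le hx.2]; exact hx.1.ne
  · exact (mem_tx.1 hx).2

lemma vR_old_tx {v : Fin k → RatFun k} {x : Fin k} (hx : x ∈ tx b₁ e) : vR n b₀ v x = v x := by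
  rw [mem_tx] at hx; rw [vR, if_neg]; rw [h.same x hx.1]; exact hx.2

lemma vR_before {v : Fin k → RatFun k} {x : Fin k} (hx : x < a) : vR n b₁ v x = vR n b₀ v x := by
  have hlt := h.lt
  rw [vR, vR, if_pos (h.eq_before x hx), if_pos (h.old x (by rw [lt_def] at hx; lia)),
    h.blkLen_before hx]

lemma vR_th {v : Fin k → RatFun k} {x : Fin k} (hx : x ∈ th b₁ e) : vR n b₁ v x = vR n b₀ v x := by
  rw [mem_th] at hx; rw [vR, vR, if_pos hx.2, h.same x hx.1, if_pos hx.2, h.blkLen_after hx.1]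

lemma vR_old_lt {v : Fin k → RatFun k} {x : Fin k} (hx : x.val < e) :
    vR n b₀ v x = v x * cst (qbar n ^ 2) := by
  rw [vR, if_pos (h.old x hx), h.blkLen_old hx, mul_one]

lemma cyc_old {γ : Perm (Fin k)} (hγ : IsCyc b₀ γ) (hj : j.val < e) : γ j = j := by
  obtain ⟨h1, h2⟩ := hγ j; rw [h.old j hj] at h1 h2; rcases h2 with h2 | h2
  · by_cases hj' : (γ j).val < e
    · rwa [h.old _ hj'] at h1
    · rw [h.same _ (not_lt.1 hj')] at h1; have := h.ge_after _ (not_lt.1 hj'); rw [h1] at this; lia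
  · exact h2.1

lemma cyc_same {γ₀ γ₁ : Perm (Fin k)} (h₀ : IsCyc b₀ γ₀) (h₁ : IsCyc b₁ γ₁)
    (hj : e ≤ j.val) : γ₀ j = γ₁ j := by
  obtain ⟨h1, h2⟩ := h₀ j; obtain ⟨h1', h2'⟩ := h₁ j
  have key : ∀ j' : Fin k, j'.val = j.val + 1 → b₀ j' = b₁ j' := fun j' hj' => h.same j' (by lia)
  rcases h2 with h2 | h2 <;> rcases h2' with h2' | h2'
  · exact Fin.ext (h2.trans h2'.symm)
  · exact absurd (by rw [← key _ h2, h1, h.same j hj]) (h2'.2 _ h2)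
  · exact absurd (by rw [key _ h2', h1', h.same j hj]) (h2.2 _ h2')
  · rw [h2.1, h2'.1, h.same j hj]

variable {γ₀ γ₁ : Perm (Fin k)} (h₀ : IsCyc b₀ γ₀) (h₁ : IsCyc b₁ γ₁)

include h₀ h₁

lemma cycq_ge {x : Fin k} (hx : e ≤ x.val) : (γ₁ * γ₀⁻¹) x = x := by
  rw [Perm.mul_apply]
  have : e ≤ (γ₀⁻¹ x).val := by
    by_contra hlt; rw [not_le] at hlt; have h1 := h.cyc_old h₀ hlt
    rw [show γ₀ (γ₀⁻¹ x) = x from γ₀.apply_symm_apply x] at h1; rw [← h1] at hlt; lia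
  rw [← h.cyc_same h₀ h₁ this, show γ₀ (γ₀⁻¹ x) = x from γ₀.apply_symm_apply x]

lemma cycq_lt {x : Fin k} (hx : x.val < e) : (γ₁ * γ₀⁻¹) x = γ₁ x := by
  rw [Perm.mul_apply]; congr 1; rw [Perm.inv_eq_iff_eq]; exact (h.cyc_old h₀ hx).symm

lemma cycq_before {x : Fin k} (hx : x < a) : (γ₁ * γ₀⁻¹) x = x := by
  have hlt := h.lt; rw [h.cycq_lt h₀ h₁ (by rw [lt_def] at hx; lia)]; obtain ⟨h1, h2⟩ := h₁ x
  rw [h.eq_before x hx] at h1 h2; rcases h2 with h2 | h2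
  · rcases lt_or_ge (γ₁ x) a with h3 | h3
    · rwa [h.eq_before _ h3] at h1
    · by_cases h4 : (γ₁ x).val < e
      · rw [h.eq_block _ h3 h4] at h1; exact absurd h1 hx.ne'
      grind
  · exact h2.1

lemma cycq_inner {x : Fin k} (hx : a ≤ x) (hxe : x.val + 1 < e) :
    ((γ₁ * γ₀⁻¹) x).val = x.val + 1 := by
  have hle := h.le; rw [h.cycq_lt h₀ h₁ (by lia)]; obtain ⟨h1, h2⟩ := h₁ x; rcases h2 with h2 | h2
  · exact h2
  · refine absurd ?_ (h2.2 ⟨x.val + 1, by lia⟩ rfl)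
    rw [h.eq_block x hx (by lia), h.eq_block _ _ hxe]; grind

lemma cycq_last {x : Fin k} (hx : a ≤ x) (hxe : x.val + 1 = e) : (γ₁ * γ₀⁻¹) x = a := by
  rw [h.cycq_lt h₀ h₁ (by lia)]; obtain ⟨h1, h2⟩ := h₁ x; rw [h.eq_block x hx (by lia)] at h1 h2
  rcases h2 with h2 | h2
  · have := h.ge_after (γ₁ x) (by lia); rw [h1] at this; lia
  · exact h2.1

lemma map_cycq : (a :: inner a e).map (γ₁ * γ₀⁻¹) = inner a e ++ [a] := by
  have hlt := h.lt; have hle := h.le; set last : Fin k := ⟨e - 1, by lia⟩ with hlast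
  set l : List (Fin k) := (finRange k).filter fun x => a ≤ x ∧ x.val + 1 < e with hl
  have hmem : ∀ x, x ∈ l ↔ a ≤ x ∧ x.val + 1 < e := fun x => by simp [hl, List.mem_finRange]
  have h1 : a :: inner a e = l ++ [last] := by
    refine eq_of_sorted (List.pairwise_cons.2 ⟨?_, inner_sorted⟩) (sorted_append
      (finRange_sorted.filter _) (List.pairwise_singleton _ _) ?_) fun x => ?_
    · simp only [mem_inner]; exact fun x hx => hx.1
    · grind
    · grind [mem_inner]
  rw [h1, List.map_append, List.map_singleton, h.cycq_last h₀ h₁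
    (by rw [le_def, hlast]; simp only; lia) (by rw [hlast]; simp only; lia)]
  congr 1; refine eq_of_sorted ?_ inner_sorted fun x => ?_
  · rw [List.pairwise_map]; refine List.Pairwise.imp_of_mem ?_ (finRange_sorted.filter _)
    intro x y hx hy hxy; have hx' := (hmem x).1 hx; have hy' := (hmem y).1 hy; rw [lt_def] at *
    rw [h.cycq_inner h₀ h₁ hx'.1 hx'.2, h.cycq_inner h₀ h₁ hy'.1 hy'.2]; lia
  · rw [mem_inner, List.mem_map]; constructor
    · rintro ⟨y, hy, rfl⟩; rw [hmem, le_def] at hy; rw [lt_def, h.cycq_inner h₀ h₁ hy.1 hy.2]; lia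
    · rintro ⟨h2, h3⟩; have h4 : a ≤ (⟨x.val - 1, by lia⟩ : Fin k) := by grind
      have h5 : (⟨x.val - 1, by lia⟩ : Fin k).val + 1 < e := by grind
      refine ⟨⟨x.val - 1, by lia⟩, (hmem _).2 ⟨h4, h5⟩, Fin.ext ?_⟩; rw [h.cycq_inner h₀ h₁ h4 h5]
      simp only; lia

lemma vR_cycq (hj : a ≤ j) (hje : j.val < e) :
    vR n b₁ (pt n b₁) ((γ₁ * γ₀⁻¹) j) = vR n b₀ (pt n b₁) j := by
  have hlt := h.lt; rw [h.vR_old_lt hje, pt, h.eq_block j hj hje, mul_assoc, ← map_mul, ← pow_add]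
  by_cases hl : j.val + 1 < e
  · have h1 := h.cycq_inner h₀ h₁ hj hl
    have h2 : (γ₁ * γ₀⁻¹) j ∈ inner a e := by rw [mem_inner, lt_def, h1]; lia
    rw [h.vR_nonhead (Or.inl h2), pt]; rw [mem_inner] at h2; rw [h.eq_block _ h2.1.le h2.2, h1]
    congr 3; lia
  · have h3 : j.val + 1 = e := by lia
    rw [h.cycq_last h₀ h₁ hj h3, vR, if_pos (h.eq_block a le_rfl hlt), h.blkLen_block, pt,
      h.eq_block a le_rfl hlt, Nat.sub_self, mul_zero, pow_zero, map_one, mul_one]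
    congr 3; lia

lemma wheel_identity (hn : 2 ≤ n) (hb : IsBlk b₁) {Y : Tensor n k}
    (hY : ∀ x, b₁ x ≠ x → TrivOn x Y) :
    ((inner a e).map fun j => ((tx b₁ e).map fun x => f (pt n b₁ j / pt n b₁ x)).prod).prod •
      (lft b₁ (pt n b₁) * Y * rgt b₁ (pt n b₁) * Pm (RatFun k) γ₁) =
    lft b₀ (pt n b₁) *
      (((before a ++ [a]).reverse.map (train (Rv n (pt n b₁)) (inner a e))).prod * Y *
        ((before a).map (trainR n (vR n b₁ (pt n b₁)) (inner a e))).prod *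
        Pm (RatFun k) (γ₁ * γ₀⁻¹)) * rgt b₀ (pt n b₁) * Pm (RatFun k) γ₀ := by
  have hlt := h.lt; set v : Fin k → RatFun k := pt n b₁ with hvdef; set u := vR n b₁ v with hu
  have hv0 : ∀ i, v i ≠ 0 := pt_ne_zero b₁
  have hvne : ∀ i j, i ≠ j → v i ≠ v j := fun i j hij => (pt_div_nondeg hn hb hij).ne (hv0 j)
  have hu0 : ∀ i, u i ≠ 0 := by
    intro i; obtain ⟨c, hc, e⟩ := vR_pt_eq (n := n) b₁ i; rw [hu, hvdef, e]
    exact mul_ne_zero (z_ne_zero _) (ofK_ne_zero hc)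
  have hune : ∀ i j, b₁ i ≠ b₁ j → u i ≠ u j := by
    intro i j hij; obtain ⟨c, hc, e⟩ := vR_pt_eq (n := n) b₁ i
    obtain ⟨c', hc', e'⟩ := vR_pt_eq (n := n) b₁ j; rw [hu, hvdef, e, e']; exact z_mul_ne hij hc
  have hdis : ∀ j ∈ inner a e, ∀ x ∈ tx b₁ e, x ≠ j ∧ b₁ j ≠ b₁ x := by
    intro j hj x hx; rw [mem_inner] at hj; rw [mem_tx] at hx
    have := h.eq_block j hj.1.le hj.2; have := h.ge_after x hx.1; grind
  have hbef : ∀ i < a, (∀ x ∈ tx b₁ e, x ≠ i ∧ b₁ i ≠ b₁ x) ∧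
      ∀ j ∈ inner a e, j ≠ i ∧ b₁ i ≠ b₁ j := by
    intro i hi; rw [h.eq_before i hi]; refine ⟨fun x hx => ?_, fun j hj => ?_⟩
    · rw [mem_tx] at hx; have := h.ge_after x hx.1; grind
    · rw [mem_inner] at hj; have := h.eq_block j hj.1.le hj.2; grind
  have nd : ∀ {l : List (Fin k)}, l.Pairwise (· < ·) → l.Nodup := fun hl => hl.imp fun h => h.ne
  set B := inner a e with hB; set T := tx b₁ e with hT; set A := before a with hA
  set ΛB := (B.reverse.map (train (Rv n v) T)).prod with hΛB
  set ΛR := (B.map (trainR n u T)).prod with hΛR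
  set fB := (B.map fun j => (T.map fun x => f (v j / v x)).prod).prod with hfB
  set CA := ((A ++ [a]).reverse.map (train (Rv n v) B)).prod with hCA
  set CR := (A.map (trainR n u B)).prod with hCR
  set Pδ := (Pm (RatFun k) (γ₁ * γ₀⁻¹) : Tensor n k) with hPδ
  -- the left factor
  have hleft : (lft b₁ v : Tensor n k) * ΛB = lft b₀ v * CA := by
    rw [h.lft_new, h.lft_old, mul_assoc, mul_assoc]; congr 1
    refine (trains_interchange (isYB_Rv (n := n) v hv0) (nd tx_sorted) (nd inner_sorted)
      (fun j hj x hx => ⟨(hdis j hj x hx).1, hvne _ _ (hdis j hj x hx).1.symm⟩) _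
      (List.nodup_reverse.2 (nd (sorted_append before_sorted (List.pairwise_singleton _ _) ?_)))
      ?_).symm
    · simp only [mem_before, List.mem_singleton]; rintro x hx y rfl; exact hx
    · intro i hi
      simp only [List.mem_reverse, List.mem_append, List.mem_singleton, hA, mem_before] at hi
      have key : (∀ x ∈ T, x ≠ i) ∧ ∀ j ∈ B, j ≠ i := by grind [mem_tx, mem_inner]
      exact ⟨fun x hx => ⟨key.1 x hx, hvne _ _ (key.1 x hx).symm⟩,
        fun j hj => ⟨key.2 j hj, hvne _ _ (key.2 j hj).symm⟩⟩
  -- the middle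
  have hcomm : Commute Y ΛB := by
    have hYB : ∀ j ∈ B, TrivOn j Y := fun j hj => hY j (by
      rw [hB, mem_inner] at hj; rw [h.eq_block j hj.1.le hj.2]; exact hj.1.ne)
    have hYT : ∀ x ∈ T, TrivOn x Y := fun x hx => hY x (mem_tx.1 hx).2
    refine commute_list_prod fun y hy => ?_; obtain ⟨j, hj, rfl⟩ := List.mem_map.1 hy
    rw [List.mem_reverse] at hj
    exact commute_train_of_trivOn (L := RatFun k) (v := v) (hYB j hj) fun x hx => ⟨(hdis j hj x hx).1, hYT x hx⟩
  have hΛ : ΛB * ΛR = fB • (1 : Tensor n k) := by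
    rw [← trains_mul_trainRs (n := n) hv0 T B fun j hj x hx =>
      ⟨(hdis j hj x hx).1, hvne _ _ (hdis j hj x hx).1.symm⟩]
    rw [hΛB, hΛR]; congr 2; refine map_congr_left fun j hj => trainR_congr ?_ fun x hx => ?_
    · exact h.vR_nonhead (Or.inl hj)
    · exact h.vR_nonhead (Or.inr hx)
  -- the right factor
  have hright : ΛR * (A.map fun i => trainR n u T i * trainR n u B i).prod =
      CR * ((A.map (trainR n u T)).prod * ΛR) := by
    refine (trainRs_interchange (n := n) hu0 (nd tx_sorted) (nd inner_sorted) (nd before_sorted)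
      (fun j hj x hx => ⟨(hdis j hj x hx).1, hune _ _ (hdis j hj x hx).2⟩) fun i hi => ?_).symm
    rw [mem_before] at hi
    exact ⟨fun x hx => ⟨((hbef i hi).1 x hx).1, hune _ _ ((hbef i hi).1 x hx).2⟩,
      fun j hj => ⟨((hbef i hi).2 j hj).1, hune _ _ ((hbef i hi).2 j hj).2⟩⟩
  set Rt₁ := ((th b₁ e).map fun h => trainR n u (T.filter (h < b₁ ·)) h).prod with hRt₁
  set Rt₀ := ((th b₁ e).map fun h => trainR n (vR n b₀ v) (T.filter (h < b₁ ·)) h).prod with hRt₀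
  have hTx : ∀ x ∈ T, (γ₁ * γ₀⁻¹) x = x ∧ u x = vR n b₀ v x := fun x hx =>
    ⟨h.cycq_ge h₀ h₁ (mem_tx.1 hx).1, (h.vR_nonhead (Or.inr hx)).trans (h.vR_old_tx hx).symm⟩
  have hp1 : Pδ * (A.map (trainR n (vR n b₀ v) T)).prod = (A.map (trainR n u T)).prod * Pδ := by
    refine Pm_mul_prod _ _ fun i hi => ?_; rw [hA, mem_before] at hi
    have hδ := h.cycq_before h₀ h₁ hi
    have := Pm_mul_trainR (n := n) (γ₁ * γ₀⁻¹) (u := vR n b₀ v) (u' := u) (xs := T) (j := i)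
      (by rw [hδ]; exact h.vR_before hi)
      fun x hx => ⟨((hbef i hi).1 x hx).1, hTx x hx⟩
    rwa [hδ] at this
  have hp2 : Pδ * ((a :: B).map (trainR n (vR n b₀ v) T)).prod = ΛR * trainR n u T a * Pδ := by
    have e1 : ΛR * trainR n u T a = ((a :: B).map fun j => trainR n u T ((γ₁ * γ₀⁻¹) j)).prod := by
      rw [← List.prod_concat]
      have : ((a :: B).map fun j => trainR n u T ((γ₁ * γ₀⁻¹) j)) =
          ((a :: B).map (γ₁ * γ₀⁻¹)).map (trainR n u T) := by rw [List.map_map]; rfl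
      rw [this, h.map_cycq h₀ h₁, List.map_append, List.concat_eq_append, List.map_singleton]
    rw [e1]; refine Pm_mul_prod _ _ fun j hj => ?_
    have hj' : a ≤ j ∧ j.val < e := by
      grind [mem_inner]
    refine Pm_mul_trainR _ (h.vR_cycq h₀ h₁ hj'.1 hj'.2) fun x hx => ⟨?_, hTx x hx⟩; rintro rfl
    have := (mem_tx.1 hx).1; lia
  have hp3 : Pδ * Rt₀ = Rt₁ * Pδ := by
    refine Pm_mul_prod _ _ fun i hi => ?_; have hδ := h.cycq_ge h₀ h₁ (mem_th.1 hi).1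
    have := Pm_mul_trainR (n := n) (γ₁ * γ₀⁻¹) (u := vR n b₀ v) (u' := u)
      (xs := T.filter (i < b₁ ·)) (j := i) (by rw [hδ]; exact h.vR_th hi)
      fun x hx => ⟨?_, hTx x (List.mem_of_mem_filter hx)⟩
    · rwa [hδ] at this
    · rintro rfl; exact (mem_tx.1 (List.mem_of_mem_filter hx)).2 (mem_th.1 hi).2
  have hp4 : Pδ * Pm (RatFun k) γ₀ = Pm (RatFun k) γ₁ := by
    rw [hPδ, Pm_mul_Pm, inv_mul_cancel_right]
  calc fB • (lft b₁ v * Y * rgt b₁ v * Pm (RatFun k) γ₁)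
      = lft b₁ v * Y * (fB • 1) * rgt b₁ v * Pm (RatFun k) γ₁ := by
        rw [mul_smul_comm, mul_one, smul_mul_assoc, smul_mul_assoc]
    _ = lft b₁ v * (Y * ΛB) * ΛR * rgt b₁ v * Pm (RatFun k) γ₁ := by
        rw [← hΛ]; simp only [mul_assoc]
    _ = (lft b₁ v * ΛB) * Y * ΛR * rgt b₁ v * Pm (RatFun k) γ₁ := by
        rw [hcomm.eq]; simp only [mul_assoc]
    _ = lft b₀ v * CA * Y * (ΛR * (A.map fun i => trainR n u T i * trainR n u B i).prod) *
          trainR n u T a * Rt₁ * Pm (RatFun k) γ₁ := by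
        rw [hleft, h.rgt_new]; simp only [mul_assoc]; rfl
    _ = lft b₀ v * CA * Y * CR * (A.map (trainR n u T)).prod * (ΛR *
          trainR n u T a) * (Rt₁ * (Pδ * Pm (RatFun k) γ₀)) := by
        rw [hright, hp4]; simp only [mul_assoc]
    _ = lft b₀ v * CA * Y * CR * (A.map (trainR n u T)).prod * (ΛR *
          trainR n u T a * Pδ) * Rt₀ * Pm (RatFun k) γ₀ := by
        rw [← mul_assoc Rt₁, ← hp3]; simp only [mul_assoc]
    _ = lft b₀ v * CA * Y * CR * ((A.map (trainR n u T)).prod * Pδ) *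
          ((a :: B).map (trainR n (vR n b₀ v) T)).prod * Rt₀ * Pm (RatFun k) γ₀ := by
        rw [← hp2]; simp only [mul_assoc]
    _ = lft b₀ v * (CA * Y * CR * Pδ) * rgt b₀ v * Pm (RatFun k) γ₀ := by
        rw [← hp1, h.rgt_old]; simp only [mul_assoc]; rfl

end IsSplit

/-! ### Braid lifts -/

section Braid

/-- The inversions of `σ⁻¹`. -/
def inversions (σ : Perm (Fin k)) : Finset (Fin k × Fin k) :=
  univ.filter fun p => p.1 < p.2 ∧ σ.symm p.2 < σ.symm p.1

lemma mem_inversions {p : Fin k × Fin k} :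
    p ∈ inversions σ ↔ p.1 < p.2 ∧ σ.symm p.2 < σ.symm p.1 := by simp [inversions]

lemma inversions_mul_swap (h : i.val + 1 = j.val)
    (hij : σ j < σ i) : inversions (σ * swap i j) ⊂ inversions σ := by
  have hlt : i < j := by rw [lt_def]; lia
  refine Finset.ssubset_iff_of_subset (fun p hp => ?_) |>.2 ⟨(σ j, σ i), ?_, ?_⟩
  · rw [mem_inversions] at hp ⊢; refine ⟨hp.1, ?_⟩
    have h2 : swap i j (σ.symm p.2) < swap i j (σ.symm p.1) := hp.2; grind
  · rw [mem_inversions]; simpa using ⟨hij, hlt⟩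
  · rw [mem_inversions]; rintro ⟨-, h2⟩
    have h3 : swap i j (σ.symm (σ i)) < swap i j (σ.symm (σ j)) := h2; grind

lemma exists_descent (hσ : σ ≠ 1) : ∃ i j : Fin k, i.val + 1 = j.val ∧ σ j < σ i := by
  by_contra! hc; apply hσ
  have hmono : StrictMono σ := by
    rcases k with - | k
    · exact fun i => i.elim0
    · refine Fin.strictMono_iff_lt_succ.2 fun i => lt_of_le_of_ne (hc _ _ (by simp)) fun h => ?_
      have := σ.injective h; exact absurd this (Fin.castSucc_lt_succ).ne
  exact Equiv.ext fun i => congrFun (Subsingleton.elim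
    (hmono.orderIsoOfSurjective σ σ.surjective) (OrderIso.refl _) ▸ rfl :
      (hmono.orderIsoOfSurjective σ σ.surjective : Fin k → Fin k) = id) i

lemma exists_lift (σ : Perm (Fin k)) : ∃ l : List (Fin k × Fin k),
    (∀ p ∈ l, p.1 < p.2 ∧ σ.symm p.2 < σ.symm p.1) ∧
    IsBraidLift σ (l.map fun p => (Rm p.1 p.2 (z p.1 / z p.2) : Tensor n k)).prod := by
  induction hm : (inversions σ).card using Nat.strong_induction_on generalizing σ with
  | _ m ih =>
    by_cases hσ : σ = 1
    · subst hσ; exact ⟨[], by simp, by simpa using IsBraidLift.one⟩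
    · obtain ⟨i, j, h, hij⟩ := exists_descent hσ; have hlt : i < j := by rw [lt_def]; lia
      have hss := inversions_mul_swap h hij
      obtain ⟨l, hl, hM⟩ := ih _ (hm ▸ Finset.card_lt_card hss) _ rfl
      refine ⟨l ++ [(σ j, σ i)], fun p hp => ?_, ?_⟩
      · rcases List.mem_append.1 hp with hp | hp
        · exact mem_inversions.1 (hss.1 (mem_inversions.2 (hl p hp)))
        grind
      · have := IsBraidLift.over _ _ i j h hM
        rw [mul_assoc, Equiv.swap_mul_self, mul_one, Perm.mul_apply, Perm.mul_apply,
          Equiv.swap_apply_left, Equiv.swap_apply_right, R_eq_Rm] at this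
        rwa [List.map_append, List.prod_append, List.map_singleton, List.prod_singleton]

lemma renameVars_poles (σ : Perm (Fin k)) : renameVars σ.toEmbedding (poles k n) = poles k n := by
  rw [poles, map_prod]; refine Finset.prod_equiv (Equiv.prodCongr σ σ) (fun p => ?_) fun p _ => ?_
  · simp
  · rw [map_sub, map_mul, renameVars_z, renameVars_z, AlgHom.commutes]; rfl

lemma poles_smul_entries (hX : X ∈ bigSpace n k) (I J : Fin k → Fin n) :
    (poles k n • X) I J ∈ laurent k := by
  have := hX.1 I J; rwa [mul_comm] at this

lemma poles_smul_comm (hX : X ∈ bigSpace n k) {M : Tensor n k} (hM : IsBraidLift σ M) :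
    (poles k n • X) * M = M * permute σ (poles k n • X) := by
  have : permute σ (poles k n • X) = poles k n • permute σ X := by
    ext I J
    exact (map_mul (renameVars σ.toEmbedding) _ _).trans (congrArg (· * _) (renameVars_poles σ))
  rw [this, smul_mul_assoc, hX.2 σ M hM, mul_smul_comm]

lemma vanish_of_permuted (hX : X ∈ bigSpace n k)
    {v : Fin k → RatFun u} (hv : ∀ i, v i ≠ 0) (hvd : ∀ i j, i ≠ j → Nondeg (v i / v j))
    (σ : Perm (Fin k)) (h0 : MVal (v ∘ σ) (poles k n • X) 0) :
    MVal v (poles k n • X) 0 := by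
  obtain ⟨l, hl, hM⟩ := exists_lift (n := n) σ; have hcomm := poles_smul_comm hX hM
  have hMv : MVal v (l.map fun p => (Rm p.1 p.2 (z p.1 / z p.2) : Tensor n k)).prod
      (l.map fun p => (Rm p.1 p.2 (v p.1 / v p.2) : Op (Fin k) n (RatFun u))).prod := by
    refine MVal.list_prod l fun p hp => MVal.rm (hl p hp).1.ne ?_ (hvd _ _ (hl p hp).1.ne).2.1
    exact (HasValueAt.z _).div (HasValueAt.z _) (hv _)
  have hunit : IsUnit (l.map fun p => (Rm p.1 p.2 (v p.1 / v p.2) : Op (Fin k) n (RatFun u))).prod := by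
    refine (RegInv.list_prod (O := ⊤) fun M hM => ?_).isUnit
    obtain ⟨p, hp, rfl⟩ := List.mem_map.1 hM
    exact (hvd _ _ (hl p hp).1.ne).regInv_top (hl p hp).1.ne
  have hex : ∀ I J, ∃ x, HasValueAt v ((poles k n • X) I J) x := fun I J =>
    laurent_le_valRing hv (poles_smul_entries hX I J)
  choose A hA using hex
  have hA' : MVal v (poles k n • X) (Matrix.of A) := hA
  have hperm : MVal v (permute σ (poles k n • X)) 0 := fun I J =>
    HasValueAt.rename σ.toEmbedding (h0 (I ∘ σ) (J ∘ σ))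
  have h1 := hA'.mul hMv; rw [hcomm] at h1; have h2 := h1.unique (hMv.mul hperm)
  rw [mul_zero] at h2; rwa [hunit.mul_left_eq_zero.1 h2] at hA'

lemma vanish_of_specialization (hX : X ∈ bigSpace n k) {b : Fin k → Fin k}
    {w : Fin k → RatFun k} (hw : ∀ i, w i ≠ 0)
    (hwb : ∀ j, w j = w (b j) * cst (qbar n ^ (2 * (j.val - (b j).val))))
    (h0 : MVal (pt n b) (poles k n • X) 0) : MVal w (poles k n • X) 0 := by
  intro I J
  obtain ⟨v', h1, h2⟩ := laurent_value_trans (w'' := w) (pt_ne_zero b) hw (fun j => by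
      rw [hwb j, pt]
      exact (HasValueAt.z _).mul (HasValueAt.const _)) (poles_smul_entries hX I J) (h0 I J)
  have h3 := h1.unique (HasValueAt.zero w); rwa [h3] at h2

end Braid

/-! ### Specializing the wheel condition -/

section Point

variable (n : ℕ)

/-- The product of the factors `z_i - z_j q̄²` for `i, j < m`. -/
def polesBelow (k m : ℕ) : RatFun k :=
  ∏ p : Fin k × Fin k with p.1 ≠ p.2 ∧ p.1.val < m ∧ p.2.val < m, (z p.1 - z p.2 * cst (qbar n ^ 2))

/-- The other factors of the denominator. -/
def denAbove (b : Fin k → Fin k) (e : ℕ) (v : Fin k → RatFun k) : RatFun k :=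
  ∏ p : Fin k × Fin k with (p.1 ≠ p.2 ∧ ¬ (p.2.val + 1 = p.1.val ∧ b p.1 = b p.2)) ∧
      ¬ (p.1.val < e ∧ p.2.val < e),
    (v p.1 - v p.2 * cst (qbar n ^ 2))

/-- Points at which only the strands before `e` are specialized further than in `pt n b`. -/
structure IsPoint (b : Fin k → Fin k) (e : ℕ) (w : Fin k → RatFun k) : Prop where
  single : ∀ j, j.val < e → b j = j
  after : ∀ j, e ≤ j.val → e ≤ (b j).val
  low : ∀ j, j.val < e → ∃ (c : Fin k) (κ : K), c.val < e ∧ κ ≠ 0 ∧ w j = z c * cst κ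
  high : ∀ j, e ≤ j.val → w j = pt n b j
  nondeg : ∀ i j, i ≠ j → Nondeg (w i / w j)

variable {n} {b : Fin k → Fin k} {e : ℕ} {w : Fin k → RatFun k}

lemma denAbove_mul (hs : ∀ j, j.val < e → b j = j) :
    den n b (pt n b) = denAbove n b e (pt n b) * polesBelow n k e := by
  have hpt : ∀ j, j.val < e → pt n b j = z j := by
    intro j hj; rw [pt, hs j hj, Nat.sub_self, mul_zero, pow_zero, map_one, mul_one]
  rw [den, denAbove, polesBelow, prod_filter, prod_filter, prod_filter, ← prod_mul_distrib]; grind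

namespace IsPoint

lemma ne_zero (h : IsPoint n b e w) (i : Fin k) : w i ≠ 0 := by
  by_cases hi : i.val < e
  · obtain ⟨c, κ, -, hκ, hw⟩ := h.low i hi; rw [hw]
    exact mul_ne_zero (z_ne_zero _) (ofK_ne_zero hκ)
  · rw [h.high i (not_lt.1 hi)]; exact pt_ne_zero b i

lemma compat (h : IsPoint n b e w) (hb : IsBlk b) (j : Fin k) :
    w j = w (b j) * cst (qbar n ^ (2 * (j.val - (b j).val))) := by
  by_cases hj : j.val < e
  · rw [h.single j hj, Nat.sub_self, mul_zero, pow_zero, map_one, mul_one]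
  · rw [h.high j (not_lt.1 hj), h.high _ (h.after j (not_lt.1 hj)), pt, pt, hb.idem, Nat.sub_self,
      mul_zero, pow_zero, map_one, mul_one]

lemma high_form (h : IsPoint n b e w) (hj : e ≤ j.val) :
    w j = z (b j) * cst (qbar n ^ (2 * (j.val - (b j).val))) := h.high j hj

lemma form (h : IsPoint n b e w) (i : Fin k) : ∃ (c : Fin k) (κ : K), κ ≠ 0 ∧
    w i = z c * cst κ ∧ (i.val < e → c.val < e) ∧ (e ≤ i.val → c = b i) := by
  by_cases hi : i.val < e
  · obtain ⟨c, κ, hc, hκ, hw⟩ := h.low i hi; grind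
  · exact ⟨b i, _, qbar_pow_ne_zero n _, h.high_form (not_lt.1 hi), fun h' => absurd h' hi,
      fun _ => rfl⟩

lemma vR_nondeg (h : IsPoint n b e w) {x : Fin k} (hx : b x ≠ x) (hxi : b x ≠ b i) :
    Nondeg (vR n b w x / vR n b w i) := by
  have hxe : e ≤ x.val := by by_contra hc; exact hx (h.single x (not_le.1 hc))
  obtain ⟨c, κ, hκ, hw, hc1, hc2⟩ := h.form i
  have hci : b x ≠ c := by
    rintro rfl
    by_cases hi : i.val < e
    · exact absurd (hc1 hi) (not_lt.2 (h.after x hxe))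
    · exact hxi (hc2 (not_lt.1 hi))
  rw [vR, if_neg hx, h.high_form hxe, vR]; split_ifs
  · rw [hw, mul_assoc, ← map_mul]
    exact z_div_nondeg hci (qbar_pow_ne_zero n _) (mul_ne_zero hκ (qbar_pow_ne_zero n _))
  · rw [hw]; exact z_div_nondeg hci (qbar_pow_ne_zero n _) hκ

lemma denAbove_ne_zero (hn : 2 ≤ n) (hb : IsBlk b) (h : IsPoint n b e w) : denAbove n b e w ≠ 0 := by
  refine prod_ne_zero_iff.2 fun p hp => ?_; obtain ⟨-, ⟨h1, h2⟩, h3⟩ := mem_filter.1 hp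
  rw [sub_ne_zero]; obtain ⟨c, κ, hκ, hw, hc1, hc2⟩ := h.form p.1
  obtain ⟨c', κ', hκ', hw', hc1', hc2'⟩ := h.form p.2
  by_cases hcc : c = c'
  · have h4 : e ≤ p.1.val ∧ e ≤ p.2.val := by
      by_contra h5; have h6 : (p.1.val < e ∧ e ≤ p.2.val) ∨ (p.2.val < e ∧ e ≤ p.1.val) := by lia
      rcases h6 with ⟨h6, h7⟩ | ⟨h6, h7⟩
      · have := hc1 h6; rw [hcc, hc2' h7] at this; exact absurd this (not_lt.2 (h.after _ h7))
      · have := hc1' h6; rw [← hcc, hc2 h7] at this; exact absurd this (not_lt.2 (h.after _ h7))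
    rw [h.high _ h4.1, h.high _ h4.2, pt, pt, ← hc2 h4.1, ← hc2' h4.2, ← hcc, mul_assoc, ← map_mul,
      ← pow_add]
    intro heq; have h5 := (cst).injective (mul_left_cancel₀ (z_ne_zero c) heq)
    have h6 := (q_qbar_inj hn (a := 0) (c := 0) (b := 2 * (p.1.val - c.val))
      (d := 2 * (p.2.val - c.val) + 2) (by rw [pow_zero, one_mul, one_mul]; exact h5)).2
    have hle : c.val ≤ p.1.val ∧ c.val ≤ p.2.val := by
      have h7 := hb.le p.1; have h8 := hb.le p.2; grind
    grind
  · rw [hw, hw', mul_assoc, ← map_mul]; exact z_mul_ne hcc hκ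

lemma isUnit_lft (h : IsPoint n b e w) : IsUnit (lft b w : Tensor n k) := by
  refine (RegInv.list_prod (O := ⊤) fun M hM => ?_).isUnit; obtain ⟨i, hi, rfl⟩ := List.mem_map.1 hM
  refine RegInv.list_prod fun M hM => ?_; obtain ⟨x, hx, rfl⟩ := List.mem_map.1 hM
  have hix : i ≠ x := by grind
  exact (h.nondeg i x hix).regInv_top hix

lemma rgt_nondeg (h : IsPoint n b e w) {x : Fin k}
    (hx : x ∈ ((nonheads b).filter (i < b ·)).reverse) (hi : i ∈ heads b) :
    x ≠ i ∧ Nondeg (vR n b w x / vR n b w i) := by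
  rw [List.mem_reverse, List.mem_filter, mem_nonheads, decide_eq_true_eq] at hx
  rw [mem_heads] at hi; refine ⟨?_, h.vR_nondeg hx.1 (by rw [hi]; exact hx.2.ne')⟩; rintro rfl
  exact hx.1 hi

lemma isUnit_rgt (h : IsPoint n b e w) : IsUnit (rgt b w : Tensor n k) := by
  refine (RegInv.list_prod (O := ⊤) fun M hM => ?_).isUnit; obtain ⟨i, hi, rfl⟩ := List.mem_map.1 hM
  refine RegInv.list_prod fun M hM => ?_; obtain ⟨x, hx, rfl⟩ := List.mem_map.1 hM
  obtain ⟨hix, hnd⟩ := h.rgt_nondeg hx hi; exact hnd.regInv_top hix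

lemma scl_ne_zero (h : IsPoint n b e w) : scl b w ≠ 0 := by
  refine prod_ne_zero_iff.2 fun p hp => ?_; exact (h.nondeg _ _ (mem_filter.1 hp).2.1.ne).f_ne_zero

lemma _root_.MatrixShuffle.HasValueAt.f {w : Fin k → RatFun u}
    {v : RatFun u} (h : HasValueAt w φ v) (hv : v ≠ 1) :
    HasValueAt w (MatrixShuffle.f φ) (MatrixShuffle.f v) := by
  refine HasValueAt.div ((HasValueAt.one.sub (h.mul (HasValueAt.const _))).mul
    (HasValueAt.one.sub (h.mul (HasValueAt.const _)))) ((HasValueAt.one.sub h).pow 2) ?_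
  exact pow_ne_zero 2 (sub_ne_zero.2 hv.symm)

lemma hasVal_pt (h : IsPoint n b e w) (hb : IsBlk b) (j : Fin k) :
    HasValueAt w (pt n b j) (w j) := by
  rw [h.compat hb j, pt]; exact (HasValueAt.z _).mul (HasValueAt.const _)

lemma hasVal_vR (h : IsPoint n b e w) (hb : IsBlk b) (j : Fin k) :
    HasValueAt w (vR n b (pt n b) j) (vR n b w j) := by
  rw [vR, vR]; split_ifs
  · exact (h.hasVal_pt hb j).mul (HasValueAt.const _)
  · exact h.hasVal_pt hb j

lemma value (h : IsPoint n b e w) (hb : IsBlk b) {X : Tensor n k} (hX : X ∈ bigSpace n k)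
    {Y : Tensor n k} {κ : K} {γ : Perm (Fin k)}
    (hV : MVal (pt n b) (poles k n • X) ((cst κ * scl b (pt n b) *
      den n b (pt n b)) • (lft b (pt n b) * Y * rgt b (pt n b) * Pm (RatFun k) γ)))
    (hY : EntriesIn (laurent k) (polesBelow n k e • Y)) :
    ∃ Z, MVal w (polesBelow n k e • Y) Z ∧ MVal w (poles k n • X)
      ((cst κ * scl b w * denAbove n b e w) • (lft b w * Z * rgt b w * Pm (RatFun k) γ)) := by
  have hw0 := h.ne_zero
  choose Z hZ using fun I J => laurent_le_valRing hw0 (hY I J)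
  have hZ' : MVal w (polesBelow n k e • Y) (Matrix.of Z) := hZ; refine ⟨Matrix.of Z, hZ', ?_⟩
  have hp := h.hasVal_pt hb
  have hu0 : ∀ i, vR n b w i ≠ 0 := by
    intro i; rw [vR]; split_ifs
    · exact mul_ne_zero (hw0 i) (ofK_ne_zero (qbar_pow_ne_zero n _))
    · exact hw0 i
  have hl : MVal w (lft b (pt n b) : Tensor n k) (lft b w) := by
    refine MVal.list_prod _ fun i hi => MVal.list_prod _ fun x hx => ?_
    have hix : i ≠ x := by grind
    exact MVal.rm hix ((hp i).div (hp x) (hw0 x)) (h.nondeg i x hix).2.1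
  have hr : MVal w (rgt b (pt n b) : Tensor n k) (rgt b w) := by
    refine MVal.list_prod _ fun i hi => MVal.list_prod _ fun x hx => ?_
    obtain ⟨hix, hnd⟩ := h.rgt_nondeg hx hi
    exact MVal.rm hix ((h.hasVal_vR hb x).div (h.hasVal_vR hb i) (hu0 i)) hnd.2.1
  have hs : HasValueAt w (scl b (pt n b)) (scl b w) := by
    refine HasValueAt.prod _ fun p hp' => ?_
    exact HasValueAt.f ((hp _).div (hp _) (hw0 _)) (h.nondeg _ _ (mem_filter.1 hp').2.1.ne).2.1
  have hd : HasValueAt w (denAbove n b e (pt n b)) (denAbove n b e w) :=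
    HasValueAt.prod _ fun p _ => (hp _).sub ((hp _).mul (HasValueAt.const _))
  have hval := (((hl.mul hZ').mul hr).mul (MVal.pm γ)).smul (((HasValueAt.const κ).mul hs).mul hd)
  have heq : (cst κ * scl b (pt n b) * denAbove n b e (pt n b)) •
      (lft b (pt n b) * (polesBelow n k e • Y) * rgt b (pt n b) * Pm (RatFun k) γ) =
      (cst κ * scl b (pt n b) *
      den n b (pt n b)) • (lft b (pt n b) * Y * rgt b (pt n b) * Pm (RatFun k) γ) := by
    rw [denAbove_mul h.single, mul_smul_comm, smul_mul_assoc, smul_mul_assoc, smul_smul, mul_assoc,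
      mul_assoc, mul_assoc]
  rw [heq] at hval; intro I J
  obtain ⟨v', h1, h2⟩ := laurent_value_trans (w'' := w) (pt_ne_zero b) hw0
    hp (poles_smul_entries hX I J) (hV I J)
  rwa [h1.unique (hval I J)] at h2

end IsPoint

end Point

/-! ### One step of the regularity argument -/

lemma prod_map_filter_finRange {M : Type*} [CommMonoid M] (p : Fin k → Prop)
    [DecidablePred p] (F : Fin k → M) :
    (((finRange k).filter p).map F).prod = ∏ x with p x, F x := by
  aesop

lemma eq_of_smul_conj {F M : Type*} [Field F] [Ring M] [Algebra F M] {A B P Z Z' : M}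
    (hA : IsUnit A) (hB : IsUnit B) (hP : IsUnit P) {c : F} (hc : c ≠ 0)
    (h : c • (A * Z * B * P) = c • (A * Z' * B * P)) : Z = Z' := by
  have h1 := congrArg (c⁻¹ • ·) h; simp only [smul_smul, inv_mul_cancel₀ hc, one_smul] at h1
  exact hA.mul_left_cancel (hB.mul_right_cancel (hP.mul_right_cancel h1))

section Step

/-- The factors of the denominator which involve one strand before the block `[a, e)`. -/
def crossFactor (n : ℕ) (a : Fin k) (e : ℕ) (v : Fin k → RatFun k) (i : Fin k) : RatFun k :=
  ∏ x with a ≤ x ∧ x.val < e, (v i - v x * cst (qbar n ^ 2)) * (v x - v i * cst (qbar n ^ 2))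

/-- The factors of the denominator, within the block `[a, e)`. -/
def blockFactor (n : ℕ) (a : Fin k) (e : ℕ) (v : Fin k → RatFun k) : RatFun k :=
  (∏ p : Fin k × Fin k with p.1 < p.2 ∧ a < p.1 ∧ p.2.val < e, f (v p.1 / v p.2)) *
  ∏ p : Fin k × Fin k with p.1 ≠ p.2 ∧ (a ≤ p.1 ∧ p.1.val < e) ∧ (a ≤ p.2 ∧ p.2.val < e) ∧
    p.2.val + 1 ≠ p.1.val, (v p.1 - v p.2 * cst (qbar n ^ 2))

namespace IsSplit

variable {b₀ b₁ : Fin k → Fin k} {e : ℕ} (h : IsSplit b₀ b₁ a e)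

include h

lemma isPoint (hn : 2 ≤ n) (hb : IsBlk b₁) : IsPoint n b₀ e (pt n b₁) where
  single := h.old
  after j hj := by rw [h.same j hj]; exact h.ge_after j hj
  low j hj := by refine ⟨b₁ j, _, lt_of_le_of_lt (hb.le j) hj, qbar_pow_ne_zero n _, rfl⟩
  high j hj := by rw [pt, pt, h.same j hj]
  nondeg i j hij := pt_div_nondeg hn hb hij

lemma pt_before (hj : j < a) : pt n b₁ j = z j := by
  rw [pt, h.eq_before j hj, Nat.sub_self, mul_zero, pow_zero, map_one, mul_one]

lemma pt_block (hj : a ≤ j) (hj' : j.val < e) :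
    pt n b₁ j = z a * cst (qbar n ^ (2 * (j.val - a.val))) := by
  rw [pt, h.eq_block j hj hj']

lemma den_new : den n b₁ (pt n b₁) = denAbove n b₀ e (pt n b₁) * polesBelow n k a *
    (∏ p : Fin k × Fin k with p.1 ≠ p.2 ∧ (a ≤ p.1 ∧ p.1.val < e) ∧ (a ≤ p.2 ∧ p.2.val < e) ∧
      p.2.val + 1 ≠ p.1.val, (pt n b₁ p.1 - pt n b₁ p.2 * cst (qbar n ^ 2))) *
    ∏ i with i < a, crossFactor n a e (pt n b₁) i := by
  set g : Fin k → Fin k → RatFun k := fun i j => pt n b₁ i - pt n b₁ j * cst (qbar n ^ 2) with hg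
  have h1 : ∏ i with i < a, crossFactor n a e (pt n b₁) i =
      ∏ p : Fin k × Fin k, (if p.1 < a ∧ a ≤ p.2 ∧ p.2.val < e then g p.1 p.2 else 1) *
        (if p.2 < a ∧ a ≤ p.1 ∧ p.1.val < e then g p.1 p.2 else 1) := by
    rw [prod_mul_distrib, Fintype.prod_prod_type, Fintype.prod_prod_type_right,
      ← prod_mul_distrib, prod_filter]
    refine prod_congr rfl fun i _ => ?_; rw [← prod_mul_distrib]
    by_cases hi : i < a
    · rw [if_pos hi, crossFactor, prod_filter]; grind
    · rw [if_neg hi]; refine (Finset.prod_eq_one fun x _ => ?_).symm; simp [hi]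
  rw [h1, den, denAbove, polesBelow, prod_filter, prod_filter, prod_filter,
    prod_filter, ← prod_mul_distrib, ← prod_mul_distrib,
    ← prod_mul_distrib]
  refine prod_congr rfl fun p _ => ?_; obtain ⟨i, j⟩ := p; have hae := h.lt; simp only
  have hcase : ∀ x, x < a ∨ (a ≤ x ∧ x.val < e) ∨ e ≤ x.val := by grind
  change (if _ then g i j else 1) = (if _ then g i j else 1) * _ * (if _ then g i j else 1) * _
  have hi0 := h.eq_before i; have hj0 := h.eq_before j; have hi1 := h.eq_block i
  have hj1 := h.eq_block j; have hi2 := h.ge_after i; have hj2 := h.ge_after j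
  have hi3 := h.old i; have hj3 := h.old j; have hi4 := h.same i; have hj4 := h.same j
  rcases hcase i with hi | hi | hi <;> rcases hcase j with hj | hj | hj
  · have e1 : pt n b₁ i = z i := h.pt_before hi; have e2 : pt n b₁ j = z j := h.pt_before hj
    grind
  all_goals grind

lemma scl_new (v : Fin k → RatFun k) : scl b₁ v =
    (∏ p : Fin k × Fin k with p.1 < p.2 ∧ a < p.1 ∧ p.2.val < e, f (v p.1 / v p.2)) *
    scl b₀ v * ((inner a e).map fun j => ((tx b₁ e).map fun x => f (v j / v x)).prod).prod := by
  have h1 : ((inner a e).map fun j => ((tx b₁ e).map fun x => f (v j / v x)).prod).prod =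
      ∏ p : Fin k × Fin k, if (a < p.1 ∧ p.1.val < e) ∧ e ≤ p.2.val ∧ b₁ p.2 ≠ p.2
        then f (v p.1 / v p.2) else 1 := by
    rw [inner, prod_map_filter_finRange, prod_filter, Fintype.prod_prod_type]
    refine prod_congr rfl fun i _ => ?_; rw [tx, prod_map_filter_finRange, prod_filter]
    split_ifs with hi
    · simp only [hi, true_and]
    · simp only [hi, false_and, if_false, Finset.prod_const_one]
  rw [h1, scl, scl, prod_filter, prod_filter, prod_filter, ← prod_mul_distrib, ← prod_mul_distrib]
  refine prod_congr rfl fun p _ => ?_; obtain ⟨i, j⟩ := p; simp only; have hae := h.lt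
  have hcase : ∀ x, (x ≤ a ∧ x.val < e ∧ b₁ x = x ∧ b₀ x = x) ∨
      (a < x ∧ x.val < e ∧ b₁ x ≠ x ∧ b₀ x = x) ∨
      (e ≤ x.val ∧ b₀ x = b₁ x) := by
    intro x; grind [h.eq_before x, h.eq_block x, h.old x, h.same x]
  rcases hcase i with ⟨i1, i2, i3, i4⟩ | ⟨i1, i2, i3, i4⟩ | ⟨i1, i2⟩ <;>
    rcases hcase j with ⟨j1, j2, j3, j4⟩ | ⟨j1, j2, j3, j4⟩ | ⟨j1, j2⟩
  all_goals grind

variable {Y₀ Y₁ : Tensor n k} {κ₀ κ₁ : K} {γ₀ γ₁ : Perm (Fin k)}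

theorem scalar_eq (hκ : κ₀ ≠ 0) : cOn k κ₁ * scl b₁ (pt n b₁) *
      den n b₁ (pt n b₁) =
    (cOn k κ₀ * scl b₀ (pt n b₁) * denAbove n b₀ e (pt n b₁)) *
    (cOn k (κ₁ / κ₀) * blockFactor n a e (pt n b₁) *
      (∏ i with i < a, crossFactor n a e (pt n b₁) i) * polesBelow n k a) *
    ((inner a e).map fun j => ((tx b₁ e).map fun x => f (pt n b₁ j / pt n b₁ x)).prod).prod := by
  have h5 : cOn k κ₁ =
      cOn k κ₀ * cOn k (κ₁ / κ₀) := by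
    rw [← map_mul, mul_div_cancel₀ _ hκ]
  rw [h.scl_new, h.den_new, blockFactor, h5]
  ring1

lemma relation (hn : 2 ≤ n) (hb : IsBlk b₁) (hX : X ∈ bigSpace n k)
    (h₀ : IsCyc b₀ γ₀) (h₁ : IsCyc b₁ γ₁) (hκ : κ₀ ≠ 0)
    (hV₀ : MVal (pt n b₀) (poles k n • X) ((cst κ₀ * scl b₀ (pt n b₀) *
      den n b₀ (pt n b₀)) • (lft b₀ (pt n b₀) * Y₀ * rgt b₀ (pt n b₀) * Pm (RatFun k) γ₀)))
    (hV₁ : MVal (pt n b₁) (poles k n • X) ((cst κ₁ * scl b₁ (pt n b₁) *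
      den n b₁ (pt n b₁)) • (lft b₁ (pt n b₁) * Y₁ * rgt b₁ (pt n b₁) * Pm (RatFun k) γ₁)))
    (hT : ∀ x, b₁ x ≠ x → TrivOn x Y₁)
    (hY : EntriesIn (laurent k) (polesBelow n k e • Y₀)) :
    ∃ Z, MVal (pt n b₁) (polesBelow n k e • Y₀) Z ∧
      Z = (cst (κ₁ / κ₀) * blockFactor n a e (pt n b₁) *
        ∏ i with i < a, crossFactor n a e (pt n b₁) i) •
      (((before a ++ [a]).reverse.map (train (Rv n (pt n b₁)) (inner a e))).prod *
        (polesBelow n k a • Y₁) * ((before a).map (trainR n (vR n b₁ (pt n b₁)) (inner a e))).prod *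
        Pm (RatFun k) (γ₁ * γ₀⁻¹)) := by
  have hpoint := h.isPoint hn hb; have hb₀ := h.isBlk_old hb
  obtain ⟨Z, hZ, hval⟩ := hpoint.value hb₀ hX hV₀ hY; refine ⟨Z, hZ, ?_⟩; have h1 := hval.unique hV₁
  have h2 := h.wheel_identity h₀ h₁ hn hb hT; set v := pt n b₁ with hv
  set W := ((before a ++ [a]).reverse.map (train (Rv n v) (inner a e))).prod * Y₁ *
        ((before a).map (trainR n (vR n b₁ v) (inner a e))).prod *
        Pm (RatFun k) (γ₁ * γ₀⁻¹) with hW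
  have hc : cst κ₀ * scl b₀ v * denAbove n b₀ e v ≠ 0 :=
    mul_ne_zero (mul_ne_zero (ofK_ne_zero hκ) hpoint.scl_ne_zero) (hpoint.denAbove_ne_zero hn hb₀)
  have h3 : (cst κ₁ * scl b₁ v * den n b₁ v) • (lft b₁ v * Y₁ * rgt b₁ v * Pm (RatFun k) γ₁) =
      (cst κ₀ * scl b₀ v * denAbove n b₀ e v) • (lft b₀ v * ((cst (κ₁ / κ₀) * blockFactor n a e v *
        (∏ i with i < a, crossFactor n a e v i) * polesBelow n k a) • W) * rgt b₀ v *
        Pm (RatFun k) γ₀) := by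
    rw [h.scalar_eq hκ, mul_smul, h2, mul_smul, mul_smul_comm, smul_mul_assoc, smul_mul_assoc]
  rw [h3] at h1
  have h8 := eq_of_smul_conj hpoint.isUnit_lft hpoint.isUnit_rgt
    (RegInv.pm (O := ⊤) (n := n) (L := RatFun k) γ₀).isUnit hc h1
  rw [h8, mul_smul, hW, mul_smul_comm, smul_mul_assoc, smul_mul_assoc]

end IsSplit

end Step

/-! ### Regularity -/

section Vanishing

lemma exists_cycle {t : Fin k} (hit : i ≤ t) : ∃ σ : Perm (Fin k),
    (∀ j, j < i → σ j = j) ∧ (∀ j, i ≤ j → j < t → (σ j).val = j.val + 1) ∧ σ t = i ∧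
    ∀ j, t < j → σ j = j := by
  rcases k with - | k
  · exact i.elim0
  refine ⟨Fin.cycleIcc i t, fun j hj => Fin.cycleIcc_of_lt hj, fun j h1 h2 => ?_,
    Fin.cycleIcc_of_last hit, fun j hj => Fin.cycleIcc_of_gt hj⟩
  rw [Fin.cycleIcc_of_ge_of_lt h1 h2, Fin.val_add_one_of_lt (lt_of_lt_of_le h2 (Fin.le_last _))]

/-- The specialization of the block point on a hyperplane. -/
def hyperPt (n : ℕ) (b : Fin k → Fin k) (i a : Fin k) (α : K) : Fin k → RatFun k :=
  update (pt n b) i (z a * cst α)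

namespace IsSplit

variable {b₀ b₁ : Fin k → Fin k} {e : ℕ} (h : IsSplit b₀ b₁ a e) (hi : i < a) {α : K}

lemma hyperPt_self : hyperPt n b₁ i a α i = z a * cst α := Function.update_self _ _ _

lemma hyperPt_ne (hj : j ≠ i) : hyperPt n b₁ i a α j = pt n b₁ j := update_of_ne hj _ _

include h hi

lemma hasVal_hyper (j : Fin k) : HasValueAt (hyper i a α) (pt n b₁ j) (hyperPt n b₁ i a α j) := by
  by_cases hj : j = i
  · subst hj; rw [hyperPt_self, h.pt_before hi]; have := HasValueAt.z (w := hyper j a α) j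
    rwa [hyper_self, mul_comm] at this
  · rw [hyperPt_ne hj, pt]; refine HasValueAt.mul ?_ (HasValueAt.const _)
    have hbj : b₁ j ≠ i := by
      intro hji; rcases lt_or_ge j a with hja | hja
      · exact hj ((h.eq_before j hja).symm.trans hji)
      · rcases lt_or_ge j.val e with hje | hje
        · rw [h.eq_block j hja hje] at hji; exact hi.ne hji.symm
        · have h1 := h.ge_after j hje; rw [hji] at h1
          exact absurd (lt_trans (lt_def.1 hi) h.lt) (not_lt.2 h1)
    have := HasValueAt.z (w := hyper i a α) (b₁ j); rwa [hyper_ne hbj] at this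

lemma hyperPt_out (hj : j < a ∨ e ≤ j.val) (hji : j ≠ i) :
    ∃ c, c ≠ a ∧ c ≠ i ∧ ∃ κ : K, κ ≠ 0 ∧ pt n b₁ j = z c * cst κ := by
  rcases hj with hj | hj
  · refine ⟨j, hj.ne, hji, 1, one_ne_zero, ?_⟩; rw [h.pt_before hj, map_one, mul_one]
  · have h1 := h.ge_after j hj; refine ⟨b₁ j, ?_, ?_, _, qbar_pow_ne_zero n _, rfl⟩
    · intro h2; rw [h2] at h1; exact absurd h.lt (not_lt.2 h1)
    · intro h2; rw [h2] at h1; exact absurd (lt_trans (lt_def.1 hi) h.lt) (not_lt.2 h1)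

lemma isPoint_hyper (hn : 2 ≤ n) (hb : IsBlk b₁) {c : K} (hc : c ≠ 0) {p s : ℕ}
    (hα : α = c * qbar n ^ p) (hs : c * qbar n ^ s = 1)
    (hps : ∀ j, a ≤ j → j.val < e → s + 2 * (j.val - a.val) ≠ p) :
    IsPoint n b₀ e (hyperPt n b₁ i a α) := by
  have hα0 : α ≠ 0 := hα ▸ mul_ne_zero hc (qbar_pow_ne_zero n _)
  have hie : i.val < e := lt_trans hi h.lt; have hp := h.isPoint hn hb
  have hblock : ∀ j, a ≤ j → j.val < e → pt n b₁ j = z a * cst c *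
        cst (qbar n ^ (s + 2 * (j.val - a.val))) := by
    intro j h1 h2
    rw [h.pt_block h1 h2, pow_add, map_mul, mul_assoc, ← mul_assoc (ofK c), ← map_mul,
      hs, map_one, one_mul]
  have hself : hyperPt n b₁ i a α i = z a * cst c * cst (qbar n ^ p) := by
    rw [hyperPt_self, hα, map_mul, mul_assoc]
  have key : ∀ j, j ≠ i → Nondeg (hyperPt n b₁ i a α i / hyperPt n b₁ i a α j) ∧
      Nondeg (hyperPt n b₁ i a α j / hyperPt n b₁ i a α i) := by
    intro j hj; rw [hyperPt_ne hj]
    by_cases hj' : a ≤ j ∧ j.val < e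
    · rw [hself, hblock j hj'.1 hj'.2]
      exact ⟨z_qbar_div_nondeg hn a hc (hps j hj'.1 hj'.2).symm,
        z_qbar_div_nondeg hn a hc (hps j hj'.1 hj'.2)⟩
    · obtain ⟨c', h1, -, κ, hκ, hw⟩ := h.hyperPt_out hi (by rw [lt_def]; rw [le_def] at hj'; lia) hj
      rw [hyperPt_self, hw]; exact ⟨z_div_nondeg h1.symm hα0 hκ, z_div_nondeg h1 hκ hα0⟩
  refine ⟨h.old, hp.after, fun j hj => ?_, fun j hj => ?_, fun j j' hjj => ?_⟩
  · by_cases hji : j = i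
    · subst hji; exact ⟨a, α, h.lt, hα0, hyperPt_self⟩
    · rw [hyperPt_ne hji]; exact hp.low j hj
  · rw [hyperPt_ne (by rintro rfl; lia)]; exact hp.high j hj
  · by_cases hji : j = i
    · subst hji; exact (key j' hjj.symm).1
    · by_cases hji' : j' = i
      · subst hji'; exact (key j hji).2
      · rw [hyperPt_ne hji, hyperPt_ne hji']; exact hp.nondeg j j' hjj

lemma vanish_hyper (hn : 2 ≤ n) (hb : IsBlk b₁) (hX : X ∈ bigSpace n k)
    {a' : Fin k} (ha' : a'.val + 1 = a.val)
    (hbig : MVal (pt n fun j => if b₁ j = a then a' else b₁ j) (poles k n • X) 0)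
    (hα : α = qbar n ^ (2 * (e - a.val)) ∨ α * qbar n ^ 2 = 1) :
    IsPoint n b₀ e (hyperPt n b₁ i a α) ∧ MVal (hyperPt n b₁ i a α) (poles k n • X) 0 := by
  have hle := h.le; have hlt := h.lt; have hi' : i.val < a.val := hi
  have hpoint : IsPoint n b₀ e (hyperPt n b₁ i a α) := by
    rcases hα with hα | hα
    · refine h.isPoint_hyper hi hn hb one_ne_zero
        (by rw [one_mul, hα]) (by rw [pow_zero, one_mul]) fun j h1 h2 => ?_
      lia
    · have hα0 : α ≠ 0 := left_ne_zero_of_mul_eq_one hα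
      exact h.isPoint_hyper hi hn hb hα0 (by rw [pow_zero, mul_one]) hα fun j h1 h2 => by lia
  refine ⟨hpoint, ?_⟩; have hw0 := hpoint.ne_zero
  have hblock : ∀ j, a ≤ j → j.val < e → hyperPt n b₁ i a α j =
      z a * cst (qbar n ^ (2 * (j.val - a.val))) := by
    intro j h1 h2; rw [hyperPt_ne (by rintro rfl; exact absurd hi (not_lt.2 h1)), h.pt_block h1 h2]
  obtain ⟨t, ht, hit, hcase⟩ : ∃ t : Fin k, t.val < e ∧ i ≤ t ∧
      ((t.val + 1 = a.val ∧ α * qbar n ^ 2 = 1) ∨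
        (t.val + 1 = e ∧ α = qbar n ^ (2 * (e - a.val)))) := by
    rcases hα with hα | hα
    · exact ⟨⟨e - 1, by lia⟩, by simp only; lia, by rw [le_def]; simp only; lia,
        Or.inr ⟨by simp only; lia, hα⟩⟩
    · exact ⟨a', by lia, by rw [le_def]; lia, Or.inl ⟨ha', hα⟩⟩
  obtain ⟨σ, σ1, σ2, σ3, σ4⟩ := exists_cycle hit
  refine vanish_of_permuted hX hw0 hpoint.nondeg σ
    (vanish_of_specialization hX (fun j => hw0 _) (fun j => ?_) hbig)
  have hsimple : ∀ c, c = j → hyperPt n b₁ i a α (σ j) = hyperPt n b₁ i a α (σ c) *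
      cst (qbar n ^ (2 * (j.val - c.val))) := by
    simp
  simp only [Function.comp]; rcases lt_or_ge j a with hja | hja
  · rw [h.eq_before j hja, if_neg hja.ne]; exact hsimple _ rfl
  rcases lt_or_ge j.val e with hje | hje
  · rw [h.eq_block j hja hje, if_pos rfl]; have hja' : a.val ≤ j.val := hja
    rcases hcase with ⟨hta, hα'⟩ | ⟨hte, hα'⟩
    · have e1 : a' = t := Fin.ext (by lia)
      rw [e1, σ3, σ4 j (by rw [lt_def]; lia), hyperPt_self, hblock j hja hje, mul_assoc, ← map_mul]
      congr 2
      rw [show 2 * (j.val - t.val) = 2 + 2 * (j.val - a.val) by lia, pow_add, ← mul_assoc, hα',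
        one_mul]
    · have e1 : σ a' = a := Fin.ext (by rw [σ2 a' (by rw [le_def]; lia) (by rw [lt_def]; lia), ha'])
      rw [e1, hblock a le_rfl hlt, Nat.sub_self, mul_zero, pow_zero, map_one, mul_one]
      by_cases hjt : j = t
      · rw [hjt, σ3, hyperPt_self, hα']; congr 4; lia
      · have hjt' : j < t := by have : j.val ≠ t.val := fun h => hjt (Fin.ext h); lia
        have e2 := σ2 j (by rw [le_def]; lia) hjt'
        rw [hblock (σ j) (by rw [le_def]; lia) (by rw [lt_def] at hjt'; lia), e2]; congr 4; lia
  · have h1 := h.ge_after j hje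
    have h2 : b₁ j ≠ a := by intro h3; rw [h3] at h1; lia
    rw [if_neg h2, σ4 j (by rw [lt_def]; lia), σ4 (b₁ j) (by rw [lt_def]; lia),
      hyperPt_ne (by rintro rfl; lia), hyperPt_ne (by rintro h3; rw [h3] at h1; lia), pt, pt,
      hb.idem, Nat.sub_self, mul_zero, pow_zero, map_one, mul_one]

end IsSplit

end Vanishing

section Strip

lemma RegInv.train {O : Subalgebra K L} {v : ι → L} {i : ι}
    (h : ∀ x ∈ xs, RegInv O (Rm i x (v i / v x) : Op ι n L)) : RegInv O (train (Rv n v) xs i) :=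
  RegInv.list_prod fun M hM => by aesop

lemma RegInv.trainR {O : Subalgebra K L} {v : ι → L} {i : ι}
    (h : ∀ x ∈ xs, RegInv O (Rm x i (v x / v i) : Op ι n L)) :
    RegInv O (MatrixShuffle.trainR n v xs i) :=
  RegInv.list_prod fun M hM => by grind

lemma RegInv.map_prod {ι κ : Type*} [Fintype ι] [DecidableEq ι]
    {O : Subalgebra K L} {l : List κ} {F : κ → Op ι n L} (h : ∀ x ∈ l, RegInv O (F x)) :
    RegInv O (l.map F).prod :=
  RegInv.list_prod fun M hM => by grind

lemma entriesIn_of_trains {L : Type*} [Field L]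
    [Algebra K L] {O : Subalgebra K L} {v u : ι → L} (hv : ∀ i, v i ≠ 0) (hu : ∀ i, u i ≠ 0)
    {es fs : List ι} {i a : ι} {G P : Op ι n L} {π : L} (hxs : xs.Nodup) (hes : es.Nodup)
    (hi : ∀ x ∈ xs, x ≠ i ∧ v i ≠ v x ∧ u i ≠ u x)
    (he : ∀ e ∈ es, (e ≠ i ∧ v i ≠ v e ∧ u i ≠ u e) ∧ ∀ x ∈ xs, x ≠ e ∧ v e ≠ v x ∧ u e ≠ u x)
    (hes' : ∀ e ∈ es, RegInv O (Rm i e (v i / v e) : Op ι n L) ∧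
      RegInv O (Rm e i (u e / u i) : Op ι n L))
    (htr : ∀ j ∈ es ++ fs, ∀ x ∈ xs, RegInv O (Rm j x (v j / v x) : Op ι n L) ∧
      RegInv O (Rm x j (u x / u j) : Op ι n L))
    (ha : ∀ x ∈ xs, RegInv O (Rm a x (v a / v x) : Op ι n L)) (hP : RegInv O P)
    (hstrip : ∀ G' : Op ι n L, (∀ x ∈ xs, TrivOn x G → TrivOn x G') →
      EntriesIn O (π • (train (Rv n v) xs i * G' * trainR n u xs i)) → EntriesIn O G')
    (h : EntriesIn O (π • ((((es ++ i :: fs) ++ [a]).reverse.map (train (Rv n v) xs)).prod * G *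
      ((es ++ i :: fs).map (trainR n u xs)).prod * P))) : EntriesIn O G := by
  set ρ := train (Rv n v) es i with hρ; set ρ' := trainR n u es i with hρ'
  have hρu : RegInv O ρ := RegInv.train fun e h => (hes' e h).1
  have hρu' : RegInv O ρ' := RegInv.trainR fun e h => (hes' e h).2
  set ΛE := (es.reverse.map (train (Rv n v) xs)).prod with hΛE
  set ΛE' := (es.map (trainR n u xs)).prod with hΛE'
  have hΛu : RegInv O ΛE := RegInv.map_prod fun j hj => RegInv.train fun x hx =>
    (htr j (List.mem_append_left _ (List.mem_reverse.1 hj)) x hx).1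
  have hΛu' : RegInv O ΛE' := RegInv.map_prod fun j hj => RegInv.trainR fun x hx =>
    (htr j (List.mem_append_left _ hj) x hx).2
  have t1 : ΛE * train (Rv n v) xs i * ρ = ρ * train (Rv n v) xs i * ΛE :=
    train_train (isYB_Rv v hv) hxs (fun x hx => ⟨(hi x hx).1, (hi x hx).2.1⟩) es hes
      fun e h => ⟨(he e h).1.1, (he e h).1.2.1, fun x hx => ⟨((he e h).2 x hx).1,
        ((he e h).2 x hx).2.1⟩⟩
  have t2 : ρ' * trainR n u xs i * ΛE' = ΛE' * trainR n u xs i * ρ' := by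
    have := train_train (isYB_RvOp (n := n) u hu) hxs (fun x hx => ⟨(hi x hx).1, (hi x hx).2.2⟩) es
      hes fun e h => ⟨(he e h).1.1, (he e h).1.2.2, fun x hx => ⟨((he e h).2 x hx).1,
        ((he e h).2 x hx).2.2⟩⟩
    have := congrArg MulOpposite.unop this
    simp only [MulOpposite.unop_mul, unop_list_prod, unop_train, List.reverse_reverse] at this
    simpa only [mul_assoc] using this
  obtain ⟨ρi, r1, r2, r3, r4⟩ := id hρu; obtain ⟨ρi', s1, s2, s3, s4⟩ := id hρu'
  have t1' : train (Rv n v) xs i * ΛE = ρi * ΛE * train (Rv n v) xs i * ρ := by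
    rw [mul_assoc ρi, mul_assoc ρi, t1, ← mul_assoc, ← mul_assoc, r2, one_mul]
  have t2' : ΛE' * trainR n u xs i = ρ' * trainR n u xs i * ΛE' * ρi' := by
    rw [t2, mul_assoc _ ρ', s1, mul_one]
  set A := train (Rv n v) xs a * (fs.reverse.map (train (Rv n v) xs)).prod with hA
  set B := (fs.map (trainR n u xs)).prod * P with hB
  have hAu : RegInv O A := (RegInv.train ha).mul (RegInv.map_prod fun j hj => RegInv.train fun x hx =>
    (htr j (List.mem_append_right _ (List.mem_reverse.1 hj)) x hx).1)
  have hBu : RegInv O B := (RegInv.map_prod fun j hj => RegInv.trainR fun x hx =>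
    (htr j (List.mem_append_right _ hj) x hx).2).mul hP
  have heq : (((es ++ i :: fs) ++ [a]).reverse.map (train (Rv n v) xs)).prod * G *
      ((es ++ i :: fs).map (trainR n u xs)).prod * P =
      (A * ρi * ΛE) * ((train (Rv n v) xs i * (ρ * G * ρ') * trainR n u xs i) *
        (ΛE' * ρi' * B)) := by
    have e1 : (((es ++ i :: fs) ++ [a]).reverse.map (train (Rv n v) xs)).prod =
        A * (train (Rv n v) xs i * ΛE) := by
      simp only [List.reverse_append, List.reverse_cons, List.reverse_nil, List.nil_append,
        List.map_append, List.map_cons, List.map_nil, List.prod_append, List.prod_cons,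
        List.prod_nil, mul_one, hA, hΛE, mul_assoc]
    have e2 : ((es ++ i :: fs).map (trainR n u xs)).prod * P = (ΛE' * trainR n u xs i) * B := by
      simp only [List.map_append, List.map_cons, List.prod_append, List.prod_cons, hB, hΛE',
        mul_assoc]
    rw [e1, mul_assoc _ _ P, e2, t1', t2']; simp only [mul_assoc]
  rw [heq, ← mul_smul_comm, ← smul_mul_assoc] at h; have hρi : RegInv O ρi := ⟨ρ, r2, r1, r4, r3⟩
  have hρi' : RegInv O ρi' := ⟨ρ', s2, s1, s4, s3⟩
  have h1 := RegInv.of_mul_right ((hΛu'.mul hρi').mul hBu)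
    (RegInv.of_mul_left ((hAu.mul hρi).mul hΛu) h)
  have h2 := hstrip _ (fun x hx hG => ?_) h1
  · exact RegInv.of_mul_left hρu (RegInv.of_mul_right hρu' h2)
  · have hxe : x ∉ es := fun hxe => ((he x hxe).2 x hx).1 rfl
    exact ((TrivOn.train (hi x hx).1 hxe).mul hG).mul (TrivOn.trainR (hi x hx).1 hxe)

end Strip

section Regular

/-- The function has a nonzero value. -/
def NonzeroAt (w : Fin k → RatFun u) (φ : RatFun k) : Prop := ∃ v, v ≠ 0 ∧ HasValueAt w φ v

section

variable {w : Fin k → RatFun u}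

lemma NonzeroAt.mul (h : NonzeroAt w φ) (h' : NonzeroAt w ψ) : NonzeroAt w (φ * ψ) := by
  obtain ⟨v, hv, hφ⟩ := h; obtain ⟨v', hv', hψ⟩ := h'; exact ⟨_, mul_ne_zero hv hv', hφ.mul hψ⟩

lemma NonzeroAt.prod {κ : Type*} (s : Finset κ) {φ : κ → RatFun k}
    (h : ∀ i ∈ s, NonzeroAt w (φ i)) : NonzeroAt w (∏ i ∈ s, φ i) := by
  classical
  induction s using Finset.induction_on with
  | empty => exact ⟨1, one_ne_zero, by simpa using HasValueAt.one⟩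
  | insert a s ha ih =>
    rw [prod_insert ha]
    exact (h a (Finset.mem_insert_self _ _)).mul (ih fun i hi => h i (Finset.mem_insert_of_mem hi))

lemma NonzeroAt.const {c : K} (hc : c ≠ 0) : NonzeroAt w (cst c) :=
  ⟨_, ofK_ne_zero hc, HasValueAt.const c⟩

lemma NonzeroAt.entriesIn (h : NonzeroAt w φ) {M : Tensor n k}
    (hM : EntriesIn (valRing w) (φ • M)) : EntriesIn (valRing w) M := by
  obtain ⟨v, hv, hφ⟩ := h; exact hM.of_smul (hφ.inv_mem hv) (hφ.ne_zero hv)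

end

lemma prod_block_eq {e : ℕ} (he : e ≤ k) {M : Type*} [CommMonoid M] (F : ℕ → M) :
    ∏ x : Fin k with a ≤ x ∧ x.val < e, F x.val = ∏ m ∈ Finset.Ico a.val e, F m := by
  refine Finset.prod_bij (fun x _ => x.val) (fun x hx => ?_) (fun x _ y _ h => Fin.ext h)
    (fun m hm => ?_) fun x _ => rfl
  · exact mem_Ico.2 (mem_filter.1 hx).2
  · rw [mem_Ico] at hm; exact ⟨⟨m, by lia⟩, (mem_filter_univ _).2 hm, rfl⟩

lemma prod_inner_eq {e : ℕ} (he : e ≤ k) {M : Type*} [CommMonoid M] (F : ℕ → M) :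
    ((inner a e).map fun x => F x.val).prod = ∏ m ∈ Finset.Ico (a.val + 1) e, F m := by
  rw [inner, prod_map_filter_finRange]
  refine Finset.prod_bij (fun x _ => x.val) (fun x hx => ?_) (fun x _ y _ h => Fin.ext h)
    (fun m hm => ?_) fun x _ => rfl
  · exact mem_Ico.2 (mem_filter.1 hx).2
  · rw [mem_Ico] at hm; exact ⟨⟨m, by lia⟩, (mem_filter_univ _).2 hm, rfl⟩

namespace IsSplit

variable {b₀ b₁ : Fin k → Fin k} {e : ℕ} (h : IsSplit b₀ b₁ a e) (hi : i < a) {α : K}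

include h

lemma vR_lt (hj : j < a) : vR n b₁ (pt n b₁) j = z j * cst (qbar n ^ 2) := by
  rw [h.vR_before hj, h.vR_old_lt (lt_trans hj h.lt), h.pt_before hj]

lemma vR_inner {x : Fin k} (hx : x ∈ inner a e) :
    vR n b₁ (pt n b₁) x = z a * cst (qbar n ^ (2 * (x.val - a.val))) := by
  rw [h.vR_nonhead (Or.inl hx)]; exact h.pt_block (mem_inner.1 hx).1.le (mem_inner.1 hx).2

lemma crossFactor_eq (hi : i < a) : crossFactor n a e (pt n b₁) i =
    ((inner a e).map fun x => pt n b₁ x * vR n b₁ (pt n b₁) i).prod *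
    ((z i - z a * cst (qbar n ^ (2 * (e - a.val)))) * (z a - z i * cst (qbar n ^ 2))) *
    ((inner a e).map fun x => (1 - pt n b₁ i / pt n b₁ x) *
      (1 - vR n b₁ (pt n b₁) x / vR n b₁ (pt n b₁) i)).prod := by
  have hlt := h.lt; have hle := h.le
  set F : ℕ → RatFun k := fun m => z i - z a * cst (qbar n ^ (2 * (m - a.val))) with hF
  set H : ℕ → RatFun k := fun m =>
    z a * cst (qbar n ^ (2 * (m - a.val))) - z i * cst (qbar n ^ 2) with hH
  have h1 : crossFactor n a e (pt n b₁) i =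
      ∏ x : Fin k with a ≤ x ∧ x.val < e, F (x.val + 1) * H x.val := by
    refine prod_congr rfl fun x hx => ?_; obtain ⟨-, h1, h2⟩ := mem_filter.1 hx
    rw [h.pt_before hi, h.pt_block h1 h2, hF, hH, mul_assoc, ← map_mul, ← pow_add]; congr 6; lia
  have h2 : ∏ x : Fin k with a ≤ x ∧ x.val < e, F (x.val + 1) * H x.val =
      ∏ m ∈ Finset.Ico a.val e, F (m + 1) * H m :=
    prod_block_eq hle fun m => F (m + 1) * H m
  have h3 : ((inner a e).map fun x => pt n b₁ x * vR n b₁ (pt n b₁) i).prod *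
    ((inner a e).map fun x => (1 - pt n b₁ i / pt n b₁ x) *
      (1 - vR n b₁ (pt n b₁) x / vR n b₁ (pt n b₁) i)).prod =
      ((inner a e).map fun x => F x.val * H x.val).prod := by
    rw [← List.prod_map_mul]; congr 1; refine map_congr_left fun x hx => ?_
    have hx' := mem_inner.1 hx; have n1 : pt n b₁ x ≠ 0 := pt_ne_zero b₁ x
    have n2 : vR n b₁ (pt n b₁) i ≠ 0 := by
      rw [h.vR_lt hi]; exact mul_ne_zero (z_ne_zero _) (ofK_ne_zero (qbar_pow_ne_zero n _))
    have e1 : pt n b₁ x * vR n b₁ (pt n b₁) i * ((1 - pt n b₁ i / pt n b₁ x) *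
      (1 - vR n b₁ (pt n b₁) x / vR n b₁ (pt n b₁) i)) =
      (pt n b₁ i - pt n b₁ x) * (vR n b₁ (pt n b₁) x - vR n b₁ (pt n b₁) i) := by
      grind
    rw [e1, h.vR_lt hi, h.vR_inner hx, h.pt_before hi, h.pt_block hx'.1.le hx'.2]
  rw [mul_right_comm, h3, h1, h2, prod_inner_eq hle fun m => F m * H m, prod_mul_distrib,
    prod_mul_distrib, Finset.prod_Ico_add' F, Finset.prod_Ico_succ_top (by lia),
    Finset.prod_eq_prod_Ico_succ_bot hlt H]
  grind

include hi

lemma hasVal_block {x : Fin k} (hx : a ≤ x) : HasValueAt (hyper i a α) (pt n b₁ x) (pt n b₁ x) := by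
  have := h.hasVal_hyper (n := n) hi (α := α) x
  rwa [hyperPt_ne (by rintro rfl; exact absurd hi (not_lt.2 hx))] at this

lemma nonzeroAt_blockFactor (hn : 2 ≤ n) (hb : IsBlk b₁) :
    NonzeroAt (hyper i a α) (blockFactor n a e (pt n b₁)) := by
  refine (NonzeroAt.prod _ fun p hp => ?_).mul (NonzeroAt.prod _ fun p hp => ?_)
  · obtain ⟨-, h1, h2, h3⟩ := mem_filter.1 hp; have hnd := pt_div_nondeg hn hb h1.ne
    exact ⟨_, hnd.f_ne_zero, ((h.hasVal_block hi h2.le).div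
      (h.hasVal_block hi (h2.trans h1).le) (pt_ne_zero _ _)).f hnd.2.1⟩
  · obtain ⟨-, h1, ⟨h2, h2'⟩, ⟨h3, h3'⟩, h4⟩ := mem_filter.1 hp
    refine ⟨_, ?_, (h.hasVal_block hi h2).sub ((h.hasVal_block hi h3).mul (HasValueAt.const _))⟩
    rw [sub_ne_zero, h.pt_block h2 h2', h.pt_block h3 h3', mul_assoc, ← map_mul, ← pow_add]
    intro heq; have h5 := (cst).injective (mul_left_cancel₀ (z_ne_zero a) heq)
    have h6 := (q_qbar_inj hn (a := 0) (c := 0) (b := 2 * (p.1.val - a.val))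
      (d := 2 * (p.2.val - a.val) + 2) (by rw [pow_zero, one_mul, one_mul]; exact h5)).2
    rw [le_def] at h2 h3; lia

lemma nonzeroAt_cross (hj : j < a) (hji : j ≠ i) :
    NonzeroAt (hyper i a α) (crossFactor n a e (pt n b₁) j) := by
  refine NonzeroAt.prod _ fun x hx => ?_; obtain ⟨-, h1, h2⟩ := mem_filter.1 hx
  have hvj : HasValueAt (hyper i a α) (pt n b₁ j) (z j * ofK 1) := by
    have := h.hasVal_hyper (n := n) hi (α := α) j; rw [hyperPt_ne hji] at this
    rwa [map_one, mul_one, ← h.pt_before hj]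
  have hvx := h.hasVal_block (n := n) hi (α := α) h1; rw [h.pt_block h1 h2] at hvx ⊢
  refine NonzeroAt.mul ⟨_, ?_, hvj.sub (hvx.mul (HasValueAt.const _))⟩
    ⟨_, ?_, hvx.sub (hvj.mul (HasValueAt.const _))⟩
  · rw [sub_ne_zero, mul_assoc, ← map_mul]; exact z_mul_ne hj.ne one_ne_zero
  · rw [sub_ne_zero, mul_assoc, ← map_mul]; exact z_mul_ne hj.ne' (qbar_pow_ne_zero n _)

/-- The two exceptional factors. -/
theorem exceptional (hn : 2 ≤ n) (hα0 : α ≠ 0) :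
    NonzeroAt (hyper i a α) ((z i - z a * cOn k (qbar n ^ (2 * (e - a.val)))) *
      (z a - z i * cOn k (qbar n ^ 2))) ∨
    ((α = qbar n ^ (2 * (e - a.val)) ∨ α * qbar n ^ 2 = 1) ∧ ∃ c, NonzeroAt (hyper i a α) c ∧
      (z i - z a * cOn k (qbar n ^ (2 * (e - a.val)))) *
      (z a - z i * cOn k (qbar n ^ 2)) =
      c * (z i - cOn k α * z a)) := by
  have hlt := h.lt
  have hvi : HasValueAt (hyper i a α) (z i) (z a * ofK α) := by
    have := HasValueAt.z (w := hyper i a α) i; rwa [hyper_self, mul_comm] at this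
  have hva : HasValueAt (hyper i a α) (z a) (z a) := by
    have := HasValueAt.z (w := hyper i a α) a; rwa [hyper_ne hi.ne'] at this
  have hone : ∀ m, m ≠ 0 → qbar n ^ m ≠ 1 := by
    intro m hm h1
    have h2 := (q_qbar_inj hn (a := 0) (c := 0) (b := m) (d := 0) (by simpa using h1)).2
    exact hm h2
  have n1 : α ≠ qbar n ^ (2 * (e - a.val)) → NonzeroAt (hyper i a α)
      (z i - z a * cOn k (qbar n ^ (2 * (e - a.val)))) := fun h1 =>
    ⟨_, by
      rw [← mul_sub, ← map_sub]; exact mul_ne_zero (z_ne_zero _) (ofK_ne_zero (sub_ne_zero.2 h1)),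
      hvi.sub (hva.mul (HasValueAt.const _))⟩
  have n2 : α * qbar n ^ 2 ≠ 1 → NonzeroAt (hyper i a α)
      (z a - z i * cOn k (qbar n ^ 2)) := fun h1 =>
    ⟨z a * cOn k (1 - α * qbar n ^ 2),
      mul_ne_zero (z_ne_zero _) (ofK_ne_zero (sub_ne_zero.2 h1.symm)), by
      have := hva.sub (hvi.mul (HasValueAt.const (qbar n ^ 2))); grind⟩
  by_cases h1 : α = qbar n ^ (2 * (e - a.val))
  · refine Or.inr ⟨Or.inl h1, _, n2 ?_, ?_⟩
    · rw [h1, ← pow_add]; exact hone _ (by lia)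
    · grind
  · by_cases h2 : α * qbar n ^ 2 = 1
    · refine Or.inr ⟨Or.inr h2, (z i - z a * cOn k (qbar n ^ (2 * (e - a.val)))) *
        cOn k (- qbar n ^ 2), (n1 h1).mul (NonzeroAt.const ?_), ?_⟩
      · exact neg_ne_zero.2 (qbar_pow_ne_zero n _)
      · have h3 : cOn k α * cOn k (qbar n ^ 2) = 1 := by
          rw [← map_mul, h2, map_one]
        grind
    · exact Or.inl ((n1 h1).mul (n2 h2))

end IsSplit

end Regular

section Regular

/-- The tensor `Y` solves the wheel condition for the decomposition `b`. -/
structure IsWheel (X : Tensor n k) (b : Fin k → Fin k) (γ : Perm (Fin k)) (Y : Tensor n k)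
    (κ : K) : Prop where
  cyc : IsCyc b γ
  triv : ∀ x, b x ≠ x → TrivOn x Y
  ne_zero : κ ≠ 0
  val : MVal (pt n b) (poles k n • X) ((cst κ * scl b (pt n b) * den n b (pt n b)) •
      (lft b (pt n b) * Y * rgt b (pt n b) * Pm (RatFun k) γ))

namespace IsSplit

variable {b₀ b₁ : Fin k → Fin k} {e : ℕ} (h : IsSplit b₀ b₁ a e) (hi : i < a) {α : K} {Y₀ Y₁ : Tensor n k} {γ₀ γ₁ : Perm (Fin k)} {κ₀ κ₁ : K}

include h hi

lemma value_zero (hn : 2 ≤ n) (hb : IsBlk b₁) (hX : X ∈ bigSpace n k)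
    (W₀ : IsWheel X b₀ γ₀ Y₀ κ₀) (hY : EntriesIn (laurent k) (polesBelow n k e • Y₀))
    {a' : Fin k} (ha' : a'.val + 1 = a.val)
    (hbig : MVal (pt n fun j => if b₁ j = a then a' else b₁ j) (poles k n • X) 0)
    (hα0 : α ≠ 0) (hα : α = qbar n ^ (2 * (e - a.val)) ∨ α * qbar n ^ 2 = 1) {Z : Tensor n k}
    (hZ : MVal (pt n b₁) (polesBelow n k e • Y₀) Z) : MVal (hyper i a α) Z 0 := by
  obtain ⟨hpoint, h0⟩ := h.vanish_hyper hi hn hb hX ha' hbig hα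
  obtain ⟨Z', hZ', hval⟩ := hpoint.value (h.isBlk_old hb) hX W₀.val hY; have h1 := hval.unique h0
  have h2 : Z' = 0 := by
    refine eq_of_smul_conj hpoint.isUnit_lft hpoint.isUnit_rgt
      (RegInv.pm (O := ⊤) (n := n) (L := RatFun k) γ₀).isUnit (mul_ne_zero (mul_ne_zero
        (ofK_ne_zero W₀.ne_zero) hpoint.scl_ne_zero)
        (hpoint.denAbove_ne_zero hn (h.isBlk_old hb))) (h1.trans ?_)
    simp
  subst h2; intro I J
  obtain ⟨v', e1, e2⟩ := laurent_value_trans (w := pt n b₁) (w' := hyper i a α)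
    (w'' := hyperPt n b₁ i a α) (pt_ne_zero b₁) hpoint.ne_zero
    (fun j => h.hasVal_hyper hi j) (hY I J) (hZ I J)
  rwa [e2.unique (hZ' I J)] at e1

theorem regular_hyper (hn : 2 ≤ n) (hb : IsBlk b₁) (hX : X ∈ bigSpace n k)
    (W₀ : IsWheel X b₀ γ₀ Y₀ κ₀) (W₁ : IsWheel X b₁ γ₁ Y₁ κ₁)
    (hY : EntriesIn (laurent k) (polesBelow n k e • Y₀))
    {a' : Fin k} (ha' : a'.val + 1 = a.val)
    (hbig : MVal (pt n fun j => if b₁ j = a then a' else b₁ j) (poles k n • X) 0)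
    (hα0 : α ≠ 0) : EntriesIn (valRing (hyper i a α)) (polesBelow n k a • Y₁) := by
  obtain ⟨Z, hZ, hrel⟩ := h.relation hn hb hX W₀.cyc W₁.cyc W₀.ne_zero W₀.val W₁.val W₁.triv hY
  have hZl : EntriesIn (laurent k) Z := fun I J => laurent_value (pt_ne_zero b₁)
    (fun j => mul_mem (z_mem_laurent _) (const_mem_laurent _))
    (fun j => by
      rw [pt, mul_inv, ← map_inv₀]
      exact mul_mem (z_inv_mem_laurent _) (const_mem_laurent _)) (hY I J) (hZ I J)
  set O := valRing (hyper i a α) with hO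
  have hlO : laurent k ≤ O := laurent_le_valRing (hyper_ne_zero i a hα0); set v := pt n b₁ with hv
  set u := vR n b₁ v with hu; set G := polesBelow n k a • Y₁ with hG
  set M := ((before a ++ [a]).reverse.map (train (Rv n v) (inner a e))).prod * G *
    ((before a).map (trainR n u (inner a e))).prod * Pm (RatFun k) (γ₁ * γ₀⁻¹) with hM
  set π := ((inner a e).map fun x => (1 - v i / v x) * (1 - u x / u i)).prod with hπ
  have hlt := h.lt
  -- values of the coordinates
  have vlt : ∀ {j}, j < a → j ≠ i → HasValueAt (hyper i a α) (v j) (z j * ofK 1) := by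
    intro j hj hji; have := h.hasVal_hyper (n := n) hi (α := α) j; rw [hyperPt_ne hji] at this
    rwa [map_one, mul_one, ← h.pt_before hj]
  have vi : HasValueAt (hyper i a α) (v i) (z a * ofK α) := by
    have := h.hasVal_hyper (n := n) hi (α := α) i; rwa [hyperPt_self] at this
  have vx : ∀ {x}, x ∈ inner a e → HasValueAt (hyper i a α) (v x)
      (z a * ofK (qbar n ^ (2 * (x.val - a.val)))) := by
    intro x hx; have := h.hasVal_block (n := n) hi (α := α) (mem_inner.1 hx).1.le; rw [hv]
    rwa [h.pt_block (mem_inner.1 hx).1.le (mem_inner.1 hx).2] at this ⊢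
  have ult : ∀ {j}, j < a → u j = v j * ofK (qbar n ^ 2) := by
    intro j hj; rw [hu, h.vR_lt hj, hv, h.pt_before hj]
  have ux : ∀ {x}, x ∈ inner a e → u x = v x := fun hx => h.vR_nonhead (Or.inl hx)
  have vulm : ∀ {j}, j < a → j ≠ i → HasValueAt (hyper i a α) (u j) (z j * ofK (qbar n ^ 2)) := by
    intro j hj hji; rw [ult hj]; have := (vlt hj hji).mul (HasValueAt.const (qbar n ^ 2))
    rwa [mul_assoc, ← map_mul, one_mul] at this
  have vui : HasValueAt (hyper i a α) (u i) (z a * ofK (α * qbar n ^ 2)) := by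
    rw [ult hi]; have := vi.mul (HasValueAt.const (qbar n ^ 2)); rwa [mul_assoc, ← map_mul] at this
  have zc : ∀ (c : Fin k) {κ : K}, κ ≠ 0 → z c * cOn k κ ≠ 0 := fun c κ hκ =>
    mul_ne_zero (z_ne_zero _) (ofK_ne_zero hκ)
  have hQ := qbar_pow_ne_zero n; have hαQ : α * qbar n ^ 2 ≠ 0 := mul_ne_zero hα0 (hQ 2)
  -- the scalar factors
  obtain ⟨U, hU, hUM⟩ : ∃ U, NonzeroAt (hyper i a α) U ∧ Z = (U * ((z i - z a *
      cOn k (qbar n ^ (2 * (e - a.val)))) *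
      (z a - z i * cOn k (qbar n ^ 2)))) • (π • M) := by
    refine ⟨cOn k (κ₁ / κ₀) * blockFactor n a e v *
      (∏ j ∈ (Finset.univ.filter (· < a)).erase i, crossFactor n a e v j) *
      ((inner a e).map fun x => v x * u i).prod, ?_, ?_⟩
    · refine (((NonzeroAt.const (div_ne_zero W₁.ne_zero W₀.ne_zero)).mul
        (h.nonzeroAt_blockFactor hi hn hb)).mul (NonzeroAt.prod _ fun j hj => ?_)).mul ?_
      · rw [Finset.mem_erase, Finset.mem_filter] at hj; exact h.nonzeroAt_cross hi hj.2.2 hj.1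
      · rw [inner, prod_map_filter_finRange]; refine NonzeroAt.prod _ fun x hx => ?_
        have hx' : x ∈ inner a e := mem_inner.2 (Finset.mem_filter.1 hx).2
        exact ⟨_, mul_ne_zero (zc a (hQ _)) (zc a hαQ), (vx hx').mul vui⟩
    · have hcr : ∏ j with j < a, crossFactor n a e v j = crossFactor n a e v i *
          ∏ j ∈ (Finset.univ.filter (· < a)).erase i, crossFactor n a e v j :=
        (Finset.mul_prod_erase _ _ (by simpa using hi)).symm
      rw [hrel, hcr, h.crossFactor_eq hi, smul_smul]; congr 1; rw [hπ]; ring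
  have hlast : EntriesIn O (π • M) := by
    rcases h.exceptional hi hn hα0 with hE | ⟨hα, c, hc, hE⟩
    · refine (hU.mul hE).entriesIn ?_; rw [← hUM]; exact fun I J => hlO (hZl I J)
    · have hzero := h.value_zero hi hn hb hX W₀ hY ha' hbig hα0 hα hZ
      refine (hU.mul hc).entriesIn fun I J => ?_
      have h1 := hlO (laurent_div hi.ne hα0 (hZl I J) (hzero I J))
      have h2 : Z I J = (U * (c * (z i - cOn k α * z a))) * (π • M) I J := by
        rw [hUM, hE]; rfl
      rw [h2] at h1; have h3 := hyper_form_ne_zero hi.ne α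
      have h4 : U * (c * (z i - cOn k α * z a)) * (π • M) I J *
          (z i - cOn k α * z a)⁻¹ = (U * c) * (π • M) I J := by
        field_simp
      rw [h4] at h1; exact h1
  -- stripping
  have hbefore : before a = before i ++ i :: ((List.finRange k).filter fun x => i < x ∧ x < a) := by
    refine eq_of_sorted before_sorted (sorted_append before_sorted (List.pairwise_cons.2
      ⟨fun x hx => ?_, finRange_sorted.filter _⟩) fun x hx y hy => ?_) fun x => ?_ <;>
    grind [mem_before]
  have hesfs : ∀ j ∈ before i ++ (List.finRange k).filter fun x => i < x ∧ x < a,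
      j < a ∧ j ≠ i := by grind [mem_before]
  have hv0 : ∀ j, v j ≠ 0 := pt_ne_zero b₁
  have hu0 : ∀ j, u j ≠ 0 := by
    intro j; obtain ⟨c, hc, e⟩ := vR_pt_eq (n := n) b₁ j; rw [hu, hv, e]; exact zc _ hc
  have hxa : ∀ {x}, x ∈ inner a e → ∀ {j}, j < a → x ≠ j ∧ v j ≠ v x ∧ u j ≠ u x := by
    intro x hx j hj; refine ⟨fun hxj => ?_, ?_, ?_⟩
    · rw [hxj, mem_inner] at hx; exact absurd hj (not_lt.2 hx.1.le)
    · have := z_mul_ne hj.ne (c := 1) (c' := qbar n ^ (2 * (x.val - a.val))) one_ne_zero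
      rwa [map_one, mul_one, ← h.pt_before (n := n) hj, ← h.pt_block (mem_inner.1 hx).1.le
        (mem_inner.1 hx).2] at this
    · have := z_mul_ne hj.ne (c := qbar n ^ 2) (c' := qbar n ^ (2 * (x.val - a.val))) (hQ 2)
      rwa [← h.vR_lt hj, ← h.vR_inner hx] at this
  rw [hM, hbefore] at hlast
  refine entriesIn_of_trains hv0 hu0 (inner_sorted.imp ne_of_lt) (before_sorted.imp ne_of_lt)
    (fun x hx => hxa hx hi) (fun j hj => ⟨?_, fun x hx => hxa hx ((mem_before.1 hj).trans hi)⟩)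
    (fun j hj => ?_) (fun j hj x hx => ?_) (fun x hx => ?_) (RegInv.pm _)
    (fun G' hG' hstrip => ?_) hlast
  · rw [mem_before] at hj; have hja := hj.trans hi; refine ⟨hj.ne, ?_, ?_⟩
    · rw [hv, h.pt_before hi, h.pt_before hja]
      have := z_mul_ne hj.ne' (c := 1) (c' := 1) one_ne_zero
      rwa [map_one, mul_one, mul_one] at this
    · rw [hu, h.vR_lt hi, h.vR_lt hja]; exact z_mul_ne hj.ne' (hQ 2)
  · rw [mem_before] at hj; have hja := hj.trans hi
    exact ⟨RegInv.rm_of_value hj.ne' (vi.div (vlt hja hj.ne) (zc j one_ne_zero))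
        (z_div_nondeg hja.ne' hα0 one_ne_zero),
      RegInv.rm_of_value hj.ne ((vulm hja hj.ne).div vui (zc a hαQ))
        (z_div_nondeg hja.ne (hQ 2) hαQ)⟩
  · obtain ⟨hja, hji⟩ := hesfs j hj; have hne := (hxa hx hja).1; have vux := vx hx
    rw [← ux hx] at vux
    exact ⟨RegInv.rm_of_value hne.symm ((vlt hja hji).div (vx hx) (zc a (hQ _)))
        (z_div_nondeg hja.ne one_ne_zero (hQ _)),
      RegInv.rm_of_value hne (vux.div (vulm hja hji) (zc j (hQ 2)))
        (z_div_nondeg hja.ne' (hQ _) (hQ 2))⟩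
  · have hax := (mem_inner.1 hx).1
    exact RegInv.rm_of_value hax.ne ((h.hasVal_block hi le_rfl).div
      (h.hasVal_block hi hax.le) (hv0 x)) (pt_div_nondeg hn hb hax.ne)
  · refine strip_trains hn (inner a e) (inner_sorted.imp ne_of_lt) (fun x hx => ?_) hstrip
    obtain ⟨h1, h2, h3⟩ := hxa hx hi; have hxe := mem_inner.1 hx
    have hT : TrivOn x G := (W₁.triv x (by rw [h.eq_block x hxe.1.le hxe.2]; exact hxe.1.ne)).smul _
    have vux := vx hx; rw [← ux hx] at vux; set Q := qbar n ^ (2 * (x.val - a.val)) with hQdef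
    have hQ0 : Q ≠ 0 := hQ _
    have hav : HasValueAt (hyper i a α) (v i / v x) (ofK (α / Q)) := by
      have := vi.div (vx hx) (zc a hQ0)
      rwa [mul_div_mul_left _ _ (z_ne_zero a), ← map_div₀] at this
    have hbv : HasValueAt (hyper i a α) (u x / u i) (ofK (Q / (α * qbar n ^ 2))) := by
      have := vux.div vui (zc a hαQ); rwa [mul_div_mul_left _ _ (z_ne_zero a), ← map_div₀] at this
    have ha0 : cOn k (α / Q) ≠ 0 := ofK_ne_zero (div_ne_zero hα0 hQ0)
    have hb0 : cOn k (Q / (α * qbar n ^ 2)) ≠ 0 :=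
      ofK_ne_zero (div_ne_zero hQ0 hαQ)
    refine ⟨h1, hG' x hx hT, ⟨fun h => h2 ((div_eq_one_iff_eq (hv0 x)).1 h),
      div_ne_zero (hv0 _) (hv0 _), hav.mem, hav.inv_mem ha0⟩,
      ⟨fun h => h3 ((div_eq_one_iff_eq (hu0 i)).1 h).symm,
      div_ne_zero (hu0 _) (hu0 _), hbv.mem, hbv.inv_mem hb0⟩, ?_⟩
    have hq := q_ne_zero; by_contra hcon; rw [not_or] at hcon
    have hA : α * q ^ 2 = Q ∨ α = Q * q ^ 2 := by
      by_contra hc; rw [not_or] at hc; refine hcon.1 (hav.fUnit (fun h => hc.1 ?_) fun h => hc.2 ?_) <;>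
      · rw [← map_mul] at h
        have h' := (cOn k).injective (h.trans (map_one _).symm); field_simp at h'; exact h'
    have hB : Q * q ^ 2 = α * qbar n ^ 2 ∨ Q = α * qbar n ^ 2 * q ^ 2 := by
      by_contra hc; rw [not_or] at hc; refine hcon.2 (hbv.fUnit (fun h => hc.1 ?_) fun h => hc.2 ?_) <;>
      · rw [← map_mul] at h
        have h' := (cOn k).injective (h.trans (map_one _).symm)
        rw [div_mul_eq_mul_div, div_eq_one_iff_eq hαQ] at h'; grind
    rcases hA with hA | hA <;> rcases hB with hB | hB
    · have : α * (q ^ 4 * qbar n ^ 0) = α * (q ^ 0 * qbar n ^ 2) := by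
        linear_combination q ^ 2 * hA + hB
      exact absurd (q_qbar_inj hn (mul_left_cancel₀ hα0 this)).1 (by norm_num)
    · have : (α * q ^ 2) * (q ^ 0 * qbar n ^ 0) = (α * q ^ 2) * (q ^ 0 * qbar n ^ 2) := by
        linear_combination hA + hB
      exact absurd (q_qbar_inj hn (mul_left_cancel₀ (mul_ne_zero hα0 (pow_ne_zero 2 hq)) this)).2
        (by norm_num)
    · have : α * (q ^ 0 * qbar n ^ 0) = α * (q ^ 0 * qbar n ^ 2) := by linear_combination hA + hB
      exact absurd (q_qbar_inj hn (mul_left_cancel₀ hα0 this)).2 (by norm_num)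
    · have : α * (q ^ 0 * qbar n ^ 0) = α * (q ^ 4 * qbar n ^ 2) := by
        linear_combination hA + q ^ 2 * hB
      exact absurd (q_qbar_inj hn (mul_left_cancel₀ hα0 this)).1 (by norm_num)

end IsSplit

end Regular

section Tame

/-- Invertibility in a subalgebra, for nonzero elements. -/
def InvIn (O : Subalgebra K L) (x : L) : Prop := x ≠ 0 ∧ x⁻¹ ∈ O

section

variable {O : Subalgebra K L}

lemma InvIn.mul {x y : L} (hx : InvIn O x) (hy : InvIn O y) : InvIn O (x * y) :=
  ⟨mul_ne_zero hx.1 hy.1, by rw [mul_inv]; exact mul_mem hx.2 hy.2⟩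

lemma InvIn.prod {κ : Type*} (s : Finset κ) {φ : κ → L} (h : ∀ i ∈ s, InvIn O (φ i)) :
    InvIn O (∏ i ∈ s, φ i) :=
  ⟨prod_ne_zero_iff.2 fun i hi => (h i hi).1, by
    rw [← Finset.prod_inv_distrib]; exact prod_mem fun i hi => (h i hi).2⟩

lemma InvIn.const {c : K} (hc : c ≠ 0) : InvIn O (ofK c) :=
  ⟨ofK_ne_zero hc, by rw [← map_inv₀]; exact algebraMap_mem _ _⟩

lemma InvIn.neg {x : L} (hx : InvIn O x) : InvIn O (-x) :=
  ⟨neg_ne_zero.2 hx.1, by rw [inv_neg]; exact neg_mem hx.2⟩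

lemma InvIn.one_sub_div {x y : L} (hy : y ∈ O) (hy0 : y ≠ 0) (h : InvIn O (y - x)) :
    InvIn O (1 - x / y) := by
  have e : 1 - x / y = (y - x) / y := by rw [sub_div, div_self hy0]
  rw [e]; exact ⟨div_ne_zero h.1 hy0, by rw [inv_div, div_eq_mul_inv]; exact mul_mem hy h.2⟩

lemma regInv_rm_div {p p' : ι} (hp : p ≠ p') {x y : L}
    (hx : x ∈ O) (hy : y ∈ O) (hx' : InvIn O x) (hy' : InvIn O y)
    (h : ∀ c : K, c ≠ 0 → InvIn O (y - x * ofK c)) :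
    RegInv O (Rm p p' (x / y) : Op ι n L) := by
  have h1 : ∀ c : K, c ≠ 0 → InvIn O (1 - x / y * ofK c) := fun c hc => by
    rw [div_mul_eq_mul_div]; exact (h c hc).one_sub_div hy hy'.1
  have h2 := h1 1 one_ne_zero; rw [map_one, mul_one] at h2; have hq := q_ne_zero
  have h3 := (h1 (q ^ 2) (pow_ne_zero 2 hq)).mul (h1 ((q⁻¹) ^ 2) (pow_ne_zero 2 (inv_ne_zero hq)))
  refine regInv_rm hp ?_ ?_ (div_ne_zero hx'.1 hy'.1) (fun e => h2.1 (by rw [e, sub_self])) h2.2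
    ⟨_, h3.2, inv_mul_cancel₀ h3.1⟩
  · rw [div_eq_mul_inv]; exact mul_mem hx hy'.2
  · rw [inv_div, div_eq_mul_inv]; exact mul_mem hy hx'.2

lemma regInv_rm_const {p p' : ι} (hp : p ≠ p') {c : K}
    (h : Nondeg (cIn L c)) : RegInv O (Rm p p' (cIn L c) : Op ι n L) := by
  obtain ⟨h1, h2, h3, h4⟩ := h
  have e1 : ∀ c : K, cIn L c ≠ 1 → InvIn O (1 - cIn L c) := fun c hc => by
    rw [← map_one (cIn L), ← map_sub]; refine InvIn.const (sub_ne_zero.2 fun e => hc ?_)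
    rw [← e, map_one]
  rw [← map_mul] at h3 h4; have h5 := (e1 _ h3).mul (e1 _ h4); rw [map_mul, map_mul] at h5
  exact regInv_rm hp (algebraMap_mem _ _) (by rw [← map_inv₀]; exact algebraMap_mem _ _) h1 h2
    (e1 _ h2).2 ⟨_, h5.2, inv_mul_cancel₀ h5.1⟩

end

lemma invIn_tame (hj : j < a) {c c' : K} (hc : c ≠ 0) (hc' : c' ≠ 0) :
    InvIn (tameRing a) (z j * cst c - z a * cst c') := by
  have e : z j * cst c - z a * cst c' = cst c * (z j - cst (c' / c) * z a) := by
    have := ofK_ne_zero (L := RatFun k) hc; rw [map_div₀]; field_simp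
  rw [e]
  exact (InvIn.const hc).mul ⟨hyper_form_ne_zero hj.ne _, inv_mem_tameRing hj (div_ne_zero hc' hc)⟩

lemma invIn_tame' (hj : j < a) {c c' : K} (hc : c ≠ 0) (hc' : c' ≠ 0) :
    InvIn (tameRing a) (z a * cst c' - z j * cst c) := by
  have := (invIn_tame hj hc hc').neg; rwa [neg_sub] at this

lemma invIn_z {O : Subalgebra K (RatFun k)} (hO : laurent k ≤ O) (i : Fin k) {c : K}
    (hc : c ≠ 0) : InvIn O (z i * cst c) :=
  InvIn.mul ⟨z_ne_zero i, hO (z_inv_mem_laurent i)⟩ (InvIn.const hc)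

lemma z_mul_mem {O : Subalgebra K (RatFun k)} (hO : laurent k ≤ O) (i : Fin k) (c : K) :
    z i * cst c ∈ O := mul_mem (hO (z_mem_laurent i)) (algebraMap_mem _ _)

lemma regInv_tame {p p' : Fin k} (hp : p ≠ p') (hj : j < a) {c c' : K} (hc : c ≠ 0)
    (hc' : c' ≠ 0) : RegInv (tameRing a) (Rm p p' (z j * cst c / (z a * cst c')) : Tensor n k) := by
  have hO := laurent_le_tameRing a
  refine regInv_rm_div hp (z_mul_mem hO _ _) (z_mul_mem hO _ _) (invIn_z hO _ hc)
    (invIn_z hO _ hc') fun d hd => ?_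
  rw [mul_assoc, ← map_mul]; exact invIn_tame' hj (mul_ne_zero hc hd) hc'

lemma regInv_tame' {p p' : Fin k} (hp : p ≠ p') (hj : j < a) {c c' : K} (hc : c ≠ 0)
    (hc' : c' ≠ 0) : RegInv (tameRing a) (Rm p p' (z a * cst c' / (z j * cst c)) : Tensor n k) := by
  have hO := laurent_le_tameRing a
  refine regInv_rm_div hp (z_mul_mem hO _ _) (z_mul_mem hO _ _) (invIn_z hO _ hc')
    (invIn_z hO _ hc) fun d hd => ?_
  rw [mul_assoc, ← map_mul]; exact invIn_tame hj hc (mul_ne_zero hc' hd)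

namespace IsSplit

variable {b₀ b₁ : Fin k → Fin k} {e : ℕ} (h : IsSplit b₀ b₁ a e)
  {Y₀ Y₁ : Tensor n k} {γ₀ γ₁ : Perm (Fin k)} {κ₀ κ₁ : K}

include h

lemma pt_block_div {x y : Fin k} (hx : a ≤ x ∧ x.val < e) (hy : a ≤ y ∧ y.val < e) :
    ∃ c : K, pt n b₁ x / pt n b₁ y = cst c := by
  refine ⟨qbar n ^ (2 * (x.val - a.val)) / qbar n ^ (2 * (y.val - a.val)), ?_⟩
  rw [h.pt_block hx.1 hx.2, h.pt_block hy.1 hy.2, mul_div_mul_left _ _ (z_ne_zero a), ← map_div₀]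

lemma invIn_blockFactor (hn : 2 ≤ n) (hb : IsBlk b₁) :
    InvIn (tameRing a) (blockFactor n a e (pt n b₁)) := by
  refine (InvIn.prod _ fun p hp => ?_).mul (InvIn.prod _ fun p hp => ?_)
  · obtain ⟨-, h1, h2, h3⟩ := mem_filter.1 hp
    obtain ⟨c, hc⟩ := h.pt_block_div (n := n) (x := p.1) (y := p.2)
      ⟨h2.le, lt_trans (lt_def.1 h1) h3⟩ ⟨(h2.trans h1).le, h3⟩
    have hnd := (pt_div_nondeg hn hb h1.ne).f_ne_zero; rw [hc] at hnd ⊢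
    have hf : f (cst c) = cst (f c) := (map_f (Algebra.ofId K (RatFun k)) c).symm; rw [hf] at hnd ⊢
    exact InvIn.const fun e => hnd (by rw [e, map_zero])
  · obtain ⟨-, h1, ⟨h2, h2'⟩, ⟨h3, h3'⟩, h4⟩ := mem_filter.1 hp
    rw [h.pt_block h2 h2', h.pt_block h3 h3', mul_assoc, ← map_mul, ← pow_add, ← mul_sub, ← map_sub]
    refine invIn_z (laurent_le_tameRing a) a (sub_ne_zero.2 fun h5 => ?_)
    have h6 := (q_qbar_inj hn (a := 0) (c := 0) (b := 2 * (p.1.val - a.val))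
      (d := 2 * (p.2.val - a.val) + 2) (by rw [pow_zero, one_mul, one_mul]; exact h5)).2
    rw [le_def] at h2 h3; lia

lemma invIn_cross (hi : i < a) : InvIn (tameRing a) (crossFactor n a e (pt n b₁) i) := by
  refine InvIn.prod _ fun x hx => ?_; obtain ⟨-, h1, h2⟩ := mem_filter.1 hx
  have e1 : pt n b₁ i = z i * cst 1 := by rw [map_one, mul_one, h.pt_before hi]
  rw [e1, h.pt_block h1 h2, mul_assoc, mul_assoc, ← map_mul, ← map_mul]
  have hQ := qbar_pow_ne_zero n
  exact (invIn_tame hi one_ne_zero (mul_ne_zero (hQ _) (hQ _))).mul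
    (invIn_tame' hi (mul_ne_zero one_ne_zero (hQ _)) (hQ _))

lemma tame (hn : 2 ≤ n) (hb : IsBlk b₁) (hX : X ∈ bigSpace n k)
    (W₀ : IsWheel X b₀ γ₀ Y₀ κ₀) (W₁ : IsWheel X b₁ γ₁ Y₁ κ₁)
    (hY : EntriesIn (laurent k) (polesBelow n k e • Y₀)) :
    EntriesIn (tameRing a) (polesBelow n k a • Y₁) := by
  obtain ⟨Z, hZ, hrel⟩ := h.relation hn hb hX W₀.cyc W₁.cyc W₀.ne_zero W₀.val W₁.val W₁.triv hY
  have hZl : EntriesIn (tameRing a) Z := fun I J => laurent_le_tameRing a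
    (laurent_value (pt_ne_zero b₁) (fun j => mul_mem (z_mem_laurent _) (const_mem_laurent _))
    (fun j => by
      rw [pt, mul_inv, ← map_inv₀]
      exact mul_mem (z_inv_mem_laurent _) (const_mem_laurent _)) (hY I J) (hZ I J))
  rw [hrel] at hZl
  have hs := ((InvIn.const (O := tameRing a) (div_ne_zero W₁.ne_zero W₀.ne_zero)).mul
    (h.invIn_blockFactor hn hb)).mul
    (InvIn.prod (univ.filter (· < a)) fun i hi =>
      h.invIn_cross (n := n) (i := i) (mem_filter.1 hi).2)
  have h1 := RegInv.of_mul_right (RegInv.pm _) (hZl.of_smul hs.2 hs.1)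
  have hQ := qbar_pow_ne_zero n
  have hx : ∀ {x}, x ∈ inner a e → ∀ {j}, j < a → x ≠ j := by
    intro x hx j hj hxj; rw [hxj, mem_inner] at hx; exact absurd hj (not_lt.2 hx.1.le)
  refine RegInv.of_mul_left (RegInv.map_prod fun j hj => RegInv.train fun x hxi => ?_)
    (RegInv.of_mul_right (RegInv.map_prod fun j hj => RegInv.trainR fun x hxi => ?_) h1)
  · have hxe := mem_inner.1 hxi
    rw [List.mem_reverse, List.mem_append, List.mem_singleton, mem_before] at hj
    rcases hj with hj | rfl
    · have e1 : pt n b₁ j = z j * cst 1 := by rw [map_one, mul_one, h.pt_before hj]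
      rw [e1, h.pt_block hxe.1.le hxe.2]; exact regInv_tame (hx hxi hj).symm hj one_ne_zero (hQ _)
    · have hnd := pt_div_nondeg hn hb hxe.1.ne
      obtain ⟨c, hc⟩ := h.pt_block_div (n := n) (x := j) (y := x) ⟨le_rfl, h.lt⟩ ⟨hxe.1.le, hxe.2⟩
      rw [hc] at hnd ⊢; exact regInv_rm_const hxe.1.ne hnd
  · rw [mem_before] at hj; rw [h.vR_lt hj, h.vR_inner hxi]
    exact regInv_tame' (hx hxi hj) hj (hQ _) (hQ _)

lemma regular_step (hn : 2 ≤ n) (hb : IsBlk b₁) (hX : X ∈ bigSpace n k)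
    (W₀ : IsWheel X b₀ γ₀ Y₀ κ₀) (W₁ : IsWheel X b₁ γ₁ Y₁ κ₁)
    (hY : EntriesIn (laurent k) (polesBelow n k e • Y₀))
    (hbig : ∀ a' : Fin k, a'.val + 1 = a.val →
      MVal (pt n fun j => if b₁ j = a then a' else b₁ j) (poles k n • X) 0) :
    EntriesIn (laurent k) (polesBelow n k a • Y₁) := by
  refine fun I J => mem_laurent_of_tame (h.tame hn hb hX W₀ W₁ hY I J) fun i α hi hα => ?_
  have hi' := lt_def.1 hi
  exact h.regular_hyper hi hn hb hX W₀ W₁ hY (a' := ⟨a.val - 1, by lia⟩) (by simp only; lia)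
    (hbig _ (by simp only; lia)) hα I J

end IsSplit

/-- The decomposition into the blocks of `b` after `m`, and single strands before. -/
def splitBelow (b : Fin k → Fin k) (m : ℕ) (j : Fin k) : Fin k := if j.val < m then j else b j

lemma isBlk_splitBelow {b : Fin k → Fin k} (hb : IsBlk b) {m : ℕ}
    (hm : ∀ j, m ≤ j.val → m ≤ (b j).val) : IsBlk (splitBelow b m) where
  le j := by
    rw [splitBelow]; split_ifs
    · exact le_rfl
    · exact hb.le j
  mono i j hij := by
    rw [splitBelow, splitBelow]; split_ifs with h1 h2 h2
    · exact hij
    · grind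
    · lia
    · exact hb.mono hij
  idem j := by
    by_cases h1 : j.val < m
    · rw [splitBelow, splitBelow, if_pos h1, if_pos h1]
    · have := hm j (not_lt.1 h1)
      rw [splitBelow, splitBelow, if_neg h1, if_neg (not_lt.2 this), hb.idem]

lemma exists_isSplit {b : Fin k → Fin k} (hb : IsBlk b)
    (ha : ∀ j : Fin k, a ≤ j → a ≤ b j) : ∃ e, (∀ j : Fin k, e ≤ j.val → e ≤ (b j).val) ∧
      IsSplit (splitBelow b e) (splitBelow b a) a e := by
  classical
  have hex : ∃ e, a.val < e ∧ ∀ j : Fin k, e ≤ j.val → e ≤ (b j).val :=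
    ⟨k, a.isLt, fun j hj => absurd j.isLt (not_lt.2 hj)⟩
  obtain ⟨h1, h2⟩ := Nat.find_spec hex; set e := Nat.find hex with he
  have hek : e ≤ k := Nat.find_min' hex ⟨a.isLt, fun j hj => absurd j.isLt (not_lt.2 hj)⟩
  have hblock : ∀ j : Fin k, a ≤ j → j.val < e → b j = a := by
    intro j hj hje; by_contra hne; have hlt : a < b j := lt_of_le_of_ne (ha j hj) (Ne.symm hne)
    have := Nat.find_min hex (m := (b j).val) (lt_of_le_of_lt (le_def.1 (hb.le j)) hje)
    refine this ⟨hlt, fun j' hj' => ?_⟩; have := hb.mono (le_def.2 hj'); rwa [hb.idem] at this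
  refine ⟨e, h2, h1, hek, fun j hj => ?_, fun j hj hje => ?_, fun j hj => ?_, fun j hj => ?_,
    fun j hj => ?_⟩
  · rw [splitBelow, if_pos (lt_def.1 hj)]
  · rw [splitBelow, if_neg (not_lt.2 (le_def.1 hj)), hblock j hj hje]
  · rw [splitBelow, if_neg (by lia)]; exact h2 j hj
  · rw [splitBelow, if_pos hj]
  · rw [splitBelow, splitBelow, if_neg (by lia), if_neg (by lia)]

lemma regular_splitBelow (hn : 2 ≤ n) {b : Fin k → Fin k} (hb : IsBlk b) (hX : X ∈ shuffleSpace n k)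
    (hbig : ∀ a a' : Fin k, b a = a → a'.val + 1 = a.val →
      MVal (pt n fun j => if splitBelow b a j = a then a' else splitBelow b a j)
        (poles k n • X) 0) :
    ∀ (l m : ℕ), m + l = k → (∀ j, m ≤ j.val → m ≤ (b j).val) →
    ∀ (γ : Perm (Fin k)) (Y : Tensor n k) (κ : K), IsWheel X (splitBelow b m) γ Y κ →
    EntriesIn (laurent k) (polesBelow n k m • Y) := by
  intro l
  induction l using Nat.strong_induction_on with
  | _ l ih =>
    intro m hml hm γ Y κ W; rcases Nat.eq_zero_or_pos l with rfl | hl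
    · have hid : splitBelow b m = id := by funext j; rw [splitBelow, if_pos (by lia)]; rfl
      have hpt : pt n (splitBelow b m) = z := by
        funext j; rw [hid, pt, id, Nat.sub_self, mul_zero, pow_zero, map_one, mul_one]
      have hnon : nonheads (splitBelow b m) = [] := by
        rw [List.eq_nil_iff_forall_not_mem]; intro x hx; rw [mem_nonheads, hid] at hx; exact hx rfl
      have hval := W.val
      have h1 : lft (splitBelow b m) (z : Fin k → RatFun k) = (1 : Tensor n k) := by
        rw [lft, hnon]; simp [train]
      have h2 : rgt (splitBelow b m) (z : Fin k → RatFun k) = (1 : Tensor n k) := by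
        rw [rgt, hnon]; simp [trainR]
      have h3 : scl (splitBelow b m) (z : Fin k → RatFun k) = 1 := by
        refine Finset.prod_eq_one fun p hp => ?_; simp_all
      have h4 : den n (splitBelow b m) z = polesBelow n k m := by
        rw [den, polesBelow]; refine prod_congr (Finset.filter_congr fun p _ => ?_) fun p _ => rfl
        simp_all
      rw [hpt, h1, h2, h3, h4, one_mul, mul_one, mul_one] at hval
      have hN : MVal z (poles k n • X) (poles k n • X) := fun I J => hasVal_z _
      have h5 := hN.unique hval
      have h6 : EntriesIn (laurent k) (poles k n • X) := poles_smul_entries hX.1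
      rw [h5, mul_smul, ← smul_mul_assoc] at h6
      exact (RegInv.of_mul_right (RegInv.pm γ) (h6.of_smul (by
        rw [← map_inv₀]; exact const_mem_laurent _) (ofK_ne_zero W.ne_zero)))
    · set a : Fin k := ⟨m, by lia⟩ with ha; obtain ⟨e, he, hs⟩ := exists_isSplit hb (a := a) hm
      have h1 := hs.lt; have h2 := hs.le; have h3 : m < e := h1
      obtain ⟨γ₀, Y₀, κ₀, w1, w2, -, w3, w4⟩ := exists_wheel hX (isBlk_splitBelow hb he)
      have W₀ : IsWheel X (splitBelow b e) γ₀ Y₀ κ₀ := ⟨w1, w2, w3, w4⟩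
      have hY := ih (k - e) (by lia) e (by lia) he γ₀ Y₀ κ₀ W₀
      have hba : b a = a := le_antisymm (hb.le a) (hm a le_rfl)
      exact hs.regular_step hn (isBlk_splitBelow hb hm) hX.1 W₀ W hY fun a' ha' => hbig a a' hba ha'

lemma regular (hn : 2 ≤ n) {b : Fin k → Fin k} (hb : IsBlk b) (hX : X ∈ shuffleSpace n k)
    (hbig : ∀ a a' : Fin k, b a = a → a'.val + 1 = a.val →
      MVal (pt n fun j => if splitBelow b a j = a then a' else splitBelow b a j) (poles k n • X) 0)
    {γ : Perm (Fin k)} {κ : K} (W : IsWheel X b γ Y κ) :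
    EntriesIn (laurent k) Y := by
  have h0 : splitBelow b 0 = b := by aesop
  have h := regular_splitBelow hn hb hX hbig k 0 (by lia) (fun _ _ => Nat.zero_le _) γ Y κ
    (by rwa [h0])
  have h1 : polesBelow n k 0 = 1 :=
    Finset.prod_eq_one fun p hp => absurd (mem_filter.1 hp).2.2.1 (Nat.not_lt_zero _)
  rwa [h1, one_smul] at h

end Tame

/-! ### Tensors on subsets of strands -/

section OnStrands

variable {ι κ ρ L : Type*} [Fintype ι] [DecidableEq ι] [Fintype κ] [DecidableEq κ]

lemma onStrands_comp [Zero L] {c : κ → ι} (hc : Injective c) (s : ρ → κ) (M : Op ρ n L) :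
    onStrands c (onStrands s M) = onStrands (c ∘ s) M := by
  ext I J
  by_cases h : ∀ m, m ∉ Set.range (c ∘ s) → I m = J m
  · rw [onStrands_pos _ h, onStrands_pos, onStrands_pos]
    · rfl
    · grind
    grind
  · rw [onStrands_neg _ h]
    by_cases h1 : ∀ m, m ∉ Set.range c → I m = J m
    · rw [onStrands_pos _ h1, onStrands_neg]; grind
    · rw [onStrands_neg _ h1]

lemma onStrands_mul [NonUnitalNonAssocSemiring L] {c : κ → ι} (hc : Injective c)
    (M N : Op κ n L) : onStrands c (M * N) = (onStrands c M * onStrands c N : Op ι n L) := by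
  ext I J; rw [mul_apply]
  by_cases h : ∀ m, m ∉ Set.range c → I m = J m
  · rw [onStrands_pos _ h, mul_apply]
    refine Finset.sum_of_injOn (fun t => Function.extend c t I) ?_ (by simp) ?_ ?_
    · intro t _ t' _ e; funext x; have := congrFun e (c x); simpa only [hc.extend_apply] using this
    · intro T _ hT; rw [onStrands_neg, zero_mul]; refine fun h1 => hT ⟨T ∘ c, by simp, ?_⟩; funext m
      by_cases h3 : m ∈ Set.range c
      · obtain ⟨y, rfl⟩ := h3; simp only [hc.extend_apply, comp_apply]
      · simp only [Function.extend_apply' _ _ _ h3, h1 m h3]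
    · intro t _; have e : Function.extend c t I ∘ c = t := by simp_all
      have e' : ∀ m, m ∉ Set.range c → Function.extend c t I m = I m := fun m hm =>
        Function.extend_apply' _ _ _ hm
      rw [onStrands_pos _ fun m hm => (e' m hm).symm,
        onStrands_pos _ fun m hm => (e' m hm).trans (h m hm), e]
  · rw [onStrands_neg _ h]; symm; refine sum_eq_zero fun T _ => ?_
    by_cases h1 : ∀ m, m ∉ Set.range c → I m = T m
    · rw [onStrands_neg (J := J), mul_zero]; exact fun h2 => h fun m hm => (h1 m hm).trans (h2 m hm)
    · rw [onStrands_neg _ h1, zero_mul]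

lemma onStrands_one [Zero L] [One L] (c : κ → ι) : (onStrands c (1 : Op κ n L) : Op ι n L) = 1 := by
  ext I J
  by_cases h : ∀ m, m ∉ Set.range c → I m = J m
  · rw [onStrands_pos _ h, Matrix.one_apply, Matrix.one_apply]
    refine if_congr ⟨fun h1 => ?_, fun h1 => by rw [h1]⟩ rfl rfl; funext m
    by_cases h3 : m ∈ Set.range c
    · obtain ⟨y, rfl⟩ := h3; exact congrFun h1 y
    · exact h m h3
  · rw [onStrands_neg _ h, Matrix.one_apply_ne]; rintro rfl; exact h fun _ _ => rfl

lemma onStrands_list_prod [Semiring L] {c : κ → ι} (hc : Injective c)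
    {α : Type*} (l : List α) (M : α → Op κ n L) :
    (onStrands c (l.map M).prod : Op ι n L) = (l.map fun a => onStrands c (M a)).prod := by
  induction l with
  | nil => exact onStrands_one c
  | cons a l ih =>
    rw [List.map_cons, List.map_cons, List.prod_cons, List.prod_cons, onStrands_mul hc, ih]

lemma onStrands_Rm [Field L] [Algebra K L] {c : κ → ι} (hc : Injective c)
    (a b : κ) (x : L) : (onStrands c (Rm a b x : Op κ n L) : Op ι n L) = Rm (c a) (c b) x := by
  rw [Rm, Rm, onStrands_comp hc]; congr 1; funext i
  fin_cases i <;> rfl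

lemma sum_cons {A : Type*} [AddCommMonoid A] (F : (Fin (k + 1) → Fin n) → A) :
    ∑ T, F T = ∑ a, ∑ U, F (a ◁ U) := by
  rw [← (Fin.consEquiv fun _ => Fin n).sum_comp, Fintype.sum_prod_type]; rfl

lemma onStrands_succ [Zero L] (M : Op (Fin k) n L) (a b : Fin n) (I J : Fin k → Fin n) :
    onStrands Fin.succ M (a ◁ I) (cons b J) = if a = b then M I J else 0 := by
  have h : (∀ m, m ∉ Set.range (Fin.succ : Fin k → Fin (k + 1)) →
      (a ◁ I) m = (b ◁ J) m) ↔ a = b := by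
    simp
  split_ifs with h1
  · rw [onStrands_pos _ (h.2 h1)]; rfl
  · rw [onStrands_neg _ (fun h2 => h1 (h.1 h2))]

/-- The component `E_{ab}` of `M` in strand `0`. -/
def slice (a b : Fin n) (M : Op (Fin (k + 1)) n L) : Op (Fin k) n L :=
  fun I J => M (a ◁ I) (cons b J)

lemma slice_onStrands_mul [NonUnitalNonAssocSemiring L] (a b : Fin n) (M : Op (Fin k) n L)
    (N : Op (Fin (k + 1)) n L) : slice a b (onStrands Fin.succ M * N) = M * slice a b N := by
  ext I J; rw [slice, mul_apply, sum_cons, sum_eq_single a, mul_apply]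
  · refine sum_congr rfl fun U _ => ?_; rw [onStrands_succ, if_pos rfl]; rfl
  · refine fun c _ hc => sum_eq_zero fun U _ => ?_; rw [onStrands_succ, if_neg hc.symm, zero_mul]
  · simp

lemma slice_mul_onStrands [NonUnitalNonAssocSemiring L] (a b : Fin n) (M : Op (Fin k) n L)
    (N : Op (Fin (k + 1)) n L) : slice a b (N * onStrands Fin.succ M) = slice a b N * M := by
  ext I J; rw [slice, mul_apply, sum_cons, sum_eq_single b, mul_apply]
  · refine sum_congr rfl fun U _ => ?_; rw [onStrands_succ, if_pos rfl]; rfl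
  · refine fun c _ hc => sum_eq_zero fun U _ => ?_; rw [onStrands_succ, if_neg hc, mul_zero]
  · simp

/-- The embedding of the strands which omits strand `1`. -/
def omitOne (k : ℕ) : Fin (k + 1) → Fin (k + 2) := cons 0 fun m => m.succ.succ

lemma omitOne_injective (k : ℕ) : Injective (omitOne k) := by
  intro a b h
  cases a using Fin.cases with
  | zero =>
    cases b using Fin.cases with
    | zero => rfl
    | succ b => exact absurd (show Fin.succ b.succ = 0 from h.symm) (Fin.succ_ne_zero _)
  | succ a =>
    cases b using Fin.cases with
    | zero => exact absurd (show Fin.succ a.succ = 0 from h) (Fin.succ_ne_zero _)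
    | succ b => exact congrArg Fin.succ (Fin.succ_injective _ (Fin.succ_injective _ h))

lemma slice_onStrands_omitOne [Zero L] (a b : Fin n) (M : Op (Fin (k + 1)) n L) :
    slice a b (onStrands (omitOne k) M) = onStrands Fin.succ (slice a b M) := by
  ext I J
  obtain ⟨c, I, rfl⟩ : ∃ c I', I = (c ◁ I') := ⟨I 0, Fin.tail I, (Fin.cons_self_tail I).symm⟩
  obtain ⟨e, J, rfl⟩ : ∃ c I', J = (c ◁ I') := ⟨J 0, Fin.tail J, (Fin.cons_self_tail J).symm⟩
  rw [onStrands_succ, slice]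
  have hr : (1 : Fin (k + 2)) ∉ Set.range (omitOne k) := by
    rintro ⟨x, hx⟩
    cases x using Fin.cases with
    | zero => exact absurd hx (by simp [omitOne])
    | succ x => exact absurd (Fin.succ_injective _ (show Fin.succ x.succ = Fin.succ 0 from hx)) (Fin.succ_ne_zero x)
  have hcomp : ∀ (a c : Fin n) (I : Fin k → Fin n), (a ◁ c ◁ I) ∘ omitOne k = cons a I := by
    intro a c I; funext m
    cases m using Fin.cases <;> rfl
  split_ifs with h
  · subst h; rw [onStrands_pos, hcomp, hcomp]
    · rfl
    intro m hm
    cases m using Fin.cases with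
    | zero => exact absurd ⟨0, rfl⟩ hm
    | succ m =>
      cases m using Fin.cases with
      | zero => rfl
      | succ m => exact absurd ⟨m.succ, rfl⟩ hm
  · rw [onStrands_neg]; exact fun h1 => h (h1 1 hr)

/-- Composition with a permutation of strands. -/
def compPerm (n : ℕ) (σ : Perm ι) : (ι → Fin n) ≃ (ι → Fin n) :=
  Equiv.arrowCongr σ.symm (Equiv.refl _)

lemma onStrands_perm [Zero L] (σ : Perm ι) (c : κ → ι) (M : Op κ n L) :
    (onStrands (σ ∘ c) M : Op ι n L) =
      (onStrands c M : Op ι n L).submatrix (compPerm n σ) (compPerm n σ) := by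
  ext I J; rw [Matrix.submatrix_apply]; change _ = onStrands c M (I ∘ σ) (J ∘ σ)
  have h : (∀ m, m ∉ Set.range (σ ∘ c) → I m = J m) ↔
      ∀ m, m ∉ Set.range c → (I ∘ σ) m = (J ∘ σ) m := by
    constructor
    · simp_all
    · intro h m hm; have := h (σ.symm m) ?_
      · simpa using this
      grind
  by_cases h1 : ∀ m, m ∉ Set.range (σ ∘ c) → I m = J m
  · rw [onStrands_pos _ h1, onStrands_pos _ (h.1 h1)]; rfl
  · rw [onStrands_neg _ h1, onStrands_neg _ (fun h2 => h1 (h.2 h2))]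

lemma onStrands_pair_apply [NonUnitalNonAssocSemiring L] (M : Op (Fin 2) n L) (a b c e : Fin n)
    (I J : Fin k → Fin n) :
    (onStrands ![0, 1] M : Op (Fin (k + 2)) n L) (cons a (c ◁ I)) (cons b (e ◁ J)) =
      if I = J then M ![a, c] ![b, e] else 0 := by
  have h : (∀ m, m ∉ Set.range (![0, 1] : Fin 2 → Fin (k + 2)) → (a ◁ c ◁ I) m =
        (b ◁ e ◁ J) m) ↔ I = J := by
    constructor
    · intro h; funext m; refine h m.succ.succ ?_
      rw [range_pair, Set.mem_insert_iff, Set.mem_singleton_iff, not_or]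
      exact ⟨Fin.succ_ne_zero _, fun h => Fin.succ_ne_zero m (Fin.succ_injective _ h)⟩
    · rintro rfl m hm
      cases m using Fin.cases with
      | zero => exact absurd ⟨0, rfl⟩ hm
      | succ m =>
        cases m using Fin.cases with
        | zero => exact absurd ⟨1, rfl⟩ hm
        | succ m => rfl
  have hc : ∀ a c (I : Fin k → Fin n), (a ◁ c ◁ I) ∘ ![0, 1] = ![a, c] := by
    intro a c I; funext m
    fin_cases m <;> rfl
  split_ifs with h1
  · rw [onStrands_pos _ (h.2 h1), hc, hc]
  · rw [onStrands_neg _ (fun h2 => h1 (h.1 h2))]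

lemma onStrands_pair_mul [NonUnitalNonAssocSemiring L] (M : Op (Fin 2) n L)
    (N : Op (Fin (k + 2)) n L) (a c : Fin n) (I : Fin k → Fin n) (J : Fin (k + 2) → Fin n) :
    (onStrands ![0, 1] M * N : Op (Fin (k + 2)) n L) (cons a (c ◁ I)) J =
      ∑ a', ∑ c', M ![a, c] ![a', c'] * N (cons a' (c' ◁ I)) J := by
  rw [mul_apply, sum_cons]; refine sum_congr rfl fun a' _ => ?_; rw [sum_cons]
  refine sum_congr rfl fun c' _ => ?_; rw [sum_eq_single I]
  · rw [onStrands_pair_apply, if_pos rfl]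
  · intro U _ hU; rw [onStrands_pair_apply, if_neg hU.symm, zero_mul]
  · simp

lemma mul_onStrands_pair [NonUnitalNonAssocSemiring L] (M : Op (Fin 2) n L)
    (N : Op (Fin (k + 2)) n L) (b e : Fin n) (I : Fin (k + 2) → Fin n) (J : Fin k → Fin n) :
    (N * onStrands ![0, 1] M : Op (Fin (k + 2)) n L) I (cons b (e ◁ J)) =
      ∑ b', ∑ e', N I (cons b' (e' ◁ J)) * M ![b', e'] ![b, e] := by
  rw [mul_apply, sum_cons]; refine sum_congr rfl fun b' _ => ?_; rw [sum_cons]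
  refine sum_congr rfl fun e' _ => ?_; rw [sum_eq_single J]
  · rw [onStrands_pair_apply, if_pos rfl]
  · intro U _ hU; rw [onStrands_pair_apply, if_neg hU, mul_zero]
  · simp

end OnStrands

/-! ### The exchange relation for two auxiliary strands -/

section Exchange

/-- `R_{k0}(z_k w) ⋯ R_{10}(z_1 w)`. -/
def psiLeft (n k : ℕ) : Op (Fin (k + 1)) n (Ser k) :=
  ((finRange k).reverse.map fun m => Rm m.succ 0 (zt m)).prod

/-- `R̃_{10}(z_1 w) ⋯ R̃_{k0}(z_k w)`. -/
def psiRight (n k : ℕ) : Op (Fin (k + 1)) n (Ser k) := ((finRange k).map fun m => Rm 0 m.succ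
    (1 / (zt m * ofK (qbar n ^ 2)))).prod

/-- The scalar factor of `psiMat`. -/
def psiScal (k : ℕ) : Ser k := (∏ m : Fin k, f (zt m : Ser k))⁻¹

lemma psiMat_eq (X : Tensor n k) : psiMat X =
    psiScal k • (psiLeft n k * onStrands Fin.succ (X.map C) * psiRight n k) := rfl

/-- The coefficients of the linear map `psiMat`. -/
def psiKer (I J : Fin (k + 1) → Fin n) (U V : Fin k → Fin n) : Ser k :=
  psiScal k * ∑ a, psiLeft n k I (a ◁ U) * psiRight n k (a ◁ V) J

theorem psiExt_apply (ρ : Ser k →ₐ[K] L) (S : Op (Fin k) n L) (I J : Fin (k + 1) → Fin n) :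
    (ρ (psiScal k) • ((psiLeft n k).map ρ * onStrands Fin.succ S * (psiRight n k).map ρ) :
      Op (Fin (k + 1)) n L) I J = ∑ U, ∑ V, ρ (psiKer I J U V) * S U V := by
  have h1 : ∀ T, ((psiLeft n k).map ρ * onStrands Fin.succ S : Op (Fin (k + 1)) n L) I T =
      ∑ U, ρ (psiLeft n k I ((T 0) ◁ U)) * S U (Fin.tail T) := by
    intro T
    obtain ⟨c, T, rfl⟩ : ∃ c T', T = (c ◁ T') := ⟨T 0, Fin.tail T, (Fin.cons_self_tail T).symm⟩
    rw [mul_apply, sum_cons, sum_eq_single c]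
    · refine sum_congr rfl fun U _ => ?_; rw [onStrands_succ, if_pos rfl]; rfl
    · refine fun a _ ha => Finset.sum_eq_zero fun U _ => ?_
      rw [onStrands_succ, if_neg ha, mul_zero]
    · simp
  rw [Matrix.smul_apply, Matrix.mul_apply, sum_cons, smul_eq_mul]
  simp only [h1, psiKer, map_mul, map_sum, Finset.mul_sum, Finset.sum_mul, Fin.cons_zero,
    Fin.tail_cons, Matrix.map_apply]
  rw [Finset.sum_comm, Finset.sum_congr rfl fun V _ => Finset.sum_comm, Finset.sum_comm]
  refine sum_congr rfl fun U _ => sum_congr rfl fun V _ => sum_congr rfl fun a _ => by ring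

lemma psiMat_apply (X : Tensor n k) (I J : Fin (k + 1) → Fin n) :
    psiMat X I J = ∑ U, ∑ V, psiKer I J U V * C (X U V) := by
  have h := psiExt_apply (AlgHom.id K _) (X.map C) I J; exact h

/-- The result of applying `psiMat` in strand `0` and then in strand `1`. -/
def psiTwo (ρ ρ' : Ser k →ₐ[K] L) (X : Tensor n k) : Op (Fin (k + 2)) n L :=
  ρ' (psiScal k) • (onStrands Fin.succ ((psiLeft n k).map ρ') *
    onStrands (omitOne k) ((psiMat X).map ρ) * onStrands Fin.succ ((psiRight n k).map ρ'))

lemma psiTwo_apply (ρ ρ' : Ser k →ₐ[K] L) (X : Tensor n k) (a b : Fin n)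
    (I J : Fin (k + 1) → Fin n) :
    psiTwo ρ ρ' X (a ◁ I) (cons b J) = ∑ U, ∑ V, ρ' (psiKer I J U V) *
        ρ (psiMat X (a ◁ U) (cons b V)) := by
  have h : slice a b (psiTwo ρ ρ' X) = ρ' (psiScal k) • ((psiLeft n k).map ρ' *
      onStrands Fin.succ (slice a b ((psiMat X).map ρ)) * (psiRight n k).map ρ') := by
    have h1 : ∀ (c : L) (M : Op (Fin (k + 2)) n L), slice a b (c • M) = c • slice a b M :=
      fun _ _ => rfl
    rw [psiTwo, h1, slice_mul_onStrands, slice_onStrands_mul, slice_onStrands_omitOne]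
  have h2 := congrFun (congrFun h I) J; rwa [psiExt_apply] at h2

lemma onStrands_psiLeft (ρ : Ser k →ₐ[K] L) {c : Fin (k + 1) → Fin (k + 2)}
    (hc : Injective c) : (onStrands c ((psiLeft n k).map ρ) : Op (Fin (k + 2)) n L) =
      ((finRange k).reverse.map fun m => Rm (c m.succ) (c 0) (ρ (zt m))).prod := by
  rw [psiLeft, map_list_prod_mat, List.map_map, onStrands_list_prod hc]
  refine congrArg List.prod (map_congr_left fun m _ => ?_)
  rw [comp_apply, map_rm _ (Fin.succ_ne_zero m), onStrands_Rm hc]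

lemma onStrands_psiRight (ρ : Ser k →ₐ[K] L) {c : Fin (k + 1) → Fin (k + 2)}
    (hc : Injective c) : (onStrands c ((psiRight n k).map ρ) : Op (Fin (k + 2)) n L) =
      ((finRange k).map fun m => Rm (c 0) (c m.succ) (1 / (ρ (zt m) * ofK (qbar n ^ 2)))).prod := by
  rw [psiRight, map_list_prod_mat, List.map_map, onStrands_list_prod hc]
  refine congrArg List.prod (map_congr_left fun m _ => ?_)
  rw [comp_apply, map_rm _ (Fin.succ_ne_zero m).symm, onStrands_Rm hc, map_div₀, map_one,
    map_mul, AlgHom.commutes]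

lemma psiTwo_eq (ρ ρ' : Ser k →ₐ[K] L) (X : Tensor n k)
    {c c' : Fin (k + 1) → Fin (k + 2)} (hc : Injective c) (hc' : Injective c')
    (hcc : c ∘ Fin.succ = c' ∘ Fin.succ) :
    ρ' (psiScal k) • (onStrands c' ((psiLeft n k).map ρ') *
      onStrands c ((psiMat X).map ρ) * onStrands c' ((psiRight n k).map ρ')) =
      (ρ (psiScal k) * ρ' (psiScal k)) • (onStrands c' ((psiLeft n k).map ρ') *
        onStrands c ((psiLeft n k).map ρ) *
        onStrands (c' ∘ Fin.succ) (X.map fun φ => ρ (C φ)) *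
        (onStrands c ((psiRight n k).map ρ) * onStrands c' ((psiRight n k).map ρ')) :
          Op (Fin (k + 2)) n L) := by
  have h : (psiMat X).map ρ = ρ (psiScal k) • ((psiLeft n k).map ρ *
      onStrands Fin.succ (X.map fun φ => ρ (C φ)) * (psiRight n k).map ρ) := by
    rw [psiMat_eq]
    have h1 : ∀ M N : Op (Fin (k + 1)) n (Ser k),
        (M * N).map ρ = M.map ρ * N.map ρ := fun M N => Matrix.map_mul (f := ρ.toRingHom)
    ext I J
    rw [Matrix.map_apply, Matrix.smul_apply, Matrix.smul_apply, smul_eq_mul, smul_eq_mul, map_mul,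
      ← Matrix.map_apply (f := ρ), h1, h1, map_onStrands, Matrix.map_map]
    rfl
  rw [h, onStrands_smul, onStrands_mul hc, onStrands_mul hc, onStrands_comp hc, hcc]
  rw [Matrix.mul_smul, Matrix.smul_mul, smul_smul, mul_comm (ρ' _)]; simp only [Matrix.mul_assoc]

lemma mul_exchange {M : Type*} [Monoid M] {r a b x c d : M} (h1 : r * (a * b) = b * (a * r))
    (h2 : x * r = r * x) (h3 : d * c * r = r * c * d) :
    r * (a * b * x * (c * d)) = b * a * x * (d * c) * r := by
  grind

lemma psiTwo_exchange (ρ₁ ρ₂ : Ser k →ₐ[K] L)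
    (hC : ∀ φ, ρ₁ (C φ) = ρ₂ (C φ)) {w₁ w₂ : L} (hw₁ : w₁ ≠ 0) (hw₂ : w₂ ≠ 0)
    (hw : w₁ ≠ w₂) (h₁ : ∀ m : Fin k, ρ₁ (zt m) = ρ₁ (C (z m)) * w₁) (h₂ : ∀ m : Fin k, ρ₂ (zt m) =
      ρ₁ (C (z m)) * w₂)
    (hg : ∀ (c : K) (m : Fin k), c ≠ 0 → ρ₁ (C (z m)) * ofK c * w₁ ≠ 1 ∧
      ρ₁ (C (z m)) * ofK c * w₂ ≠ 1) (X : Tensor n k) :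
    Rm 0 1 (w₂ / w₁) * psiTwo ρ₁ ρ₂ X =
      (psiTwo ρ₂ ρ₁ X).submatrix (compPerm n (swap 0 1)) (compPerm n (swap 0 1)) *
        Rm 0 1 (w₂ / w₁) := by
  have hs : Injective (Fin.succ : Fin (k + 1) → Fin (k + 2)) := Fin.succ_injective _
  have ho := omitOne_injective k; have hos : omitOne k ∘ Fin.succ = Fin.succ ∘ Fin.succ := rfl
  have h01 : (0 : Fin (k + 2)) ≠ 1 := by simp
  have hm0 : ∀ m : Fin k, m.succ.succ ≠ 0 := fun m => Fin.succ_ne_zero _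
  have hm1 : ∀ m : Fin k, m.succ.succ ≠ 1 := fun m h => Fin.succ_ne_zero m (Fin.succ_injective _ h)
  have hsw1 : (Fin.succ : Fin (k + 1) → Fin (k + 2)) = swap 0 1 ∘ omitOne k := by
    funext m
    cases m using Fin.cases with
    | zero => exact (Equiv.swap_apply_left 0 1).symm
    | succ m => exact (Equiv.swap_apply_of_ne_of_ne (hm0 m) (hm1 m)).symm
  have hsw2 : omitOne k = swap 0 1 ∘ Fin.succ := by rw [hsw1]; funext m; simp
  have hR : (psiTwo ρ₂ ρ₁ X).submatrix (compPerm n (swap 0 1)) (compPerm n (swap 0 1)) =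
      ρ₁ (psiScal k) • (onStrands (omitOne k) ((psiLeft n k).map ρ₁) *
        onStrands Fin.succ ((psiMat X).map ρ₂) * onStrands (omitOne k) ((psiRight n k).map ρ₁)) := by
    have e1 : ∀ M : Op (Fin (k + 1)) n L, onStrands (omitOne k) M = (onStrands Fin.succ M).submatrix
        (compPerm n (swap 0 1)) (compPerm n (swap 0 1)) := fun M => by
      rw [hsw2, onStrands_perm]
    have e2 : ∀ M : Op (Fin (k + 1)) n L, onStrands Fin.succ M = (onStrands (omitOne k) M).submatrix
        (compPerm n (swap 0 1)) (compPerm n (swap 0 1)) := fun M => by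
      conv_lhs => rw [hsw1, onStrands_perm]
    rw [e1, e1, e2 ((psiMat X).map ρ₂), Matrix.submatrix_mul_equiv, Matrix.submatrix_mul_equiv]; rfl
  have hq : qbar n ^ 2 ≠ 0 := qbar_pow_ne_zero n 2; set y : Fin k → L := fun m => ρ₁ (C (z m)) with hy
  have hy0 : ∀ m, y m ≠ 0 := by
    intro m h
    have := congrArg (ρ₁ : Ser k → L)
      ((single_mul_single (a := (0 : ℤ)) (b := 0) (r := z m) (s := (z m)⁻¹)))
    rw [map_mul, mul_inv_cancel₀ (z_ne_zero m)] at this; have h' : ρ₁ (single 0 (z m)) = 0 := h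
    rw [h', zero_mul] at this; exact one_ne_zero ((map_one ρ₁).symm.trans this.symm)
  set u : K → Fin (k + 2) → L := fun c => cons w₁⁻¹ (cons w₂⁻¹ fun m => y m * ofK c :
      Fin (k + 1) → L) with hudef
  have hu : ∀ c : K, c ≠ 0 → ∀ i, u c i ≠ 0 := by
    intro c hc i
    cases i using Fin.cases with
    | zero => exact inv_ne_zero hw₁
    | succ i =>
      cases i using Fin.cases with
      | zero => exact inv_ne_zero hw₂
      | succ m => exact mul_ne_zero (hy0 m) (by simpa using hc)
  set S : List (Fin (k + 2)) := (finRange k).map fun m => m.succ.succ with hS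
  have hx : ∀ c : K, c ≠ 0 → ∀ x ∈ S, (x ≠ 0 ∧ x ≠ 1) ∧ w₁⁻¹ ≠ u c x ∧ w₂⁻¹ ≠ u c x := by
    intro c hc x hx; obtain ⟨m, -, rfl⟩ := List.mem_map.1 hx; obtain ⟨h1, h2⟩ := hg c m hc
    exact ⟨⟨hm0 m, hm1 m⟩, fun h => h1 (by
      change _ = y m * ofK c at h; rw [← h, inv_mul_cancel₀ hw₁]), fun h => h2 (by
      change _ = y m * ofK c at h; rw [← h, inv_mul_cancel₀ hw₂])⟩
  have hnd : S.Nodup :=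
    (List.nodup_finRange k).map fun a b h => Fin.succ_injective _ (Fin.succ_injective _ h)
  have hww : w₁⁻¹ ≠ w₂⁻¹ := fun h => hw (inv_injective h)
  have hdiv : w₂ / w₁ = w₁⁻¹ / w₂⁻¹ := by rw [div_inv_eq_mul, div_eq_mul_inv, mul_comm]
  have hLeft : ∀ {c : Fin (k + 1) → Fin (k + 2)}, Injective c → (∀ m : Fin k, c m.succ = m.succ.succ) →
      ∀ {w : L} {ρ : Ser k →ₐ[K] L}, u 1 (c 0) = w⁻¹ → (∀ m : Fin k, ρ (zt m) = y m * w) →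
      onStrands c ((psiLeft n k).map ρ) = trainR n (u 1) S (c 0) := by
    intro c hc hcs w ρ hi hρ
    rw [onStrands_psiLeft ρ hc, trainR, ← List.map_reverse, List.map_map]
    refine congrArg List.prod (map_congr_left fun m _ => ?_)
    rw [comp_apply, hcs, hρ, hi, div_inv_eq_mul]; congr 2; change _ = y m * ofK 1
    rw [map_one, mul_one]
  have hRight : ∀ {c : Fin (k + 1) → Fin (k + 2)}, Injective c → (∀ m : Fin k, c m.succ = m.succ.succ) →
      ∀ {w : L} {ρ : Ser k →ₐ[K] L}, u (qbar n ^ 2) (c 0) = w⁻¹ → (∀ m : Fin k, ρ (zt m) = y m * w) →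
      onStrands c ((psiRight n k).map ρ) = train (Rv n (u (qbar n ^ 2))) S (c 0) := by
    intro c hc hcs w ρ hi hρ; rw [onStrands_psiRight ρ hc, train, List.map_map]
    refine congrArg List.prod (map_congr_left fun m _ => ?_)
    rw [comp_apply, hcs, hρ, Rv, hi]; congr 1
    change _ = w⁻¹ / (y m * ofK (qbar n ^ 2))
    rw [one_div, mul_inv, mul_inv, div_eq_mul_inv, mul_inv]; ring
  have sw1 := congrArg MulOpposite.unop <| train_swap (isYB_RvOp (n := n) (u 1) (hu 1 one_ne_zero))
    (i := 1) (j := 0) h01.symm hww.symm _ hnd fun x hx' =>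
      have h := hx 1 one_ne_zero x hx'; ⟨h.1.2, h.1.1, h.2.2, h.2.1⟩
  simp only [MulOpposite.unop_mul, unop_train] at sw1
  have sw2 := train_swap (isYB_Rv (n := n) (u (qbar n ^ 2)) (hu _ hq)) (i := 0) (j := 1) h01
    hww _ hnd fun x hx' => have h := hx _ hq x hx'; ⟨h.1.1, h.1.2, h.2.1, h.2.2⟩
  have hX : ∀ M : Op (Fin k) n L, (onStrands (Fin.succ ∘ Fin.succ) M : Op (Fin (k + 2)) n L) *
      Rm 0 1 (w₁⁻¹ / w₂⁻¹) = Rm 0 1 (w₁⁻¹ / w₂⁻¹) * onStrands (Fin.succ ∘ Fin.succ) M :=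
    fun M => TrivOn.commute_Rm h01 (TrivOn.onStrands _ _ fun ⟨m, hm⟩ => hm0 m hm)
      (TrivOn.onStrands _ _ fun ⟨m, hm⟩ => hm1 m hm) _
  have hXX : (X.map fun φ => ρ₂ (C φ)) = X.map fun φ => ρ₁ (C φ) := by ext I J; exact (hC _).symm
  rw [hR, psiTwo_eq ρ₂ ρ₁ X hs ho hos.symm, psiTwo, psiTwo_eq ρ₁ ρ₂ X ho hs hos, hXX, hos, hdiv,
    hLeft ho (fun _ => rfl) rfl h₁, hLeft hs (fun _ => rfl) rfl h₂,
    hRight ho (fun _ => rfl) rfl h₁, hRight hs (fun _ => rfl) rfl h₂,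
    Matrix.mul_smul, Matrix.smul_mul, mul_comm (ρ₁ _)]
  exact congrArg _ (mul_exchange sw1 (hX _) sw2)

end Exchange

/-! ### The exchange relation for the coefficients -/

section Coefficients

instance (k : ℕ) : Algebra K (LaurentSeries (Ser k)) := HahnSeries.instAlgebra

/-- Laurent series in the first variable. -/
def firstVar (k : ℕ) : Ser k →ₐ[K] LaurentSeries (Ser k) where
  toRingHom := C
  commutes' _ := rfl

/-- Laurent series in the second variable. -/
def secondVar (k : ℕ) : Ser k →ₐ[K] LaurentSeries (Ser k) where
  toFun φ := φ.map (C : RatFun k →+* Ser k)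
  map_one' := HahnSeries.map_C (1 : RatFun k) (C : RatFun k →+* Ser k)
  map_zero' := by ext; simp
  map_add' φ ψ := by ext; simp
  map_mul' φ ψ := by
    have h := HahnSeries.map_mul (x := φ) (y := ψ) ((C : RatFun k →+* Ser k).toNonUnitalRingHom)
    exact h
  commutes' c := HahnSeries.map_C _ (C : RatFun k →+* Ser k)

lemma coeff_secondVar_mul_firstVar (φ ψ : Ser k) (r p : ℤ) :
    ((secondVar k φ * firstVar k ψ).coeff r).coeff p = φ.coeff r * ψ.coeff p := by
  have h : firstVar k ψ = single 0 ψ := rfl; rw [h, HahnSeries.coeff_mul_single_zero]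
  have h' : (secondVar k φ).coeff r = single 0 (φ.coeff r) := rfl
  rw [h', HahnSeries.coeff_single_zero_mul]

/-- The coefficient of `E_{ab} y^{-d}` of `psiMat X`, for an integer `d`. -/
def psiZ (X : Tensor n k) (a b : Fin n) (d : ℤ) : Tensor n k :=
  fun I J => (psiMat X (cons a I) (cons b J)).coeff d

lemma psiZ_apply (X : Tensor n k) (a b : Fin n) (d : ℤ) (I J : Fin k → Fin n) :
    psiZ X a b d I J = ∑ U, ∑ V, (psiKer (a ◁ I) (b ◁ J) U V).coeff d * X U V := by
  have h : ∀ (φ : Ser k) (x : RatFun k), (φ * C x).coeff d = φ.coeff d * x := fun φ x => by simp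
  rw [psiZ, psiMat_apply]; simp only [coeff_sum, h]

lemma psiZ_add (X Y : Tensor n k) (a b : Fin n) (d : ℤ) :
    psiZ (X + Y) a b d = psiZ X a b d + psiZ Y a b d := by
  ext I J; simp only [psiZ_apply, Matrix.add_apply, mul_add, sum_add_distrib]

theorem psiZ_smul (c : K) (X : Tensor n k) (a b : Fin n) (d : ℤ) :
    psiZ (c • X) a b d = c • psiZ X a b d := by
  ext I J; simp only [psiZ_apply, Matrix.smul_apply, mul_smul_comm, Finset.smul_sum]

lemma coeff_psiTwo (X : Tensor n k) (a b c e : Fin n) (I J : Fin k → Fin n) (r p : ℤ) :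
    ((psiTwo (firstVar k) (secondVar k) X (a ◁ c ◁ I) (cons b (e ◁ J))).coeff r).coeff p =
      psiZ (psiZ X a b p) c e r I J := by
  rw [psiTwo_apply, psiZ_apply]; simp only [coeff_sum, coeff_secondVar_mul_firstVar]; rfl

lemma coeff_psiTwo' (X : Tensor n k) (a b c e : Fin n) (I J : Fin k → Fin n) (r p : ℤ) :
    ((psiTwo (secondVar k) (firstVar k) X (a ◁ c ◁ I) (cons b (e ◁ J))).coeff r).coeff p =
      psiZ (psiZ X a b r) c e p I J := by
  rw [psiTwo_apply, psiZ_apply]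
  simp only [coeff_sum, mul_comm (firstVar k _), coeff_secondVar_mul_firstVar]
  refine sum_congr rfl fun U _ => sum_congr rfl fun V _ => mul_comm _ _

/-- The constant coefficient of `(1 - x) R(x)`. -/
def rNum₀ (n : ℕ) : Op (Fin 2) n K := fun I J =>
  if I 0 = J 0 ∧ I 1 = J 1 then if I 0 = I 1 then q else 1
  else if I 0 = J 1 ∧ I 1 = J 0 then (q - q⁻¹) * (if I 0 < I 1 then 0 else 1) else 0

/-- The linear coefficient of `(1 - x) R(x)`. -/
def rNum₁ (n : ℕ) : Op (Fin 2) n K := fun I J =>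
  if I 0 = J 0 ∧ I 1 = J 1 then if I 0 = I 1 then -q⁻¹ else -1
  else if I 0 = J 1 ∧ I 1 = J 0 then (q - q⁻¹) * (if I 0 < I 1 then 1 else 0) else 0

lemma one_sub_mul_rMatrix {x : L} (hx : x ≠ 1) (I J : Fin 2 → Fin n) : (1 - x) * rMatrix n x I J =
      ofK (rNum₀ n I J) + x * ofK (rNum₁ n I J) := by
  have h : 1 - x ≠ 0 := sub_ne_zero.2 hx.symm; rw [rMatrix, rNum₀, rNum₁]; grind

lemma rCoeff_recursion (I J : Fin 2 → Fin n) : (∀ m < 0, (rMatrix n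
      (single (1 : ℤ) (1 : K) : LaurentSeries K) I J).coeff m = 0) ∧
    ∀ m : ℤ, (rMatrix n (single (1 : ℤ) (1 : K) : LaurentSeries K) I J).coeff m =
      (rMatrix n (single (1 : ℤ) (1 : K) : LaurentSeries K) I J).coeff (m - 1) +
        (if m = 0 then rNum₀ n I J else 0) + if m = 1 then rNum₁ n I J else 0 := by
  have hl : HasLead (1 - single (1 : ℤ) (1 : K)) 0 1 := hasLead_one_sub
  have hx : (single (1 : ℤ) (1 : K) : LaurentSeries K) ≠ 1 := by
    intro h; have := hl.2; rw [h, sub_self] at this; exact zero_ne_one this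
  have h := one_sub_mul_rMatrix hx I J
  have hC : ∀ c : K, algebraMap K (LaurentSeries K) c = single 0 c := fun _ => rfl
  rw [hC, hC, single_mul_single, add_zero, one_mul] at h; constructor
  · have h1 : rMatrix n (single (1 : ℤ) (1 : K) : LaurentSeries K) I J =
        (1 - single (1 : ℤ) (1 : K))⁻¹ *
        (single 0 (rNum₀ n I J) + single 1 (rNum₁ n I J)) := by
      grind
    rw [h1]
    exact ((hl.inv one_ne_zero).mul ((HasLead.single 0 _).add
      ((HasLead.single 1 (rNum₁ n I J)).mono zero_lt_one))).1
  · intro m; have h2 := congrArg (fun φ => HahnSeries.coeff φ m) h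
    simp only [sub_mul, one_mul, HahnSeries.coeff_sub, coeff_single_mul,
      coeff_add, HahnSeries.coeff_single] at h2
    grind

lemma rCoeff_zero (I J : Fin 2 → Fin n) : rCoeff n 0 I J = rNum₀ n I J := by
  obtain ⟨h1, h2⟩ := rCoeff_recursion I J; have h3 := h2 0
  rwa [h1 (0 - 1) (by norm_num), if_pos rfl, if_neg (by norm_num), zero_add, add_zero] at h3

lemma rCoeff_succ (m : ℕ) (I J : Fin 2 → Fin n) :
    rCoeff n (m + 1) I J = rNum₀ n I J + rNum₁ n I J := by
  obtain ⟨-, h2⟩ := rCoeff_recursion I J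
  have h4 : rCoeff n (m + 1) I J = rCoeff n m I J + if m = 0 then rNum₁ n I J else 0 := by
    have h3 := h2 ((m + 1 : ℕ) : ℤ); rw [if_neg (by lia), add_zero] at h3
    have e : (((m + 1 : ℕ) : ℤ) - 1) = m := by push_cast; ring
    rw [e] at h3; refine h3.trans (congrArg _ ?_); exact if_congr (by lia) rfl rfl
  induction m with
  | zero => rw [h4, rCoeff_zero, if_pos rfl]
  | succ m ih =>
    rw [h4, if_neg (Nat.succ_ne_zero m), add_zero]; refine ih ?_; have h3 := h2 ((m + 1 : ℕ) : ℤ)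
    rw [if_neg (by lia), add_zero] at h3; have e : (((m + 1 : ℕ) : ℤ) - 1) = m := by push_cast; ring
    rw [e] at h3; refine h3.trans (congrArg _ ?_); exact if_congr (by lia) rfl rfl

/-- The grading in which only strand `0` has a weight. -/
def auxGrading (k : ℕ) (hn : 0 < n) : Grading (Fin (k + 1)) n where
  N := n
  pos := hn
  w := cons (-1) fun _ => 0
  g i := i.val

lemma auxGrading_shift (hn : 0 < n) (a b : Fin n) (I J : Fin k → Fin n) :
    (auxGrading k hn).shift (a ◁ I) (cons b J) = (b.val : ℤ) - a.val := by
  rw [Grading.shift, Fin.sum_univ_succ]; simp [auxGrading]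

lemma list_prod_diagonal {ι A : Type*} [Fintype ι] [DecidableEq ι] [Ring A] {α : Type*} (l : List α)
    (M : α → Matrix ι ι A) (h : ∀ a ∈ l, ∃ d, (∀ i, IsUnit (d i)) ∧ M a = Matrix.diagonal d) :
    ∃ d : ι → A, (∀ i, IsUnit (d i)) ∧ (l.map M).prod = Matrix.diagonal d := by
  induction l with
  | nil => exact ⟨fun _ => 1, fun _ => isUnit_one, Matrix.diagonal_one.symm⟩
  | cons a l ih =>
    obtain ⟨d, hd, h1⟩ := h a (by simp); obtain ⟨d', hd', h2⟩ := ih fun b hb => h b (by simp [hb])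
    exact ⟨fun i => d i * d' i, fun i => (hd i).mul (hd' i), by simp_all⟩

lemma rLead_diagonal {ι F : Type*} [Fintype ι] [DecidableEq ι] [Field F] [Algebra K F] {δ : ℤ}
    (hδ : δ ≠ 0) (a b : ι) (x₀ : F) :
    ∃ d : (ι → Fin n) → F, (∀ I, IsUnit (d I)) ∧ rLead n δ a b x₀ = Matrix.diagonal d := by
  rw [rLead, if_neg hδ]; refine ⟨_, fun I => isUnit_iff_ne_zero.2 ?_, rfl⟩
  have := algebraMap_q_ne_zero (F := F); split_ifs
  exacts [this, inv_ne_zero this, one_ne_zero]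

lemma hasLead_map_f {L F : Type*} [Field L] [Algebra K L] [Field F] [Algebra K F]
    {e : L →+* HahnSeries ℤ F} (he : IsConst e) {δ : ℤ} (hδ : 0 < δ) {x : L} {x₀ : F}
    (hx : e x = single δ x₀) : HasLead (e (f x)) 0 1 := by
  have h : ∀ c : F, HasLead (1 - single δ c) 0 1 := fun c => by
    have := hasLead_one_sub (δ := δ) (x₀ := c); grind
  have h1 := ((h (x₀ * ofK (q ^ 2))).mul (h (x₀ * ofK ((q⁻¹) ^ 2)))).mul
    (((h x₀).mul (h x₀)).inv (by rw [mul_one]; exact one_ne_zero))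
  rw [mul_one, inv_one, mul_one, zero_add, neg_zero, zero_add] at h1
  have h2 : ∀ c : K, e (1 - x * ofK c) = 1 - single δ (x₀ * ofK c) := fun c => by
    rw [map_sub, map_one, map_mul, hx, he, single_mul_single, add_zero]
  have h3 : e (1 - x) = 1 - single δ x₀ := by rw [map_sub, map_one, hx]
  rwa [f, map_div₀, map_mul, h2, h2, pow_two (1 - x), map_mul e (1 - x), h3, div_eq_mul_inv]

lemma ordLead_C {ι F : Type*} [Fintype ι] [DecidableEq ι] [Ring F] (G : Grading ι n) (M : Op ι n F)
    (hM : ∀ I J, M I J ≠ 0 → G.shift I J = 0) : OrdLead G (M.map C) 0 M := by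
  refine ordLead_of_entries fun I J => ?_
  by_cases h : M I J = 0
  · have hN : (0 : ℤ) < G.N := by have := G.pos; lia
    refine ⟨|G.shift I J| + 1, 0, ?_, Or.inr ⟨?_, h⟩⟩
    · rw [Matrix.map_apply, h, map_zero]; exact HasLead.zero _
    have h1 := neg_abs_le (G.shift I J)
    have h2 : |G.shift I J| + 1 ≤ G.N * (|G.shift I J| + 1) := by aesop
    lia
  · exact ⟨0, M I J, HasLead.single 0 _, Or.inl ⟨by rw [hM I J h]; ring, rfl⟩⟩

lemma psiMat_ordLead (hn : 0 < n) : ∃ d d' : (Fin (k + 1) → Fin n) → RatFun k,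
    (∀ I, d I ≠ 0) ∧ (∀ I, d' I ≠ 0) ∧ ∀ X, OrdLead (auxGrading k hn) (psiMat X) 0
      (Matrix.diagonal d * onStrands Fin.succ X * Matrix.diagonal d') := by
  have hC : ∀ c : K, algebraMap K (Ser k) c = single 0 (ofK c) := fun _ => rfl
  have hg : ∀ i j : Fin n, i < j → 0 < (auxGrading k hn).g j - (auxGrading k hn).g i ∧
      (auxGrading k hn).g j - (auxGrading k hn).g i < (auxGrading k hn).N := by
    intro i j hij; have := j.isLt; rw [lt_def] at hij; simp only [auxGrading]; lia
  have hL : ∀ m : Fin k, OrdLead (auxGrading k hn) (Rm m.succ 0 (zt m) : Op _ n (Ser k)) 0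
      (rLead n 1 m.succ 0 (z m)) := by
    intro m
    have := ordLead_R (G := auxGrading k hn) (e := RingHom.id (Ser k)) hC (Fin.succ_ne_zero m)
      (x := zt m) rfl (z_ne_zero m) (by simp [auxGrading]) fun _ => hg
    simpa [auxGrading] using this
  have hR : ∀ m : Fin k, OrdLead (auxGrading k hn) (Rm 0 m.succ (1 / (zt m * ofK (qbar n ^ 2))) :
        Op _ n (Ser k)) 0
      (rLead n (-1) 0 m.succ ((z m * ofK (qbar n ^ 2))⁻¹)) := by
    intro m; have hne : z m * cst (qbar n ^ 2) ≠ 0 := mul_ne_zero (z_ne_zero m) (by simpa using qbar_ne_zero n)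
    have hx : 1 / (zt m * algebraMap K (Ser k) (qbar n ^ 2)) =
        single (-1 : ℤ) ((z m * ofK (qbar n ^ 2))⁻¹) := by
      simp_all
    have := ordLead_R (G := auxGrading k hn) (e := RingHom.id (Ser k)) hC (Fin.succ_ne_zero m).symm
      (x := single (-1 : ℤ) _) rfl (inv_ne_zero hne) (by simp [auxGrading]) fun _ => hg
    rw [hx]; simpa [auxGrading] using this
  obtain ⟨d, hd, h1⟩ := list_prod_diagonal (finRange k).reverse
    (fun m => rLead n 1 m.succ 0 (z m : RatFun k)) fun m _ => rLead_diagonal one_ne_zero _ _ _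
  obtain ⟨d', hd', h2⟩ := list_prod_diagonal (finRange k)
    (fun m => rLead n (-1) 0 m.succ ((z m * cst (qbar n ^ 2))⁻¹))
    fun m _ => rLead_diagonal (by norm_num) _ _ _
  refine ⟨d, d', fun I => (hd I).ne_zero, fun I => (hd' I).ne_zero, fun X => ?_⟩
  have hX : OrdLead (auxGrading k hn) (onStrands Fin.succ (X.map C)) 0 (onStrands Fin.succ X) := by
    have e : (onStrands Fin.succ (X.map C) : Op (Fin (k + 1)) n (Ser k)) =
        (onStrands Fin.succ X).map C := by
      ext1 I J; rw [Matrix.map_apply]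
      by_cases h : ∀ m, m ∉ Set.range (Fin.succ : Fin k → Fin (k + 1)) → I m = J m
      · rw [onStrands_pos _ h, onStrands_pos _ h, Matrix.map_apply]
      · rw [onStrands_neg _ h, onStrands_neg _ h, map_zero]
    rw [e]; refine ordLead_C _ _ fun I J h => ?_
    have h0 : I 0 = J 0 := by
      by_contra hne; refine h (onStrands_neg _ fun h' => hne (h' 0 ?_)); rintro ⟨x, hx⟩
      exact Fin.succ_ne_zero x hx
    rw [Grading.shift, Fin.sum_univ_succ]; simp [auxGrading, h0]
  have hS : HasLead (psiScal k) 0 1 := by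
    have := HasLead.prod univ fun (m : Fin k) _ => hasLead_map_f
      (e := RingHom.id (Ser k)) hC zero_lt_one (x₀ := z m) rfl
    rw [Finset.sum_const_zero, Finset.prod_const_one] at this; have := this.inv one_ne_zero
    rwa [neg_zero, inv_one] at this
  have h := (((OrdLead.list_prod (finRange k).reverse fun m _ => hL m).mul hX).mul
    (OrdLead.list_prod (finRange k) fun m _ => hR m)).smul hS
  rwa [h1, h2, one_smul, mul_zero, add_zero, add_zero, add_zero] at h

lemma psiZ_neg (X : Tensor n k) (a b : Fin n) {d : ℤ} (hd : d < 0) :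
    psiZ X a b d = 0 := by
  obtain ⟨e, e', -, -, h⟩ := psiMat_ordLead a.pos; ext I J
  refine ordGE_iff.1 (h X).ordGE _ _ d ?_; rw [auxGrading_shift]; have h1 := b.isLt
  change (n : ℤ) * d + _ < 0; nlinarith

lemma psiZ_zero_of_lt (X : Tensor n k) {a b : Fin n} (hab : b < a) :
    psiZ X a b 0 = 0 := by
  obtain ⟨e, e', -, -, h⟩ := psiMat_ordLead (k := k) a.pos; ext I J
  refine ordGE_iff.1 (h X).ordGE _ _ 0 ?_; rw [auxGrading_shift]; rw [lt_def] at hab; lia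

lemma psiZ_zero_self (a : Fin n) :
    ∃ κ : (Fin k → Fin n) → (Fin k → Fin n) → RatFun k, (∀ I J, κ I J ≠ 0) ∧
      ∀ (X : Tensor n k) I J, psiZ X a a 0 I J = κ I J * X I J := by
  obtain ⟨e, e', he, he', h⟩ := psiMat_ordLead a.pos
  refine ⟨fun I J => e (a ◁ I) * e' (a ◁ J), fun I J => mul_ne_zero (he _) (he' _), fun X I J => ?_⟩
  have h1 := (h X).coeff (a ◁ I) (cons a J) 0 (by rw [auxGrading_shift]; ring)
  rw [psiZ, h1, Matrix.mul_diagonal, Matrix.diagonal_mul, onStrands_succ, if_pos rfl]; ring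

/-- The ratio of the two auxiliary variables. -/
notation:max "ratio" k:max => single (1 : ℤ) (single (-1 : ℤ) (1 : RatFun k))

lemma psiTwo_exchange_coeff (X : Tensor n k) (a b c e : Fin n) (r p : ℤ) (I J : Fin k → Fin n) :
    ∑ a', ∑ c', (cst (rNum₀ n ![a, c] ![a', c']) *
        psiZ (psiZ X a' b p) c' e r I J + cst (rNum₁ n ![a, c] ![a', c']) *
        psiZ (psiZ X a' b (p + 1)) c' e (r - 1) I J) =
      ∑ b', ∑ e', (cst (rNum₀ n ![b', e'] ![b, e]) *
        psiZ (psiZ X c e' r) a b' p I J + cst (rNum₁ n ![b', e'] ![b, e]) *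
        psiZ (psiZ X c e' (r - 1)) a b' (p + 1) I J) := by
  have hc1 : firstVar k (single 1 1) = single 0 (single 1 1) := rfl
  have hc2 : secondVar k (single 1 1) = single 1 1 := by
    exact HahnSeries.map_single (a := (1 : ℤ)) (r := (1 : RatFun k))
      ((C : RatFun k →+* Ser k).toAddMonoidHom.toZeroHom)
  have hξ : (secondVar k (single 1 1) / firstVar k (single 1 1)) =
      ratio k := by
    simp_all
  have hξ1 : ratio k ≠ 1 := by
    intro h; have := congrArg (fun φ => HahnSeries.coeff φ 0) h; simp at this
  have hN : ∀ (S T : Fin 2 → Fin n) (G : LaurentSeries (Ser k)),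
      (((1 - ratio k) *
        rMatrix n (ratio k) S T * G).coeff
        r).coeff p = cst (rNum₀ n S T) * (G.coeff r).coeff p +
          cst (rNum₁ n S T) * (G.coeff (r - 1)).coeff (p + 1) := by
    intro S T G
    have hC : ∀ c : K, algebraMap K (LaurentSeries (Ser k)) c =
      single 0 (single 0 (cst c)) := fun _ => rfl
    rw [one_sub_mul_rMatrix hξ1, hC, hC, single_mul_single, single_mul_single,
      add_mul, coeff_add, coeff_single_mul, coeff_single_mul,
      coeff_add, coeff_single_mul, coeff_single_mul]
    simp
  have hswap : ∀ (a c : Fin n) (I : Fin k → Fin n), compPerm n (swap 0 1) (a ◁ c ◁ I) =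
      (c ◁ a ◁ I) := by
    intro a c I; funext m; change (a ◁ c ◁ I) (swap 0 1 m) = _
    cases m using Fin.cases with
    | zero => rw [Equiv.swap_apply_left]; rfl
    | succ m =>
      cases m using Fin.cases with
      | zero => exact congrArg (a ◁ c ◁ I) (Equiv.swap_apply_right 0 1)
      | succ m =>
        exact congrArg (a ◁ c ◁ I) (Equiv.swap_apply_of_ne_of_ne (Fin.succ_ne_zero m.succ)
          (fun h => Fin.succ_ne_zero m (Fin.succ_injective _ h)))
  have h := psiTwo_exchange (n := n) (firstVar k) (secondVar k)
    (fun φ => ?_) (w₁ := firstVar k (single 1 1)) (w₂ := secondVar k (single 1 1))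
    ?_ ?_ ?_ ?_ ?_ ?_ X
  · rw [hξ] at h; have h' := congrFun (congrFun h (a ◁ c ◁ I)) (cons b (e ◁ J))
    rw [Rm, onStrands_pair_mul, mul_onStrands_pair] at h'
    simp only [fun x S T => mul_comm (x : LaurentSeries (Ser k))
      (rMatrix n (ratio k) S T)] at h'
    have h'' := congrArg (fun G : LaurentSeries (Ser k) => (((1 -
      ratio k) * G).coeff r).coeff p) h'
    simp only [Finset.mul_sum, coeff_sum] at h''
    simp only [← mul_assoc, hN, coeff_psiTwo, Matrix.submatrix_apply, hswap, coeff_psiTwo'] at h''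
    exact h''
  · exact (HahnSeries.map_C φ (C : RatFun k →+* Ser k)).symm
  · simp [hc1]
  · simp [hc2]
  · intro h; have := congrArg (fun φ => HahnSeries.coeff φ 0) h; simp [hc1, hc2] at this
  · intro m; rw [← map_mul, HahnSeries.C_apply, single_mul_single, zero_add, mul_one]
  · intro m
    have : firstVar k (C (z m)) = secondVar k (C (z m)) :=
      (HahnSeries.map_C (z m) (C : RatFun k →+* Ser k)).symm
    rw [this, ← map_mul, HahnSeries.C_apply, single_mul_single, zero_add, mul_one]
  · intro c m hc
    have hy : firstVar k (C (z m)) * ofK c = single 0 (single 0 (z m * cst c)) := by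
      have h1 : firstVar k (C (z m)) = single 0 (single 0 (z m)) := rfl
      have h2 : algebraMap K (LaurentSeries (Ser k)) c = single 0 (single 0 (cst c)) := rfl
      rw [h1, h2, single_mul_single, single_mul_single, add_zero]
    rw [hy, hc1, hc2, single_mul_single, single_mul_single, single_mul_single]; constructor <;>
    · intro h; have := congrArg (fun φ => (HahnSeries.coeff φ 0).coeff 0) h; simp at this

lemma sum_range_telescope {A : Type*} [CommRing A] (x y : A) (c : ℕ → A) (h0 : c 0 = x)
    (h1 : ∀ m, c (m + 1) = x + y) (G : ℕ → A) (r : ℕ) (hG : G (r + 1) = 0) :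
    ∑ j ∈ range (r + 1), (x * G j + y * G (j + 1)) = ∑ m ∈ range (r + 1), c m * G m := by
  have h : ∀ r, ∑ j ∈ range (r + 1), (x * G j + y * G (j + 1)) =
      ∑ m ∈ range (r + 1), c m * G m + y * G (r + 1) := by
    intro r
    induction r with
    | zero => simp [h0]
    | succ r ih => rw [Finset.sum_range_succ, ih, Finset.sum_range_succ _ (r + 1), h1]; ring
  rw [h, hG, mul_zero, add_zero]

theorem psiZ_rtt (X : Tensor n k) (a b c e : Fin n) (p : ℤ) (r : ℕ) :
    ∑ m ∈ Finset.range (r + 1), ∑ a' : Fin n, ∑ c' : Fin n,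
        rCoeff n m ![a, c] ![a', c'] • psiZ (psiZ X a' b (p + m)) c' e (r - m) =
      ∑ m ∈ Finset.range (r + 1), ∑ b' : Fin n, ∑ e' : Fin n,
        rCoeff n m ![b', e'] ![b, e] • psiZ (psiZ X c e' (r - m)) a b' (p + m) := by
  ext I J; simp only [Matrix.sum_apply, Matrix.smul_apply]; simp only [Algebra.smul_def]
  have hz : ((r : ℤ) - ((r + 1 : ℕ) : ℤ)) < 0 := by push_cast; lia
  have hneg : ∀ (Y : Tensor n k) (a b : Fin n), psiZ Y a b ((r : ℤ) - ((r + 1 : ℕ) : ℤ)) = 0 :=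
    fun Y a b => psiZ_neg Y a b hz
  have hlin : ∀ (a b : Fin n) (d : ℤ), psiZ (0 : Tensor n k) a b d = 0 := fun a b d => by
    ext I J; simp [psiZ_apply]
  rw [Finset.sum_comm, Finset.sum_congr rfl fun a' _ => Finset.sum_comm]
  rw [Finset.sum_comm (f := fun m b' => ∑ e' : Fin n,
    cOn k (rCoeff n m ![b', e'] ![b, e]) *
      psiZ (psiZ X c e' (r - m)) a b' (p + m) I J)]
  rw [Finset.sum_congr rfl fun b' _ => Finset.sum_comm
    (f := fun m e' => cOn k (rCoeff n m ![b', e'] ![b, e]) *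
      psiZ (psiZ X c e' (r - m)) a b' (p + m) I J)]
  have hc0 : ∀ S T, cOn k (rCoeff n 0 S T) = ofK (rNum₀ n S T) :=
    fun S T => by rw [rCoeff_zero]
  have hc1 : ∀ S T m, cOn k (rCoeff n (m + 1) S T) =
      ofK (rNum₀ n S T) + ofK (rNum₁ n S T) :=
    fun S T m => by rw [rCoeff_succ, map_add]
  have hL : ∀ a' c', ∑ m ∈ Finset.range (r + 1), cOn k
      (rCoeff n m ![a, c] ![a', c']) * psiZ (psiZ X a' b (p + m)) c' e (r - m) I J = _ :=
    fun a' c' => (sum_range_telescope (cOn k (rNum₀ n ![a, c] ![a', c']))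
      (cOn k (rNum₁ n ![a, c] ![a', c'])) _ (hc0 _ _) (hc1 _ _)
      (fun m => psiZ (psiZ X a' b (p + m)) c' e (r - m) I J) r (by
        change psiZ (psiZ X a' b _) c' e _ I J = 0; rw [hneg]; rfl)).symm
  have hR : ∀ b' e', ∑ m ∈ Finset.range (r + 1), cOn k
      (rCoeff n m ![b', e'] ![b, e]) * psiZ (psiZ X c e' (r - m)) a b' (p + m) I J = _ :=
    fun b' e' => (sum_range_telescope (cOn k (rNum₀ n ![b', e'] ![b, e]))
      (cOn k (rNum₁ n ![b', e'] ![b, e])) _ (hc0 _ _) (hc1 _ _)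
      (fun m => psiZ (psiZ X c e' (r - m)) a b' (p + m) I J) r (by
        change psiZ (psiZ X c e' _) a b' _ I J = 0; rw [hneg, hlin]; rfl)).symm
  simp only [hL, hR]
  rw [Finset.sum_congr rfl fun a' _ => Finset.sum_comm, Finset.sum_comm,
    Finset.sum_congr (s₁ := Finset.univ) rfl fun b' _ => Finset.sum_comm (s := Finset.univ)
      (t := Finset.range (r + 1)), Finset.sum_comm (s := Finset.univ) (t := Finset.range (r + 1))]
  refine Finset.sum_congr rfl fun j _ => ?_
  have h := psiTwo_exchange_coeff X a b c e (r - j) (p + j) I J; grind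

end Coefficients

/-! ### A representation of the extended algebra -/

section Representation

lemma psiZ_empty (X : Tensor n 0) (a b : Fin n) (d : ℤ) :
    psiZ X a b d = if a = b ∧ d = 0 then X else 0 := by
  have h : psiMat X = onStrands Fin.succ (X.map C) := by
    rw [psiMat_eq]; simp [psiScal, psiLeft, psiRight]
  ext I J; rw [psiZ, h, onStrands_succ]
  by_cases hab : a = b
  · aesop
  · rw [if_neg hab, if_neg fun h => hab h.1]; rfl

/-- Rational functions in no variables are constant. -/
def constFun : RatFun 0 →ₐ[K] K :=
  IsFractionRing.liftAlgHom (g := (MvPolynomial.isEmptyAlgEquiv K (Fin 0)).toAlgHom)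
    (MvPolynomial.isEmptyAlgEquiv K (Fin 0)).injective

/-- The scalar which is an empty tensor. -/
def scalarOf (n : ℕ) : Tensor n 0 →ₗ[K] K :=
  constFun.toLinearMap ∘ₗ Matrix.entryLinearMap K (RatFun 0) default default

lemma scalarOf_injective (n : ℕ) : Injective (scalarOf n) := by
  intro X Y h; have h1 : X default default = Y default default := constFun.toRingHom.injective h
  ext I J; rw [Subsingleton.elim I default, Subsingleton.elim J default, h1]

lemma scalarOf_one (n : ℕ) : scalarOf n 1 = 1 := by
  change constFun ((1 : Tensor n 0) default default) = 1; rw [Matrix.one_apply_eq, map_one]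

/-- The linear map `X ↦ psiZ X a b d`. -/
def psiLin (k : ℕ) (a b : Fin n) (d : ℤ) : Tensor n k →ₗ[K] Tensor n k where
  toFun X := psiZ X a b d
  map_add' X Y := psiZ_add X Y a b d
  map_smul' c X := psiZ_smul c X a b d

lemma exists_psiLin_inverse (k : ℕ) (a : Fin n) :
    ∃ φ : Tensor n k →ₗ[K] Tensor n k, φ * psiLin k a a 0 = 1 ∧ psiLin k a a 0 * φ = 1 := by
  obtain ⟨κ, hκ, h⟩ := psiZ_zero_self a
  refine ⟨{ toFun := fun X I J => (κ I J)⁻¹ * X I J, map_add' := ?_, map_smul' := ?_ }, ?_, ?_⟩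
  · intro X Y; ext I J; exact mul_add _ _ _
  · intro c X; ext I J; exact mul_smul_comm c (κ I J)⁻¹ (X I J)
  · ext X I J; exact (congrArg _ (h X I J)).trans (inv_mul_cancel_left₀ (hκ I J) _)
  · ext X I J; exact (h _ I J).trans (mul_inv_cancel_left₀ (hκ I J) _)

variable (n k)

/-- The module on which the extended algebra acts from the right. -/
abbrev ExtModule : Type := Tensor n 0 × Tensor n k

variable {n}

/-- The action of `s_{[a;b+nd)}`. -/
def sAct (a b : Fin n) (d : ℤ) : Module.End K (ExtModule n k) :=
  LinearMap.prodMap (psiLin 0 a b d) (psiLin k a b d)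

/-- The action of a tensor with `k` strands. -/
def tensorAct : Tensor n k →ₗ[K] Module.End K (ExtModule n k) where
  toFun X := LinearMap.inr K (Tensor n 0) (Tensor n k) ∘ₗ
    (scalarOf n ∘ₗ LinearMap.fst K (Tensor n 0) (Tensor n k)).smulRight X
  map_add' X Y := by refine LinearMap.ext fun x => Prod.ext ?_ ?_ <;> simp
  map_smul' c X := by
    refine LinearMap.ext fun x => Prod.ext ?_ ?_
    · simp
    · simp [smul_comm c]

/-- The action of a tensor. -/
def xAct : (j : ℕ) → Tensor n j →ₗ[K] Module.End K (ExtModule n k)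
  | 0 => (scalarOf n).smulRight 1
  | j + 1 => if h : j + 1 = k then h ▸ tensorAct (j + 1) else 0

variable {k}

lemma sAct_neg (a b : Fin n) {d : ℤ} (hd : d < 0) : sAct k a b d = 0 :=
  LinearMap.ext fun x => Prod.ext (psiZ_neg x.1 a b hd) (psiZ_neg x.2 a b hd)

lemma sAct_fst (a b : Fin n) (d : ℤ) (x : ExtModule n k) :
    (sAct k a b d x).1 = if a = b ∧ d = 0 then x.1 else 0 := psiZ_empty x.1 a b d

lemma xAct_mul_s (j : ℕ) (X : Tensor n j) (a b : Fin n) (d : ℕ) :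
    sAct k a b d * xAct k j X =
      ∑ c : Fin n, ∑ m ∈ range (d + 1), xAct k j (psiZ X c b m) * sAct k a c (d - m) := by
  cases j with
  | zero =>
    rw [sum_eq_single b, sum_eq_single 0]
    · rw [psiZ_empty, if_pos ⟨rfl, rfl⟩]; simp [xAct]
    · intro m _ hm; rw [psiZ_empty, if_neg fun h => hm (by exact_mod_cast h.2), map_zero, zero_mul]
    · simp
    · refine fun c _ hc => sum_eq_zero fun m _ => ?_
      rw [psiZ_empty, if_neg fun h => hc h.1, map_zero, zero_mul]
    · simp
  | succ j =>
    by_cases h : j + 1 = k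
    · subst h
      have hx : ∀ Y : Tensor n (j + 1), xAct (j + 1) (j + 1) Y = tensorAct (j + 1) Y := fun Y => by
        rw [xAct, dif_pos rfl]
      simp only [hx]; refine LinearMap.ext fun x => ?_
      rw [LinearMap.sum_apply, sum_eq_single a, LinearMap.sum_apply, sum_eq_single d]
      · refine Prod.ext ?_ ?_
        · change psiZ 0 a b d = 0; exact (psiLin 0 a b d).map_zero
        · change psiZ (scalarOf n x.1 • X) a b d = scalarOf n (sAct (j + 1) a a (d - d) x).1 • psiZ X a b d
          rw [sAct_fst, sub_self, if_pos ⟨rfl, rfl⟩, psiZ_smul]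
      · refine fun m _ hm => Prod.ext rfl ?_
        change scalarOf n (sAct (j + 1) a a (d - m) x).1 • psiZ X a b m = 0
        rw [sAct_fst, if_neg, map_zero, zero_smul]; rintro ⟨-, h⟩; exact hm (by lia)
      · simp
      · intro c _ hc; rw [LinearMap.sum_apply]; refine sum_eq_zero fun m _ => Prod.ext rfl ?_
        change scalarOf n (sAct (j + 1) a c (d - m) x).1 • psiZ X c b m = 0
        rw [sAct_fst, if_neg fun h => hc h.1.symm, map_zero, zero_smul]
      · simp
    · have hx : ∀ Y : Tensor n (j + 1), xAct k (j + 1) Y = 0 := fun Y => by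
        rw [xAct, dif_neg h]; rfl
      simp [hx]

lemma exists_rep (k : ℕ) : ∃ ρ : Ext n →ₐ[K] (Module.End K (ExtModule n k))ᵐᵒᵖ,
    ∀ j X, ρ (xLin n j X) = MulOpposite.op (xAct k j X) := by
  have hinv : ∀ a, ∃ φ : Module.End K (ExtModule n k),
      φ * sAct k a a 0 = 1 ∧ sAct k a a 0 * φ = 1 := by
    intro a; obtain ⟨φ, h1, h2⟩ := exists_psiLin_inverse 0 a
    obtain ⟨ψ, h3, h4⟩ := exists_psiLin_inverse k a; refine ⟨LinearMap.prodMap φ ψ, ?_, ?_⟩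
    · exact LinearMap.ext fun x => Prod.ext (LinearMap.congr_fun h1 x.1) (LinearMap.congr_fun h3 x.2)
    · exact LinearMap.ext fun x => Prod.ext (LinearMap.congr_fun h2 x.1) (LinearMap.congr_fun h4 x.2)
  choose φ hφ1 hφ2 using hinv
  set g : Gen n → (Module.End K (ExtModule n k))ᵐᵒᵖ := fun t => match t with
    | .s a b d => MulOpposite.op (sAct k a b d)
    | .psi a => MulOpposite.op (φ a)
    | .x j X => MulOpposite.op (xAct k j X) with hg
  have hS : ∀ a b (d : ℤ), FreeAlgebra.lift K g (freeS n a b d) = MulOpposite.op (sAct k a b d) := by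
    intro a b d; rw [freeS]; split_ifs with hd
    · simp_all
    · rw [sAct_neg a b (not_le.1 hd), map_zero, MulOpposite.op_zero]
  have hX : ∀ j (X : Tensor n j), FreeAlgebra.lift K g (freeX X) = MulOpposite.op (xAct k j X) :=
    fun j X => FreeAlgebra.lift_ι_apply _ _
  have hP : ∀ a, FreeAlgebra.lift K g (FreeAlgebra.ι K (Gen.psi a)) = MulOpposite.op (φ a) :=
    fun a => FreeAlgebra.lift_ι_apply _ _
  have hrel : ∀ ⦃u v⦄, ExtRel n u v → FreeAlgebra.lift K g u = FreeAlgebra.lift K g v := by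
    intro u v huv
    cases huv with
    | s_tri a b h =>
      rw [hS, map_zero]; refine congrArg MulOpposite.op (LinearMap.ext fun x => Prod.ext ?_ ?_)
      · exact psiZ_zero_of_lt x.1 h
      · exact psiZ_zero_of_lt x.2 h
    | s_psi a => rw [map_mul, hS, hP, ← MulOpposite.op_mul, hφ1, map_one, MulOpposite.op_one]
    | psi_s a => rw [map_mul, hS, hP, ← MulOpposite.op_mul, hφ2, map_one, MulOpposite.op_one]
    | rtt a b c e p r =>
      simp only [map_sum, map_smul, map_mul, hS, ← MulOpposite.op_mul, ← MulOpposite.op_smul,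
        ← Finset.op_sum]
      refine congrArg MulOpposite.op (LinearMap.ext fun x => Prod.ext ?_ ?_)
      · simp only [LinearMap.sum_apply, Prod.fst_sum]; exact psiZ_rtt x.1 a b c e p r
      · simp only [LinearMap.sum_apply, Prod.snd_sum]; exact psiZ_rtt x.2 a b c e p r
    | x_add j X Y => rw [map_add, hX, hX, hX, map_add, MulOpposite.op_add]
    | x_smul j r X => rw [map_smul, hX, hX, map_smul, MulOpposite.op_smul]
    | x_one =>
      rw [hX, map_one (FreeAlgebra.lift K g)]
      refine (congrArg MulOpposite.op ?_).trans MulOpposite.op_one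
      change scalarOf n 1 • (1 : Module.End K (ExtModule n k)) = 1; rw [scalarOf_one, one_smul]
    | x_s j X a b d =>
      simp only [map_sum, map_mul, hS, hX, ← MulOpposite.op_mul, ← Finset.op_sum]
      exact congrArg MulOpposite.op (xAct_mul_s j X a b d)
  refine ⟨RingQuot.liftAlgHom K ⟨FreeAlgebra.lift K g, hrel⟩, fun j X => ?_⟩
  exact (RingQuot.liftAlgHom_mkAlgHom_apply _ _ hrel _).trans (hX j X)

lemma xLin_injective (k : ℕ) : Injective (xLin n k) := by
  intro X Y h; obtain ⟨ρ, hρ⟩ := exists_rep k; have h1 := congrArg (fun u => (ρ u).unop (1, 0)) h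
  simp only [hρ, MulOpposite.unop_op] at h1
  cases k with
  | zero =>
    have hx : ∀ Y, scalarOf n (xAct 0 0 Y (1, 0)).1 = scalarOf n Y := fun Y => by
      have h2 : (xAct 0 0 Y (1, 0)).1 = scalarOf n Y • (1 : Tensor n 0) := rfl
      rw [h2, map_smul, scalarOf_one, smul_eq_mul, mul_one]
    refine scalarOf_injective n ?_; rw [← hx X, h1, hx]
  | succ k =>
    have hx : ∀ Y, (xAct (k + 1) (k + 1) Y (1, 0)).2 = Y := fun Y => by
      rw [xAct, dif_pos rfl]; change scalarOf n 1 • Y = Y; rw [scalarOf_one, one_smul]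
    rw [← hx X, h1, hx]

end Representation

/-! ### Triangular matrices over a ring -/

section Triangular

variable {A : Type*} [Ring A] {M N : Matrix (Fin n) (Fin n) A}

lemma isUnit_of_triangular (h0 : ∀ i j, i < j → M i j = 0) (h1 : ∀ i, IsUnit (M i i)) :
    IsUnit M := by
  choose u hu using h1
  set D : Matrix (Fin n) (Fin n) A := Matrix.diagonal fun i => ((u i)⁻¹ : Aˣ)
  have hD : IsUnit D := by
    refine ⟨⟨D, Matrix.diagonal fun i => (u i : A), ?_, ?_⟩, rfl⟩ <;>
      rw [Matrix.diagonal_mul_diagonal, ← Matrix.diagonal_one] <;> simp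
  have hU : ∀ i j, i ≤ j → (D * M - 1) i j = 0 := by
    intro i j hij; rw [Matrix.sub_apply, Matrix.diagonal_mul]; rcases hij.eq_or_lt with rfl | h
    · rw [← hu, Units.inv_mul, Matrix.one_apply_eq, sub_self]
    · rw [h0 _ _ h, mul_zero, Matrix.one_apply_ne h.ne, sub_zero]
  have hpow : ∀ (r : ℕ) i j, i.val < j.val + r → ((D * M - 1) ^ r) i j = 0 := by
    intro r
    induction r with
    | zero => intro i j h; rw [pow_zero, Matrix.one_apply_ne (Fin.ne_of_val_ne (by lia))]
    | succ r ih =>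
      intro i j h; rw [pow_succ, mul_apply]; refine sum_eq_zero fun l _ => ?_
      rcases le_or_gt l j with hl | hl
      · rw [hU _ _ hl, mul_zero]
      · rw [ih i l (by rw [lt_def] at hl; lia), zero_mul]
  have hnil : IsNilpotent (D * M - 1) := ⟨n, by ext i j; exact hpow n i j (by lia)⟩
  have h := hnil.isUnit_one_add; rw [add_sub_cancel] at h; exact (hD.mul_left_iff).1 h

lemma triangular_of_mul_eq_one (h0 : ∀ i j, i < j → M i j = 0) (h1 : ∀ i, IsUnit (M i i))
    (h : M * N = 1) : (∀ i j, i < j → N i j = 0) ∧ ∀ i, IsUnit (N i i) := by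
  have hz : ∀ i j, i < j → N i j = 0 := by
    intro i
    induction hr : i.val using Nat.strong_induction_on generalizing i with
    | _ r ih =>
      intro j hij; have h2 := congrFun (congrFun h i) j
      rw [mul_apply, Matrix.one_apply_ne hij.ne, sum_eq_single i] at h2
      · exact (h1 i).mul_right_eq_zero.1 h2
      · grind
      · simp
  refine ⟨hz, fun i => ?_⟩; have h2 := congrFun (congrFun h i) i
  rw [mul_apply, Matrix.one_apply_eq, sum_eq_single i] at h2
  · obtain ⟨u, hu⟩ := h1 i; rw [← hu] at h2; rw [← Units.inv_eq_of_mul_eq_one_right h2]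
    exact Units.isUnit _
  · grind
  · simp

end Triangular

/-! ### The leading terms of the series `S` and `T` -/

section Dress

variable {m : ℕ}

lemma sElt_of_lt {a b : Fin n} (h : b < a) : sElt n a b 0 = 0 :=
  (toExt_rel (ExtRel.s_tri a b h)).trans (map_zero _)

lemma isUnit_sElt (a : Fin n) : IsUnit (sElt n a a 0) := ⟨⟨_, toExt n (FreeAlgebra.ι K (Gen.psi a)),
    (map_mul _ _ _).symm.trans ((toExt_rel (ExtRel.s_psi a)).trans (map_one _)),
    (map_mul _ _ _).symm.trans ((toExt_rel (ExtRel.psi_s a)).trans (map_one _))⟩, rfl⟩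

lemma tElt_zero : (∀ a b, b < a → tElt n a b 0 = 0) ∧ ∀ a, IsUnit (tElt n a a 0) := by
  have e : ∀ a b, PowerSeries.constantCoeff (sDual n) a b =
      ((q ^ (2 * (a.val + 1)))⁻¹ * q ^ (2 * (b.val + 1)) * ((q ^ (2 * n) * qbar n ^ 2) ^ 0)⁻¹) •
      sElt n b a 0 := fun a b => by
    rw [← PowerSeries.coeff_zero_eq_constantCoeff_apply, sDual, PowerSeries.coeff_mk]; rfl
  have h0 : ∀ a b, a < b → PowerSeries.constantCoeff (sDual n) a b = 0 := fun a b h => by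
    rw [e, sElt_of_lt h, smul_zero]
  have h1 : ∀ a, IsUnit (PowerSeries.constantCoeff (sDual n) a a) := fun a => by
    rw [e, pow_zero, inv_one, mul_one, inv_mul_cancel₀ (pow_ne_zero _ q_ne_zero), one_smul]
    exact isUnit_sElt a
  have hu : IsUnit (sDual n) := PowerSeries.isUnit_iff_constantCoeff.2 (isUnit_of_triangular h0 h1)
  have h := triangular_of_mul_eq_one h0 h1
    (by rw [← map_mul, Ring.mul_inverse_cancel _ hu, map_one])
  have e' : ∀ a b, tElt n a b 0 = PowerSeries.constantCoeff (Ring.inverse (sDual n)) b a :=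
    fun a b => by rw [tElt, PowerSeries.coeff_zero_eq_constantCoeff_apply]
  exact ⟨fun a b hab => (e' a b).trans (h.1 b a hab), fun a => (e' a a) ▸ h.2 a⟩

/-- The grading in which all strands have weight `-1`. -/
def degGrading (m : ℕ) (hn : 0 < n) : Grading (Fin m) n := ⟨n, hn, fun _ => -1, fun i => i.val⟩

lemma strandSeries_ordLead (hn : 0 < n) {g : Fin n → Fin n → ℕ → Ext n}
    (hg : ∀ a b, b < a → g a b 0 = 0) (b : Fin m) : OrdLead (degGrading m hn) (strandSeries g b) 0
      (Matrix.diagonal fun I => g (I b) (I b) 0 ⊗ₜ[K] (1 : RatFun m)) := by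
  have hc : ∀ i j : Fin n, (HahnSeries.ofPowerSeries ℤ _ (PowerSeries.mk fun d =>
      g i j d ⊗ₜ[K] (z b ^ d : RatFun m)⁻¹)).coeff 0 = g i j 0 ⊗ₜ[K] (1 : RatFun m) := fun i j => by
    have := HahnSeries.ofPowerSeries_apply_coeff (Γ := ℤ) (PowerSeries.mk fun d =>
      g i j d ⊗ₜ[K] (z b ^ d : RatFun m)⁻¹) 0
    simp_all
  have hneg : ∀ i j : Fin n, ∀ p < 0, (HahnSeries.ofPowerSeries ℤ _ (PowerSeries.mk fun d =>
      g i j d ⊗ₜ[K] (z b ^ d : RatFun m)⁻¹)).coeff p = 0 := fun i j p hp => by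
    exact (PowerSeries.coeff_coe _ p).trans (if_pos hp)
  refine ordLead_of_entries fun I J => ?_
  by_cases h : ∀ x, x ∉ Set.range (fun _ : Fin 1 => b) → I x = J x
  · have hs : (degGrading m hn).shift I J = ((J b).val : ℤ) - (I b).val := by
      rw [Grading.shift, sum_eq_single b]
      · simp [degGrading]
      · grind
      · simp
    have he : strandSeries g b I J = HahnSeries.ofPowerSeries ℤ _ (PowerSeries.mk fun d =>
      g (I b) (J b) d ⊗ₜ[K] (z b ^ d : RatFun m)⁻¹) := if_pos h
    rw [he, hs]; rcases lt_trichotomy (J b) (I b) with hlt | heq | hlt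
    · refine ⟨1, _, ⟨fun p hp => ?_, rfl⟩, Or.inr ⟨?_, ?_⟩⟩
      · rcases (show p ≤ 0 by lia).lt_or_eq with h1 | rfl
        · exact hneg _ _ p h1
        simp_all
      · have h1 : ((I b).val : ℤ) < n := by exact_mod_cast (I b).isLt
        have h2 := Int.natCast_nonneg (J b).val; change (0 : ℤ) < n * 1 + _; linarith
      · exact Matrix.diagonal_apply_ne _ fun e => hlt.ne (by rw [e])
    · have hIJ : I = J := by grind
      subst hIJ; refine ⟨0, _, ⟨fun p hp => hneg _ _ p hp, hc _ _⟩, Or.inl ⟨by ring, ?_⟩⟩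
      exact Matrix.diagonal_apply_eq _ _
    · refine ⟨0, _, ⟨fun p hp => hneg _ _ p hp, hc _ _⟩, Or.inr ⟨?_, ?_⟩⟩
      · have h1 : ((I b).val : ℤ) < (J b).val := by exact_mod_cast hlt
        linarith
      · exact Matrix.diagonal_apply_ne _ fun e => hlt.ne (by rw [e])
  · have he : strandSeries g b I J = 0 := if_neg h; rw [he]; have hN : (0 : ℤ) < n := by lia
    refine ⟨|(degGrading m hn).shift I J| + 1, 0, HasLead.zero _, Or.inr ⟨?_, ?_⟩⟩
    · have h1 := neg_abs_le ((degGrading m hn).shift I J)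
      have h2 : |(degGrading m hn).shift I J| + 1 ≤ n * (|(degGrading m hn).shift I J| + 1) := by
        have := abs_nonneg ((degGrading m hn).shift I J); nlinarith
      change _ < (n : ℤ) * _ + _; lia
    · exact Matrix.diagonal_apply_ne _ fun e => h fun _ _ => by rw [e]

end Dress

section UnitLead

variable {ι A : Type*} [Fintype ι] [DecidableEq ι] [Ring A] {G : Grading ι n}

/-- The leading term has order zero, and lies in `𝒮`. -/
def LeadIn (𝒮 : Submonoid (Op ι n A)) (G : Grading ι n) (M : Op ι n (HahnSeries ℤ A)) : Prop :=
  ∃ M₀ ∈ 𝒮, OrdLead G M 0 M₀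

/-- The leading term has order zero, and is invertible. -/
abbrev UnitLead (G : Grading ι n) (M : Op ι n (HahnSeries ℤ A)) : Prop :=
  LeadIn (IsUnit.submonoid (Op ι n A)) G M

variable {𝒮 : Submonoid (Op ι n A)}

lemma isUnit_diagonal {d : (ι → Fin n) → A} (hd : ∀ I, IsUnit (d I)) : IsUnit (Matrix.diagonal d) :=
  (Pi.isUnit_iff.2 hd).map (Matrix.diagonalRingHom (ι → Fin n) A)

lemma LeadIn.mul {M M' : Op ι n (HahnSeries ℤ A)} (h : LeadIn 𝒮 G M) (h' : LeadIn 𝒮 G M') :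
    LeadIn 𝒮 G (M * M') := by
  obtain ⟨M₀, h0, h1⟩ := h; obtain ⟨M₁, h2, h3⟩ := h'
  exact ⟨M₀ * M₁, mul_mem h0 h2, by simpa using h1.mul h3⟩

lemma LeadIn.list_prod {κ : Type*} (l : List κ) {M : κ → Op ι n (HahnSeries ℤ A)}
    (h : ∀ i ∈ l, LeadIn 𝒮 G (M i)) : LeadIn 𝒮 G (l.map M).prod := by
  induction l with
  | nil => exact ⟨1, one_mem _, OrdLead.one⟩
  | cons a l ih =>
    rw [List.map_cons, List.prod_cons]
    exact (h a (by simp)).mul (ih fun i hi => h i (by simp [hi]))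

lemma UnitLead.ordGE_of_mul {D D' M : Op ι n (HahnSeries ℤ A)} {E : ℤ} (hD : UnitLead G D)
    (hD' : UnitLead G D') (h : OrdGE G (D * M * D') E) : OrdGE G M E := by
  obtain ⟨D₀, hu, hD⟩ := hD; obtain ⟨D₁, hu', hD'⟩ := hD'
  by_cases hM : M = 0
  · rw [hM]; exact OrdGE.zero E
  obtain ⟨E', M₀, h0, hl⟩ := exists_ordLead hM; refine hl.ordGE.mono (not_lt.1 fun hE => h0 ?_)
  have hl' := (hD.mul hl).mul hD'; rw [zero_add, add_zero] at hl'
  have h1 : D₀ * M₀ * D₁ = 0 := by ext1 I J; exact (hl' I J).2.symm.trans (h I J E' hE)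
  exact (IsUnit.mul_right_eq_zero hu).1 ((IsUnit.mul_left_eq_zero hu').1 h1)

end UnitLead

section Slope

variable {m : ℕ}

/-- The weights `0` on the first `i` strands and `-1` on the others. -/
abbrev lastWeights (i m : ℕ) : Fin (i + m) → ℤ := Fin.append (fun _ => (0 : ℤ)) (fun _ => -1)

lemma expand_z (w : Fin k → ℤ) (i : Fin k) : expand w (z i) = single (w i) (z i) := by
  rw [expand, z, IsFractionRing.liftAlgHom_apply, IsFractionRing.lift_algebraMap]
  exact MvPolynomial.aeval_X _ _

lemma isConst_expand (w : Fin k → ℤ) : IsConst (expand w).toRingHom :=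
  fun c => (expand w).commutes c

lemma single_div_single {F : Type*} [Field F] (a b : ℤ) (x : F) {y : F} (hy : y ≠ 0) :
    single a x / single b y = single (a - b) (x / y) := by
  simp

lemma SlopeCond.ordGE (hn : 0 < n) {i : ℕ} {μ : ℚ} {X : Tensor n (i + m)}
    (hX : SlopeCond μ i m X) :
    OrdGE ⟨n, hn, lastWeights i m, fun a => a.val⟩ (X.map (expand (lastWeights i m))) ⌈-(μ * m)⌉ := by
  obtain ⟨τ, hτ, hs⟩ := hX
  have hu : ∀ a, IsUnit a → IsUnit (a ⊗ₜ[K] (1 : RatFun m)) := fun a ha =>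
    ha.map (Algebra.TensorProduct.includeLeft : Ext n →ₐ[K] Ext n ⊗[K] RatFun m)
  have h1 : OrdGE (degGrading m hn) (τ.map fun φ => φ.map (LinearMap.rTensor (RatFun m) (xLin n i)))
      ⌈-(μ * m)⌉ := by
    refine UnitLead.ordGE_of_mul (LeadIn.list_prod _ fun b _ => ⟨_, isUnit_diagonal
      fun I => hu _ (isUnit_sElt (I b)), strandSeries_ordLead hn (fun _ _ => sElt_of_lt) b⟩)
      (LeadIn.list_prod _ fun b _ => ⟨_, isUnit_diagonal fun I => hu _ (tElt_zero.2 (I b)),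
      strandSeries_ordLead hn tElt_zero.1 b⟩) (ordGE_iff.2 fun I J p hp => hs I J p ?_)
    rw [Int.lt_ceil] at hp
    have hsh : (degGrading m hn).shift I J = ∑ b, (((J b).val : ℤ) - (I b).val) := by
      rw [Grading.shift]; exact sum_congr rfl fun b _ => by simp [degGrading]
    rw [hsh] at hp; change (((n : ℤ) * p + _ : ℤ) : ℚ) < _ at hp; push_cast at hp ⊢; linarith
  have hinj := Module.Flat.rTensor_preserves_injective_linearMap (M := RatFun m) (xLin n i)
    (xLin_injective i)
  have h2 : ∀ I J p, (n : ℤ) * p + (degGrading m hn).shift I J < ⌈-(μ * m)⌉ → (τ I J).coeff p = 0 :=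
    fun I J p hp => hinj ((ordGE_iff.1 h1 I J p hp).trans (map_zero _).symm)
  have hf : ∀ (a : Fin i) (b : Fin m), HasLead (expand (lastWeights i m)
      (f (z (Fin.castAdd m a) / z (Fin.natAdd i b)))) 0 1 := by
    refine fun a b => hasLead_map_f (e := (expand (lastWeights i m)).toRingHom) (isConst_expand _) zero_lt_one
      (x₀ := z (Fin.castAdd m a) / z (Fin.natAdd i b)) ?_
    change expand (lastWeights i m) _ = _
    rw [map_div₀, expand_z, expand_z, single_div_single _ _ _ (z_ne_zero _)]; simp [lastWeights]
  have hF : HasLead (expand (lastWeights i m) (∏ a : Fin i, ∏ b : Fin m,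
      f (z (Fin.castAdd m a) / z (Fin.natAdd i b)))) 0 1 := by
    rw [map_prod]; simp only [map_prod]
    simpa using HasLead.prod univ fun a _ => HasLead.prod univ fun b _ => hf a b
  have h3 : OrdGE ⟨n, hn, lastWeights i m, fun a => a.val⟩ (fun I J => expand (lastWeights i m)
      (X I J / ∏ a : Fin i, ∏ b : Fin m, f (z (Fin.castAdd m a) / z (Fin.natAdd i b))))
      ⌈-(μ * m)⌉ := by
    refine ordGE_iff.2 fun I J p hp => ?_
    have h4 := congrArg (fun φ => HahnSeries.coeff φ p) (hτ (fun a => I (Fin.castAdd m a))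
      (fun a => J (Fin.castAdd m a)) (fun b => I (Fin.natAdd i b)) (fun b => J (Fin.natAdd i b)))
    rw [Fin.append_castAdd_natAdd, Fin.append_castAdd_natAdd] at h4; refine h4.symm.trans ?_
    rw [HahnSeries.map_coeff, h2 _ _ p, map_zero]; convert hp using 2
    rw [Grading.shift, Grading.shift, Fin.sum_univ_add]; simp [degGrading]
  have h0 : (∏ a : Fin i, ∏ b : Fin m, f (z (Fin.castAdd m a) / z (Fin.natAdd i b)) :
      RatFun (i + m)) ≠ 0 := fun h0 => by
    rw [h0, map_zero] at hF; exact zero_ne_one hF.2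
  have h5 := h3.smul hF.1; rw [mul_zero, zero_add] at h5; refine ordGE_iff.2 fun I J p hp => ?_
  have h6 : expand (lastWeights i m) (X I J) = _ * expand (lastWeights i m) _ :=
    (congrArg _ (mul_div_cancel₀ (X I J) h0).symm).trans (map_mul _ _ _)
  rw [Matrix.map_apply, h6]; exact ordGE_iff.1 h5 I J p hp

end Slope

/-! ### Laurent monomials -/

section Mono

/-- The monomial with exponents `p`. -/
def mono (p : Fin k → ℤ) : RatFun k := ∏ i, z i ^ p i

lemma mono_add (p p' : Fin k → ℤ) : mono (p + p') = mono p * mono p' := by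
  rw [mono, mono, mono, ← prod_mul_distrib]
  exact prod_congr rfl fun i _ => zpow_add₀ (z_ne_zero i) _ _

lemma mono_single (i : Fin k) (a : ℤ) : mono (Pi.single i a) = z i ^ a := by
  rw [mono, Finset.prod_eq_single i]
  · rw [Pi.single_eq_same]
  · simp_all
  · simp

lemma mono_natCast (s : Fin k →₀ ℕ) : (mono fun i => (s i : ℤ)) =
    algebraMap _ (RatFun k) (MvPolynomial.monomial s (1 : K)) := by
  rw [mono, MvPolynomial.monomial_eq, map_mul, map_one, map_one, one_mul, Finsupp.prod_fintype _ _
    (fun i => pow_zero _), map_prod]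
  exact prod_congr rfl fun i _ => by rw [zpow_natCast, map_pow]; rfl

lemma linearCombination_mono_injective :
    Injective (Finsupp.linearCombination K (mono (k := k))) := by
  rw [injective_iff_map_eq_zero]; intro φ h
  obtain ⟨D, hD⟩ : ∃ D : ℕ, ∀ p ∈ φ.support, ∀ i, 0 ≤ p i + D := by
    refine ⟨∑ p ∈ φ.support, ∑ i, (p i).natAbs, fun p hp i => ?_⟩
    have h1 := Finset.single_le_sum (f := fun p : Fin k → ℤ => ∑ i, (p i).natAbs)
      (fun _ _ => Nat.zero_le _) hp
    have h2 := Finset.single_le_sum (f := fun i => (p i).natAbs) (fun _ _ => Nat.zero_le _)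
      (mem_univ i)
    have h3 := h2.trans h1; lia
  set e : (Fin k → ℤ) → (Fin k →₀ ℕ) := fun p => Finsupp.equivFunOnFinite.symm fun i =>
    (p i + D).toNat with he
  have h1 : algebraMap _ (RatFun k) (∑ p ∈ φ.support, MvPolynomial.monomial (e p) (φ p)) = 0 := by
    rw [← zero_mul (mono fun _ => (D : ℤ)), ← h, Finsupp.linearCombination_apply, Finsupp.sum,
      Finset.sum_mul, map_sum]
    refine sum_congr rfl fun p hp => ?_
    rw [smul_mul_assoc, ← mono_add, ← mul_one (φ p), ← smul_eq_mul, ← MvPolynomial.smul_monomial,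
      ← IsScalarTower.coe_toAlgHom' K, map_smul, IsScalarTower.coe_toAlgHom', ← mono_natCast,
      smul_eq_mul, mul_one]
    congr 2; funext i; exact Int.toNat_of_nonneg (hD p hp i)
  have h2 := cst_injective k (h1.trans (map_zero _).symm); ext p; by_contra hp
  have h3 := congrArg (MvPolynomial.coeff (e p)) h2
  rw [MvPolynomial.coeff_sum, sum_eq_single p, MvPolynomial.coeff_monomial, if_pos rfl] at h3
  · exact hp h3
  · intro p' hp' hne; rw [MvPolynomial.coeff_monomial, if_neg]
    refine fun heq => hne (funext fun i => ?_); have h4 := DFunLike.congr_fun heq i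
    have h5 := hD p (Finsupp.mem_support_iff.2 hp) i; have h6 := hD p' hp' i
    change (p' i + D).toNat = (p i + D).toNat at h4; lia
  · exact fun h => absurd (Finsupp.mem_support_iff.2 hp) h

lemma mem_span_mono (hφ : φ ∈ laurent k) : φ ∈ Submodule.span K (Set.range (mono)) := by
  have h : Subalgebra.toSubmodule (laurent k) ≤ Submodule.span K (Set.range (mono)) := by
    rw [laurent, Algebra.adjoin_eq_span]; refine Submodule.span_mono fun x hx => ?_
    induction hx using Submonoid.closure_induction with
    | mem x hx =>
      rcases hx with ⟨i, rfl⟩ | ⟨i, rfl⟩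
      · exact ⟨Pi.single i 1, (mono_single i 1).trans (zpow_one _)⟩
      · exact ⟨Pi.single i (-1), (mono_single i (-1)).trans (zpow_neg_one _)⟩
    | one => exact ⟨0, Finset.prod_eq_one fun i _ => zpow_zero _⟩
    | mul x y _ _ hx hy =>
      obtain ⟨p, rfl⟩ := hx; obtain ⟨p', rfl⟩ := hy; exact ⟨p + p', mono_add p p'⟩
  exact h hφ

lemma exists_lcoef (k : ℕ) : ∃ g : RatFun k →ₗ[K] ((Fin k → ℤ) →₀ K),
    g ∘ₗ Finsupp.linearCombination K (mono (k := k)) = LinearMap.id :=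
  LinearMap.exists_leftInverse_of_injective _
    (LinearMap.ker_eq_bot.2 linearCombination_mono_injective)

/-- The coefficients of Laurent polynomials, extended linearly to all functions. -/
def lcoef (k : ℕ) : RatFun k →ₗ[K] ((Fin k → ℤ) →₀ K) := (exists_lcoef k).choose

lemma lcoef_mono (p : Fin k → ℤ) : lcoef k (mono p) = Finsupp.single p 1 := by
  have h := LinearMap.congr_fun (exists_lcoef k).choose_spec (Finsupp.single p 1)
  rwa [LinearMap.comp_apply, Finsupp.linearCombination_single, one_smul] at h

lemma sum_lcoef (hφ : φ ∈ laurent k) : ∑ p ∈ (lcoef k φ).support, lcoef k φ p • mono p = φ := by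
  have h := mem_span_mono hφ; rw [← Finsupp.range_linearCombination] at h; obtain ⟨c, rfl⟩ := h
  have h1 : lcoef k (Finsupp.linearCombination K mono c) = c :=
    LinearMap.congr_fun (exists_lcoef k).choose_spec c
  rw [h1]; rfl

/-- Homogeneous functions of degree `δ`, for the weights `w`. -/
def IsHom (w : Fin k → ℤ) (δ : ℤ) (x : RatFun k) : Prop := expand w x = single δ x

variable {w : Fin k → ℤ} {δ δ' : ℤ} {x y : RatFun k}

lemma IsHom.mul (hx : IsHom w δ x) (hy : IsHom w δ' y) : IsHom w (δ + δ') (x * y) := by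
  rw [IsHom, map_mul, hx, hy, single_mul_single]

lemma IsHom.const (c : K) : IsHom w 0 (cst c) := isConst_expand w c

lemma IsHom.inv (hx : IsHom w δ x) : IsHom w (-δ) x⁻¹ := by
  rw [IsHom, map_inv₀, hx, HahnSeries.inv_single]

lemma IsHom.div (hx : IsHom w δ x) (hy : IsHom w δ' y) : IsHom w (δ - δ') (x / y) := by
  rw [sub_eq_add_neg, div_eq_mul_inv]; exact hx.mul hy.inv

lemma IsHom.sub (hx : IsHom w δ x) (hy : IsHom w δ y) : IsHom w δ (x - y) := by
  rw [IsHom, map_sub, hx, hy]; simp_all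

lemma IsHom.zpow (hx : IsHom w δ x) (m : ℤ) : IsHom w (δ * m) (x ^ m) := by
  have h : ∀ m : ℕ, IsHom w (δ * m) (x ^ m) := fun m => by
    rw [IsHom, map_pow, hx, HahnSeries.single_pow, nsmul_eq_mul, mul_comm]
  obtain ⟨m, rfl | rfl⟩ := m.eq_nat_or_neg
  · simp_all
  · rw [zpow_neg, zpow_natCast, mul_neg]; exact (h m).inv

lemma IsHom.prod {κ : Type*} (s : Finset κ) {x : κ → RatFun k} {δ : κ → ℤ}
    (h : ∀ i ∈ s, IsHom w (δ i) (x i)) : IsHom w (∑ i ∈ s, δ i) (∏ i ∈ s, x i) := by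
  classical
  induction s using Finset.induction_on with
  | empty => rw [Finset.sum_empty, Finset.prod_empty, ← map_one (cst)]; exact .const 1
  | insert i s hi ih =>
    rw [Finset.sum_insert hi, prod_insert hi]
    exact (h i (by simp)).mul (ih fun j hj => h j (by simp [hj]))

lemma IsHom.f (hx : IsHom w 0 x) : IsHom w 0 (f x) := by
  have h : ∀ c : K, IsHom w 0 (1 - x * cst c) := fun c => by
    rw [← map_one (cst)]; exact (IsHom.const 1).sub (hx.mul (.const c))
  have h1 := h 1; rw [map_one, mul_one] at h1; rw [MatrixShuffle.f, pow_two (1 - x)]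
  exact ((h _).mul (h _)).div (h1.mul h1)

lemma isHom_z (i : Fin k) : IsHom w (w i) (z i) := expand_z w i

lemma isHom_mono (p : Fin k → ℤ) : IsHom w (∑ i, w i * p i) (mono p) :=
  IsHom.prod _ fun i _ => (isHom_z i).zpow (p i)

lemma lcoef_coeff_expand (hφ : φ ∈ laurent k) (e : ℤ) (p : Fin k → ℤ) :
    lcoef k ((expand w φ).coeff e) p = if ∑ i, w i * p i = e then lcoef k φ p else 0 := by
  have hs := mem_span_mono hφ
  clear hφ
  induction hs using Submodule.span_induction with
  | mem x hx =>
    obtain ⟨p', rfl⟩ := hx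
    rw [show expand w (mono p') = _ from isHom_mono p', HahnSeries.coeff_single, lcoef_mono]
    by_cases h : p' = p
    · subst h
      by_cases h' : ∑ i, w i * p' i = e
      · rw [if_pos h'.symm, if_pos h', lcoef_mono]
      grind
    · rw [Finsupp.single_eq_of_ne (Ne.symm h), ite_self]; split_ifs
      · rw [lcoef_mono, Finsupp.single_eq_of_ne (Ne.symm h)]
      · rw [map_zero, Finsupp.zero_apply]
  | zero => simp
  | add x y hx hy ihx ihy =>
    rw [map_add, coeff_add, map_add, Finsupp.add_apply, map_add, Finsupp.add_apply, ihx, ihy]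
    split_ifs
    · rfl
    · exact add_zero 0
  | smul c x hx ih =>
    rw [map_smul, HahnSeries.coeff_smul, map_smul, Finsupp.smul_apply, map_smul, Finsupp.smul_apply, ih,
      smul_ite, smul_zero]

lemma lcoef_eq_zero (hφ : φ ∈ laurent k) {e : ℤ}
    (h : ∀ m < e, (expand w φ).coeff m = 0) {p : Fin k → ℤ} (hp : lcoef k φ p ≠ 0) :
    e ≤ ∑ i, w i * p i := by
  by_contra hlt; have := lcoef_coeff_expand (w := w) hφ (∑ i, w i * p i) p; grind

lemma coeff_expand_value {w : Fin u → ℤ} {ω : Fin k → ℤ} {v : Fin k → RatFun u}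
    (hv : ∀ i, IsHom w (ω i) (v i)) (hv0 : ∀ i, v i ≠ 0) (hφ : φ ∈ laurent k)
    {φ' : RatFun u} (h : HasValueAt v φ φ') {e : ℤ} (he : ∀ m < e, (expand ω φ).coeff m = 0) :
    ∀ m < e, (expand w φ').coeff m = 0 := by
  have hz : ∀ (i : Fin k) (m : ℤ), HasValueAt v (z i ^ m) (v i ^ m) := fun i m => by
    obtain ⟨m, rfl | rfl⟩ := m.eq_nat_or_neg
    · rw [zpow_natCast, zpow_natCast]; exact (HasValueAt.z i).pow m
    · rw [zpow_neg, zpow_neg, zpow_natCast, zpow_natCast]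
      exact ((HasValueAt.z i).pow m).inv (pow_ne_zero _ (hv0 i))
  have h1 : HasValueAt v (∑ p ∈ (lcoef k φ).support, lcoef k φ p • mono p)
      (∑ p ∈ (lcoef k φ).support, lcoef k φ p • ∏ i, v i ^ p i) :=
    HasValueAt.sum _ fun p _ => (HasValueAt.prod _ fun i _ => hz i (p i)).smul _
  rw [sum_lcoef hφ] at h1; intro m hm; rw [h.unique h1, map_sum, coeff_sum]
  refine sum_eq_zero fun p hp => ?_
  have h2 : IsHom w (∑ i, ω i * p i) (∏ i, v i ^ p i) := IsHom.prod _ fun i _ => (hv i).zpow (p i)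
  rw [map_smul, HahnSeries.coeff_smul, h2, coeff_single_of_ne, smul_zero]
  exact (hm.trans_le (lcoef_eq_zero hφ he (Finsupp.mem_support_iff.1 hp))).ne

lemma renameVars_mono (σ : Perm (Fin k)) (p : Fin k → ℤ) :
    renameVars σ.toEmbedding (mono (p ∘ σ)) = mono p := by
  rw [mono, map_prod, mono, ← Equiv.prod_comp σ fun i => z i ^ p i]
  exact prod_congr rfl fun i _ => by rw [map_zpow₀, renameVars_z]; rfl

lemma lcoef_renameVars (σ : Perm (Fin k)) (hφ : φ ∈ laurent k)
    (p : Fin k → ℤ) : lcoef k (renameVars σ.toEmbedding φ) p = lcoef k φ (p ∘ σ) := by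
  have hs := mem_span_mono hφ
  clear hφ
  induction hs using Submodule.span_induction with
  | mem x hx =>
    obtain ⟨p', rfl⟩ := hx; have h := renameVars_mono σ (p' ∘ σ.symm)
    rw [Function.comp_assoc, Equiv.symm_comp_self, Function.comp_id] at h
    rw [h, lcoef_mono, lcoef_mono, Finsupp.single_apply, Finsupp.single_apply]; congr 1
    rw [← Equiv.comp_symm_eq]
  | zero => simp
  | add x y hx hy ihx ihy => rw [map_add, map_add, map_add, Finsupp.add_apply, Finsupp.add_apply, ihx, ihy]
  | smul c x hx ih => rw [map_smul, map_smul, map_smul, Finsupp.smul_apply, Finsupp.smul_apply, ih]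

/-- Applying a ring homomorphism to the coefficients. -/
def mapCoeff {A B : Type*} [Ring A] [Ring B] (ρ : A →+* B) : HahnSeries ℤ A →+* HahnSeries ℤ B where
  toFun x := x.map (ρ : ZeroHom A B)
  map_one' := (HahnSeries.map_single (ρ : ZeroHom A B)).trans (congrArg _ (map_one ρ))
  map_zero' := HahnSeries.map_zero (ρ : ZeroHom A B)
  map_add' _ _ := HahnSeries.map_add (ρ : A →+ B)
  map_mul' _ _ := HahnSeries.map_mul (ρ : A →ₙ+* B)

lemma mapCoeff_single {A B : Type*} [Ring A] [Ring B] (ρ : A →+* B) (m : ℤ) (a : A) :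
    mapCoeff ρ (single m a) = single m (ρ a) :=
  HahnSeries.map_single (ρ : ZeroHom A B)

lemma coeff_expand_renameVars (σ : Perm (Fin k)) (w : Fin k → ℤ) (φ : RatFun k) (e : ℤ) :
    (expand w (renameVars σ.toEmbedding φ)).coeff e =
      renameVars σ.toEmbedding ((expand (w ∘ σ) φ).coeff e) := by
  have h : (expand w : RatFun k →+* Ser k).comp (renameVars σ.toEmbedding) =
      (mapCoeff (renameVars σ.toEmbedding : RatFun k →+* RatFun k)).comp
        (expand (w ∘ σ) : RatFun k →+* Ser k) := by
    refine IsLocalization.ringHom_ext (nonZeroDivisors (MvPolynomial (Fin k) K))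
      (MvPolynomial.ringHom_ext (fun c => ?_) fun i => ?_)
    · refine (congrArg (expand w) ((renameVars σ.toEmbedding).commutes c)).trans
        ((isConst_expand w c).trans ?_)
      refine Eq.trans ?_ (congrArg (mapCoeff _) (isConst_expand (w ∘ σ) c)).symm
      rw [mapCoeff_single]; simp_all
    · refine (congrArg (expand w) (renameVars_z _ i)).trans ((expand_z w _).trans ?_)
      refine Eq.trans ?_ (congrArg (mapCoeff _) (expand_z (w ∘ σ) i)).symm; rw [mapCoeff_single]
      exact congrArg _ (renameVars_z _ i).symm
  have h1 : expand w (renameVars σ.toEmbedding φ) = mapCoeff _ (expand (w ∘ σ) φ) :=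
    RingHom.congr_fun h φ
  rw [h1]; rfl

end Mono

/-! ### Leading terms of the factors of the wheel condition -/

section Leads

variable {G : Grading (Fin k) n}

/-- The grading separates matrix units whenever it separates strands. -/
def Grading.Good (G : Grading (Fin k) n) : Prop :=
  ∀ a b, G.w a ≠ G.w b → ∀ i j, i < j → 0 < G.g j - G.g i ∧ G.g j - G.g i < G.N

/-- The expansion of a tensor, for the weights of a grading. -/
abbrev xp (G : Grading (Fin k) n) (M : Tensor n k) : Op (Fin k) n (Ser k) := M.map (expand G.w)

lemma xp_mul (M M' : Tensor n k) : xp G (M * M') = xp G M * xp G M' := map_mul_matrix _ _ _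

lemma xp_smul (φ : RatFun k) (M : Tensor n k) : xp G (φ • M) = expand G.w φ • xp G M := by aesop

lemma ordLead_crossing (hG : G.Good) {b : Fin k} (hab : a ≠ b) {x : RatFun k}
    (hx : IsHom G.w (G.w a - G.w b) x) (h : Nondeg x) :
    OrdLead G (xp G (Rm a b x)) 0 (rLead n (G.w a - G.w b) a b x) :=
  ordLead_R (isConst_expand _) hab hx h.1 (fun _ => h.2.1) (hG a b)

lemma isUnit_rLead {b : Fin k} (hab : a ≠ b) (δ : ℤ) {x : RatFun k} (h : Nondeg x) :
    IsUnit (rLead n δ a b x) := by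
  by_cases hδ : δ = 0
  · rw [rLead, if_pos hδ]; exact (h.regInv_top hab).isUnit
  · obtain ⟨d, hd, e⟩ := rLead_diagonal hδ a b x; rw [e]; exact isUnit_diagonal hd

lemma ordLead_pm {γ : Perm (Fin k)} (hγ : ∀ j, G.w (γ j) = G.w j) :
    OrdLead G (xp G (Pm (RatFun k) γ)) 0 (Pm (RatFun k) γ) := by
  have e : xp G (Pm (RatFun k) γ) = (Pm (RatFun k) γ : Op (Fin k) n _).map C := by
    ext1 I J; change expand G.w (if J = I ∘ γ then 1 else 0) = C (if J = I ∘ γ then 1 else 0)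
    split_ifs <;> simp
  rw [e]; refine ordLead_C _ _ fun I J h => ?_
  have hJ : J = I ∘ γ := by by_contra h'; exact h (if_neg h')
  have h1 := Equiv.sum_comp γ fun b => G.w b * G.g (I b); simp only [hγ] at h1
  simp only [Grading.shift, hJ, mul_sub, Finset.sum_sub_distrib, comp_apply, h1, sub_self]

lemma unitLead_pm {γ : Perm (Fin k)} (hγ : ∀ j, G.w (γ j) = G.w j) :
    UnitLead G (xp G (Pm (RatFun k) γ)) :=
  ⟨_, (RegInv.pm (O := (⊤ : Subalgebra K (RatFun k))) γ).isUnit, ordLead_pm hγ⟩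

/-- The grading with permuted weights. -/
def Grading.comp (G : Grading (Fin k) n) (σ : Perm (Fin k)) : Grading (Fin k) n :=
  { G with w := G.w ∘ σ }

lemma Grading.comp_shift (σ : Perm (Fin k)) (I J : Fin k → Fin n) :
    (G.comp σ).shift (I ∘ σ) (J ∘ σ) = G.shift I J :=
  Equiv.sum_comp σ fun b => G.w b * (G.g (I b) - G.g (J b))

lemma coeff_xp_permute (σ : Perm (Fin k)) (M : Tensor n k) (I J : Fin k → Fin n) (p : ℤ) :
    (xp G (permute σ M) I J).coeff p =
      renameVars σ.toEmbedding ((xp (G.comp σ) M (I ∘ σ) (J ∘ σ)).coeff p) :=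
  coeff_expand_renameVars σ G.w _ p

lemma ordGE_permute {M : Tensor n k} {E : ℤ} :
    OrdGE G (xp G (permute σ M)) E ↔ OrdGE (G.comp σ) (xp (G.comp σ) M) E := by
  rw [ordGE_iff, ordGE_iff]; refine ⟨fun h I J p hp => ?_, fun h I J p hp => ?_⟩
  · have e : ∀ I : Fin k → Fin n, (I ∘ σ.symm) ∘ σ = I := fun I => by grind
    have h1 := G.comp_shift σ (I ∘ σ.symm) (J ∘ σ.symm); rw [e, e] at h1
    have h2 := h (I ∘ σ.symm) (J ∘ σ.symm) p (h1 ▸ hp); rw [coeff_xp_permute, e, e] at h2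
    exact (map_eq_zero _).1 h2
  · rw [coeff_xp_permute, h _ _ p (by rw [Grading.comp_shift]; exact hp), map_zero]

lemma unitLead_lift (hG : G.Good) {l : List (Fin k × Fin k)}
    (hl : ∀ p ∈ l, p.1 < p.2 ∧ σ.symm p.2 < σ.symm p.1) {v : Fin k → RatFun k}
    (hv : ∀ j, IsHom G.w (G.w j) (v j)) (hvd : ∀ i j, i ≠ j → Nondeg (v i / v j)) :
    UnitLead G (xp G (l.map fun p => (Rm p.1 p.2 (v p.1 / v p.2) : Tensor n k)).prod) := by
  rw [xp, map_list_prod_mat, List.map_map]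
  exact LeadIn.list_prod _ fun p hp => ⟨_, isUnit_rLead (hl p hp).1.ne _ (hvd _ _ (hl p hp).1.ne),
    ordLead_crossing hG (hl p hp).1.ne ((hv _).div (hv _)) (hvd _ _ (hl p hp).1.ne)⟩

lemma z_div_z_nondeg (hij : i ≠ j) : Nondeg (z i / z j : RatFun k) := by
  simpa using z_div_nondeg hij (one_ne_zero) one_ne_zero

lemma OrdGE.of_comp (hX : X ∈ bigSpace n k) (hG : G.Good)
    (σ : Perm (Fin k)) {E : ℤ} (h : OrdGE (G.comp σ) (xp (G.comp σ) (poles k n • X)) E) :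
    OrdGE G (xp G (poles k n • X)) E := by
  obtain ⟨l, hl, hM⟩ := exists_lift σ
  have hU := unitLead_lift hG hl isHom_z fun i j => z_div_z_nondeg
  have h1 := congrArg (xp G) (poles_smul_comm hX hM); rw [xp_mul, xp_mul] at h1
  have ⟨M₀, _, h0⟩ := hU; have h2 := h0.ordGE.mul (ordGE_permute.2 h)
  rw [xp, xp, ← h1, zero_add, ← one_mul (xp G (poles k n • X))] at h2
  exact UnitLead.ordGE_of_mul ⟨1, one_mem _, OrdLead.one⟩ hU h2

lemma hasLead_sub {w : Fin k → ℤ} {δ δ' : ℤ} {x y : RatFun k} (hx : IsHom w δ x)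
    (hy : IsHom w δ' y) (hx0 : x ≠ 0) (hy0 : y ≠ 0) (h : x - y ≠ 0) :
    ∃ c, c ≠ 0 ∧ HasLead (expand w (x - y)) (min δ δ') c := by
  rcases lt_trichotomy δ δ' with h1 | rfl | h1
  · refine ⟨x, hx0, ?_⟩; rw [min_eq_left h1.le, map_sub, hx, hy, sub_eq_add_neg]
    simpa using (HasLead.single δ x).add ((HasLead.single δ' y).neg.mono h1)
  · refine ⟨x - y, h, ?_⟩; rw [min_self, (show expand w (x - y) = _ from hx.sub hy)]
    exact HasLead.single _ _
  · refine ⟨-y, neg_ne_zero.2 hy0, ?_⟩; rw [min_eq_right h1.le, map_sub, hx, hy, sub_eq_add_neg]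
    simpa using ((HasLead.single δ x).mono h1).add (HasLead.single δ' y).neg

lemma hasLead_prod_sub {w : Fin k → ℤ} {v : Fin k → RatFun k} (hv : ∀ j, IsHom w (w j) (v j))
    (hv0 : ∀ j, v j ≠ 0) (T : Finset (Fin k × Fin k))
    (hT : ∏ p ∈ T, (v p.1 - v p.2 * cst (qbar n ^ 2)) ≠ 0) :
    ∃ c, c ≠ 0 ∧ HasLead (expand w (∏ p ∈ T, (v p.1 - v p.2 * cst (qbar n ^ 2))))
      (∑ p ∈ T, min (w p.1) (w p.2)) c := by
  have h : ∀ p, ∃ c, p ∈ T → c ≠ 0 ∧ HasLead (expand w (v p.1 - v p.2 *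
      cst (qbar n ^ 2))) (min (w p.1) (w p.2)) c := fun p => by
    by_cases hp : p ∈ T
    · obtain ⟨c, hc⟩ := hasLead_sub (hv p.1) ((hv p.2).mul (.const (qbar n ^ 2))) (hv0 _)
        (mul_ne_zero (hv0 _) (ofK_ne_zero (qbar_pow_ne_zero n 2)))
        (prod_ne_zero_iff.1 hT p hp)
      rw [add_zero] at hc; exact ⟨c, fun _ => hc⟩
    · exact ⟨0, fun h => absurd h hp⟩
  choose c hc using h
  refine ⟨∏ p ∈ T, c p, prod_ne_zero_iff.2 fun p hp => (hc p hp).1, ?_⟩; rw [map_prod]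
  exact HasLead.prod _ fun p hp => (hc p hp).2

theorem f_inv {x : RatFun k} (hx : x ≠ 0) : f x⁻¹ = f x := by
  have h1 : cOn k (q ^ 2) * cOn k ((q⁻¹) ^ 2) = 1 := by
    rw [← map_mul, ← mul_pow, mul_inv_cancel₀ q_ne_zero, one_pow, map_one]
  have h2 := mul_inv_cancel₀ hx; rw [f, f]; set Q := cOn k (q ^ 2)
  set Q' := cOn k ((q⁻¹) ^ 2); set y := x⁻¹
  rw [show (1 - y * Q) * (1 - y * Q') = (1 - x * Q) * (1 - x * Q') * y ^ 2 by
    grind,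
    show (1 - y) ^ 2 = (1 - x) ^ 2 * y ^ 2 by linear_combination (2 * y - (x * y + 1)) * h2,
    mul_div_mul_right _ _ (pow_ne_zero 2 (inv_ne_zero hx))]

lemma hasLead_f {w : Fin k → ℤ} {δ : ℤ} {x : RatFun k} (hx : IsHom w δ x) (h : Nondeg x) :
    ∃ c, c ≠ 0 ∧ HasLead (expand w (f x)) 0 c := by
  rcases lt_trichotomy δ 0 with h1 | rfl | h1
  · refine ⟨1, one_ne_zero, ?_⟩; have h2 := hasLead_map_f (isConst_expand w) (neg_pos.2 h1) hx.inv
    rwa [f_inv h.1] at h2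
  · refine ⟨f x, h.f_ne_zero, ?_⟩; rw [show expand w (f x) = _ from hx.f]; exact HasLead.single _ _
  · exact ⟨1, one_ne_zero, hasLead_map_f (isConst_expand w) h1 hx⟩

lemma OrdGE.poles_smul {E : ℤ} (h : OrdGE G (xp G X) E) : OrdGE G (xp G (poles k n • X))
      (G.N * (∑ p : Fin k × Fin k with p.1 ≠ p.2, min (G.w p.1) (G.w p.2)) + E) := by
  obtain ⟨c, -, hc⟩ := hasLead_prod_sub (n := n) (w := G.w) (isHom_z (w := G.w)) z_ne_zero
    (univ.filter fun p => p.1 ≠ p.2) (prod_ne_zero_iff.2 fun p hp => sub_ne_zero.2 (by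
      have := z_mul_ne (mem_filter.1 hp).2 (one_ne_zero (α := K)) (c' := qbar n ^ 2)
      rwa [map_one, mul_one] at this))
  rw [xp_smul]; exact h.smul hc.1

variable {b : Fin k → Fin k} {γ : Perm (Fin k)} {κ : K}

lemma isHom_pt (hw : ∀ j, G.w (b j) = G.w j) (j : Fin k) : IsHom G.w (G.w j) (pt n b j) := by
  have h := (isHom_z (w := G.w) (b j)).mul (.const (qbar n ^ (2 * (j.val - (b j).val))))
  rwa [add_zero, hw] at h

lemma leadIn_lft (hn : 2 ≤ n) (hb : IsBlk b) (hG : G.Good) (hw : ∀ j, G.w (b j) = G.w j)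
    {𝒮 : Submonoid (Tensor n k)} (h : ∀ h x, h ≠ x →
      rLead n (G.w h - G.w x) h x (pt n b h / pt n b x) ∈ 𝒮) :
    LeadIn 𝒮 G (xp G (lft b (pt n b))) := by
  rw [lft, xp, map_list_prod_mat, List.map_map]; refine LeadIn.list_prod _ fun i _ => ?_
  rw [comp_apply, train, map_list_prod_mat, List.map_map]; refine LeadIn.list_prod _ fun x hx => ?_
  have hix : i ≠ x := (of_decide_eq_true (List.mem_filter.1 hx).2).ne
  exact ⟨_, h i x hix, ordLead_crossing hG hix ((isHom_pt hw i).div (isHom_pt hw x))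
    (pt_div_nondeg hn hb hix)⟩

lemma leadIn_rgt (hG : G.Good) (hw : ∀ j, G.w (b j) = G.w j) {𝒮 : Submonoid (Tensor n k)}
    (h : ∀ h x : Fin k, b x ≠ b h → ∀ y, Nondeg y → rLead n (G.w x - G.w h) x h y ∈ 𝒮) :
    LeadIn 𝒮 G (xp G (rgt b (pt n b))) := by
  rw [rgt, xp, map_list_prod_mat, List.map_map]; refine LeadIn.list_prod _ fun i hi => ?_
  rw [comp_apply, trainR, map_list_prod_mat, List.map_map]; refine LeadIn.list_prod _ fun x hx => ?_
  have hix : b x ≠ b i := by rw [(mem_heads b).1 hi]; grind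
  have hxi : x ≠ i := fun e => hix (congrArg b e); obtain ⟨c, hc, e⟩ := vR_pt_eq (n := n) b x
  obtain ⟨c', hc', e'⟩ := vR_pt_eq (n := n) b i
  have h1 : Nondeg (vR n b (pt n b) x / vR n b (pt n b) i) := by
    rw [e, e']; exact z_div_nondeg hix hc hc'
  have h2 : IsHom G.w (G.w x - G.w i) (vR n b (pt n b) x / vR n b (pt n b) i) := by
    have := ((isHom_z (w := G.w) (b x)).mul (.const c)).div ((isHom_z (b i)).mul (.const c'))
    rwa [add_zero, add_zero, hw, hw, ← e, ← e'] at this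
  exact ⟨_, h i x hix _ h1, ordLead_crossing hG hxi h2 h1⟩

/-- The scalar in the wheel condition. -/
def wheelScal (n : ℕ) (b : Fin k → Fin k) : RatFun k := scl b (pt n b) * den n b (pt n b)

lemma hasLead_wheelScal (hn : 2 ≤ n) (hb : IsBlk b) (h0 : wheelScal n b ≠ 0)
    (hw : ∀ j, G.w (b j) = G.w j) : ∃ c, c ≠ 0 ∧ HasLead (expand G.w (wheelScal n b))
      (∑ p : Fin k × Fin k with p.1 ≠ p.2 ∧ ¬ (p.2.val + 1 = p.1.val ∧ b p.1 = b p.2),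
        min (G.w p.1) (G.w p.2)) c := by
  obtain ⟨c, hc, h1⟩ := hasLead_prod_sub (n := n) (w := G.w) (isHom_pt hw) (pt_ne_zero b) _
    (right_ne_zero_of_mul h0)
  have h2 : ∀ p : Fin k × Fin k, ∃ c, p.1 ≠ p.2 →
      c ≠ 0 ∧ HasLead (expand G.w (f (pt n b p.1 / pt n b p.2))) 0 c := fun p => by
    by_cases hp : p.1 = p.2
    · exact ⟨0, fun h => absurd hp h⟩
    · obtain ⟨c, h⟩ := hasLead_f ((isHom_pt hw p.1).div (isHom_pt hw p.2)) (pt_div_nondeg hn hb hp)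
      exact ⟨c, fun _ => h⟩
  choose e he using h2
  have h3 : ∀ p ∈ univ.filter fun p : Fin k × Fin k =>
      p.1 < p.2 ∧ b p.1 ≠ p.1 ∧ b p.2 ≠ p.2, p.1 ≠ p.2 := fun p hp => (mem_filter.1 hp).2.1.ne
  have h4 := HasLead.prod _ fun p hp => (he p (h3 p hp)).2
  rw [← map_prod, Finset.sum_const_zero] at h4; have h5 := h4.mul h1; rw [zero_add, ← map_mul] at h5
  exact ⟨_, mul_ne_zero (prod_ne_zero_iff.2 fun p hp => (he p (h3 p hp)).1) hc, h5⟩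

lemma OrdGE.value (hw : ∀ j, G.w (b j) = G.w j) {M V : Tensor n k} (hM : EntriesIn (laurent k) M)
    {E : ℤ} (h : OrdGE G (xp G M) E) (hV : MVal (pt n b) M V) : OrdGE G (xp G V) E := by
  refine ordGE_iff.2 fun I J p hp => coeff_expand_value (isHom_pt hw) (pt_ne_zero b) (hM I J)
    (hV I J) (e := p + 1) (fun m hm => ordGE_iff.1 h I J m (lt_of_le_of_lt ?_ hp)) p (by lia)
  have hN : (0 : ℤ) ≤ G.N := Int.natCast_nonneg _; nlinarith

lemma OrdGE.of_wheel (hn : 2 ≤ n) (hb : IsBlk b) (hγ : IsCyc b γ) (hG : G.Good)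
    (hw : ∀ j, G.w (b j) = G.w j) {E : ℤ} (h : OrdGE G (xp G (lft b (pt n b)) * xp G Y *
      (xp G (rgt b (pt n b)) * xp G (Pm (RatFun k) γ))) E) : OrdGE G (xp G Y) E := by
  have hL : UnitLead G (xp G (lft b (pt n b))) := leadIn_lft hn hb hG hw fun i x hix =>
    isUnit_rLead hix _ (pt_div_nondeg hn hb hix)
  have hR : UnitLead G (xp G (rgt b (pt n b))) := leadIn_rgt hG hw fun i x hix y hy =>
    isUnit_rLead (fun e => hix (congrArg b e)) _ hy
  exact hL.ordGE_of_mul (hR.mul (unitLead_pm fun j => by rw [← hw, (hγ j).1, hw])) h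

lemma IsWheel.ordGE (hn : 2 ≤ n) (hb : IsBlk b) (hX : X ∈ bigSpace n k) (W : IsWheel X b γ Y κ)
    (h0 : wheelScal n b ≠ 0) (hG : G.Good) (hw : ∀ j, G.w (b j) = G.w j) {E : ℤ}
    (h : OrdGE G (xp G (poles k n • X)) E) :
    OrdGE G (xp G Y) (E - G.N * ∑ p : Fin k × Fin k with
      p.1 ≠ p.2 ∧ ¬ (p.2.val + 1 = p.1.val ∧ b p.1 = b p.2), min (G.w p.1) (G.w p.2)) := by
  have h1 := h.value hw (poles_smul_entries hX) W.val
  have hs : cst κ * wheelScal n b ≠ 0 := mul_ne_zero (ofK_ne_zero W.ne_zero) h0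
  obtain ⟨c, hc, h2⟩ := hasLead_wheelScal hn hb h0 hw
  have h3 := ((show HasLead (expand G.w (cst κ)) 0 _ from
    (isConst_expand G.w κ) ▸ HasLead.single _ _).mul h2).inv
      (mul_ne_zero (ofK_ne_zero W.ne_zero) hc)
  rw [← map_mul, ← map_inv₀] at h3; have h4 := h1.smul h3.1
  have e : (cst κ * wheelScal n b)⁻¹ • ((cst κ * scl b (pt n b) * den n b (pt n b)) •
        (lft b (pt n b) * Y * rgt b (pt n b) * Pm (RatFun k) γ)) =
      lft b (pt n b) * Y * (rgt b (pt n b) * Pm (RatFun k) γ) := by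
    rw [mul_assoc (cst κ), ← wheelScal, smul_smul, inv_mul_cancel₀ hs, one_smul,
      mul_assoc (lft b (pt n b) * Y)]
  have e1 := congrArg (xp G) e; rw [xp_smul, xp_mul, xp_mul, xp_mul (rgt b (pt n b))] at e1
  rw [e1] at h4; refine (OrdGE.of_wheel hn hb W.cyc hG hw h4).mono ?_; linarith

end Leads

/-! ### Permutations of blocks of the same length -/

section BlockPerm

variable {b b' : Fin k → Fin k} {γ γ' : Perm (Fin k)}

/-- The permutation `σ` moves the blocks of `b'` to those of `b`, preserving positions in them. -/
structure IsBlockPerm (b b' : Fin k → Fin k) (σ : Perm (Fin k)) : Prop where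
  comm : ∀ j, b (σ j) = σ (b' j)
  pos : ∀ j, (σ j).val + (b' j).val = j.val + (b (σ j)).val

lemma IsBlockPerm.iff (h : IsBlockPerm b b' σ) (i j : Fin k) : b (σ i) = b (σ j) ↔ b' i = b' j := by
  rw [h.comm, h.comm, σ.injective.eq_iff]

lemma IsCyc.commute (hγ' : IsCyc b' γ') (hγ : IsCyc b γ) (h : IsBlockPerm b b' σ) (j : Fin k) :
    γ (σ j) = σ (γ' j) := by
  have hpos := h.pos
  have key : ∀ x y, b' x = b' y → y.val = x.val + 1 → (σ y).val = (σ x).val + 1 :=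
    fun x y e hy => by
      have h1 := hpos x; have h2 := hpos y; rw [← e, (h.iff y x).2 e.symm] at h2; lia
  obtain ⟨h1, h2⟩ := hγ' j; obtain ⟨h3, h4⟩ := hγ (σ j)
  rcases h2 with h2 | ⟨h2, h2'⟩ <;> rcases h4 with h4 | ⟨h4, h4'⟩
  · exact Fin.ext (by rw [h4, key _ _ h1.symm h2])
  · exact absurd ((h.iff _ _).2 h1) (h4' _ (key _ _ h1.symm h2))
  · obtain ⟨x, hx⟩ := σ.surjective (γ (σ j)); rw [← hx] at h3 h4; have h5 := (h.iff _ _).1 h3; grind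
  · rw [h4, h2, h.comm]

lemma IsBlockPerm.rename_pt (h : IsBlockPerm b b' σ) (hb : IsBlk b) (hb' : IsBlk b') (j : Fin k) :
    renameVars σ.toEmbedding (pt n b' j) = pt n b (σ j) := by
  have h1 := h.pos j; have h2 : (b' j).val ≤ j.val := hb'.le j
  have h3 : (b (σ j)).val ≤ (σ j).val := hb.le _
  rw [pt, pt, map_mul, renameVars_z, AlgHom.commutes, h.comm,
    show j.val - (b' j).val = (σ j).val - (σ (b' j)).val by rw [← h.comm]; lia]
  rfl

lemma scl_sq {v : Fin k → RatFun k} (hv : ∀ j, v j ≠ 0) : scl b v ^ 2 =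
    ∏ p : Fin k × Fin k with p.1 ≠ p.2 ∧ b p.1 ≠ p.1 ∧ b p.2 ≠ p.2, f (v p.1 / v p.2) := by
  rw [← Finset.prod_filter_mul_prod_filter_not _ fun p => p.1 < p.2, filter_filter,
    filter_filter, pow_two]
  congr 1
  · refine prod_congr (Finset.filter_congr fun p _ => ?_) fun _ _ => rfl; grind
  · refine Finset.prod_nbij' Prod.swap Prod.swap (fun p hp => ?_) (fun p hp => ?_) (fun _ _ => rfl)
      (fun _ _ => rfl) fun p _ => ?_
    · grind
    · grind
    · rw [Prod.fst_swap, Prod.snd_swap, ← inv_div, f_inv (div_ne_zero (hv _) (hv _))]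

lemma IsBlockPerm.rename_wheelScal (h : IsBlockPerm b b' σ) (hb : IsBlk b) (hb' : IsBlk b') :
    ∃ ε : K, ε ≠ 0 ∧ renameVars σ.toEmbedding (wheelScal n b') = cst ε * wheelScal n b := by
  have hd : ∀ P P' : Fin k × Fin k → Prop, ∀ g : RatFun k → RatFun k → RatFun k,
      [DecidablePred P] → [DecidablePred P'] → (∀ p, P' p ↔ P (σ p.1, σ p.2)) →
      (∏ p with P' p, g (renameVars σ.toEmbedding (pt n b' p.1))
        (renameVars σ.toEmbedding (pt n b' p.2))) = ∏ p with P p, g (pt n b p.1) (pt n b p.2) :=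
    fun P P' g _ _ hP => by
      refine Finset.prod_equiv (σ.prodCongr σ) (fun p => ?_) fun p _ => ?_
      · aesop
      · rw [h.rename_pt hb hb', h.rename_pt hb hb']; rfl
  have hne : ∀ p : Fin k × Fin k, p.1 ≠ p.2 ↔ σ p.1 ≠ σ p.2 := fun p => σ.injective.ne_iff.symm
  have hh : ∀ j, b' j ≠ j ↔ b (σ j) ≠ σ j := fun j => by rw [h.comm, σ.injective.ne_iff]
  have h1 : renameVars σ.toEmbedding (den n b' (pt n b')) = den n b (pt n b) := by
    rw [den, map_prod]
    refine Eq.trans (prod_congr rfl fun p _ => ?_) (hd (fun p => p.1 ≠ p.2 ∧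
      ¬ (p.2.val + 1 = p.1.val ∧ b p.1 = b p.2)) _
      (fun x y => x - y * cst (qbar n ^ 2)) fun p => ?_)
    · rw [map_sub, map_mul, AlgHom.commutes]
    · refine and_congr (hne p) (not_congr ?_); simp only [h.iff]; refine and_congr_left fun e => ?_
      have h1 := h.pos p.1; have h2 := h.pos p.2; rw [(h.iff _ _).2 e, e] at h1; lia
  have h2 : renameVars σ.toEmbedding (scl b' (pt n b')) ^ 2 = scl b (pt n b) ^ 2 := by
    rw [← map_pow, scl_sq (pt_ne_zero b'), scl_sq (pt_ne_zero b), map_prod]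
    refine Eq.trans (prod_congr rfl fun p _ => ?_) (hd (fun p => p.1 ≠ p.2 ∧
      b p.1 ≠ p.1 ∧ b p.2 ≠ p.2) _ (fun x y => f (x / y)) fun p =>
      and_congr (hne p) (and_congr (hh _) (hh _)))
    rw [map_f, map_div₀]
  rw [wheelScal, wheelScal, map_mul, h1]; rcases sq_eq_sq_iff_eq_or_eq_neg.1 h2 with h3 | h3
  · exact ⟨1, one_ne_zero, by rw [h3, map_one, one_mul]⟩
  · exact ⟨-1, neg_ne_zero.2 one_ne_zero, by rw [h3, map_neg, map_one]; ring⟩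

/-- The matrices whose rows in `S` are nonzero constant multiples of those of the identity. -/
def rowEigen (n k : ℕ) (S : Set (Fin k → Fin n)) : Submonoid (Tensor n k) where
  carrier := {M | ∀ I ∈ S, ∃ c : K, c ≠ 0 ∧ ∀ (B : Tensor n k) J, (M * B) I J = cst c * B I J}
  one_mem' := fun I _ => ⟨1, one_ne_zero, fun B J => by rw [one_mul, map_one, one_mul]⟩
  mul_mem' := fun {M M'} h h' I hI => by
    obtain ⟨c, hc, h1⟩ := h I hI; obtain ⟨c', hc', h2⟩ := h' I hI
    exact ⟨c * c', mul_ne_zero hc hc', fun B J => by rw [mul_assoc, h1, h2, map_mul, mul_assoc]⟩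

lemma mul_rowEigen {M : Tensor n k} (hM : M ∈ rowEigen n k Set.univ) (J : Fin k → Fin n) :
    ∃ c : K, c ≠ 0 ∧ ∀ (B : Tensor n k) I, (B * M) I J = B I J * cst c := by
  choose c hc h using fun I => hM I (Set.mem_univ I)
  refine ⟨c J, hc J, fun B I => ?_⟩
  have h1 : M = Matrix.diagonal fun I => cst (c I) := by
    ext1 I T; have := h I 1 T; rw [mul_one] at this
    rw [this, Matrix.one_apply, Matrix.diagonal_apply, mul_ite, mul_one, mul_zero]
  rw [h1, Matrix.mul_diagonal]

lemma rLead_mem_rowEigen {S : Set (Fin k → Fin n)} {x : Fin k} (hix : i ≠ x) {δ : ℤ}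
    {y : RatFun k} (h : δ = 0 → (∀ I ∈ S, I i = I x) ∧ ∃ c : K, y = cst c)
    (hy : Nondeg y) : rLead n δ i x y ∈ rowEigen n k S := by
  intro I hI
  by_cases hδ : δ = 0
  · obtain ⟨h1, c, rfl⟩ := h hδ; rw [rLead, if_pos hδ]
    refine ⟨(q - c * q⁻¹) / (1 - c), ?_, fun B J => ?_⟩
    · refine div_ne_zero (fun h0 => ?_) fun h0 => hy.2.1 (by rw [← sub_eq_zero.1 h0, map_one])
      refine hy.2.2.2 ?_; rw [← map_mul, ← map_one (cst)]; congr 1; have := q_ne_zero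
      field_simp at h0 ⊢
      linear_combination -h0
    · rw [Rm_mul_apply hix, h1 I hI, rOff_self, zero_mul, add_zero, rDiag, if_pos rfl]
      simp only [map_div₀, map_sub, map_mul, map_one]
  · rw [rLead, if_neg hδ]
    refine ⟨if I i = I x then (if 0 < δ then q else q⁻¹) else 1, ?_, fun B J => ?_⟩
    · split_ifs
      exacts [q_ne_zero, inv_ne_zero q_ne_zero, one_ne_zero]
    · rw [Matrix.diagonal_mul]; split_ifs <;> simp

variable {G : Grading (Fin k) n} {Y' : Tensor n k} {κ κ' : K}

/-- The core of the wheel condition. -/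
abbrev wheelCore (b : Fin k → Fin k) (γ : Perm (Fin k)) (Y : Tensor n k) : Tensor n k :=
  lft b (pt n b) * Y * rgt b (pt n b) * Pm (RatFun k) γ

lemma wheelCore_lead (hn : 2 ≤ n) (hb : IsBlk b) (hγ : IsCyc b γ) (hG : G.Good)
    (hw : ∀ i j, G.w i = G.w j ↔ b i = b j) {E : ℤ} {Y₀ : Tensor n k} (hY : OrdLead G (xp G Y) E Y₀) :
    ∃ A₀, OrdLead G (xp G (wheelCore b γ Y)) E A₀ ∧ ∀ I, (∀ j, I (b j) = I j) → ∀ J,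
      ∃ α : K, α ≠ 0 ∧ A₀ I (J ∘ γ) = cst α * Y₀ I J := by
  have hw' : ∀ j, G.w (b j) = G.w j := fun j => (hw _ _).2 (hb.idem j)
  obtain ⟨L₀, hL, hL'⟩ := leadIn_lft hn hb hG hw' (𝒮 := rowEigen n k {I | ∀ j, I (b j) = I j})
    fun i x hix => rLead_mem_rowEigen hix (fun h0 => by
      have e := (hw i x).1 (sub_eq_zero.1 h0)
      refine ⟨fun I hI => by rw [← hI i, e, hI x], qbar n ^ (2 * (i.val - (b i).val)) /
        qbar n ^ (2 * (x.val - (b x).val)), ?_⟩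
      rw [pt, pt, e, mul_div_mul_left _ _ (z_ne_zero _), map_div₀]) (pt_div_nondeg hn hb hix)
  obtain ⟨R₀, hR, hR'⟩ := leadIn_rgt hG hw' (𝒮 := rowEigen n k Set.univ) fun i x hix y hy =>
    rLead_mem_rowEigen (fun e => hix (congrArg b e))
      (fun h0 => absurd ((hw _ _).1 (sub_eq_zero.1 h0)) hix) hy
  have h := ((hL'.mul hY).mul hR').mul
    (ordLead_pm (n := n) (G := G) (γ := γ) fun j => (hw _ _).2 (hγ j).1)
  rw [zero_add, add_zero, add_zero, ← xp_mul, ← xp_mul, ← xp_mul] at h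
  refine ⟨_, h, fun I hI J => ?_⟩; obtain ⟨l, hl, h1⟩ := hL I hI
  obtain ⟨r, hr, h2⟩ := mul_rowEigen hR J; refine ⟨l * r, mul_ne_zero hl hr, ?_⟩
  rw [mul_Pm_apply, Function.comp_assoc, Equiv.self_comp_symm, Function.comp_id, h2, h1, map_mul]
  ring

lemma renameVars_mem_laurent (σ : Perm (Fin k)) (hφ : φ ∈ laurent k) :
    renameVars σ.toEmbedding φ ∈ laurent k := by
  refine laurent_value (fun i => ?_) (fun i => ?_)
    (fun i => ?_) hφ ((hasVal_z φ).map (renameVars σ.toEmbedding)) <;> rw [renameVars_z]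
  exacts [z_ne_zero _, z_mem_laurent _, z_inv_mem_laurent _]

theorem IsWheel.commute (hn : 2 ≤ n) (hb : IsBlk b) (hb' : IsBlk b') (hX : X ∈ bigSpace n k)
    (W : IsWheel X b γ Y κ) (W' : IsWheel X b' γ' Y' κ') (h0 : wheelScal n b ≠ 0)
    (hσ : IsBlockPerm b b' σ)
    {l : List (Fin k × Fin k)} (hl : ∀ p ∈ l, p.1 < p.2 ∧ σ.symm p.2 < σ.symm p.1)
    (hM : IsBraidLift σ (l.map fun p => (Rm p.1 p.2 (z p.1 / z p.2) : Tensor n k)).prod) :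
    ∃ ε : K, ε ≠ 0 ∧
      wheelCore b γ Y * (l.map fun p => (Rm p.1 p.2 (pt n b p.1 / pt n b p.2) : Tensor n k)).prod =
      cOn k ε •
        ((l.map fun p => (Rm p.1 p.2 (pt n b p.1 / pt n b p.2) : Tensor n k)).prod *
          permute σ (wheelCore b' γ' Y')) := by
  have hMv : MVal (pt n b) (l.map fun p => (Rm p.1 p.2 (z p.1 / z p.2) : Tensor n k)).prod
      (l.map fun p => (Rm p.1 p.2 (pt n b p.1 / pt n b p.2) : Tensor n k)).prod :=
    MVal.list_prod l fun p hp => MVal.rm (hl p hp).1.ne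
      ((HasValueAt.z _).div (HasValueAt.z _) (pt_ne_zero b _))
      (pt_div_nondeg hn hb (hl p hp).1.ne).2.1
  obtain ⟨ε, hε, h1⟩ := hσ.rename_wheelScal hb hb'; have hV := W.val; have hV' := W'.val
  rw [mul_assoc (cOn k κ), ← wheelScal, ← wheelCore] at hV
  rw [mul_assoc (cOn k κ'), ← wheelScal, ← wheelCore] at hV'
  set s := cOn k κ * wheelScal n b with hs
  set s' := cOn k κ' * wheelScal n b' with hs'
  have hs0 : s ≠ 0 := mul_ne_zero (ofK_ne_zero W.ne_zero) h0
  have hp : MVal (pt n b) (permute σ (poles k n • X)) (permute σ (s' • wheelCore b' γ' Y')) :=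
    fun I J => HasValueAt.rename σ.toEmbedding (by
      have h2 := (hV' (I ∘ σ) (J ∘ σ)).map (renameVars σ.toEmbedding)
      rwa [funext (hσ.rename_pt hb hb')] at h2)
  have e : permute σ (s' • wheelCore b' γ' Y') =
      s • cOn k (κ⁻¹ * κ' * ε) • permute σ (wheelCore b' γ' Y') := by
    ext1 I J; refine (map_mul (renameVars σ.toEmbedding) s' _).trans ?_
    rw [hs', map_mul, AlgHom.commutes, h1]
    change _ = cOn k κ * wheelScal n b *
      (cOn k (κ⁻¹ * κ' * ε) * renameVars σ.toEmbedding _)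
    have h4 : cOn k κ * cOn k κ⁻¹ = 1 := by simp_all
    rw [map_mul, map_mul]
    linear_combination (-cOn k κ' * cOn k ε * wheelScal n b *
      renameVars σ.toEmbedding (wheelCore b' γ' Y' (I ∘ σ) (J ∘ σ))) * h4
  have h3 := hV.mul hMv; rw [poles_smul_comm hX hM] at h3; have h4 := h3.unique (hMv.mul hp)
  rw [e, smul_mul_assoc, mul_smul_comm, mul_smul_comm] at h4
  exact ⟨_, mul_ne_zero (mul_ne_zero (inv_ne_zero W.ne_zero) W'.ne_zero) hε,
    smul_right_injective _ hs0 h4⟩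

theorem IsWheel.swap (hn : 2 ≤ n) (hb : IsBlk b) (hb' : IsBlk b') (hX : X ∈ bigSpace n k)
    (W : IsWheel X b γ Y κ) (W' : IsWheel X b' γ' Y' κ')
    (hY : EntriesIn (laurent k) Y) (hY' : EntriesIn (laurent k) Y') (h0 : wheelScal n b ≠ 0) (hσ : IsBlockPerm b b' σ) (hG : G.Good)
    (hw : ∀ i j, G.w i = G.w j ↔ b i = b j) {E : ℤ} (hE : OrdGE G (xp G Y) E)
    {I J : Fin k → Fin n} (hI : ∀ j, I (b j) = I j) {p : Fin k → ℤ}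
    (hp : G.N * ∑ i, G.w i * p i + G.shift I J = E) (hne : lcoef k (Y I J) p ≠ 0) :
    lcoef k (Y' (I ∘ σ) (J ∘ σ)) (p ∘ σ) ≠ 0 := by
  obtain ⟨l, hl, hM⟩ := exists_lift σ; obtain ⟨ε, hε, hc⟩ := W.commute hn hb hb' hX W' h0 hσ hl hM
  have hw' : ∀ j, G.w (b j) = G.w j := fun j => (hw _ _).2 (hb.idem j)
  have hlb : ∀ p ∈ l, b p.1 ≠ b p.2 := fun p hp e => by
    have h1 := hσ.pos (σ.symm p.1); have h2 := hσ.pos (σ.symm p.2)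
    have h3 : b' (σ.symm p.1) = b' (σ.symm p.2) := by
      rw [← hσ.iff, Equiv.apply_symm_apply, Equiv.apply_symm_apply, e]
    rw [Equiv.apply_symm_apply, h3] at h1; rw [Equiv.apply_symm_apply, ← e] at h2
    have h4 := hl p hp; lia
  obtain ⟨M₀, hM₀, hML⟩ : LeadIn (rowEigen n k Set.univ) G (xp G (l.map fun p =>
      (Rm p.1 p.2 (pt n b p.1 / pt n b p.2) : Tensor n k)).prod) := by
    rw [xp, map_list_prod_mat, List.map_map]
    exact LeadIn.list_prod _ fun p hp => ⟨_, rLead_mem_rowEigen (hl p hp).1.ne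
      (fun h => absurd ((hw _ _).1 (sub_eq_zero.1 h)) (hlb p hp)) (pt_div_nondeg hn hb (hl p hp).1.ne),
      ordLead_crossing hG (hl p hp).1.ne ((isHom_pt hw' _).div (isHom_pt hw' _))
      (pt_div_nondeg hn hb (hl p hp).1.ne)⟩
  have hMU := unitLead_lift hG hl (isHom_pt hw') fun i j => pt_div_nondeg hn hb
  generalize (l.map fun p => (Rm p.1 p.2 (pt n b p.1 / pt n b p.2) : Tensor n k)).prod = M at *
  obtain ⟨A₀, hA, hA'⟩ := wheelCore_lead hn hb W.cyc hG hw hE.ordLead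
  have hc' : xp G (wheelCore b γ Y) * xp G M = expand G.w (cOn k ε) •
      (xp G M * xp G (permute σ (wheelCore b' γ' Y'))) := by rw [← xp_mul, hc, xp_smul, xp_mul]
  have hconst : ∀ c : K, HasLead (expand G.w (cOn k c)) 0
      (cOn k c) := fun c => (isConst_expand G.w c) ▸ HasLead.single _ _
  have hpA : OrdGE G (xp G (permute σ (wheelCore b' γ' Y'))) E := by
    have h1 := (hA.mul hML).ordGE.smul (hconst ε⁻¹).1
    rw [hc', smul_smul, ← map_mul, ← map_mul, inv_mul_cancel₀ hε, map_one, map_one, one_smul,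
      mul_zero, zero_add, add_zero, ← mul_one (_ * _)] at h1
    exact hMU.ordGE_of_mul ⟨1, one_mem _, OrdLead.one⟩ h1
  have hA1 := ordGE_permute.1 hpA; have hG1 : (G.comp σ).Good := fun a b => hG _ _
  have hw1 : ∀ i j, (G.comp σ).w i = (G.comp σ).w j ↔ b' i = b' j := fun i j =>
    (hw _ _).trans (hσ.iff i j)
  have hY1 : OrdGE (G.comp σ) (xp (G.comp σ) Y') E := by
    refine OrdGE.of_wheel hn hb' W'.cyc hG1 (fun j => (hw1 _ _).2 (hb'.idem j)) ?_
    rwa [← xp_mul, ← xp_mul, ← xp_mul, ← mul_assoc]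
  obtain ⟨A₁, hA1L, hA1'⟩ := wheelCore_lead hn hb' W'.cyc hG1 hw1 hY1.ordLead
  have hl1 := hA.mul hML; have hl2 := (hML.mul hpA.ordLead).smul (hconst ε)
  rw [← hc', mul_zero, zero_add, zero_add] at hl2; rw [add_zero] at hl1
  have he := congrFun (congrFun (hl1.unique hl2) I) (J ∘ γ)
  obtain ⟨m, hm, h1⟩ := hM₀ I (Set.mem_univ I); obtain ⟨r, hr, h2⟩ := mul_rowEigen hM₀ (J ∘ γ)
  obtain ⟨α, hα, h3⟩ := hA' I hI J
  obtain ⟨α', hα', h4⟩ := hA1' (I ∘ σ) (fun j => by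
    rw [Function.comp_apply, Function.comp_apply, ← hσ.comm, hI]) (J ∘ σ)
  have hsh : G.shift I (J ∘ γ) = G.shift I J := by
    have h5 := Equiv.sum_comp γ fun b => G.w b * G.g (J b); simp only [(hw _ _).2 (W.cyc _).1] at h5
    simp only [Grading.shift, mul_sub, Finset.sum_sub_distrib, Function.comp_apply, h5]
  have hcomm : (J ∘ γ) ∘ σ = (J ∘ σ) ∘ γ' := funext fun j => congrArg J (W'.cyc.commute W.cyc hσ j)
  have h5 := hpA.ordLead.coeff I (J ∘ γ) _ (hsh ▸ hp); have hp1 := (G.comp_shift σ I J).symm ▸ hp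
  have hp2 := (G.comp_shift σ I (J ∘ γ)).symm ▸ hsh.symm ▸ hp
  rw [coeff_xp_permute, hA1L.coeff _ _ _ hp2, hcomm, h4, ← hY1.ordLead.coeff _ _ _ hp1, map_mul,
    AlgHom.commutes, ← coeff_xp_permute] at h5
  rw [h2, h3, ← hE.ordLead.coeff _ _ _ hp, Matrix.smul_apply, smul_eq_mul] at he
  replace he := he.trans (congrArg (cOn k ε * ·) ((h1 _ _).trans
    (congrArg (cOn k m * ·) h5.symm)))
  have he' := congrArg (fun φ => lcoef k φ p) (show (r * α) • (xp G Y I J).coeff (∑ i, G.w i * p i) =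
      (ε * m * α') • (xp G (permute σ Y') I J).coeff (∑ i, G.w i * p i) by
    rw [Algebra.smul_def, Algebra.smul_def, map_mul, map_mul, map_mul]
    linear_combination he)
  simp only [map_smul, Finsupp.smul_apply, smul_eq_mul] at he'; intro h0'
  have h6 : lcoef k ((xp G (permute σ Y') I J).coeff (∑ i, G.w i * p i)) p = 0 := by
    refine (lcoef_coeff_expand (renameVars_mem_laurent σ (hY' _ _)) _ p).trans ?_
    rw [if_pos rfl, lcoef_renameVars σ (hY' _ _), h0']
  have h7 : lcoef k ((xp G Y I J).coeff (∑ i, G.w i * p i)) p = lcoef k (Y I J) p :=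
    (lcoef_coeff_expand (hY _ _) _ p).trans (if_pos rfl)
  rw [h6, h7, mul_zero] at he'; exact mul_ne_zero (mul_ne_zero hr hα) hne he'

end BlockPerm

/-! ### The bounds on the exponents, from the grading and from the slope conditions -/

section Bounds

lemma isHom_of_isWeightedHomogeneous {w : Fin k → ℤ} {a : MvPolynomial (Fin k) K} {δ : ℤ}
    (h : a.IsWeightedHomogeneous w δ) :
    IsHom w δ (algebraMap (MvPolynomial (Fin k) K) (RatFun k) a) := by
  rw [IsHom, expand, IsFractionRing.liftAlgHom_apply, IsFractionRing.lift_algebraMap]; ext p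
  refine (coeff_aeval_single w a p).trans ?_; rw [HahnSeries.coeff_single]; split_ifs with hp
  · rw [hp, h.weightedHomogeneousComponent_same]
  · rw [h.weightedHomogeneousComponent_ne p hp, map_zero]

lemma IsHomogeneousOfDegree.isHom {h : ℤ} (hφ : IsHomogeneousOfDegree φ h) (ε : ℤ) :
    IsHom (fun _ => ε) (ε * h) φ := by
  rcases hφ with rfl | ⟨a, b, l, m, hb, ha, hb', rfl, e⟩
  · rw [IsHom, map_zero, HahnSeries.single_eq_zero]
  have key : ∀ {c : MvPolynomial (Fin k) K} {l : ℕ}, c.IsHomogeneous l →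
      IsHom (fun _ => ε) (ε * l) (algebraMap (MvPolynomial (Fin k) K) (RatFun k) c) :=
    fun hc => isHom_of_isWeightedHomogeneous fun d hd => by
      have := hc hd; rw [Finsupp.weight_apply, Finsupp.sum] at this ⊢
      simp only [Pi.one_apply, smul_eq_mul, mul_one, nsmul_eq_mul] at this ⊢
      rw [← this, ← Finset.sum_mul, mul_comm]; push_cast; rfl
  have hb0 : algebraMap (MvPolynomial (Fin k) K) (RatFun k) b ≠ 0 := fun h =>
    hb (cst_injective k (h.trans (map_zero _).symm))
  rw [eq_div_of_mul_eq hb0 e, mul_sub]; exact (key ha).div (key hb')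

/-- The indicator function of `r < a`. -/
def step (r a : Fin n) : ℤ := if r < a then 1 else 0

lemma root_eq_step (a b r : Fin n) (p : ℤ) :
    root n (a.val + 1) (b.val + 1 + n * p) r = step r b - step r a + p := by
  have hn : (0 : ℤ) < n := by have := r.2; lia
  have key : ∀ a, ⌈(((a.val + 1 : ℤ) : ℚ) - ((r.val + 1 : ℤ) : ℚ)) / ((n : ℤ) : ℚ)⌉ =
      step r a := fun a => by
    have hn' : (0 : ℚ) < ((n : ℤ) : ℚ) := by exact_mod_cast hn
    have h1 := a.2; have h2 := r.2; rw [Int.ceil_eq_iff, step, lt_div_iff₀ hn', div_le_iff₀ hn']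
    split_ifs with h <;> rw [lt_def] at h <;> norm_cast <;> lia
  have h1 := Int.Ico_filter_modEq_card (a.val + 1 : ℤ) (b.val + 1 + n * p) hn (r.val + 1)
  have h2 := Int.Ico_filter_modEq_card (b.val + 1 + n * p : ℤ) (a.val + 1) hn (r.val + 1)
  have h3 : ⌈(((b.val + 1 + n * p : ℤ) : ℚ) - ((r.val + 1 : ℤ) : ℚ)) / ((n : ℤ) : ℚ)⌉ =
      step r b + p := by
    rw [← key b, ← Int.ceil_add_intCast]; congr 1; have : (n : ℚ) ≠ 0 := by exact_mod_cast hn.ne'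
    push_cast; field_simp; ring
  rw [h3, key] at h1 h2; rw [root, h1, h2]; lia

lemma hdeg_ordGE {d : Fin n → ℤ} (hX : X ∈ hdegSpace n k d) (r : Fin n) (ε : ℤ) :
    OrdGE ⟨1, one_pos, fun _ => ε, step r⟩ (xp ⟨1, one_pos, fun _ => ε, step r⟩ X) (ε * d r) := by
  rw [ordGE_iff]; intro I J p hp; have h := (hX I J r).isHom ε
  refine (congrArg (fun x => HahnSeries.coeff x p) h).trans (coeff_single_of_ne ?_); rintro rfl
  refine hp.ne ?_
  have e : ∀ a, root n ((I a).val + 1) ((J a).val + 1) r = step r (J a) - step r (I a) :=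
    fun a => by have := root_eq_step (I a) (J a) r 0; rwa [mul_zero, add_zero, add_zero] at this
  simp only [Grading.shift, e, ← Finset.mul_sum, Finset.sum_sub_distrib]; push_cast; ring

lemma exists_lastWeights {w : Fin k → ℤ} (hw : ∀ i, w i = 0 ∨ w i = -1) :
    ∃ (i m : ℕ) (_ : k = i + m) (σ : Fin (i + m) ≃ Fin k), w ∘ σ = lastWeights i m := by
  let e := finSumFinEquiv.symm.trans ((Equiv.sumCongr (Fintype.equivFin {j // w j = 0}).symm
    (Fintype.equivFin {j // ¬ w j = 0}).symm).trans (Equiv.sumCompl fun j => w j = 0))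
  refine ⟨_, _, by simpa using (Fintype.card_congr e).symm, e, funext fun j => ?_⟩
  refine Fin.addCases (fun a => ?_) (fun a => ?_) j
  · rw [lastWeights, Fin.append_left, comp_apply, Equiv.trans_apply, Equiv.trans_apply,
      finSumFinEquiv_symm_apply_castAdd]
    exact ((Fintype.equivFin {j // w j = 0}).symm a).2
  · rw [lastWeights, Fin.append_right, comp_apply, Equiv.trans_apply, Equiv.trans_apply,
      finSumFinEquiv_symm_apply_natAdd]
    exact (hw _).resolve_left ((Fintype.equivFin {j // ¬ w j = 0}).symm a).2

lemma slope_ordGE (hn : 0 < n) {μ : ℚ} (hX : X ∈ bigSpace n k)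
    (hs : X ∈ slopeSpace n k μ) {w : Fin k → ℤ} (hw : ∀ i, w i = 0 ∨ w i = -1) :
    OrdGE ⟨n, hn, w, fun a => a.val⟩ (xp ⟨n, hn, w, fun a => a.val⟩ (poles k n • X))
      (n * (∑ p : Fin k × Fin k with p.1 ≠ p.2, min (w p.1) (w p.2)) + ⌈μ * ∑ j, (w j : ℚ)⌉) := by
  obtain ⟨i, m, rfl, σ, hσ⟩ := exists_lastWeights hw
  have h1 := (SlopeCond.ordGE hn (hs i m rfl)).poles_smul
  refine OrdGE.of_comp hX ?_ σ ?_
  · intro a b _ i j hij; grind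
  have e1 : ∑ p : Fin (i + m) × Fin (i + m) with p.1 ≠ p.2, min (w p.1) (w p.2) =
      ∑ p : Fin (i + m) × Fin (i + m) with p.1 ≠ p.2,
        min (lastWeights i m p.1) (lastWeights i m p.2) := by
    refine (Finset.sum_equiv (σ.prodCongr σ) (fun p => ?_) fun p _ => ?_).symm
    · simp
    · rw [← hσ]; rfl
  have e2 : -(μ * m) = μ * ∑ j, (w j : ℚ) := by
    rw [← Equiv.sum_comp σ fun j => (w j : ℚ)]
    have : ∀ j, (w (σ j) : ℚ) = (lastWeights i m j : ℚ) := fun j => by rw [← hσ]; rfl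
    simp only [this, Fin.sum_univ_add, lastWeights, Fin.append_left, Fin.append_right]; simp
  rw [e1, ← e2]; convert h1 using 2 <;> simp only [Grading.comp, hσ]

lemma lcoef_of_free {b : Fin k → Fin k} (hb : IsBlk b) (hφ : φ ∈ laurent k)
    (h : HasValueAt (fun j => z (b j)) φ φ) {p : Fin k → ℤ} (hp : lcoef k φ p ≠ 0) {x : Fin k}
    (hx : b x ≠ x) : p x = 0 := by
  have h0 : IsHom (0 : Fin k → ℤ) 0 φ := by
    obtain ⟨a, b, hb, rfl⟩ := IsFractionRing.div_surjective (A := MvPolynomial (Fin k) K) φ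
    have key : ∀ a : MvPolynomial (Fin k) K, IsHom (0 : Fin k → ℤ) 0
        (algebraMap (MvPolynomial (Fin k) K) (RatFun k) a) :=
      fun a => isHom_of_isWeightedHomogeneous fun d _ => by simp [Finsupp.weight_apply]
    exact (key a).div (key b)
  have key : ∀ ε : ℤ, 0 ≤ ∑ i, (Pi.single x ε : Fin k → ℤ) i * p i := fun ε =>
    lcoef_eq_zero hφ (coeff_expand_value (ω := 0) (fun j => by
      have hj : b j ≠ x := fun e => hx (by rw [← e, hb.idem])
      have := isHom_z (w := (Pi.single x ε : Fin k → ℤ)) (b j)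
      rwa [Pi.single_eq_of_ne hj] at this) (fun _ => z_ne_zero _) hφ h
      fun m hm => (congrArg (fun y => HahnSeries.coeff y m) h0).trans (coeff_single_of_ne hm.ne)) hp
  have h1 := key 1; have h2 := key (-1); simp [Pi.single_apply] at h1 h2; lia

end Bounds

/-! ### Collections of labels -/

section Labels

variable {b b' : Fin k → Fin k} {I J I' J' : Fin k → Fin n} {p p' : Fin k → ℤ}

lemma IsBlk.eq_iff (hb : IsBlk b) {t : Fin k} (ht : b t = t) (j : Fin k) :
    b j = t ↔ t ≤ j ∧ j.val < t.val + blkLen b t := by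
  have h1 : ∀ i, b i = t → ∀ j, t ≤ j → j ≤ i → b j = t := fun i hi j h h' =>
    le_antisymm (hi ▸ hb.mono h') (ht ▸ hb.mono h)
  rw [blkLen]; constructor
  · intro h; have h2 : Finset.Icc t j ⊆ univ.filter fun i => b i = t := fun i hi => by grind
    have h3 := Finset.card_le_card h2; have h4 : t ≤ j := h ▸ hb.le j; rw [Fin.card_Icc] at h3
    exact ⟨h4, by lia⟩
  · rintro ⟨h2, h3⟩; by_contra hne
    have h4 : (univ.filter fun i => b i = t) ⊆ Finset.Ico t j := fun i hi => by
      have h5 := (mem_filter.1 hi).2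
      exact mem_Ico.2 ⟨h5 ▸ hb.le i, lt_of_not_ge fun h6 => hne (h1 i h5 j h2 h6)⟩
    have h5 := Finset.card_le_card h4; rw [Fin.card_Ico] at h5; lia

lemma blkLen_le (hb : IsBlk b) (t : Fin k) : t.val + blkLen b t ≤ k := by
  have h : (univ.filter fun i => b i = t) ⊆ Finset.Ici t := fun i hi =>
    Finset.mem_Ici.2 ((mem_filter.1 hi).2 ▸ hb.le i)
  have h1 := Finset.card_le_card h; rw [Fin.card_Ici] at h1; have := t.2; rw [blkLen]; lia

lemma exists_blockPerm (hb : IsBlk b) (hb' : IsBlk b') (e : {t // b' t = t} ≃ {t // b t = t})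
    (he : ∀ t, blkLen b (e t).1 = blkLen b' t.1) :
    ∃ σ, IsBlockPerm b b' σ ∧ ∀ t, σ t.1 = (e t).1 := by
  let h : Fin k → {t // b' t = t} := fun j => ⟨b' j, hb'.idem j⟩
  have h0 : ∀ j, (b' j).val ≤ j.val := fun j => hb'.le j
  have h1 : ∀ j, j.val < (b' j).val + blkLen b (e (h j)).1 := fun j =>
    he (h j) ▸ ((hb'.eq_iff (hb'.idem j) j).1 rfl).2
  let s : Fin k → Fin k := fun j => ⟨(e (h j)).1.val + (j.val - (b' j).val), by
    have := h0 j; have := h1 j; have := blkLen_le hb (e (h j)).1; lia⟩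
  have h2 : ∀ j, b (s j) = (e (h j)).1 := fun j =>
    (hb.eq_iff (e (h j)).2 _).2 ⟨(Nat.le_add_right _ _), by grind⟩
  have h3 : ∀ t, s t.1 = (e t).1 := fun t => by grind
  have hs : Injective s := fun i j hij => by
    have h4 : h i = h j := e.injective (Subtype.ext (by rw [← h2, ← h2, hij])); grind
  refine ⟨Equiv.ofBijective s (Finite.injective_iff_bijective.1 hs), ⟨fun j => ?_, fun j => ?_⟩, h3⟩
  · exact (h2 j).trans (h3 (h j)).symm
  grind

/-- The summand of a collection which belongs to the block of `t`. -/
def label (b : Fin k → Fin k) (I J : Fin k → Fin n) (p : Fin k → ℤ) (t : Fin k) : Pairs n × ℕ :=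
  (QuotientAddGroup.mk (((J t).val : ℤ) + 1, ((I t).val : ℤ) + 1 + n * (p t - (blkLen b t - 1))),
    blkLen b t)

/-- The collection which consists of the labels of all blocks. -/
def coll (b : Fin k → Fin k) (I J : Fin k → Fin n) (p : Fin k → ℤ) : Multiset (Pairs n × ℕ) :=
  (univ : Finset {t // b t = t}).val.map fun t => label b I J p t.1

/-- The position of a coefficient of a tensor which is trivial outside the heads of blocks. -/
structure IsLabel (b : Fin k → Fin k) (I J : Fin k → Fin n) (p : Fin k → ℤ) : Prop where
  row : ∀ j, I (b j) = I j
  col : ∀ j, b j ≠ j → J j = I j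
  exp : ∀ j, b j ≠ j → p j = 0

lemma label_inj {t t' : Fin k} (h : label b I J p t = label b' I' J' p' t') :
    I t = I' t' ∧ J t = J' t' ∧ p t = p' t' ∧ blkLen b t = blkLen b' t' := by
  obtain ⟨h1, h2⟩ := Prod.ext_iff.1 h; simp only [label] at h1 h2
  rw [QuotientAddGroup.eq, h2] at h1; obtain ⟨m, hm⟩ := h1; obtain ⟨h3, h4⟩ := Prod.ext_iff.1 hm
  simp only [Prod.smul_fst, Prod.smul_snd, Prod.fst_add, Prod.snd_add, Prod.fst_neg, Prod.snd_neg,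
    smul_eq_mul] at h3 h4
  have key : ∀ (x y : Fin n) (m : ℤ), (x.val : ℤ) - y.val = m * n → x = y ∧ m = 0 := fun x y m h => by
    have hx := x.2; have hy := y.2
    have h5 : m = 0 := by by_contra h0; rcases lt_or_gt_of_ne h0 with h0 | h0 <;> nlinarith
    exact ⟨Fin.ext (by rw [h5, zero_mul] at h; lia), h5⟩
  obtain ⟨h5, h6⟩ := key (J' t') (J t) m (by linarith)
  obtain ⟨h7, h8⟩ := key (I' t') (I t) (p t - p' t') (by rw [h6] at h4; linarith)
  exact ⟨h7.symm, h5.symm, by linarith, h2⟩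

lemma exists_blockPerm_of_coll_eq (hb : IsBlk b) (hb' : IsBlk b') (h : IsLabel b I J p)
    (h' : IsLabel b' I' J' p') (hc : coll b I J p = coll b' I' J' p') :
    ∃ σ, IsBlockPerm b b' σ ∧ I' = I ∘ σ ∧ J' = J ∘ σ ∧ p' = p ∘ σ := by
  have hcard : ∀ x, Nonempty ({t : {t // b' t = t} // label b' I' J' p' t.1 = x} ≃
      {t : {t // b t = t} // label b I J p t.1 = x}) := fun x => by
    refine ⟨Fintype.equivOfCardEq ?_⟩; have h1 := congrArg (Multiset.count x) hc
    rw [coll, coll, Multiset.count_map, Multiset.count_map] at h1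
    rw [Fintype.card_subtype, Fintype.card_subtype, Finset.card_def, Finset.card_def,
      Finset.filter_val, Finset.filter_val]
    simp only [eq_comm (a := x)] at h1; exact h1.symm
  have he := Equiv.ofFiberEquiv_map (fun x => (hcard x).some)
  set e := Equiv.ofFiberEquiv (fun x => (hcard x).some)
  obtain ⟨σ, hσ, h1⟩ := exists_blockPerm hb hb' e fun t => (label_inj (he t)).2.2.2
  have key : ∀ j, b' j = j → I' j = I (σ j) ∧ J' j = J (σ j) ∧ p' j = p (σ j) := fun j hj => by
    obtain ⟨h2, h3, h4, -⟩ := label_inj (he ⟨j, hj⟩); grind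
  have hI : ∀ j, I' j = I (σ j) := fun j => by
    rw [← h'.row, (key _ (hb'.idem j)).1, ← hσ.comm, h.row]
  have hh : ∀ j, b' j ≠ j → b (σ j) ≠ σ j := fun j hj => by rwa [hσ.comm, σ.injective.ne_iff]
  refine ⟨σ, hσ, funext hI, funext fun j => ?_, funext fun j => ?_⟩ <;> by_cases hj : b' j = j
  · exact (key j hj).2.1
  · rw [h'.col j hj, comp_apply, h.col _ (hh j hj), hI]
  · exact (key j hj).2.2
  · rw [h'.exp j hj, comp_apply, h.exp _ (hh j hj)]

end Labels

/-! ### The labels of the elements of a slope piece -/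

section Slope

variable {b : Fin k → Fin k} {I J : Fin k → Fin n} {p : Fin k → ℤ} {γ : Perm (Fin k)} {κ : K} {μ : ℚ} {d : Fin n → ℤ}

lemma sum_heads {F : Fin k → ℤ} (h : ∀ j, b j ≠ j → F j = 0) :
    ∑ t : {t // b t = t}, F t.1 = ∑ j, F j := by
  rw [← Finset.sum_subtype (univ.filter fun j => b j = j) (by simp) F]
  exact Finset.sum_filter_of_ne fun j _ hj => not_imp_comm.1 (h j) hj

lemma sum_blkLen (hb : IsBlk b) : ∑ t : {t // b t = t}, blkLen b t.1 = k := by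
  rw [← Finset.sum_subtype (univ.filter fun j => b j = j) (by simp) (blkLen b)]
  refine (Finset.card_eq_sum_card_fiberwise fun j _ => ?_).symm.trans (Finset.card_fin k)
  exact Finset.mem_coe.2 ((mem_filter_univ _).2 (hb.idem j))

lemma card_nonheads (hb : IsBlk b) : ∑ t : {t // b t = t}, ((blkLen b t.1 : ℤ) - 1) =
    (univ.filter fun j => b j ≠ j).card := by
  have h := Finset.card_filter_add_card_filter_not (s := univ) fun j => b j = j
  have h1 : ∑ t : {t // b t = t}, (1 : ℤ) = (univ.filter fun j => b j = j).card := by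
    rw [Finset.sum_const, Finset.card_univ, Fintype.card_subtype, nsmul_eq_mul, mul_one]
  have h2 := sum_blkLen hb; rw [Finset.card_fin] at h
  rw [Finset.sum_sub_distrib, h1, ← Nat.cast_sum, h2]; lia

lemma coll_mem (hb : IsBlk b) (hl : IsLabel b I J p)
    (hs : ∀ t, b t = t → (((I t).val - (J t).val + n * (p t - (blkLen b t - 1)) : ℤ) : ℚ) ≤
      μ * blkLen b t)
    (hd : ∀ r, ∑ j, p j + ∑ j, (step r (I j) - step r (J j)) =
      d r + (univ.filter fun j => b j ≠ j).card) : coll b I J p ∈ collections n k μ d := by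
  refine ⟨fun c hc => ?_, ?_, ?_, fun c hc => ?_⟩
  · obtain ⟨t, -, rfl⟩ := Multiset.mem_map.1 hc; have := ((hb.eq_iff t.2 t.1).1 t.2).2; rw [label]
    simp only; lia
  · rw [coll, Multiset.map_map]; exact sum_blkLen hb
  · rw [coll, Multiset.map_map]; refine (?_ : ∑ t : {t // b t = t}, (label b I J p t.1).1.root = d)
    funext r
    rw [Finset.sum_apply, ← add_left_inj ((univ.filter fun j => b j ≠ j).card : ℤ), ← hd r,
      ← card_nonheads hb, ← sum_add_distrib, ← sum_add_distrib,
      ← sum_heads fun j hj => by rw [hl.exp j hj, hl.col j hj, sub_self, add_zero]]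
    refine sum_congr rfl fun t _ => ?_
    rw [show (label b I J p t.1).1.root r = _ from root_eq_step (J t.1) (I t.1) r _]; ring
  · obtain ⟨t, -, rfl⟩ := Multiset.mem_map.1 hc
    refine le_trans (le_of_eq (congrArg Int.cast ?_)) (hs t.1 t.2)
    change ((I t.1).val : ℤ) + 1 + n * (p t.1 - (blkLen b t.1 - 1)) - (((J t.1).val : ℤ) + 1) = _
    ring

lemma sum_neighbours (hb : IsBlk b) {w : Fin k → ℤ} (hw : ∀ j, w (b j) = w j) :
    ∑ p : Fin k × Fin k with p.1 ≠ p.2, min (w p.1) (w p.2) =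
      ∑ p : Fin k × Fin k with p.1 ≠ p.2 ∧ ¬ (p.2.val + 1 = p.1.val ∧ b p.1 = b p.2),
        min (w p.1) (w p.2) + ∑ x with b x ≠ x, w x := by
  rw [← Finset.sum_filter_add_sum_filter_not _ fun p =>
    ¬ (p.2.val + 1 = p.1.val ∧ b p.1 = b p.2), filter_filter, filter_filter]
  congr 1
  refine Finset.sum_bij (fun p _ => p.1) (fun p hp => ?_) (fun p hp p' hp' e => ?_)
    (fun x hx => ?_) fun p hp => ?_
  all_goals simp only [mem_filter_univ, not_not] at *
  · intro e; have := (hb.le p.2); rw [← hp.2.2, e] at this; lia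
  · exact Prod.ext e (Fin.ext (by have := congrArg Fin.val e; lia))
  · have h1 := lt_of_le_of_ne (hb.le x) hx; rw [lt_def] at h1
    refine ⟨(x, ⟨x.val - 1, by have := x.2; lia⟩), ⟨?_, by simp only; lia, ?_⟩, rfl⟩
    · grind
    · refine le_antisymm ?_ (hb.mono (le_def.2 (Nat.sub_le _ _))); rw [← hb.idem x]
      exact hb.mono (le_def.2 (by simp only; lia))
  · rw [← hw p.1, ← hw p.2, hp.2.2, min_self]

lemma OrdGE.lcoef_le {G : Grading (Fin k) n} {E : ℤ} (h : OrdGE G (xp G Y) E)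
    (hY : EntriesIn (laurent k) Y) (hp : lcoef k (Y I J) p ≠ 0) :
    E ≤ G.N * ∑ i, G.w i * p i + G.shift I J := by
  by_contra hlt; have h1 := lcoef_coeff_expand (w := G.w) (hY I J) (∑ i, G.w i * p i) p
  rw [if_pos rfl, show (expand G.w (Y I J)).coeff _ = 0 from
    ordGE_iff.1 h I J _ (not_le.1 hlt), map_zero] at h1
  exact hp h1.symm

lemma IsWheel.coll_mem (hn : 2 ≤ n) (hb : IsBlk b) (hX : X ∈ slopePiece n k μ d)
    (W : IsWheel X b γ Y κ) (h0 : wheelScal n b ≠ 0) (hY : EntriesIn (laurent k) Y)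
    (hl : IsLabel b I J p) (hp : lcoef k (Y I J) p ≠ 0) : coll b I J p ∈ collections n k μ d := by
  have hXb := hX.1.1.1; have hn0 : 0 < n := by lia
  refine MatrixShuffle.coll_mem hb hl (fun t ht => ?_) fun r => ?_
  · let w : Fin k → ℤ := fun j => if b j = t then -1 else 0
    have hw : ∀ j, w (b j) = w j := fun j => by simp only [w, hb.idem]
    have h1 := (W.ordGE hn hb hXb h0 (G := ⟨n, hn0, w, fun a => a.val⟩) (fun a c _ i j hij => by
        grind) hw
      (slope_ordGE hn0 hXb hX.2 (w := w) fun i => by simp only [w]; split_ifs <;> simp)).lcoef_le hY hp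
    rw [sum_neighbours hb hw] at h1; have hwt : w t = -1 := if_pos ht
    have key : ∀ F : Fin k → ℤ, (∀ j, b j ≠ j → F j = 0) → ∑ j, w j * F j = -F t := fun F hF => by
      rw [sum_eq_single t (fun j _ hj => ?_) (fun h => absurd (mem_univ t) h), hwt, neg_one_mul]
      grind
    have e1 : ∑ j, w j = -(blkLen b t : ℤ) := by
      simp only [w, Finset.sum_ite, Finset.sum_const, blkLen, smul_eq_mul, mul_neg, mul_one,
        nsmul_eq_mul, mul_zero, add_zero]
    have e2 : ∑ j with b j ≠ j, w j = 1 - (blkLen b t : ℤ) := by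
      have h2 := Finset.sum_filter_add_sum_filter_not univ (fun j => b j ≠ j) w
      have h3 : ∑ j with ¬ b j ≠ j, w j = -1 := by
        have h3 := key (fun j => if b j = j then 1 else 0) fun j hj => if_neg hj
        simpa only [not_not, Finset.sum_filter, mul_ite, mul_one, mul_zero, if_pos ht] using h3
      lia
    have e3 := key p hl.exp
    have e4 := key (fun j => ((I j).val : ℤ) - (J j).val) fun j hj => by rw [hl.col j hj, sub_self]
    have e5 : (μ * ∑ j, (w j : ℚ)) = -(μ * blkLen b t) := by
      rw [← Int.cast_sum, e1]; push_cast; ring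
    simp only [Grading.shift, e2, e3, e4, e5] at h1
    have h2 : (⌈-(μ * blkLen b t)⌉ : ℤ) ≤ -(((I t).val - (J t).val + n * (p t - (blkLen b t - 1)) : ℤ)) := by
      grind
    have h3 := Int.ceil_le.1 h2; push_cast at h3 ⊢; linarith
  · have key : ∀ ε : ℤ, ε * (d r + (univ.filter fun j => b j ≠ j).card) ≤
        ε * (∑ j, p j + ∑ j, (step r (I j) - step r (J j))) := fun ε => by
      have h1 := (W.ordGE hn hb hXb h0 (fun a c h => absurd rfl h) (fun _ => rfl)
        (hdeg_ordGE hX.1.2 r ε).poles_smul).lcoef_le hY hp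
      rw [sum_neighbours hb fun _ => rfl] at h1
      simp only [Grading.shift, Finset.sum_const, nsmul_eq_mul, ← Finset.mul_sum] at h1
      push_cast at h1; linarith
    have h1 := key 1; have h2 := key (-1); linarith

end Slope

/-! ### Leading coefficients -/

section Top

variable {b b' : Fin k → Fin k} {I J I' J' : Fin k → Fin n} {p p' : Fin k → ℤ}
  {γ : Perm (Fin k)} {X' : Tensor n k} {κ : K} {μ : ℚ} {d : Fin n → ℤ}

lemma ordGE_of_lcoef {G : Grading (Fin k) n} {E : ℤ} (hY : EntriesIn (laurent k) Y)
    (h : ∀ I J p, lcoef k (Y I J) p ≠ 0 → E ≤ G.N * ∑ i, G.w i * p i + G.shift I J) :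
    OrdGE G (xp G Y) E := by
  rw [ordGE_iff]
  refine fun I J m hm => (congrArg (fun φ => (expand G.w φ).coeff m) (sum_lcoef (hY I J)).symm).trans ?_
  simp only [map_sum, coeff_sum, map_smul, HahnSeries.coeff_smul]; refine sum_eq_zero fun p hp => ?_
  rw [isHom_mono p, coeff_single_of_ne, smul_zero]; grind

lemma exists_isLabel (hb : IsBlk b) (ht : ∀ x, b x ≠ x → TrivOn x Y) (h0 : Y I J ≠ 0) :
    (∀ j, b j ≠ j → I j = J j) ∧ Y (I ∘ b) (fun j => if b j = j then J j else I (b j)) = Y I J := by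
  classical
  have h1 : ∀ j, b j ≠ j → I j = J j := fun j hj => by_contra fun e => h0 ((ht j hj).1 I J e)
  refine ⟨h1, ?_⟩; set J' : Fin k → Fin n := fun j => if b j = j then J j else I (b j)
  have key : ∀ s : Finset (Fin k), (∀ j ∈ s, b j ≠ j) →
      Y (s.piecewise (I ∘ b) I) (s.piecewise J' J) = Y I J := fun s => by
    induction s using Finset.induction_on with
    | empty => intro _; rw [Finset.piecewise_empty, Finset.piecewise_empty]
    | insert x s hx ih =>
      intro hs; have hbx := hs x (Finset.mem_insert_self x s)
      rw [Finset.piecewise_insert, Finset.piecewise_insert,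
        show J' x = (I ∘ b) x from if_neg hbx, (ht x hbx).2 _ _ _ (by simp_all)]
      exact ih fun j hj => hs j (Finset.mem_insert_of_mem hj)
  rw [← key (univ.filter fun j => b j ≠ j) fun j hj => (mem_filter.1 hj).2]
  congr 1 <;> funext j <;> by_cases hj : b j = j
  · rw [Finset.piecewise_eq_of_notMem _ _ _ (by simpa using hj), comp_apply, hj]
  · rw [Finset.piecewise_eq_of_mem _ _ _ (by simpa using hj)]
  · aesop
  · rw [Finset.piecewise_eq_of_mem _ _ _ (by simpa using hj)]

/-- The blocks of `b` are the longest ones, beginning with the last block, such that the numerator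
of `X` does not vanish at the wheel point. -/
structure IsMinBlk (X : Tensor n k) (b : Fin k → Fin k) : Prop where
  blk : IsBlk b
  ne : ¬ MVal (pt n b) (poles k n • X) 0
  min : ∀ b', IsBlk b' → ¬ MVal (pt n b') (poles k n • X) 0 →
    toLex (b ∘ Fin.rev) ≤ toLex (b' ∘ Fin.rev)

lemma exists_isMinBlk (h0 : X ≠ 0) : ∃ b, IsMinBlk X b := by
  classical
  have hid : ¬ MVal (pt n (id : Fin k → Fin k)) (poles k n • X) 0 := fun h => by
    have e : pt n (id : Fin k → Fin k) = z := funext fun j => by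
      rw [pt, id, Nat.sub_self, mul_zero, pow_zero, map_one, mul_one]
    rw [e] at h
    refine h0 ((smul_eq_zero.1 (MVal.unique (fun I J => hasVal_z _) h)).resolve_left ?_)
    refine prod_ne_zero_iff.2 fun p hp => sub_ne_zero.2 ?_
    have := z_mul_ne (mem_filter.1 hp).2 (one_ne_zero (α := K)) (c' := qbar n ^ 2)
    rwa [map_one, mul_one] at this
  obtain ⟨b, hb, h⟩ := Finset.exists_min_image
    (univ.filter fun b => IsBlk b ∧ ¬ MVal (pt n b) (poles k n • X) 0)
    (fun b => toLex (b ∘ Fin.rev)) ⟨id, mem_filter.2 ⟨mem_univ _,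
      ⟨fun _ => le_rfl, monotone_id, fun _ => rfl⟩, hid⟩⟩
  obtain ⟨-, hb, hne⟩ := mem_filter.1 hb
  exact ⟨b, hb, hne, fun b' hb' hne' => h b' ((mem_filter_univ _).2 ⟨hb', hne'⟩)⟩

lemma IsMinBlk.regular (hn : 2 ≤ n) (hX : X ∈ shuffleSpace n k) (h : IsMinBlk X b)
    (W : IsWheel X b γ Y κ) : EntriesIn (laurent k) Y := by
  have hb := h.blk; refine MatrixShuffle.regular hn hb hX (fun a a' ha ha' => ?_) W; by_contra hne
  have hlt : a' < a := (by lia); have hS := isBlk_splitBelow hb fun j hj => ha ▸ hb.mono hj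
  set s := splitBelow b a with hs; have hsa : ∀ j, j < a → s j = j := fun j hj => if_pos hj
  have hsb : ∀ j, a ≤ j → s j = b j := fun j hj => if_neg (not_lt.2 hj)
  have hS' : IsBlk fun j => if s j = a then a' else s j := by
    refine ⟨fun j => ?_, fun i j hij => ?_, fun j => ?_⟩
    · split_ifs with e
      · exact hlt.le.trans (e ▸ hS.le j)
      · exact hS.le j
    · have := hS.mono hij; grind
    · split_ifs with e e' e' e'
      · rfl
      · rw [hsa _ hlt]
      · exact absurd ((hS.idem j).symm.trans e') e
      · rw [hS.idem]
  obtain ⟨j₀, hj₀, hmax⟩ := Finset.exists_max_image (univ.filter fun j => b j = a) id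
    ⟨a, (mem_filter_univ _).2 ha⟩
  have hj₀' := (mem_filter.1 hj₀).2; have haj : a ≤ j₀ := hj₀' ▸ hb.le j₀
  refine not_lt.2 (h.min _ hS' hne) (?_ : Pi.Lex _ _ _ _); refine ⟨j₀.rev, fun j hj => ?_, ?_⟩
  · have h1 : j₀ < j.rev := Fin.lt_rev_iff.2 hj; have h2 := hsb _ (haj.trans h1.le)
    have h3 : b j.rev ≠ a := fun e => absurd (hmax _ ((mem_filter_univ _).2 e)) (not_le.2 h1)
    change (if s j.rev = a then a' else s j.rev) = b j.rev; rw [h2, if_neg h3]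
  · change (if s j₀.rev.rev = a then a' else s j₀.rev.rev) < b j₀.rev.rev
    rwa [Fin.rev_rev, hsb _ haj, if_pos hj₀', hj₀']

lemma IsBlockPerm.vanish (hn : 2 ≤ n) (hb : IsBlk b) (hb' : IsBlk b') (hσ : IsBlockPerm b b' σ)
    (hX : X ∈ bigSpace n k) (h : MVal (pt n b') (poles k n • X) 0) :
    MVal (pt n b) (poles k n • X) 0 := by
  refine vanish_of_permuted hX (pt_ne_zero b) (fun i j => pt_div_nondeg hn hb) σ fun I J => ?_
  have h1 := (h I J).map (renameVars σ.toEmbedding)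
  rw [funext (hσ.rename_pt hb hb'), Matrix.zero_apply, map_zero] at h1; exact h1

lemma IsBlockPerm.symm (hσ : IsBlockPerm b b' σ) : IsBlockPerm b' b σ.symm where
  comm j := by apply σ.injective; rw [← hσ.comm, Equiv.apply_symm_apply, Equiv.apply_symm_apply]
  pos j := by have := hσ.pos (σ.symm j); rw [Equiv.apply_symm_apply] at this; exact this.symm

lemma IsMinBlk.eq (hn : 2 ≤ n) (hX : X ∈ bigSpace n k) (hX' : X' ∈ bigSpace n k)
    (h : IsMinBlk X b) (h' : IsMinBlk X' b') (hσ : IsBlockPerm b b' σ) : b = b' := by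
  have h1 := h.min b' h'.blk fun h0 => h.ne (hσ.vanish hn h.blk h'.blk hX h0)
  have h2 := h'.min b h.blk fun h0 => h'.ne (hσ.symm.vanish hn h'.blk h.blk hX' h0)
  have h3 := toLex.injective (le_antisymm h1 h2); exact Fin.rev_surjective.injective_comp_right h3

end Top

/-! ### The dimension of a slope piece -/

section Dimension

variable {b b' : Fin k → Fin k} {I J I' J' : Fin k → Fin n} {p p' : Fin k → ℤ}
  {γ : Perm (Fin k)} {X' : Tensor n k} {κ : K} {μ : ℚ} {d : Fin n → ℤ}

lemma exists_wheelMap (hn : 2 ≤ n) (hb : IsBlk b) (h0 : wheelScal n b ≠ 0) :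
    ∃ Φ : shuffleSpace n k →ₗ[K] Tensor n k,
      ∀ (X : shuffleSpace n k) γ Y κ, IsWheel X.1 b γ Y κ → Φ X = κ • Y := by
  have ex : ∀ X : shuffleSpace n k, ∃ γ Y κ, IsWheel X.1 b γ Y κ := fun X => by
    obtain ⟨γ, Y, κ, h1, h2, -, h3, h4⟩ := exists_wheel X.2 hb; exact ⟨γ, Y, κ, h1, h2, h3, h4⟩
  obtain ⟨γ₀, _, _, W₀⟩ := ex 0
  let P : Tensor n k → Tensor n k → Prop := fun X Z =>
    MVal (pt n b) (poles k n • X) (wheelScal n b • wheelCore b γ₀ Z)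
  have hsmul : ∀ (c : K) (Z : Tensor n k), wheelCore b γ₀ (c • Z) = c • wheelCore b γ₀ Z :=
    fun c Z => by rw [wheelCore, mul_smul_comm, smul_mul_assoc, smul_mul_assoc]
  have hP : ∀ X γ Y κ, IsWheel X b γ Y κ → P X (κ • Y) := fun X γ Y κ W => by
    have e : γ = γ₀ := Equiv.ext fun j =>
      W₀.cyc.commute W.cyc (σ := 1) ⟨fun _ => rfl, fun _ => rfl⟩ j
    have h1 := W.val; rw [mul_assoc, ← wheelScal, mul_smul, algebraMap_smul, smul_comm, e] at h1
    simp only [P]; rwa [hsmul]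
  have huniq : ∀ X Z Z', P X Z → P X Z' → Z = Z' := fun X Z Z' h h' => by
    have hpt : IsPoint n b 0 (pt n b) := ⟨fun _ h => absurd h (Nat.not_lt_zero _),
      fun _ _ => Nat.zero_le _, fun _ h => absurd h (Nat.not_lt_zero _), fun _ _ => rfl,
      fun i j => pt_div_nondeg hn hb⟩
    exact eq_of_smul_conj hpt.isUnit_lft hpt.isUnit_rgt
      (RegInv.pm (O := ⊤) (n := n) (L := RatFun k) γ₀).isUnit h0 (h.unique h')
  have hex : ∀ X : shuffleSpace n k, ∃ Z, P X.1 Z := fun X => by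
    obtain ⟨γ, Y, κ, W⟩ := ex X; exact ⟨_, hP _ _ _ _ W⟩
  choose Z hZ using hex
  refine ⟨⟨⟨Z, fun X X' => huniq _ _ _ (hZ _) ?_⟩, fun c X => huniq _ _ _ (hZ _) ?_⟩,
    fun X γ Y κ W => huniq _ _ _ (hZ X) (hP _ _ _ _ W)⟩
  · simp only [P, wheelCore, mul_add, add_mul, smul_add, Submodule.coe_add]
    exact fun I J => (hZ X I J).add (hZ X' I J)
  · change P (c • X.1) (c • Z X); simp only [P]; rw [hsmul, smul_comm, smul_comm _ c]
    exact fun I J => (hZ X I J).smul c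

/-- The grading which orders the labels by the blocks. -/
def blkGrading (hn : 2 ≤ n) (b : Fin k → Fin k) : Grading (Fin k) n :=
  ⟨n, by lia, fun j => (b j).val, fun a => a.val⟩

lemma blkGrading_good (hn : 2 ≤ n) (b : Fin k → Fin k) : (blkGrading hn b).Good := by
  intro a c _ i j hij; have h2 := j.2; rw [lt_def] at hij
  exact ⟨by simp only [blkGrading]; lia, by simp only [blkGrading]; lia⟩

/-- The position of a coefficient of minimal order of the solution of the wheel condition. -/
structure IsTop (hn : 2 ≤ n) (X : Tensor n k) (b : Fin k → Fin k) (I J : Fin k → Fin n)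
    (p : Fin k → ℤ) : Prop where
  minBlk : IsMinBlk X b
  scal : wheelScal n b ≠ 0
  label : IsLabel b I J p
  wheel : ∃ γ Y κ, IsWheel X b γ Y κ ∧ lcoef k (Y I J) p ≠ 0 ∧ OrdGE (blkGrading hn b)
    (xp (blkGrading hn b) Y) ((blkGrading hn b).N * ∑ i, (blkGrading hn b).w i * p i +
      (blkGrading hn b).shift I J)

lemma exists_isTop (hn : 2 ≤ n) (hX : X ∈ shuffleSpace n k) (h0 : X ≠ 0) :
    ∃ b I J p, IsTop hn X b I J p := by
  obtain ⟨b, hm⟩ := exists_isMinBlk h0; have hb := hm.blk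
  obtain ⟨γ, Y, κ, h1, h2, hfree, h3, h4⟩ := exists_wheel hX hb
  have W : IsWheel X b γ Y κ := ⟨h1, h2, h3, h4⟩
  have hs : wheelScal n b ≠ 0 := fun h => hm.ne (by
    rwa [mul_assoc, ← wheelScal, h, mul_zero, zero_smul] at h4)
  have hY := hm.regular hn hX W
  let G := blkGrading hn b
  let F : ((_ : (Fin k → Fin n) × (Fin k → Fin n)) × (Fin k → ℤ)) → ℤ := fun x =>
    G.N * ∑ i, G.w i * x.2 i + G.shift x.1.1 x.1.2
  obtain ⟨⟨⟨I, J⟩, p⟩, hx, hmin⟩ := Finset.exists_min_image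
    (univ.sigma fun x => (lcoef k (Y x.1 x.2)).support)
    F (by
      by_contra hne; rw [Finset.not_nonempty_iff_eq_empty, Finset.sigma_eq_empty] at hne
      have hY0 : Y = 0 := by
        ext1 I J
        rw [← sum_lcoef (hY I J), show (lcoef k (Y I J)).support = ∅ from
          hne (I, J) (mem_univ _), Finset.sum_empty, Matrix.zero_apply]
      refine hm.ne ?_; rwa [hY0, mul_zero, zero_mul, zero_mul, smul_zero] at h4)
  have hp : lcoef k (Y I J) p ≠ 0 := Finsupp.mem_support_iff.1 (Finset.mem_sigma.1 hx).2
  obtain ⟨h5, h6⟩ := exists_isLabel hb h2 fun h : Y I J = 0 => hp (by rw [h, map_zero]; rfl)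
  have hl : IsLabel b (I ∘ b) (fun j => if b j = j then J j else I (b j)) p :=
    ⟨fun j => congrArg I (hb.idem j), fun j hj => if_neg hj,
      fun j hj => lcoef_of_free hb (hY I J) (hfree I J) hp hj⟩
  refine ⟨b, _, _, p, hm, hs, hl, γ, Y, κ, W, h6 ▸ hp, ?_⟩
  have hsh : G.shift (I ∘ b) (fun j => if b j = j then J j else I (b j)) = G.shift I J :=
    sum_congr rfl fun j _ => by grind
  refine ordGE_of_lcoef hY fun I' J' p' hp' => ?_
  refine le_trans (le_of_eq ?_) (hmin ⟨(I', J'), p'⟩ (Finset.mem_sigma.2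
    ⟨mem_univ _, Finsupp.mem_support_iff.2 hp'⟩))
  exact congrArg _ hsh

lemma IsTop.coll_mem (hn : 2 ≤ n) (hX : X ∈ slopePiece n k μ d) (h : IsTop hn X b I J p) :
    coll b I J p ∈ collections n k μ d := by
  obtain ⟨γ, Y, κ, W, hp, -⟩ := h.wheel
  exact W.coll_mem hn h.minBlk.blk hX h.scal (h.minBlk.regular hn hX.1.1 W) h.label hp

lemma exists_functional (hn : 2 ≤ n) (C : Multiset (Pairs n × ℕ)) :
    ∃ Φ : shuffleSpace n k →ₗ[K] K, ∀ (X : shuffleSpace n k) b I J p, IsTop hn X.1 b I J p →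
      coll b I J p = C → Φ X ≠ 0 := by
  by_cases hC : ∃ (X : shuffleSpace n k) (b : Fin k → Fin k) (I J : Fin k → Fin n) (p : Fin k → ℤ),
      IsTop hn X.1 b I J p ∧ coll b I J p = C
  · obtain ⟨X', b', I', J', p', h', rfl⟩ := hC
    obtain ⟨Φ, hΦ⟩ := exists_wheelMap hn h'.minBlk.blk h'.scal
    refine ⟨(Finsupp.lapply p').comp ((lcoef k).comp
      ((Matrix.entryLinearMap K (RatFun k) I' J').comp Φ)), fun X b I J p h hc => ?_⟩
    obtain ⟨σ, hσ, rfl, rfl, rfl⟩ :=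
      exists_blockPerm_of_coll_eq h.minBlk.blk h'.minBlk.blk h.label h'.label hc
    obtain rfl := h.minBlk.eq hn X.2.1 X'.2.1 h'.minBlk hσ; obtain ⟨γ, Y, κ, W, hp, hE⟩ := h.wheel
    have hY := h.minBlk.regular hn X.2 W
    have h1 := W.swap hn h.minBlk.blk h.minBlk.blk X.2.1 W hY hY h.scal hσ (blkGrading_good hn b)
      (fun i j => ⟨fun e => Fin.ext (Nat.cast_injective e), fun e =>
        congrArg (fun x => (x.val : ℤ)) e⟩) hE h.label.row rfl hp
    change lcoef k (Φ X (I ∘ σ) (J ∘ σ)) (p ∘ σ) ≠ 0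
    rw [hΦ X γ Y κ W, Matrix.smul_apply, map_smul, Finsupp.smul_apply]
    exact mul_ne_zero W.ne_zero h1
  · exact ⟨0, fun X b I J p h hc => absurd ⟨X, b, I, J, p, h, hc⟩ hC⟩

lemma rank_slopePiece (hn : 2 ≤ n) (hfin : (collections n k μ d).Finite) :
    Module.rank K (slopePiece n k μ d) ≤ ((collections n k μ d).ncard : Cardinal) := by
  classical
  haveI := hfin.fintype
  choose Φ hΦ using fun C : collections n k μ d => exists_functional (k := k) hn C.1
  let ι : slopePiece n k μ d →ₗ[K] shuffleSpace n k :=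
    Submodule.inclusion (inf_le_left.trans inf_le_left)
  have h := LinearMap.rank_le_of_injective (LinearMap.pi fun C => (Φ C).comp ι) (by
    rw [← LinearMap.ker_eq_bot, LinearMap.ker_eq_bot']
    intro X hX
    by_contra h0
    obtain ⟨b, I, J, p, h⟩ := exists_isTop hn X.2.1.1 fun e => h0 (Subtype.ext e)
    exact hΦ ⟨_, h.coll_mem hn X.2⟩ (ι X) b I J p h rfl (congrFun hX _))
  rwa [rank_fun', ← Nat.card_eq_fintype_card, Nat.card_coe_set_eq] at h

end Dimension

/-! ### Finiteness of the collections -/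

section Finiteness

lemma Pairs.exists_rep (hn : 0 < n) (c : Pairs n) : ∃ (a b : Fin n) (p : ℤ),
    c = QuotientAddGroup.mk ((a.val : ℤ) + 1, (b.val : ℤ) + 1 + n * p) := by
  obtain ⟨⟨i, j⟩, rfl⟩ := QuotientAddGroup.mk_surjective c
  have hn' : (0 : ℤ) < n := by exact_mod_cast hn
  have key : ∀ x : ℤ, ∃ a : Fin n, x = a.val + 1 + n * ((x - 1) / n) := fun x => by
    have h1 := Int.emod_nonneg (x - 1) hn'.ne'; have h2 := Int.emod_lt_of_pos (x - 1) hn'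
    have h3 := Int.emod_add_mul_ediv (x - 1) n
    exact ⟨⟨((x - 1) % n).toNat, by lia⟩, by simp only; lia⟩
  obtain ⟨a, ha⟩ := key i; obtain ⟨b, hb⟩ := key j
  refine ⟨a, b, (j - 1) / n - (i - 1) / n, QuotientAddGroup.eq.2 ⟨-((i - 1) / n), Prod.ext ?_ ?_⟩⟩ <;>
    simp only [Prod.smul_fst, Prod.smul_snd, Prod.fst_add, Prod.snd_add, Prod.fst_neg, Prod.snd_neg,
      smul_eq_mul] <;> linarith

lemma finite_collections (hn : 0 < n) (k : ℕ) (μ : ℚ) (d : Fin n → ℤ) :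
    (collections n k μ d).Finite := by
  classical
  let r : Fin n := ⟨0, hn⟩
  obtain ⟨M, hM⟩ := exists_nat_ge (|μ| * k)
  let T : Finset (Pairs n × ℕ) := ((univ ×ˢ univ) ×ˢ
    Finset.Icc (d r - k * (M + 2) - 1) (M + 1) ×ˢ range (k + 1)).image
    fun x : (Fin n × Fin n) × ℤ × ℕ =>
      (QuotientAddGroup.mk ((x.1.1.val : ℤ) + 1, (x.1.2.val : ℤ) + 1 + n * x.2.1), x.2.2)
  refine (Set.finite_Iic (k • T.val)).subset fun C hC => ?_; obtain ⟨h1, h2, h3, h4⟩ := hC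
  have hle : ∀ c ∈ C, c.2 ≤ k := fun c hc =>
    h2 ▸ Multiset.single_le_sum (fun _ _ => Nat.zero_le _) _ (Multiset.mem_map_of_mem _ hc)
  have hcard : Multiset.card C ≤ k := by
    rw [← h2, ← Multiset.card_map fun c : Pairs n × ℕ => c.2]
    refine (Multiset.card_nsmul_le_sum fun x hx => ?_).trans' (by rw [nsmul_eq_mul, mul_one]; rfl)
    obtain ⟨c, hc, rfl⟩ := Multiset.mem_map.1 hx; exact h1 c hc
  have hstep : ∀ a b : Fin n, -1 ≤ step r b - step r a ∧ step r b - step r a ≤ 1 := fun a b => by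
    rw [step, step]; split_ifs <;> lia
  have hup : ∀ c ∈ C, ∀ (a b : Fin n) (p : ℤ),
      c.1 = QuotientAddGroup.mk ((a.val : ℤ) + 1, (b.val : ℤ) + 1 + n * p) → p ≤ M + 1 :=
    fun c hc a b p e => by
      have h5 := h4 c hc
      have h6 : Pairs.diff n c.1 = (b.val : ℤ) + 1 + n * p - (a.val + 1) := by rw [e]; rfl
      have h7 : μ * c.2 ≤ M := by
        refine le_trans ?_ hM
        refine (mul_le_mul_of_nonneg_right (le_abs_self μ) (Nat.cast_nonneg _)).trans
          (mul_le_mul_of_nonneg_left ?_ (abs_nonneg μ))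
        exact_mod_cast hle c hc
      have h8 : Pairs.diff n c.1 ≤ M := by exact_mod_cast h5.trans h7
      have ha := a.2; rw [h6] at h8; by_contra hlt; nlinarith
  have hroot : ∀ c ∈ C, c.1.root r ≤ M + 2 := fun c hc => by
    obtain ⟨a, b, p, e⟩ := c.1.exists_rep hn; have h5 := hup c hc a b p e
    have h6 : c.1.root r = step r b - step r a + p := by rw [e]; exact root_eq_step a b r p
    have h7 := (hstep a b).2; lia
  have hmem : ∀ c ∈ C, c ∈ T := fun c hc => by
    obtain ⟨a, b, p, e⟩ := c.1.exists_rep hn; have h5 := hup c hc a b p e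
    have h6 : c.1.root r = step r b - step r a + p := by rw [e]; exact root_eq_step a b r p
    have h7 := (hstep a b).2; obtain ⟨D, rfl⟩ := Multiset.exists_cons_of_mem hc
    have h8 : c.1.root r + (D.map fun c => c.1.root r).sum = d r := by
      rw [← h3, Multiset.map_cons, Multiset.sum_cons, Pi.add_apply]; congr 1
      rw [← Pi.evalAddMonoidHom_apply (fun _ : Fin n => ℤ) r (Multiset.sum _), map_multiset_sum,
        Multiset.map_map]
      rfl
    have h9 : (D.map fun c => c.1.root r).sum ≤ Multiset.card D * (M + 2 : ℤ) := by
      rw [← nsmul_eq_mul, ← Multiset.card_map fun c : Pairs n × ℕ => c.1.root r]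
      refine Multiset.sum_le_card_nsmul _ _ fun x hx => ?_
      obtain ⟨c, hc, rfl⟩ := Multiset.mem_map.1 hx; exact hroot c (Multiset.mem_cons_of_mem hc)
    rw [Multiset.card_cons] at hcard
    have h10 : (Multiset.card D : ℤ) * (M + 2) ≤ k * (M + 2) :=
      mul_le_mul_of_nonneg_right (by exact_mod_cast (Nat.le_succ _).trans hcard) (by lia)
    refine Finset.mem_image.2 ⟨((a, b), p, c.2), Finset.mem_product.2 ⟨Finset.mem_product.2
      ⟨mem_univ _, mem_univ _⟩, Finset.mem_product.2 ⟨Finset.mem_Icc.2 ⟨?_, h5⟩,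
      Finset.mem_range.2 (Nat.lt_succ_of_le (hle c hc))⟩⟩, Prod.ext e.symm rfl⟩
    simp only; lia
  refine Multiset.le_iff_count.2 fun c => ?_
  by_cases hc : c ∈ C
  · rw [Multiset.count_nsmul, Multiset.count_eq_one_of_mem T.nodup (hmem c hc), mul_one]
    exact (Multiset.count_le_card c C).trans hcard
  · rw [Multiset.count_eq_zero_of_notMem hc]; exact Nat.zero_le _

end Finiteness

end MatrixShuffle

end

theorem mainTheorem8 (n k : ℕ) (hn : 2 ≤ n) (μ : ℚ) (d : Fin n → ℤ) :
    (MatrixShuffle.collections n k μ d).Finite ∧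
      Module.rank MatrixShuffle.K (MatrixShuffle.slopePiece n k μ d) ≤
        ((MatrixShuffle.collections n k μ d).ncard : Cardinal) := by
  have h := MatrixShuffle.finite_collections (by lia : 0 < n) k μ d
  exact ⟨h, MatrixShuffle.rank_slopePiece hn h⟩
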